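/- **The exponential formula for the Airy function.** Let $Ai$, $Bi$ be the Airy functions normalised by $Ai(x)\sim \frac{e^{-\frac23x^{3/2}}}{\sqrt2\,x^{1/4}}$ and $Bi(x)\sim \frac{e^{+\frac23x^{3/2}}}{\sqrt2\,x^{1/4}}$ as $x\to+\infty$, that is $\sqrt{2\pi}$ times the classical $\mathrm{Ai}$ and $\sqrt{\pi/2}$ times the classical $\mathrm{Bi}$, so that $Ai\,Bi'-Ai'\,Bi=1$. Put $$K(x_1,x_2)=\frac{Ai(x_1)Bi'(x_2)-Ai'(x_1)Bi(x_2)}{x_1-x_2},\qquad W_1(x)=Ai'(x)Bi'(x)-x\,Ai(x)Bi(x),$$ and for $n\ge2$ $$W_n(x_1,\dots,x_n)=-\frac{\delta_{n,2}}{(x_1-x_2)^2}-(-1)^n\sum_{\sigma}\prod_{i=1}^nK(x_i,x_{\sigma(i)}),$$ where $\sigma$ runs over the permutations of $\{1,\dots,n\}$ that are a single $n$-cycle. For $x,x_i>0$ define the symmetric primitives of the $W_n$ by $$\Phi_1(x)=-\tfrac23x^{3/2}+\int_\infty^x\big(W_1(x')+\sqrt{x'}\big)\,dx',$$ $$\Phi_2(x_1,x_2)=-\ln(\sqrt{x_1}+\sqrt{x_2})+\int_\infty^{x_1}\!\!\int_\infty^{x_2}\Big(W_2(x_1',x_2')-\frac{1}{4\sqrt{x_1'}\sqrt{x_2'}(\sqrt{x_1'}+\sqrt{x_2'})^2}\Big)dx_1'dx_2',$$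 $$\Phi_n(x_1,\dots,x_n)=\int_\infty^{x_1}\!\!\cdots\int_\infty^{x_n}W_n(x_1',\dots,x_n')\,dx_1'\cdots dx_n'\qquad(n\ge3).$$ All these integrals converge absolutely, and $$Ai(x)=\exp\Big(\sum_{l\ge1}\frac1{l!}\Phi_l(x,\dots,x)\Big),\qquad Bi(x)=\exp\Big(\sum_{l\ge1}\frac{(-1)^l}{l!}\Phi_l(x,\dots,x)\Big)$$ order by order in the large $x$ expansion, in the following sense. 1. For every $L\ge2$, as $x\to+\infty$, $$Ai(x)=\exp\Big(\sum_{l=1}^L\frac1{l!}\Phi_l(x,\dots,x)\Big)\Big(1+O\big(x^{-\frac32(L-1)}\big)\Big),\qquad Bi(x)=\exp\Big(\sum_{l=1}^L\frac{(-1)^l}{l!}\Phi_l(x,\dots,x)\Big)\Big(1+O\big(x^{-\frac32(L-1)}\big)\Big).$$ 2. There are real numbers $a_{l,m}$ ($l,m\ge1$), with $a_{l,m}=0$ whenever $l>m+2$, such that as $x\to+\infty$ there is for every $l\ge1$ the asymptotic expansion (to all orders) $$\Phi_l(x,\dots,x)\sim\Lambda_l(x)+\sum_{m\ge1}a_{l,m}x^{-\frac32m},\qquad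 \Lambda_1(x)=-\tfrac23x^{3/2},\quad\Lambda_2(x)=-\ln(2\sqrt x),\quad\Lambda_l=0\ (l\ge3),$$ and for every $M\ge0$ $$Ai(x)=\exp\Big(\Lambda_1(x)+\tfrac12\Lambda_2(x)+\sum_{m=1}^M\Big(\sum_{l=1}^{m+2}\frac{a_{l,m}}{l!}\Big)x^{-\frac32m}\Big)\Big(1+O\big(x^{-\frac32(M+1)}\big)\Big),$$ $$Bi(x)=\exp\Big(-\Lambda_1(x)+\tfrac12\Lambda_2(x)+\sum_{m=1}^M\Big(\sum_{l=1}^{m+2}\frac{(-1)^la_{l,m}}{l!}\Big)x^{-\frac32m}\Big)\Big(1+O\big(x^{-\frac32(M+1)}\big)\Big).$$ -/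

import Mathlib

open Asymptotics Filter MeasureTheory

noncomputable section

/-- The integral of `exp (t ^ 3 / 3 - x * t) dt` along the ray `t = ω * r`, `0 < r < ∞`.
It converges absolutely for every `x` when `ω ^ 3 = -1`. -/
def airyRay (ω : ℂ) (x : ℝ) : ℂ :=
  ∫ r in Set.Ioi (0 : ℝ), ω * Complex.exp ((ω * (r : ℂ)) ^ 3 / 3 - (x : ℂ) * (ω * (r : ℂ)))

/-- The Airy function of the real variable `x`, that is
`√(2π) * (1 / (2πi)) * ∫ exp (t ^ 3 / 3 - x * t) dt` over the contour that comes in from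
`∞ exp (-iπ/3)` to `0` and goes out to `∞ exp (iπ/3)` (the two rays are complex conjugate).
It is `√(2π)` times the classical `Ai`, so that
`airyAi x ∼ exp (-(2/3) * x ^ (3/2)) / (√2 * x ^ (1/4))` as `x → +∞`. -/
def airyAi (x : ℝ) : ℝ :=
  √(2 * Real.pi) * ((1 / Real.pi) * (airyRay (Complex.exp (Real.pi / 3 * Complex.I)) x).im)

/-- The second Airy function of the real variable `x`, that is
`√(π/2) * (1 / (2π)) * ∫ exp (t ^ 3 / 3 - x * t) dt` summed over the two contours that come in from
`-∞` to `0` and go out to `∞ exp (iπ/3)`, respectively to `∞ exp (-iπ/3)`.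
It is `√(π/2)` times the classical `Bi`, so that
`airyBi x ∼ exp ((2/3) * x ^ (3/2)) / (√2 * x ^ (1/4))` as `x → +∞`
and `Ai * Bi' - Ai' * Bi = 1`. -/
def airyBi (x : ℝ) : ℝ :=
  √(Real.pi / 2) *
    ((1 / Real.pi) * (airyRay (Complex.exp (Real.pi / 3 * Complex.I)) x - airyRay (-1) x).re)

/-- The Airy kernel (used only off the diagonal). -/
def airyK (x y : ℝ) : ℝ :=
  (airyAi x * deriv airyBi y - deriv airyAi x * airyBi y) / (x - y)

/-- The connected correlators `W_n` of the Airy system. For `n ≥ 2` the sum runs over the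
permutations of the `n` indices that consist of a single `n`-cycle. The formula for `n ≥ 2` is
meaningful at points with pairwise distinct coordinates; the other points form a null set. -/
def airyW : (n : ℕ) → (Fin n → ℝ) → ℝ
  | 0, _ => 0
  | 1, x => deriv airyAi (x 0) * deriv airyBi (x 0) - x 0 * airyAi (x 0) * airyBi (x 0)
  | n + 2, x =>
      -(if n = 0 then 1 / (x 0 - x 1) ^ 2 else 0)
        - (-1) ^ (n + 2) *
          ∑ σ : Equiv.Perm (Fin (n + 2)) with σ.cycleType = {n + 2},
            ∏ i, airyK (x i) (x (σ i))

/-- `W_n` minus the leading term of its large `x` expansion when `n = 1, 2`,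
and `W_n` itself when `n ≥ 3`. -/
def airyWReg : (n : ℕ) → (Fin n → ℝ) → ℝ
  | 1, x => airyW 1 x + √(x 0)
  | 2, x => airyW 2 x - 1 / (4 * √(x 0) * √(x 1) * (√(x 0) + √(x 1)) ^ 2)
  | n, x => airyW n x

/-- The explicit primitive of the leading term subtracted in `airyWReg`. -/
def airyPhiLead : (n : ℕ) → (Fin n → ℝ) → ℝ
  | 1, x => -(2 / 3) * x 0 ^ (3 / 2 : ℝ)
  | 2, x => -Real.log (√(x 0) + √(x 1))
  | _, _ => 0

/-- The symmetric primitives `Φ_n` of the correlators `W_n`: the explicit leading term plus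
`∫_∞^{x_1} ⋯ ∫_∞^{x_n}` of `airyWReg n`. Each of the `n` integrals from `∞` to `x_i` is minus the
integral over `(x_i, ∞)`. -/
def airyPhi (n : ℕ) (x : Fin n → ℝ) : ℝ :=
  airyPhiLead n x +
    (-1) ^ n * ∫ y in Set.univ.pi (fun i => Set.Ioi (x i)), airyWReg n y

end

/-! Let `∂` denote the derivative along a common translation of all the points. The Airy kernel has
a rank one derivative, `∂K(x_i, x_j) = -Ai(x_i) Bi(x_j)` (`hasDerivAt_airyK`). Differentiating a
cyclic product of kernels therefore cuts the cycle at one link, and for `n ≥ 2` one gets `∂W_n =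
(-1)^n F_n`, where `F_n` is the sum over all orderings of the open chains `Bi K ⋯ K Ai`
(`hasDerivAt_sum_cycles`, `hasDerivAt_airyW`). Moreover `W_n` tends to `0` along translations
(`tendsto_airyW`), so `F_n` determines it.

The chains are studied as multilinear power series with one nilpotent variable per point (`SetAlg`).
Chains through a point `z` factor into an outgoing and an incoming walk, and each of these solves a
Schrödinger equation with potential `x_z - 2 ∂F` (`AirySystem.hasDerivAt_Ad`). Products of two such
solutions satisfy a third order equation (`hasDerivAt_airyChain_three`). Since the commutator of `K`
with multiplication by `x` has rank two, there is also an exchange relation that expresses `(x_z -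
x_y) F` through chains with fewer points (`airyChain_insert_insert`).

Convergence of the integrals comes from Laplace representations `F_n(x) = ∫ g exp(-∑ t_i x_i)` with
complex frequencies in the cone `|t| ≤ 2 Re t`. For one point this is the classical integral for `Ai
Bi` (`airyP_eq`). The exchange relation writes `F_n` as a sum of divided differences of products,
which become Laplace integrals after interpolating two frequencies (`LaplaceRep.conv`,
`isFine_airyChain`). Integration along translations divides the density by `T = ∑ t_i`, integration
over an orthant divides it by `∏ t_i`, so `Φ_n` converges as soon as `g / (T ∏ t_i)` is integrable
near frequency zero. The estimates collected in `Fine` give this for `n ≥ 3`. For `n = 1, 2` the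
subtracted leading term has the same density without the factor `exp(-r^3/12)`, and the difference
of the densities has enough additional decay (`tame_airyDelta`, `tame_airyDeltaPair`).

The expansion is then a matter of one variable. Put `q_l = (1/l!) (d/dx)^2 Φ_l(x, …, x)`.
Integrating the third order equation over all points but one yields `q_l''' = 4 x q_l' + 2 q_l - 6
∑_{i+j=l} (q_i q_j)'` (`airyQ_three`), which is the coefficient of `ε^l` in `q''' = 4 x q' + 2 q - 6
(q^2)'` for the formal series `q = ∑ ε^l q_l`. On the other hand, if `f'' = x f`, then `R = (log
f)''` satisfies exactly this equation (`hasExp_airyR`). On `x^(-1/2 - 3k/2)` the operator `4 x d/dx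
+ 2` acts as `-6k`, so all the coefficients follow from the first one, `-ε/2`. `HasExp.step` turns
this formal recursion into genuine asymptotics. Hence the same polynomials `airyPoly k` in `ε`
describe both sides: their coefficients give the `q_l`, their values at `ε = ±1` give `(log Ai)''`
and `(log Bi)''`. Their degree is at most `k + 1`, which is why only finitely many `l` contribute to
each power. Two integrations finish the proof. The constants are fixed by decay at infinity, by
steepest descent for `Ai`, and by `Ai Bi ∼ x^(-1/2) / 2` for `Bi`. -/

noncomputable section

/-! ### Exponential integrals with a cubic phase. -/

/-- The moments `∫ r ^ a * exp (-b r ^ 3 - x w r) dr` over `(0, ∞)`. -/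
def cubicMoment (b a : ℝ) (w : ℂ) (x : ℝ) : ℂ :=
  ∫ r in Set.Ioi (0 : ℝ), ((r ^ a : ℝ) : ℂ) * Complex.exp (-((b * r ^ 3 : ℝ) : ℂ) - (x : ℂ) * w * r)

/-- Makes the moments converge for every `x` and every direction `w`, including those for which the
linear term grows. -/
theorem linear_le_cubic {b : ℝ} (hb : 0 < b) (c : ℝ) :
    ∃ K : ℝ, ∀ r : ℝ, 0 < r → c * r ≤ b * r ^ 3 + K := by
  refine ⟨|c| * (1 + |c| / b), fun r hr => ?_⟩
  have h1 : c * r ≤ |c| * r := mul_le_mul_of_nonneg_right (le_abs_self c) hr.le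
  rcases le_total r (1 + |c| / b) with h | h
  · have : |c| * r ≤ |c| * (1 + |c| / b) := mul_le_mul_of_nonneg_left h (abs_nonneg c)
    have h3 : 0 ≤ b * r ^ 3 := by positivity
    linarith
  · have h0 : 0 ≤ |c| / b := by positivity
    have hr1 : 1 ≤ r := by linarith
    have hcb : |c| ≤ b * r := by
      have : |c| / b ≤ r := by linarith
      rw [div_le_iff₀ hb] at this
      linarith
    have h4 : |c| * r ≤ b * r * r := mul_le_mul_of_nonneg_right hcb hr.le
    have h5 : b * r * r ≤ b * r ^ 3 := by
      have : 0 ≤ b * r * r * (r - 1) := mul_nonneg (by positivity) (by linarith)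
      nlinarith
    have h6 : 0 ≤ |c| * (1 + |c| / b) := by positivity
    linarith

theorem integrableOn_rpow_mul_exp_cubic {a b : ℝ} (ha : -1 < a) (hb : 0 < b) (c : ℝ) :
    IntegrableOn (fun r : ℝ => r ^ a * Real.exp (-(b * r ^ 3) + c * r)) (Set.Ioi 0) := by
  obtain ⟨K, hK⟩ := linear_le_cubic (half_pos hb) c
  have h := (integrableOn_rpow_mul_exp_neg_mul_rpow (p := 3) ha (by norm_num) (half_pos hb)).const_mul
    (Real.exp K)
  refine Integrable.mono' h ?_ ?_
  · refine ContinuousOn.aestronglyMeasurable ?_ measurableSet_Ioi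
    intro r hr
    refine ContinuousAt.continuousWithinAt ?_
    refine ContinuousAt.mul (Real.continuousAt_rpow_const _ _ (Or.inl (ne_of_gt hr))) ?_
    fun_prop
  · refine (ae_restrict_iff' measurableSet_Ioi).2 (Eventually.of_forall fun r hr => ?_)
    have hr' : (0 : ℝ) < r := hr
    rw [Real.norm_of_nonneg (by positivity)]
    have h3 : r ^ (3 : ℝ) = r ^ 3 := by exact_mod_cast Real.rpow_natCast r 3
    rw [h3, mul_left_comm, ← Real.exp_add]
    refine mul_le_mul_of_nonneg_left (Real.exp_le_exp.2 ?_) (by positivity)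
    have := hK r hr'
    linarith

theorem norm_cubicMoment_integrand {b a r : ℝ} (hr : 0 < r) (w : ℂ) (x : ℝ) :
    ‖((r ^ a : ℝ) : ℂ) * Complex.exp (-((b * r ^ 3 : ℝ) : ℂ) - (x : ℂ) * w * r)‖
      = r ^ a * Real.exp (-(b * r ^ 3) + (-x * w.re) * r) := by
  rw [norm_mul, Complex.norm_real, Complex.norm_exp, Real.norm_of_nonneg (by positivity)]
  congr 2
  have h : (((b * r ^ 3 : ℝ) : ℂ)).re = b * r ^ 3 := Complex.ofReal_re _
  rw [Complex.sub_re, Complex.neg_re, h]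
  simp
  ring

theorem aestronglyMeasurable_cubicMoment (b a : ℝ) (w : ℂ) (x : ℝ) :
    AEStronglyMeasurable (fun r : ℝ => ((r ^ a : ℝ) : ℂ) *
      Complex.exp (-((b * r ^ 3 : ℝ) : ℂ) - (x : ℂ) * w * r)) (volume.restrict (Set.Ioi 0)) := by
  refine ContinuousOn.aestronglyMeasurable ?_ measurableSet_Ioi
  intro r hr
  refine ContinuousAt.continuousWithinAt ?_
  refine ContinuousAt.mul ?_ (by fun_prop)
  exact Complex.continuous_ofReal.continuousAt.comp
    (Real.continuousAt_rpow_const _ _ (Or.inl (ne_of_gt hr)))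

theorem integrableOn_cubicMoment {a b : ℝ} (ha : -1 < a) (hb : 0 < b) (w : ℂ) (x : ℝ) :
    IntegrableOn (fun r : ℝ => ((r ^ a : ℝ) : ℂ) *
      Complex.exp (-((b * r ^ 3 : ℝ) : ℂ) - (x : ℂ) * w * r)) (Set.Ioi 0) := by
  refine Integrable.mono' (integrableOn_rpow_mul_exp_cubic ha hb (-x * w.re))
    (aestronglyMeasurable_cubicMoment b a w x) ?_
  refine (ae_restrict_iff' measurableSet_Ioi).2 (Eventually.of_forall fun r hr => ?_)
  rw [norm_cubicMoment_integrand hr]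

theorem hasDerivAt_cubicMoment {a b : ℝ} (ha : -1 < a) (hb : 0 < b) (w : ℂ) (x : ℝ) :
    HasDerivAt (cubicMoment b a w) (-w * cubicMoment b (a + 1) w x) x := by
  have key := hasDerivAt_integral_of_dominated_loc_of_deriv_le
    (μ := volume.restrict (Set.Ioi (0 : ℝ))) (s := Metric.ball x 1) (x₀ := x)
    (F := fun (y : ℝ) (r : ℝ) => ((r ^ a : ℝ) : ℂ) *
      Complex.exp (-((b * r ^ 3 : ℝ) : ℂ) - (y : ℂ) * w * r))
    (F' := fun (y : ℝ) (r : ℝ) => -w * (((r ^ (a + 1) : ℝ) : ℂ) *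
      Complex.exp (-((b * r ^ 3 : ℝ) : ℂ) - (y : ℂ) * w * r)))
    -- For `|y - x| < 1` one has `-y Re w ≤ (|x| + 1) ‖w‖`, so the bound is uniform in `y`.
    (bound := fun r => ‖w‖ * (r ^ (a + 1) * Real.exp (-(b * r ^ 3) + ((|x| + 1) * ‖w‖) * r)))
    (Metric.ball_mem_nhds x one_pos)
    (Eventually.of_forall fun y => aestronglyMeasurable_cubicMoment b a w y)
    (integrableOn_cubicMoment ha hb w x)
    ((aestronglyMeasurable_cubicMoment b (a + 1) w x).const_mul _)
    ?_ ((integrableOn_rpow_mul_exp_cubic (by linarith) hb _).const_mul _) ?_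
  · refine key.2.congr_deriv ?_
    rw [integral_const_mul, cubicMoment]
  · refine (ae_restrict_iff' measurableSet_Ioi).2 (Eventually.of_forall fun r hr y hy => ?_)
    have hr' : (0 : ℝ) < r := hr
    rw [norm_mul, norm_neg, norm_cubicMoment_integrand hr']
    refine mul_le_mul_of_nonneg_left (mul_le_mul_of_nonneg_left (Real.exp_le_exp.2 ?_)
      (by positivity)) (norm_nonneg _)
    have h1 : |y| ≤ |x| + 1 := by
      have : |y - x| < 1 := by simpa [Real.dist_eq] using hy
      have h2 := abs_add_le (y - x) x
      rw [sub_add_cancel] at h2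
      linarith
    have h2 : -y * w.re ≤ (|x| + 1) * ‖w‖ := by
      calc -y * w.re ≤ |(-y) * w.re| := le_abs_self _
        _ = |y| * |w.re| := by rw [abs_mul, abs_neg]
        _ ≤ _ := mul_le_mul h1 (Complex.abs_re_le_norm w) (abs_nonneg _) (by positivity)
    have := mul_le_mul_of_nonneg_right h2 hr'.le
    linarith
  · refine (ae_restrict_iff' measurableSet_Ioi).2 (Eventually.of_forall fun r hr y hy => ?_)
    have hr' : (0 : ℝ) < r := hr
    have h1 : HasDerivAt (fun y : ℝ => -((b * r ^ 3 : ℝ) : ℂ) - (y : ℂ) * w * r) (-(w * r)) y := by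
      have := ((Complex.ofRealCLM.hasDerivAt (x := y)).mul_const (w * r)).const_sub
        (-((b * r ^ 3 : ℝ) : ℂ))
      simpa [mul_assoc] using this
    have h2 := (h1.cexp).const_mul (((r ^ a : ℝ) : ℂ))
    refine h2.congr_deriv ?_
    rw [Real.rpow_add hr', Real.rpow_one]
    push_cast
    ring

/-- A bound for the integrand that serves for the limits at both ends. -/
theorem tendsto_rpow_mul_exp_cubic_atTop (a : ℝ) {b : ℝ} (hb : 0 < b) (w : ℂ) (x : ℝ) :
    Tendsto (fun r : ℝ => ((r ^ a : ℝ) : ℂ) *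
      Complex.exp (-((b * r ^ 3 : ℝ) : ℂ) - (x : ℂ) * w * r)) atTop (nhds 0) := by
  rw [tendsto_zero_iff_norm_tendsto_zero]
  obtain ⟨K, hK⟩ := linear_le_cubic hb (-x * w.re + 1)
  have h0 : Tendsto (fun r : ℝ => Real.exp K * (r ^ a * Real.exp (-1 * r))) atTop (nhds 0) := by
    simpa using (tendsto_rpow_mul_exp_neg_mul_atTop_nhds_zero a 1 one_pos).const_mul (Real.exp K)
  refine squeeze_zero' (Eventually.of_forall fun _ => norm_nonneg _) ?_ h0
  filter_upwards [eventually_gt_atTop (0 : ℝ)] with r hr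
  rw [norm_cubicMoment_integrand hr, mul_left_comm, ← Real.exp_add]
  refine mul_le_mul_of_nonneg_left (Real.exp_le_exp.2 ?_) (by positivity)
  have := hK r hr
  linarith

theorem hasDerivAt_cubicMoment_integrand (b a : ℝ) (w : ℂ) (x : ℝ) {r : ℝ} (hr : 0 < r) :
    HasDerivAt (fun r : ℝ => ((r ^ a : ℝ) : ℂ) *
      Complex.exp (-((b * r ^ 3 : ℝ) : ℂ) - (x : ℂ) * w * r))
      (a * (((r ^ (a - 1) : ℝ) : ℂ) * Complex.exp (-((b * r ^ 3 : ℝ) : ℂ) - (x : ℂ) * w * r))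
        - 3 * b * (((r ^ (a + 2) : ℝ) : ℂ) *
          Complex.exp (-((b * r ^ 3 : ℝ) : ℂ) - (x : ℂ) * w * r))
        - x * w * (((r ^ a : ℝ) : ℂ) *
          Complex.exp (-((b * r ^ 3 : ℝ) : ℂ) - (x : ℂ) * w * r))) r := by
  have h1 : HasDerivAt (fun r : ℝ => ((r ^ a : ℝ) : ℂ)) ((a * r ^ (a - 1) : ℝ) : ℂ) r :=
    (Real.hasDerivAt_rpow_const (Or.inl hr.ne')).ofReal_comp
  have h2 : HasDerivAt (fun r : ℝ => -((b * r ^ 3 : ℝ) : ℂ) - (x : ℂ) * w * r)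
      (-((b * (3 * r ^ 2) : ℝ) : ℂ) - x * w) r := by
    have h3 : HasDerivAt (fun r : ℝ => ((b * r ^ 3 : ℝ) : ℂ)) ((b * (3 * r ^ 2) : ℝ) : ℂ) r := by
      have := ((hasDerivAt_pow 3 r).const_mul b).ofReal_comp
      simpa using this
    have h4 := (Complex.ofRealCLM.hasDerivAt (x := r)).const_mul ((x : ℂ) * w)
    simpa using h3.fun_neg.fun_sub h4
  refine (h1.fun_mul h2.cexp).congr_deriv ?_
  have h5 : r ^ (a + 2) = r ^ a * r ^ 2 := by
    rw [Real.rpow_add hr]; norm_cast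
  rw [h5]
  push_cast
  ring

theorem tendsto_cubicMoment_integrand_zero {a : ℝ} (ha : 0 ≤ a) (b : ℝ) (w : ℂ) (x : ℝ) :
    Tendsto (fun r : ℝ => ((r ^ a : ℝ) : ℂ) *
      Complex.exp (-((b * r ^ 3 : ℝ) : ℂ) - (x : ℂ) * w * r)) (nhdsWithin 0 (Set.Ioi 0))
      (nhds (((0 : ℝ) ^ a : ℝ) : ℂ)) := by
  have h : ContinuousAt (fun r : ℝ => ((r ^ a : ℝ) : ℂ) *
      Complex.exp (-((b * r ^ 3 : ℝ) : ℂ) - (x : ℂ) * w * r)) 0 := by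
    refine ContinuousAt.mul ?_ (by fun_prop)
    exact Complex.continuous_ofReal.continuousAt.comp
      (Real.continuousAt_rpow_const _ _ (Or.inr ha))
  have h2 := h.tendsto.mono_left (nhdsWithin_le_nhds (s := Set.Ioi 0))
  simpa using h2

/-- Integration of a total derivative over the half line; for `a > 0` both boundary values vanish.
-/
theorem cubicMoment_recurrence {a b : ℝ} (ha : 0 < a) (hb : 0 < b) (w : ℂ) (x : ℝ) :
    a * cubicMoment b (a - 1) w x - 3 * b * cubicMoment b (a + 2) w x
      - x * w * cubicMoment b a w x = 0 := by
  have i1 := (integrableOn_cubicMoment (a := a - 1) (by linarith) hb w x).const_mul (a : ℂ)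
  have i2 := (integrableOn_cubicMoment (a := a + 2) (by linarith) hb w x).const_mul (3 * b : ℂ)
  have i3 := (integrableOn_cubicMoment (a := a) (by linarith) hb w x).const_mul (x * w)
  have key := integral_Ioi_of_hasDerivAt_of_tendsto
    (f := fun r : ℝ => ((r ^ a : ℝ) : ℂ) *
      Complex.exp (-((b * r ^ 3 : ℝ) : ℂ) - (x : ℂ) * w * r)) (a := (0 : ℝ)) (m := 0) ?_
    (fun r hr => hasDerivAt_cubicMoment_integrand b a w x hr) ((i1.sub i2).sub i3)
    (tendsto_rpow_mul_exp_cubic_atTop a hb w x)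
  · rw [Real.zero_rpow ha.ne'] at key
    simp only [cubicMoment, ← integral_const_mul]
    rw [← integral_sub i1 i2, ← integral_sub (by exact i1.sub i2) i3]
    simpa using key
  · have := tendsto_cubicMoment_integrand_zero ha.le b w x
    rw [← continuousWithinAt_Ioi_iff_Ici]
    simpa [ContinuousWithinAt] using this

/-- For `a = 0` the boundary at the origin contributes the `1`. -/
theorem cubicMoment_recurrence_zero {b : ℝ} (hb : 0 < b) (w : ℂ) (x : ℝ) :
    3 * b * cubicMoment b 2 w x + x * w * cubicMoment b 0 w x = 1 := by
  have i2 := (integrableOn_cubicMoment (a := 0 + 2) (by norm_num) hb w x).const_mul (3 * b : ℂ)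
  have i3 := (integrableOn_cubicMoment (a := 0) (by norm_num) hb w x).const_mul (x * w)
  have key := integral_Ioi_of_hasDerivAt_of_tendsto
    (f := fun r : ℝ => ((r ^ (0 : ℝ) : ℝ) : ℂ) *
      Complex.exp (-((b * r ^ 3 : ℝ) : ℂ) - (x : ℂ) * w * r)) (a := (0 : ℝ)) (m := 0)
    (f' := fun r : ℝ => -(3 * b * (((r ^ ((0 : ℝ) + 2) : ℝ) : ℂ) *
          Complex.exp (-((b * r ^ 3 : ℝ) : ℂ) - (x : ℂ) * w * r)))
        - x * w * (((r ^ (0 : ℝ) : ℝ) : ℂ) *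
          Complex.exp (-((b * r ^ 3 : ℝ) : ℂ) - (x : ℂ) * w * r))) ?_
    (fun r hr => ?_) (i2.neg.sub i3)
    (tendsto_rpow_mul_exp_cubic_atTop 0 hb w x)
  · rw [integral_sub (by exact i2.neg) i3, integral_neg, integral_const_mul, integral_const_mul] at key
    simp only [Real.rpow_zero, zero_add] at key
    simp only [cubicMoment, Real.rpow_zero]
    have h : Complex.exp (-((b * (0 : ℝ) ^ 3 : ℝ) : ℂ) - (x : ℂ) * w * ((0 : ℝ) : ℂ)) = 1 := by simp
    rw [h] at key
    linear_combination -key + Complex.ofReal_one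
  · have := tendsto_cubicMoment_integrand_zero le_rfl b w x
    rw [← continuousWithinAt_Ioi_iff_Ici]
    simpa [ContinuousWithinAt] using this
  · have := hasDerivAt_cubicMoment_integrand b 0 w x (r := r) hr
    refine this.congr_deriv ?_
    push_cast
    ring

end

/-! ### The Airy equation, the Wronskian and the Laplace integral of `Ai Bi`. -/

noncomputable section

theorem exp_pi_div_three : Complex.exp (Real.pi / 3 * Complex.I) = ⟨1 / 2, √3 / 2⟩ := by
  have h : (Real.pi / 3 * Complex.I : ℂ) = ((Real.pi / 3 : ℝ) : ℂ) * Complex.I := by push_cast; ring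
  rw [h]
  apply Complex.ext
  · rw [Complex.exp_ofReal_mul_I_re, Real.cos_pi_div_three]
  · rw [Complex.exp_ofReal_mul_I_im, Real.sin_pi_div_three]

/-- The cube root `exp (iπ/3)` of `-1`. -/
def airyOmega : ℂ := ⟨1 / 2, √3 / 2⟩

/-- The square root `exp (iπ/6)` of `airyOmega`. -/
def airyNu : ℂ := ⟨√3 / 2, 1 / 2⟩

theorem airyNu_sq : airyNu ^ 2 = airyOmega := by
  have h3 : √3 * √3 = 3 := Real.mul_self_sqrt (by norm_num)
  apply Complex.ext <;> simp [pow_two, airyNu, airyOmega] <;> nlinarith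

theorem airyNu_cube : airyNu ^ 3 = Complex.I := by
  have h3 : √3 * √3 = 3 := Real.mul_self_sqrt (by norm_num)
  rw [pow_succ, airyNu_sq]
  apply Complex.ext <;> simp [airyNu, airyOmega] <;> nlinarith

theorem airyOmega_sq : airyOmega ^ 2 = ⟨-1 / 2, √3 / 2⟩ := by
  have h3 : √3 * √3 = 3 := Real.mul_self_sqrt (by norm_num)
  apply Complex.ext <;> simp [pow_two, airyOmega] <;> nlinarith

theorem airyOmega_cube : airyOmega ^ 3 = -1 := by
  rw [← airyNu_sq, ← pow_mul, mul_comm, pow_mul, airyNu_cube, Complex.I_sq]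

theorem airyRay_eq {w : ℂ} (hw : w ^ 3 = -1) (x : ℝ) :
    airyRay w x = w * cubicMoment (1 / 3) 0 w x := by
  rw [airyRay, cubicMoment, ← integral_const_mul]
  congr 1
  ext r
  rw [mul_pow, hw, Real.rpow_zero]
  push_cast
  ring_nf

theorem hasDerivAt_airyRay {w : ℂ} (hw : w ^ 3 = -1) (x : ℝ) :
    HasDerivAt (airyRay w) (-w ^ 2 * cubicMoment (1 / 3) 1 w x) x := by
  rw [funext (airyRay_eq hw)]
  have h := (hasDerivAt_cubicMoment (a := 0) (b := 1 / 3) (by norm_num) (by norm_num) w x).const_mul w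
  refine h.congr_deriv ?_
  rw [zero_add]; ring

/-- A single ray solves `y'' = x y - 1`. The inhomogeneity is real and independent of the ray, so it
disappears in the imaginary part for `Ai` and in the difference of two rays for `Bi`. -/
theorem hasDerivAt_airyRay_deriv {w : ℂ} (hw : w ^ 3 = -1) (x : ℝ) :
    HasDerivAt (fun x => -w ^ 2 * cubicMoment (1 / 3) 1 w x) (x * airyRay w x - 1) x := by
  have h := (hasDerivAt_cubicMoment (a := 1) (b := 1 / 3) (by norm_num) (by norm_num) w x).const_mul
    (-w ^ 2)
  refine h.congr_deriv ?_
  have h2 := cubicMoment_recurrence_zero (b := 1 / 3) (by norm_num) w x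
  rw [airyRay_eq hw, show (1 : ℝ) + 1 = 2 by norm_num]
  push_cast at h2
  linear_combination (cubicMoment (1 / 3) 2 w x) * hw - h2

theorem HasDerivAt.complex_re {f : ℝ → ℂ} {f' : ℂ} {x : ℝ} (h : HasDerivAt f f' x) :
    HasDerivAt (fun y => (f y).re) f'.re x :=
  (Complex.reCLM.hasFDerivAt.comp_hasDerivAt x h)

theorem HasDerivAt.complex_im {f : ℝ → ℂ} {f' : ℂ} {x : ℝ} (h : HasDerivAt f f' x) :
    HasDerivAt (fun y => (f y).im) f'.im x :=
  (Complex.imCLM.hasFDerivAt.comp_hasDerivAt x h)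

/-- The derivative of `airyAi`. -/
def airyAi' (x : ℝ) : ℝ :=
  √(2 * Real.pi) * ((1 / Real.pi) * (-airyOmega ^ 2 * cubicMoment (1 / 3) 1 airyOmega x).im)

/-- The derivative of `airyBi`. -/
def airyBi' (x : ℝ) : ℝ :=
  √(Real.pi / 2) * ((1 / Real.pi) * (-airyOmega ^ 2 * cubicMoment (1 / 3) 1 airyOmega x -
    -(-1) ^ 2 * cubicMoment (1 / 3) 1 (-1) x).re)

theorem hasDerivAt_airyAi (x : ℝ) : HasDerivAt airyAi (airyAi' x) x := by
  have h := (((hasDerivAt_airyRay airyOmega_cube x).complex_im).const_mul (1 / Real.pi)).const_mul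
    √(2 * Real.pi)
  refine h.congr_of_eventuallyEq (Eventually.of_forall fun y => ?_)
  simp only [airyAi, exp_pi_div_three, airyOmega]

theorem hasDerivAt_airyAi' (x : ℝ) : HasDerivAt airyAi' (x * airyAi x) x := by
  have h := (((hasDerivAt_airyRay_deriv airyOmega_cube x).complex_im).const_mul
    (1 / Real.pi)).const_mul √(2 * Real.pi)
  refine h.congr_deriv ?_
  simp only [airyAi, exp_pi_div_three, airyOmega]
  simp
  ring

theorem hasDerivAt_airyBi (x : ℝ) : HasDerivAt airyBi (airyBi' x) x := by
  have h := ((((hasDerivAt_airyRay airyOmega_cube x).fun_sub (hasDerivAt_airyRay (w := -1)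
    (by norm_num) x)).complex_re).const_mul (1 / Real.pi)).const_mul √(Real.pi / 2)
  refine h.congr_of_eventuallyEq (Eventually.of_forall fun y => ?_)
  simp only [airyBi, exp_pi_div_three, airyOmega]

theorem hasDerivAt_airyBi' (x : ℝ) : HasDerivAt airyBi' (x * airyBi x) x := by
  have h := ((((hasDerivAt_airyRay_deriv airyOmega_cube x).fun_sub (hasDerivAt_airyRay_deriv
    (w := -1) (by norm_num) x)).complex_re).const_mul (1 / Real.pi)).const_mul √(Real.pi / 2)
  refine h.congr_deriv ?_
  simp only [airyBi, exp_pi_div_three, airyOmega]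
  simp
  ring

theorem deriv_airyAi : deriv airyAi = airyAi' := funext fun x => (hasDerivAt_airyAi x).deriv

theorem deriv_airyBi : deriv airyBi = airyBi' := funext fun x => (hasDerivAt_airyBi x).deriv

theorem cubicMoment_at_zero {b a : ℝ} (ha : -1 < a) (hb : 0 < b) (w : ℂ) :
    cubicMoment b a w 0 = ((b ^ (-(a + 1) / 3) * (1 / 3) * Real.Gamma ((a + 1) / 3) : ℝ) : ℂ) := by
  rw [← integral_rpow_mul_exp_neg_mul_rpow (p := 3) (by norm_num) ha hb, cubicMoment,
    ← integral_complex_ofReal]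
  refine setIntegral_congr_fun measurableSet_Ioi fun r hr => ?_
  have h3 : r ^ (3 : ℝ) = r ^ 3 := by exact_mod_cast Real.rpow_natCast r 3
  rw [h3]
  push_cast
  simp

/-- The numbers `2 ^ (1/3)` and `3 ^ (1/6)` and the values of `Γ` at `1/3`, `2/3`, `1/6`, `5/6`. -/
theorem airy_gamma_relations : ∃ u v G1 G2 : ℝ, 0 < u ∧ 0 < v ∧ 0 < G1 ∧ 0 < G2 ∧ u ^ 3 = 2 ∧
    v ^ 3 = √3 ∧ G1 * G2 = 2 * Real.pi / √3 ∧
    (1 / 3 : ℝ) ^ (-(0 + 1) / 3 : ℝ) * (1 / 3) * Real.Gamma ((0 + 1) / 3) = v ^ 2 / 3 * G1 ∧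
    (1 / 3 : ℝ) ^ (-(1 + 1) / 3 : ℝ) * (1 / 3) * Real.Gamma ((1 + 1) / 3) = v ^ 4 / 3 * G2 ∧
    (1 / 12 : ℝ) ^ (-(-1 / 2 + 1) / 3 : ℝ) * (1 / 3) * Real.Gamma ((-1 / 2 + 1) / 3) * G2
      = u * v / 3 * (u ^ 2 * √Real.pi * G1) ∧
    (1 / 12 : ℝ) ^ (-(3 / 2 + 1) / 3 : ℝ) * (1 / 3) * Real.Gamma ((3 / 2 + 1) / 3) * G1
      = u ^ 5 * v ^ 5 / 3 * (u * √Real.pi * G2) := by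
  have p3 : ∀ s : ℝ, (1 / 3 : ℝ) ^ (-s) = (3 : ℝ) ^ s := fun s => by
    rw [one_div, Real.inv_rpow (by norm_num), Real.rpow_neg (by norm_num), inv_inv]
  have p12 : ∀ s : ℝ, (1 / 12 : ℝ) ^ (-s) = (2 : ℝ) ^ (2 * s) * (3 : ℝ) ^ s := fun s => by
    rw [one_div, Real.inv_rpow (by norm_num), Real.rpow_neg (by norm_num), inv_inv,
      Real.rpow_mul (by norm_num), ← Real.mul_rpow (by norm_num) (by norm_num)]
    norm_num
  have pu : ∀ n : ℕ, ((2 : ℝ) ^ (1 / 3 : ℝ)) ^ n = (2 : ℝ) ^ ((n : ℝ) / 3) := fun n => by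
    rw [← Real.rpow_natCast, ← Real.rpow_mul (by norm_num)]; congr 1; ring
  have pv : ∀ n : ℕ, ((3 : ℝ) ^ (1 / 6 : ℝ)) ^ n = (3 : ℝ) ^ ((n : ℝ) / 6) := fun n => by
    rw [← Real.rpow_natCast, ← Real.rpow_mul (by norm_num)]; congr 1; ring
  -- Duplication at `1/6` and at `1/3` reduces `Γ(1/6)` and `Γ(5/6)` to `Γ(1/3)` and `Γ(2/3)`;
  -- reflection gives the product of the latter two.
  have d1 := Real.Gamma_mul_Gamma_add_half (1 / 6)
  have d2 := Real.Gamma_mul_Gamma_add_half (1 / 3)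
  have r1 := Real.Gamma_mul_Gamma_one_sub (1 / 3)
  refine ⟨2 ^ (1 / 3 : ℝ), 3 ^ (1 / 6 : ℝ), Real.Gamma (1 / 3), Real.Gamma (2 / 3), by positivity,
    by positivity, Real.Gamma_pos_of_pos (by norm_num), Real.Gamma_pos_of_pos (by norm_num),
    ?_, ?_, ?_, ?_, ?_, ?_, ?_⟩
  · rw [pu]; norm_num
  · rw [pv, Real.sqrt_eq_rpow]; norm_num
  · rw [show (1 : ℝ) - 1 / 3 = 2 / 3 by norm_num, show Real.pi * (1 / 3) = Real.pi / 3 by ring,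
      Real.sin_pi_div_three] at r1
    rw [r1]; field_simp
  · rw [pv, neg_div, p3]; norm_num; left; ring
  · rw [pv, neg_div, p3]; norm_num; left; ring
  · rw [show (1 / 6 : ℝ) + 1 / 2 = 2 / 3 by norm_num, show 2 * (1 / 6 : ℝ) = 1 / 3 by norm_num,
      show (1 : ℝ) - 1 / 3 = (2 : ℕ) / 3 by norm_num, ← pu] at d1
    rw [neg_div, p12, show 2 * ((-1 / 2 + 1 : ℝ) / 3) = 1 / 3 by norm_num,
      show (-1 / 2 + 1 : ℝ) / 3 = 1 / 6 by norm_num]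
    linear_combination (2 : ℝ) ^ (1 / 3 : ℝ) * (3 : ℝ) ^ (1 / 6 : ℝ) / 3 * d1
  · rw [show (1 / 3 : ℝ) + 1 / 2 = 5 / 6 by norm_num, show 2 * (1 / 3 : ℝ) = 2 / 3 by norm_num,
      show (1 : ℝ) - 2 / 3 = 1 / 3 by norm_num] at d2
    rw [neg_div, p12, show 2 * ((3 / 2 + 1 : ℝ) / 3) = (5 : ℕ) / 3 by norm_num,
      show (3 / 2 + 1 : ℝ) / 3 = (5 : ℕ) / 6 by norm_num, ← pu, ← pv,
      show ((5 : ℕ) : ℝ) / 6 = 5 / 6 by norm_num]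
    linear_combination ((2 : ℝ) ^ (1 / 3 : ℝ)) ^ 5 * ((3 : ℝ) ^ (1 / 6 : ℝ)) ^ 5 / 3 * d2

/-- At `x = 0` the moments are real and do not depend on the ray, so only the real and imaginary
parts of the cube roots `ω`, `-1` and of their squares enter. -/
theorem airy_at_zero : ∃ g0 g1 : ℝ,
    g0 = (1 / 3 : ℝ) ^ (-(0 + 1) / 3 : ℝ) * (1 / 3) * Real.Gamma ((0 + 1) / 3) ∧
    g1 = (1 / 3 : ℝ) ^ (-(1 + 1) / 3 : ℝ) * (1 / 3) * Real.Gamma ((1 + 1) / 3) ∧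
    airyAi 0 = √(2 * Real.pi) * (1 / Real.pi * (√3 / 2 * g0)) ∧
    airyBi 0 = √(Real.pi / 2) * (1 / Real.pi * (3 / 2 * g0)) ∧
    airyAi' 0 = -(√(2 * Real.pi) * (1 / Real.pi * (√3 / 2 * g1))) ∧
    airyBi' 0 = √(Real.pi / 2) * (1 / Real.pi * (3 / 2 * g1)) := by
  refine ⟨_, _, rfl, rfl, ?_, ?_, ?_, ?_⟩
  · simp only [airyAi, exp_pi_div_three]
    rw [← airyOmega, airyRay_eq airyOmega_cube, cubicMoment_at_zero (by norm_num) (by norm_num),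
      Complex.im_mul_ofReal]
    rfl
  · simp only [airyBi, exp_pi_div_three]
    rw [← airyOmega, airyRay_eq airyOmega_cube, airyRay_eq (by norm_num),
      cubicMoment_at_zero (by norm_num) (by norm_num),
      cubicMoment_at_zero (by norm_num) (by norm_num), ← sub_mul, Complex.re_mul_ofReal]
    simp only [airyOmega, Complex.sub_re, Complex.neg_re, Complex.one_re]
    ring
  · simp only [airyAi']
    rw [cubicMoment_at_zero (by norm_num) (by norm_num), Complex.im_mul_ofReal, airyOmega_sq]
    simp only [Complex.neg_im]
    ring
  · simp only [airyBi']
    rw [cubicMoment_at_zero (by norm_num) (by norm_num),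
      cubicMoment_at_zero (by norm_num) (by norm_num), ← sub_mul, Complex.re_mul_ofReal,
      airyOmega_sq, show (-1 : ℂ) ^ 2 = 1 by norm_num]
    simp only [Complex.sub_re, Complex.neg_re, Complex.one_re]
    ring

theorem sqrt_two_pi_mul : √(2 * Real.pi) * √(Real.pi / 2) = Real.pi := by
  rw [← Real.sqrt_mul (by positivity), show 2 * Real.pi * (Real.pi / 2) = Real.pi ^ 2 by ring,
    Real.sqrt_sq Real.pi_pos.le]

/-- Constant because the Airy equation has no first order term; the value at `0` is the reflection
formula for `Γ(1/3) Γ(2/3)`. -/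
theorem wronskian_airy (x : ℝ) : airyAi x * airyBi' x - airyAi' x * airyBi x = 1 := by
  have hd : ∀ x, HasDerivAt (fun x => airyAi x * airyBi' x - airyAi' x * airyBi x) 0 x := by
    intro x
    refine (((hasDerivAt_airyAi x).fun_mul (hasDerivAt_airyBi' x)).fun_sub
      ((hasDerivAt_airyAi' x).fun_mul (hasDerivAt_airyBi x))).congr_deriv ?_
    ring
  have hc := is_const_of_deriv_eq_zero (fun x => (hd x).differentiableAt) (fun x => (hd x).deriv) x 0
  refine hc.trans ?_
  obtain ⟨g0, g1, h0, h1, e1, e2, e3, e4⟩ := airy_at_zero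
  obtain ⟨u, v, G1, G2, hu, hv, hG1, hG2, u3, v3, hG, r1, r2, -, -⟩ := airy_gamma_relations
  rw [r1] at h0
  rw [r2] at h1
  rw [e1, e2, e3, e4, h0, h1]
  have h3 : √3 * √3 = 3 := Real.mul_self_sqrt (by norm_num)
  have h4 : v ^ 6 = 3 := by rw [← h3, ← v3]; ring
  have h5 := sqrt_two_pi_mul
  have hpi := Real.pi_pos.ne'
  have hs3 : √3 ≠ 0 := by positivity
  have key : √(2 * Real.pi) * √(Real.pi / 2) / Real.pi ^ 2 * (√3 * v ^ 6 / 6) * (G1 * G2) = 1 := by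
    rw [hG, h4, h5]
    field_simp
    norm_num
  refine Eq.trans ?_ key
  ring

/-- The integral representation of `Ai * Bi`. -/
def airyP (x : ℝ) : ℝ :=
  1 / (2 * √Real.pi) * (airyNu * cubicMoment (1 / 12) (-1 / 2) airyOmega x).re

theorem hasDerivAt_airyP_aux {a : ℝ} (ha : -1 < a) (c : ℂ) (x : ℝ) :
    HasDerivAt (fun x => 1 / (2 * √Real.pi) * (c * cubicMoment (1 / 12) a airyOmega x).re)
      (1 / (2 * √Real.pi) * (-airyOmega * c * cubicMoment (1 / 12) (a + 1) airyOmega x).re) x := by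
  have h := (((hasDerivAt_cubicMoment ha (b := 1 / 12) (by norm_num) airyOmega x).const_mul
    c).complex_re).const_mul (1 / (2 * √Real.pi))
  refine h.congr_deriv ?_
  congr 2
  ring

/-- A linear third order equation with vanishing initial values, solved with the squares and the
product of two solutions `A`, `B` of the Airy equation. -/
theorem eq_zero_of_airy_product_ode {A A' B B' h h1 h2 : ℝ → ℝ}
    (hA : ∀ x, HasDerivAt A (A' x) x) (hA' : ∀ x, HasDerivAt A' (x * A x) x)
    (hB : ∀ x, HasDerivAt B (B' x) x) (hB' : ∀ x, HasDerivAt B' (x * B x) x)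
    (hW : ∀ x, A x * B' x - A' x * B x = 1)
    (hh : ∀ x, HasDerivAt h (h1 x) x) (hh1 : ∀ x, HasDerivAt h1 (h2 x) x)
    (hh2 : ∀ x, HasDerivAt h2 (4 * x * h1 x + 2 * h x) x)
    (h00 : h 0 = 0) (h10 : h1 0 = 0) (h20 : h2 0 = 0) (x : ℝ) : h x = 0 := by
  -- The third order operator `y''' - 4xy' - 2y` is skew-adjoint, so pairing `h` with a product `u
  -- v` of Airy solutions gives a conserved bilinear form, which vanishes at `0`.
  have key : ∀ {u u' v v' : ℝ → ℝ}, (∀ x, HasDerivAt u (u' x) x) →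
      (∀ x, HasDerivAt u' (x * u x) x) → (∀ x, HasDerivAt v (v' x) x) →
      (∀ x, HasDerivAt v' (x * v x) x) →
      h2 x * (u x * v x) - h1 x * (u x * v' x + u' x * v x)
        + h x * (2 * (u' x * v' x) - 2 * (x * (u x * v x))) = 0 := by
    intro u u' v v' hu hu' hv hv'
    have hd : ∀ x, HasDerivAt (fun x => h2 x * (u x * v x) - h1 x * (u x * v' x + u' x * v x)
        + h x * (2 * (u' x * v' x) - 2 * (x * (u x * v x)))) 0 x := by
      intro x
      refine ((((hh2 x).fun_mul ((hu x).fun_mul (hv x))).fun_sub ((hh1 x).fun_mul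
        (((hu x).fun_mul (hv' x)).fun_add ((hu' x).fun_mul (hv x))))).fun_add ((hh x).fun_mul
        ((((hu' x).fun_mul (hv' x)).const_mul 2).fun_sub (((hasDerivAt_id' x).fun_mul
          ((hu x).fun_mul (hv x))).const_mul 2)))).congr_deriv ?_
      ring
    refine (is_const_of_deriv_eq_zero (fun x => (hd x).differentiableAt)
      (fun x => (hd x).deriv) x 0).trans ?_
    simp [h00, h10, h20]
  have k1 := key hA hA' hA hA'
  have k2 := key hA hA' hB hB'
  have k3 := key hB hB' hB hB'
  have hw := hW x
  -- This combination of the three conservation laws eliminates `h1` and `h2` and leaves the square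
  -- of the Wronskian.
  have : 2 * h x * (A x * B' x - A' x * B x) ^ 2 = 0 := by
    linear_combination (B x) ^ 2 * k1 - 2 * A x * B x * k2 + (A x) ^ 2 * k3
  rw [hw] at this
  linarith

theorem hasDerivAt_airyP (x : ℝ) :
    HasDerivAt airyP
      (1 / (2 * √Real.pi) * (-Complex.I * cubicMoment (1 / 12) (1 / 2) airyOmega x).re) x := by
  refine (hasDerivAt_airyP_aux (a := -1 / 2) (by norm_num) airyNu x).congr_deriv ?_
  rw [show (-1 / 2 + 1 : ℝ) = 1 / 2 by norm_num, ← airyNu_sq, ← airyNu_cube]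
  congr 2
  ring

theorem hasDerivAt_airyP1 (x : ℝ) :
    HasDerivAt
      (fun x => 1 / (2 * √Real.pi) * (-Complex.I * cubicMoment (1 / 12) (1 / 2) airyOmega x).re)
      (1 / (2 * √Real.pi) * (airyOmega * Complex.I *
        cubicMoment (1 / 12) (3 / 2) airyOmega x).re) x := by
  refine (hasDerivAt_airyP_aux (a := 1 / 2) (by norm_num) (-Complex.I) x).congr_deriv ?_
  rw [show (1 / 2 + 1 : ℝ) = 3 / 2 by norm_num]
  congr 2
  ring

/-- With `b = 1/12` and `a = 1/2` the moment recurrence becomes `y''' = 4 x y' + 2 y`, the equation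
of products of Airy solutions. This is what singles out the density `r^(-1/2) exp(-r^3/12)`. -/
theorem hasDerivAt_airyP2 (x : ℝ) :
    HasDerivAt
      (fun x => 1 / (2 * √Real.pi) * (airyOmega * Complex.I *
        cubicMoment (1 / 12) (3 / 2) airyOmega x).re)
      (4 * x * (1 / (2 * √Real.pi) * (-Complex.I * cubicMoment (1 / 12) (1 / 2) airyOmega x).re)
        + 2 * airyP x) x := by
  refine (hasDerivAt_airyP_aux (a := 3 / 2) (by norm_num) (airyOmega * Complex.I) x).congr_deriv ?_
  have h := cubicMoment_recurrence (a := 1 / 2) (b := 1 / 12) (by norm_num) (by norm_num) airyOmega x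
  rw [show (1 / 2 - 1 : ℝ) = -1 / 2 by norm_num, show (1 / 2 + 2 : ℝ) = 3 / 2 + 1 by norm_num] at h
  have e : -airyOmega * (airyOmega * Complex.I) * cubicMoment (1 / 12) (3 / 2 + 1) airyOmega x
      = ((4 * x : ℝ) : ℂ) * (-Complex.I * cubicMoment (1 / 12) (1 / 2) airyOmega x)
        + ((2 : ℝ) : ℂ) * (airyNu * cubicMoment (1 / 12) (-1 / 2) airyOmega x) := by
    have h6 : airyNu ^ 6 = -1 := by
      rw [show 6 = 2 * 3 by norm_num, pow_mul, airyNu_sq, airyOmega_cube]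
    rw [← airyNu_sq, ← airyNu_cube] at *
    push_cast at h ⊢
    linear_combination (-4 * airyNu) * h - airyNu * cubicMoment (1 / 12) (3 / 2 + 1) (airyNu ^ 2) x * h6
  rw [e, Complex.add_re, Complex.re_ofReal_mul, Complex.re_ofReal_mul, airyP]
  ring

/-- Both sides solve the same third order equation, so it suffices to compare the value and two
derivatives at `0`. The first derivatives both vanish there; the other two comparisons are
duplication formulas. -/
theorem airyP_eq (x : ℝ) : airyP x = airyAi x * airyBi x := by
  obtain ⟨g0, g1, h0, h1, e1, e2, e3, e4⟩ := airy_at_zero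
  obtain ⟨u, v, G1, G2, hu, hv, hG1, hG2, u3, v3, hG, r1, r2, r3, r4⟩ := airy_gamma_relations
  rw [r1] at h0
  rw [r2] at h1
  have h3 : √3 * √3 = 3 := Real.mul_self_sqrt (by norm_num)
  have h4 : v ^ 6 = 3 := by rw [← h3, ← v3]; ring
  have h5 := sqrt_two_pi_mul
  have hpi := Real.pi_pos.ne'
  have hsp : √Real.pi ≠ 0 := by have := Real.pi_pos; positivity
  have hs3 : √3 ≠ 0 := by positivity
  have hv0 := hv.ne'
  have hG' : G1 * G2 = 2 * Real.pi / v ^ 3 := by rw [v3]; exact hG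
  have key := eq_zero_of_airy_product_ode hasDerivAt_airyAi hasDerivAt_airyAi' hasDerivAt_airyBi
    hasDerivAt_airyBi' wronskian_airy
    (fun x => (hasDerivAt_airyP x).fun_sub ((hasDerivAt_airyAi x).fun_mul (hasDerivAt_airyBi x)))
    (fun x => (hasDerivAt_airyP1 x).fun_sub
      (((hasDerivAt_airyAi' x).fun_mul (hasDerivAt_airyBi x)).fun_add
        ((hasDerivAt_airyAi x).fun_mul (hasDerivAt_airyBi' x))))
    (fun x => ((hasDerivAt_airyP2 x).fun_sub
      (((((hasDerivAt_id' x).fun_mul (hasDerivAt_airyAi x)).fun_mul (hasDerivAt_airyBi x)).fun_add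
        ((hasDerivAt_airyAi' x).fun_mul (hasDerivAt_airyBi' x))).fun_add
        (((hasDerivAt_airyAi' x).fun_mul (hasDerivAt_airyBi' x)).fun_add
        ((hasDerivAt_airyAi x).fun_mul ((hasDerivAt_id' x).fun_mul
          (hasDerivAt_airyBi x)))))).congr_deriv (by ring)) ?_ ?_ ?_ x
  · linarith
  · rw [airyP, cubicMoment_at_zero (by norm_num) (by norm_num), Complex.re_mul_ofReal, e1, e2, h0]
    have k : (1 / 12 : ℝ) ^ (-(-1 / 2 + 1) / 3 : ℝ) * (1 / 3) * Real.Gamma ((-1 / 2 + 1) / 3)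
        = u ^ 3 * v ^ 4 * √Real.pi * G1 ^ 2 / (6 * Real.pi) := by
      refine mul_right_cancel₀ hG2.ne' (r3.trans ?_)
      rw [show u ^ 3 * v ^ 4 * √Real.pi * G1 ^ 2 / (6 * Real.pi) * G2
        = u ^ 3 * v ^ 4 * √Real.pi * G1 / (6 * Real.pi) * (G1 * G2) by ring, hG']
      field_simp
      ring
    have k2 : √(2 * Real.pi) * (1 / Real.pi * (√3 / 2 * (v ^ 2 / 3 * G1))) *
        (√(Real.pi / 2) * (1 / Real.pi * (3 / 2 * (v ^ 2 / 3 * G1))))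
        = (√(2 * Real.pi) * √(Real.pi / 2)) * √3 * v ^ 4 * G1 ^ 2 / (12 * Real.pi ^ 2) := by
      field_simp; norm_num
    rw [k, k2, h5, u3]
    simp only [airyNu]
    field_simp
    norm_num
  · rw [cubicMoment_at_zero (by norm_num) (by norm_num), Complex.re_mul_ofReal, e1, e2, e3, e4]
    simp
    ring
  · rw [cubicMoment_at_zero (by norm_num) (by norm_num), Complex.re_mul_ofReal, e3, e4, h1]
    have k : (1 / 12 : ℝ) ^ (-(3 / 2 + 1) / 3 : ℝ) * (1 / 3) * Real.Gamma ((3 / 2 + 1) / 3)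
        = u ^ 6 * v ^ 8 * √Real.pi * G2 ^ 2 / (6 * Real.pi) := by
      refine mul_right_cancel₀ hG1.ne' (r4.trans ?_)
      rw [show u ^ 6 * v ^ 8 * √Real.pi * G2 ^ 2 / (6 * Real.pi) * G1
        = u ^ 6 * v ^ 8 * √Real.pi * G2 / (6 * Real.pi) * (G1 * G2) by ring, hG']
      field_simp
      ring
    have k2 : -(√(2 * Real.pi) * (1 / Real.pi * (√3 / 2 * (v ^ 4 / 3 * G2)))) *
        (√(Real.pi / 2) * (1 / Real.pi * (3 / 2 * (v ^ 4 / 3 * G2))))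
        = -((√(2 * Real.pi) * √(Real.pi / 2)) * √3 * v ^ 8 * G2 ^ 2 / (12 * Real.pi ^ 2)) := by
      field_simp; norm_num
    have k3 : (airyOmega * Complex.I).re = -√3 / 2 := by simp [airyOmega]; ring
    rw [k, k3, show u ^ 6 = 4 by rw [show 6 = 3 * 2 by norm_num, pow_mul, u3]; norm_num]
    have k4 : ∀ a b : ℝ, 0 * a + b + (b + 0 * a) = 2 * b := fun a b => by ring
    simp only [zero_mul, mul_zero, zero_add, add_zero]
    rw [k2, h5]
    field_simp
    norm_num

end

/-! ### The leading asymptotics of `Ai` by steepest descent. -/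

noncomputable section

theorem quadratic_le_cubic (B M : ℝ) :
    ∃ K : ℝ, ∀ r : ℝ, 0 < r → B * r + M * r ^ 2 ≤ 1 / 3 * r ^ 3 + K := by
  obtain ⟨K, hK⟩ := linear_le_cubic (b := 1 / 6) (by norm_num) B
  refine ⟨K + |M| * (6 * |M|) ^ 2, fun r hr => ?_⟩
  have h := hK r hr
  have h1 : M * r ^ 2 ≤ |M| * r ^ 2 := mul_le_mul_of_nonneg_right (le_abs_self M) (by positivity)
  have h2 : |M| * r ^ 2 ≤ 1 / 6 * r ^ 3 + |M| * (6 * |M|) ^ 2 := by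
    rcases le_total r (6 * |M|) with h | h
    · have : |M| * r ^ 2 ≤ |M| * (6 * |M|) ^ 2 :=
        mul_le_mul_of_nonneg_left (pow_le_pow_left₀ hr.le h 2) (abs_nonneg M)
      have h3 : 0 ≤ 1 / 6 * r ^ 3 := by positivity
      linarith
    · have : 0 ≤ (r - 6 * |M|) * r ^ 2 := mul_nonneg (by linarith) (by positivity)
      have h3 : 0 ≤ |M| * (6 * |M|) ^ 2 := by positivity
      nlinarith
  linarith

/-- The exponential in the Airy integral at the point `c + w r`. -/
def airyShift (x c r : ℝ) : ℂ :=
  Complex.exp ((c + airyOmega * r) ^ 3 / 3 - x * (c + airyOmega * r))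

theorem norm_airyShift (x c r : ℝ) :
    ‖airyShift x c r‖ =
      Real.exp (c ^ 3 / 3 - x * c + (c ^ 2 - x) * r / 2 - c * r ^ 2 / 2 - r ^ 3 / 3) := by
  rw [airyShift, Complex.norm_exp]
  congr 1
  have e : ((c + airyOmega * r) ^ 3 / 3 - x * (c + airyOmega * r) : ℂ)
      = ((c ^ 3 / 3 - x * c - r ^ 3 / 3 : ℝ) : ℂ) + ((c ^ 2 - x) * r : ℝ) * airyOmega
        + ((c * r ^ 2 : ℝ) : ℂ) * airyOmega ^ 2 := by
    push_cast
    linear_combination (r : ℂ) ^ 3 / 3 * airyOmega_cube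
  rw [e, Complex.add_re, Complex.add_re, Complex.re_ofReal_mul, Complex.re_ofReal_mul,
    Complex.ofReal_re, airyOmega_sq, airyOmega]
  simp only
  ring

theorem continuous_airyShift (x c : ℝ) : Continuous (airyShift x c) := by
  unfold airyShift; fun_prop

/-- The second bound serves at once for the derivatives in `r` and in `c`, since these coincide (up
to the constant factor `ω`, which is of modulus one). -/
theorem norm_airyShift_le (x M : ℝ) : ∃ K : ℝ, ∀ c r : ℝ, |c| ≤ M → 0 < r →
    ‖airyShift x c r‖ ≤ Real.exp (K - r) ∧
    ‖airyOmega * ((c + airyOmega * r) ^ 2 - x) * airyShift x c r‖ ≤ Real.exp (K - r) := by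
  obtain ⟨K, hK⟩ := quadratic_le_cubic (M ^ 2 + |x| + 2) M
  have hlog : Real.exp (Real.log (2 + |x|)) = 2 + |x| := Real.exp_log (by positivity)
  refine ⟨M ^ 3 + |x| * M + K + M + Real.log (2 + |x|), fun c r hc hr => ?_⟩
  have hM : 0 ≤ M := (abs_nonneg c).trans hc
  have hL : 0 ≤ Real.log (2 + |x|) := Real.log_nonneg (by have := abs_nonneg x; linarith)
  have b1 : ‖airyShift x c r‖ ≤ Real.exp (M ^ 3 + |x| * M + K - 2 * r) := by
    rw [norm_airyShift]
    refine Real.exp_le_exp.2 ?_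
    have h1 : c ^ 3 ≤ M ^ 3 := by
      calc c ^ 3 ≤ |c ^ 3| := le_abs_self _
        _ = |c| ^ 3 := abs_pow c 3
        _ ≤ M ^ 3 := pow_le_pow_left₀ (abs_nonneg c) hc 3
    have h2 : -(x * c) ≤ |x| * M := by
      calc -(x * c) ≤ |x * c| := neg_le_abs _
        _ = |x| * |c| := abs_mul x c
        _ ≤ |x| * M := mul_le_mul_of_nonneg_left hc (abs_nonneg x)
    have h3 : c ^ 2 - x ≤ M ^ 2 + |x| := by
      have : c ^ 2 ≤ M ^ 2 := by rw [← sq_abs c]; exact pow_le_pow_left₀ (abs_nonneg c) hc 2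
      have := neg_le_abs x
      linarith
    have h4 : (c ^ 2 - x) * r ≤ (M ^ 2 + |x|) * r := mul_le_mul_of_nonneg_right h3 hr.le
    have h5 : 0 ≤ (M ^ 2 + |x|) * r := by positivity
    have h6 : -(c * r ^ 2) ≤ M * r ^ 2 := by
      have := mul_le_mul_of_nonneg_right ((neg_le_abs c).trans hc) (sq_nonneg r)
      linarith
    have h7 : 0 ≤ M * r ^ 2 := by positivity
    have h8 : 0 ≤ M ^ 3 := by positivity
    have := hK r hr
    linarith
  refine ⟨b1.trans (Real.exp_le_exp.2 (by linarith)), ?_⟩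
  have hw : ‖airyOmega‖ = 1 := by
    have : ‖airyOmega‖ ^ 3 = 1 := by rw [← norm_pow, airyOmega_cube]; simp
    exact (pow_eq_one_iff_of_nonneg (norm_nonneg _) (by norm_num)).1 this
  have b2 : ‖airyOmega * ((c + airyOmega * r) ^ 2 - x)‖ ≤ Real.exp (M + Real.log (2 + |x|) + r) := by
    rw [norm_mul, hw, one_mul]
    have h1 : ‖(c + airyOmega * r : ℂ)‖ ≤ M + r := by
      refine (norm_add_le _ _).trans ?_
      rw [norm_mul, hw, one_mul, Complex.norm_real, Complex.norm_real, Real.norm_eq_abs,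
        Real.norm_of_nonneg hr.le]
      linarith
    have h2 : ‖((c + airyOmega * r) ^ 2 - x : ℂ)‖ ≤ (M + r) ^ 2 + |x| := by
      refine (norm_sub_le _ _).trans ?_
      rw [norm_pow, Complex.norm_real, Real.norm_eq_abs]
      gcongr
    refine h2.trans ?_
    have h3 := Real.quadratic_le_exp_of_nonneg (x := M + r) (by linarith)
    rw [show M + Real.log (2 + |x|) + r = Real.log (2 + |x|) + (M + r) by ring, Real.exp_add, hlog]
    have h4 : 1 ≤ Real.exp (M + r) := Real.one_le_exp (by linarith)
    have h5 : (M + r) ^ 2 ≤ 2 * Real.exp (M + r) := by nlinarith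
    have h6 : |x| * 1 ≤ |x| * Real.exp (M + r) := mul_le_mul_of_nonneg_left h4 (abs_nonneg x)
    linarith
  rw [norm_mul]
  refine (mul_le_mul b2 b1 (norm_nonneg _) (Real.exp_pos _).le).trans ?_
  rw [← Real.exp_add]
  exact Real.exp_le_exp.2 (by linarith)

theorem integrableOn_exp_const_sub (K : ℝ) :
    IntegrableOn (fun r : ℝ => Real.exp (K - r)) (Set.Ioi 0) := by
  have h := (exp_neg_integrableOn_Ioi 0 one_pos).const_mul (Real.exp K)
  refine h.congr (Eventually.of_forall fun r => ?_)
  simp only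
  rw [← Real.exp_add]; congr 1; ring

theorem hasDerivAt_airyShift_r (x c r : ℝ) :
    HasDerivAt (airyShift x c) (airyOmega * ((c + airyOmega * r) ^ 2 - x) * airyShift x c r) r := by
  have h1 : HasDerivAt (fun r : ℝ => (c + airyOmega * r : ℂ)) airyOmega r := by
    simpa using ((Complex.ofRealCLM.hasDerivAt (x := r)).const_mul airyOmega).const_add (c : ℂ)
  have h2 := (((h1.fun_pow 3).div_const 3).fun_sub (h1.const_mul (x : ℂ))).cexp
  refine h2.congr_deriv ?_
  rw [airyShift]
  push_cast
  ring

theorem hasDerivAt_airyShift_c (x c r : ℝ) :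
    HasDerivAt (fun c => airyOmega * airyShift x c r)
      (airyOmega * ((c + airyOmega * r) ^ 2 - x) * airyShift x c r) c := by
  have h1 : HasDerivAt (fun c : ℝ => (c + airyOmega * r : ℂ)) 1 c := by
    simpa using (Complex.ofRealCLM.hasDerivAt (x := c)).add_const (airyOmega * r)
  have h2 := ((((h1.fun_pow 3).div_const 3).fun_sub (h1.const_mul (x : ℂ))).cexp).const_mul airyOmega
  refine h2.congr_deriv ?_
  rw [airyShift]
  push_cast
  ring

/-- Moving the origin of the ray: the integrand depends on `c + ω r` only, so its `c`-derivative is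
a total `r`-derivative and only the boundary value at `r = 0` survives. -/
theorem hasDerivAt_integral_airyShift (x c : ℝ) :
    HasDerivAt (fun c => ∫ r in Set.Ioi (0 : ℝ), airyOmega * airyShift x c r)
      (-((Real.exp (c ^ 3 / 3 - x * c) : ℝ) : ℂ)) c := by
  obtain ⟨K, hK⟩ := norm_airyShift_le x (|c| + 1)
  have hc0 : |c| ≤ |c| + 1 := by linarith
  have hball : ∀ y ∈ Metric.ball c 1, |y| ≤ |c| + 1 := by
    intro y hy
    have : |y - c| < 1 := by simpa [Real.dist_eq] using hy
    have h2 := abs_add_le (y - c) c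
    rw [sub_add_cancel] at h2
    linarith
  have hi : IntegrableOn (airyShift x c) (Set.Ioi 0) := by
    refine Integrable.mono' (integrableOn_exp_const_sub K)
      (continuous_airyShift x c).aestronglyMeasurable ?_
    exact (ae_restrict_iff' measurableSet_Ioi).2
      (Eventually.of_forall fun r hr => (hK c r hc0 hr).1)
  have key := hasDerivAt_integral_of_dominated_loc_of_deriv_le
    (μ := volume.restrict (Set.Ioi (0 : ℝ))) (s := Metric.ball c 1) (x₀ := c)
    (F := fun (c : ℝ) (r : ℝ) => airyOmega * airyShift x c r)
    (F' := fun (c : ℝ) (r : ℝ) => airyOmega * ((c + airyOmega * r) ^ 2 - x) * airyShift x c r)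
    (bound := fun r => Real.exp (K - r))
    (Metric.ball_mem_nhds c one_pos)
    (Eventually.of_forall fun y => ((continuous_airyShift x y).const_mul _).aestronglyMeasurable)
    (hi.const_mul _)
    (by
      refine Continuous.aestronglyMeasurable ?_
      have := continuous_airyShift x c
      fun_prop)
    ((ae_restrict_iff' measurableSet_Ioi).2
      (Eventually.of_forall fun r hr y hy => (hK y r (hball y hy) hr).2))
    (integrableOn_exp_const_sub K)
    (Eventually.of_forall fun r y _ => hasDerivAt_airyShift_c x y r)
  refine key.2.congr_deriv ?_
  have h := integral_Ioi_of_hasDerivAt_of_tendsto' (a := (0 : ℝ)) (m := 0)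
    (fun r _ => hasDerivAt_airyShift_r x c r) key.1 ?_
  · rw [h, airyShift]
    push_cast
    simp
  · rw [tendsto_zero_iff_norm_tendsto_zero]
    have h0 : Tendsto (fun r : ℝ => Real.exp (K - r)) atTop (nhds 0) :=
      Real.tendsto_exp_atBot.comp (tendsto_atBot_add_const_left _ K tendsto_neg_atTop_atBot)
    refine squeeze_zero' (Eventually.of_forall fun _ => norm_nonneg _) ?_ h0
    filter_upwards [eventually_gt_atTop (0 : ℝ)] with r hr using (hK c r hc0 hr).1

/-- Cauchy's theorem in differential form: the derivative in `c` is real, so the imaginary part does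
not change when the ray is moved along the real axis. -/
theorem airyAi_eq_shift (x c : ℝ) :
    airyAi x = √(2 * Real.pi) *
      (1 / Real.pi * (∫ r in Set.Ioi (0 : ℝ), airyOmega * airyShift x c r).im) := by
  have hd : ∀ c, HasDerivAt
      (fun c => (∫ r in Set.Ioi (0 : ℝ), airyOmega * airyShift x c r).im) 0 c := by
    intro c
    refine (hasDerivAt_integral_airyShift x c).complex_im.congr_deriv ?_
    rw [Complex.neg_im, Complex.ofReal_im, neg_zero]
  have hc : (∫ r in Set.Ioi (0 : ℝ), airyOmega * airyShift x c r).im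
      = (∫ r in Set.Ioi (0 : ℝ), airyOmega * airyShift x 0 r).im :=
    is_const_of_deriv_eq_zero (fun c => (hd c).differentiableAt) (fun c => (hd c).deriv) c 0
  rw [hc, airyAi, exp_pi_div_three, ← airyOmega, airyRay]
  simp only [airyShift, Complex.ofReal_zero, zero_add]

/-- With `x = y^4` the saddle point of `t^3/3 - x t` is `y^2`: there the linear term drops out and
the critical value is `-(2/3) y^6`. The scaling `u = y r` normalises the quadratic term and leaves
the cubic one with the small factor `y^(-3)`. -/
theorem integral_airyShift_sqrt {y : ℝ} (hy : 0 < y) :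
    (∫ r in Set.Ioi (0 : ℝ), airyOmega * airyShift (y ^ 4) (y ^ 2) r)
      = ((Real.exp (-(2 / 3 * y ^ 6)) / y : ℝ) : ℂ) * (airyOmega * ∫ u in Set.Ioi (0 : ℝ),
        Complex.exp (airyOmega ^ 2 * u ^ 2 - ((y ^ 3)⁻¹ : ℝ) * u ^ 3 / 3)) := by
  have h := integral_comp_mul_left_Ioi (fun u : ℝ =>
    Complex.exp (airyOmega ^ 2 * u ^ 2 - ((y ^ 3)⁻¹ : ℝ) * u ^ 3 / 3)) 0 hy
  rw [mul_zero] at h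
  have h' : (∫ u in Set.Ioi (0 : ℝ),
        Complex.exp (airyOmega ^ 2 * u ^ 2 - ((y ^ 3)⁻¹ : ℝ) * u ^ 3 / 3))
      = (y : ℂ) * ∫ x in Set.Ioi (0 : ℝ), Complex.exp (airyOmega ^ 2 * ((y * x : ℝ) : ℂ) ^ 2
        - ((y ^ 3)⁻¹ : ℝ) * ((y * x : ℝ) : ℂ) ^ 3 / 3) := by
    rw [h, Complex.real_smul, ← mul_assoc]
    have : (y : ℂ) ≠ 0 := by exact_mod_cast hy.ne'
    push_cast
    rw [mul_inv_cancel₀ this, one_mul]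
  suffices k : (∫ r in Set.Ioi (0 : ℝ), airyShift (y ^ 4) (y ^ 2) r)
      = ((Real.exp (-(2 / 3 * y ^ 6)) / y : ℝ) : ℂ) * ((y : ℂ) * ∫ x in Set.Ioi (0 : ℝ),
        Complex.exp (airyOmega ^ 2 * ((y * x : ℝ) : ℂ) ^ 2
        - ((y ^ 3)⁻¹ : ℝ) * ((y * x : ℝ) : ℂ) ^ 3 / 3)) by
    rw [h', integral_const_mul, k]
    ring
  rw [← integral_const_mul, ← integral_const_mul]
  refine setIntegral_congr_fun measurableSet_Ioi fun r hr => ?_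
  have hy' : (y : ℂ) ≠ 0 := by exact_mod_cast hy.ne'
  simp only [airyShift]
  push_cast
  rw [← mul_assoc, div_mul_cancel₀ _ hy', ← Complex.exp_add]
  congr 1
  field_simp
  linear_combination (r : ℂ) ^ 3 * airyOmega_cube

/-- Dominated convergence with the Gaussian `exp(-u^2/2)`, since `Re ω^2 = -1/2` and the cubic term
only damps. -/
theorem tendsto_airy_gaussian :
    Tendsto (fun y : ℝ => airyOmega * ∫ u in Set.Ioi (0 : ℝ),
        Complex.exp (airyOmega ^ 2 * u ^ 2 - ((y ^ 3)⁻¹ : ℝ) * u ^ 3 / 3)) atTop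
      (nhds (Complex.I * (√Real.pi : ℝ) / 2)) := by
  have hlim : Tendsto (fun y : ℝ => ∫ u in Set.Ioi (0 : ℝ),
        Complex.exp (airyOmega ^ 2 * u ^ 2 - ((y ^ 3)⁻¹ : ℝ) * u ^ 3 / 3)) atTop
      (nhds (∫ u in Set.Ioi (0 : ℝ), Complex.exp (-(-airyOmega ^ 2) * (u : ℂ) ^ 2))) := by
    refine tendsto_integral_filter_of_dominated_convergence
      (fun u : ℝ => Real.exp (-(1 / 2) * u ^ 2)) ?_ ?_ ?_ ?_
    · exact Eventually.of_forall fun y => by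
        refine Continuous.aestronglyMeasurable ?_
        fun_prop
    · filter_upwards [eventually_gt_atTop (0 : ℝ)] with y hy
      refine (ae_restrict_iff' measurableSet_Ioi).2 (Eventually.of_forall fun u hu => ?_)
      have hu' : (0 : ℝ) < u := hu
      rw [Complex.norm_exp]
      refine Real.exp_le_exp.2 ?_
      have e : (airyOmega ^ 2 * u ^ 2 - ((y ^ 3)⁻¹ : ℝ) * u ^ 3 / 3 : ℂ)
          = ((u ^ 2 : ℝ) : ℂ) * airyOmega ^ 2 - (((y ^ 3)⁻¹ * u ^ 3 / 3 : ℝ) : ℂ) := by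
        push_cast; ring
      rw [e, Complex.sub_re, Complex.re_ofReal_mul, Complex.ofReal_re, airyOmega_sq]
      have : 0 ≤ (y ^ 3)⁻¹ * u ^ 3 / 3 := by positivity
      simp only
      linarith
    · exact (integrable_exp_neg_mul_sq (by norm_num)).integrableOn
    · refine Eventually.of_forall fun u => ?_
      have h1 : Tendsto (fun y : ℝ => ((y ^ 3)⁻¹ : ℝ)) atTop (nhds 0) :=
        (tendsto_pow_atTop (by norm_num)).inv_tendsto_atTop
      have h2 : Tendsto (fun y : ℝ => (((y ^ 3)⁻¹ : ℝ) : ℂ)) atTop (nhds ((0 : ℝ) : ℂ)) :=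
        (Complex.continuous_ofReal.tendsto 0).comp h1
      have h3 := (((h2.mul_const ((u : ℂ) ^ 3)).div_const 3).const_sub (airyOmega ^ 2 * u ^ 2)).cexp
      simpa using h3
  have hb : 0 < (-airyOmega ^ 2).re := by rw [airyOmega_sq]; norm_num
  have hval := integral_gaussian_complex_Ioi hb
  -- By `ω^3 = -1` the quotient `-1/ω^2` is `ω = ν^2`; the root `√π ν` has positive real part and is
  -- therefore the principal one.
  have h4 : (Real.pi / -airyOmega ^ 2 : ℂ) = ((√Real.pi : ℝ) * airyNu) ^ 2 := by
    have hw : airyOmega ≠ 0 := by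
      intro h; have := airyOmega_cube; rw [h] at this; norm_num at this
    have h5 : (((√Real.pi : ℝ) : ℂ)) ^ 2 = Real.pi := by
      rw [← Complex.ofReal_pow, Real.sq_sqrt Real.pi_pos.le]
    rw [mul_pow, h5, airyNu_sq, div_eq_iff (neg_ne_zero.2 (pow_ne_zero 2 hw))]
    linear_combination (Real.pi : ℂ) * airyOmega_cube
  have h6 : 0 < (((√Real.pi : ℝ) : ℂ) * airyNu).re := by
    rw [Complex.re_ofReal_mul, airyNu]
    have := Real.pi_pos
    positivity
  rw [h4, one_div, Complex.sq_cpow_two_inv h6] at hval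
  rw [hval] at hlim
  have h7 := hlim.const_mul airyOmega
  have h8 : airyOmega * (((√Real.pi : ℝ) : ℂ) * airyNu / 2) = Complex.I * (√Real.pi : ℝ) / 2 := by
    rw [← airyNu_sq, ← airyNu_cube]; ring
  rwa [h8] at h7

/-- The only individual asymptotics that is needed; that of `Bi` will follow from the product `Ai
Bi`. -/
theorem tendsto_airyAi_mul :
    Tendsto (fun x : ℝ => airyAi x * Real.exp (2 / 3 * x ^ (3 / 2 : ℝ)) * x ^ (1 / 4 : ℝ)) atTop
      (nhds (1 / √2)) := by
  have h1 : Tendsto (fun y : ℝ => airyAi (y ^ 4) * Real.exp (2 / 3 * y ^ 6) * y) atTop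
      (nhds (1 / √2)) := by
    have h2 := ((((Complex.continuous_im.tendsto _).comp tendsto_airy_gaussian).const_mul
      (1 / Real.pi)).const_mul √(2 * Real.pi))
    have h3 : √(2 * Real.pi) * (1 / Real.pi * (Complex.I * (√Real.pi : ℝ) / 2 : ℂ).im) = 1 / √2 := by
      have e : (Complex.I * (√Real.pi : ℝ) / 2 : ℂ).im = √Real.pi / 2 := by
        simp
      have := Real.pi_pos
      rw [e, Real.sqrt_mul (by norm_num)]
      have h4 : √Real.pi * √Real.pi = Real.pi := Real.mul_self_sqrt Real.pi_pos.le
      have h5 : √2 * √2 = (2 : ℝ) := Real.mul_self_sqrt (by norm_num)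
      have h6 : √2 ≠ 0 := by positivity
      rw [eq_div_iff h6]
      calc √2 * √Real.pi * (1 / Real.pi * (√Real.pi / 2)) * √2
          = (√2 * √2) * (√Real.pi * √Real.pi) / (2 * Real.pi) := by ring
        _ = 1 := by rw [h4, h5]; field_simp
    rw [h3] at h2
    refine h2.congr' ?_
    filter_upwards [eventually_gt_atTop (0 : ℝ)] with y hy
    have h4 := integral_airyShift_sqrt hy
    have h5 := airyAi_eq_shift (y ^ 4) (y ^ 2)
    rw [h5, h4, Complex.im_ofReal_mul]
    simp only [Function.comp]
    have h6 : Real.exp (-(2 / 3 * y ^ 6)) * Real.exp (2 / 3 * y ^ 6) = 1 := by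
      rw [← Real.exp_add]; simp
    have h7 : Real.exp (-(2 / 3 * y ^ 6)) / y * Real.exp (2 / 3 * y ^ 6) * y = 1 := by
      rw [div_mul_eq_mul_div, h6]; field_simp
    generalize (airyOmega * ∫ u in Set.Ioi (0 : ℝ),
        Complex.exp (airyOmega ^ 2 * u ^ 2 - ((y ^ 3)⁻¹ : ℝ) * u ^ 3 / 3)).im = q
    linear_combination -(√(2 * Real.pi) * (1 / Real.pi) * q) * h7
  have h2 : Tendsto (fun x : ℝ => x ^ (1 / 4 : ℝ)) atTop atTop := tendsto_rpow_atTop (by norm_num)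
  refine (h1.comp h2).congr' ?_
  filter_upwards [eventually_ge_atTop (0 : ℝ)] with x hx
  simp only [Function.comp]
  rw [← Real.rpow_natCast, ← Real.rpow_natCast, ← Real.rpow_mul hx, ← Real.rpow_mul hx]
  norm_num

end

/-! ### Multilinear power series and generating series of self-avoiding walks. -/

noncomputable section

/-- Real functions of finite sets, with the product
`(F * G) X = ∑ I ⊆ X, F I * G (X \ I)`: multilinear power series in variables indexed by `ι`. -/
structure SetAlg (ι : Type*) where
  /-- The coefficients. -/
  coeff : Finset ι → ℝ

namespace SetAlg

section

variable {ι : Type*}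

instance : CoeFun (SetAlg ι) (fun _ => Finset ι → ℝ) := ⟨coeff⟩

instance : Zero (SetAlg ι) := ⟨⟨fun _ => 0⟩⟩
instance : Add (SetAlg ι) := ⟨fun F G => ⟨fun X => F X + G X⟩⟩
instance : Neg (SetAlg ι) := ⟨fun F => ⟨fun X => -F X⟩⟩
instance : Sub (SetAlg ι) := ⟨fun F G => ⟨fun X => F X - G X⟩⟩

@[ext] theorem ext {F G : SetAlg ι} (h : ∀ X, F X = G X) : F = G := by
  cases F; cases G; congr; exact funext h

theorem add_apply (F G : SetAlg ι) (X : Finset ι) : (F + G) X = F X + G X := rfl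
theorem sub_apply (F G : SetAlg ι) (X : Finset ι) : (F - G) X = F X - G X := rfl
theorem neg_apply (F : SetAlg ι) (X : Finset ι) : (-F) X = -F X := rfl
theorem zero_apply (X : Finset ι) : (0 : SetAlg ι) X = 0 := rfl

instance : AddCommGroup (SetAlg ι) where
  add_assoc F G H := by ext X; simp only [add_apply, add_assoc]
  zero_add F := by ext X; simp only [add_apply, zero_apply, zero_add]
  add_zero F := by ext X; simp only [add_apply, zero_apply, add_zero]
  neg_add_cancel F := by ext X; simp only [add_apply, zero_apply, neg_apply, neg_add_cancel]
  add_comm F G := by ext X; simp only [add_apply, add_comm]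
  sub_eq_add_neg F G := by ext X; simp only [add_apply, neg_apply, sub_apply, sub_eq_add_neg]
  nsmul := nsmulRec
  zsmul := zsmulRec

theorem sum_apply {κ : Type*} (s : Finset κ) (F : κ → SetAlg ι) (X : Finset ι) :
    (∑ j ∈ s, F j) X = ∑ j ∈ s, F j X := by
  classical
  induction s using Finset.induction_on with
  | empty => simp [zero_apply]
  | insert a s ha ih => rw [Finset.sum_insert ha, Finset.sum_insert ha, add_apply, ih]

end

variable {ι : Type*} [DecidableEq ι]

instance : Mul (SetAlg ι) := ⟨fun F G => ⟨fun X => ∑ I ∈ X.powerset, F I * G (X \ I)⟩⟩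

instance : One (SetAlg ι) := ⟨⟨fun X => if X = ∅ then 1 else 0⟩⟩

theorem one_apply (X : Finset ι) : (1 : SetAlg ι) X = if X = ∅ then 1 else 0 := rfl
theorem mul_apply (F G : SetAlg ι) (X : Finset ι) :
    (F * G) X = ∑ I ∈ X.powerset, F I * G (X \ I) := rfl

protected theorem mul_comm (F G : SetAlg ι) : F * G = G * F := by
  ext X
  rw [mul_apply, mul_apply]
  refine Finset.sum_nbij' (fun I => X \ I) (fun I => X \ I) ?_ ?_ ?_ ?_ ?_
  · intro I _; simp
  · intro I _; simp
  · intro I hI; simpa using hI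
  · intro I hI; simpa using hI
  · intro I hI
    rw [Finset.mem_powerset] at hI
    rw [Finset.sdiff_sdiff_eq_self hI, mul_comm]

protected theorem one_mul (F : SetAlg ι) : 1 * F = F := by
  ext X
  rw [mul_apply, Finset.sum_eq_single ∅]
  · simp [one_apply]
  · intro I _ hI; simp [one_apply, hI]
  · simp

protected theorem left_distrib (F G H : SetAlg ι) : F * (G + H) = F * G + F * H := by
  ext X
  simp only [mul_apply, add_apply, mul_add, Finset.sum_add_distrib]

protected theorem mul_assoc (F G H : SetAlg ι) : F * G * H = F * (G * H) := by
  ext X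
  simp only [mul_apply, Finset.sum_mul, Finset.mul_sum]
  rw [Finset.sum_sigma', Finset.sum_sigma']
  -- Both sides sum over the partitions of `X` into three labelled blocks: `J ⊆ I ⊆ X` corresponds
  -- to `J` and `I \ J ⊆ X \ J`.
  refine Finset.sum_nbij' (fun p => ⟨p.2, p.1 \ p.2⟩) (fun p => ⟨p.1 ∪ p.2, p.1⟩) ?_ ?_ ?_ ?_ ?_
  · rintro ⟨I, J⟩ h
    simp only [Finset.mem_sigma, Finset.mem_powerset] at h ⊢
    exact ⟨h.2.trans h.1, Finset.sdiff_subset_sdiff h.1 le_rfl⟩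
  · rintro ⟨J, L⟩ h
    simp only [Finset.mem_sigma, Finset.mem_powerset] at h ⊢
    exact ⟨Finset.union_subset h.1 (h.2.trans Finset.sdiff_subset), Finset.subset_union_left⟩
  · rintro ⟨I, J⟩ h
    simp only [Finset.mem_sigma, Finset.mem_powerset] at h
    simp [Finset.union_sdiff_of_subset h.2]
  · rintro ⟨J, L⟩ h
    simp only [Finset.mem_sigma, Finset.mem_powerset] at h
    have hd : Disjoint L J := Finset.disjoint_of_subset_left h.2 Finset.sdiff_disjoint
    simp [Finset.union_sdiff_cancel_left hd.symm]
  · rintro ⟨I, J⟩ h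
    simp only [Finset.mem_sigma, Finset.mem_powerset] at h
    have e : (X \ J) \ (I \ J) = X \ I := by
      ext i
      simp only [Finset.mem_sdiff]
      have := @h.2 i
      tauto
    simp only [e, mul_assoc]

instance : CommRing (SetAlg ι) :=
  { (inferInstance : AddCommGroup (SetAlg ι)) with
    mul := (· * ·)
    one := 1
    mul_assoc := SetAlg.mul_assoc
    mul_comm := SetAlg.mul_comm
    one_mul := SetAlg.one_mul
    mul_one := fun F => by rw [SetAlg.mul_comm, SetAlg.one_mul]
    left_distrib := SetAlg.left_distrib
    right_distrib := fun F G H => by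
      rw [SetAlg.mul_comm, SetAlg.left_distrib, SetAlg.mul_comm H, SetAlg.mul_comm H]
    zero_mul := fun F => by ext X; simp [mul_apply, zero_apply]
    mul_zero := fun F => by ext X; simp [mul_apply, zero_apply] }

/-- The constants. -/
def C (r : ℝ) : SetAlg ι := ⟨fun X => if X = ∅ then r else 0⟩

theorem C_mul_apply (r : ℝ) (F : SetAlg ι) (X : Finset ι) : (C r * F : SetAlg ι) X = r * F X := by
  rw [mul_apply, Finset.sum_eq_single ∅]
  · simp [C]
  · intro I _ hI; simp [C, hI]
  · simp

theorem C_apply (r : ℝ) (X : Finset ι) : (C r : SetAlg ι) X = if X = ∅ then r else 0 := rfl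

theorem C_mul (r s : ℝ) : (C (r * s) : SetAlg ι) = C r * C s := by
  ext X; rw [C_mul_apply, C_apply, C_apply]; split_ifs <;> simp

theorem C_sub (r s : ℝ) : (C (r - s) : SetAlg ι) = C r - C s := by
  ext X; rw [sub_apply, C_apply, C_apply, C_apply]; split_ifs <;> simp

theorem C_zero : (C 0 : SetAlg ι) = 0 := by
  ext X; rw [C_apply, zero_apply]; simp

/-- The variable with index `j`. -/
def eps (j : ι) : SetAlg ι := ⟨fun X => if X = {j} then 1 else 0⟩

theorem eps_mul_apply (j : ι) (F : SetAlg ι) (X : Finset ι) :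
    (eps j * F) X = if j ∈ X then F (X.erase j) else 0 := by
  rw [mul_apply]
  split_ifs with h
  · rw [Finset.sum_eq_single {j}]
    · simp [eps, Finset.sdiff_singleton_eq_erase]
    · intro I _ hI; simp [eps, hI]
    · intro h2; simp [h] at h2
  · refine Finset.sum_eq_zero fun I hI => ?_
    have : I ≠ {j} := by
      rintro rfl
      simp at hI
      exact h hI
    simp [eps, this]

/-- Nilpotency of the variables encodes that a walk visits no point twice. -/
theorem eps_sq (j : ι) : (eps j : SetAlg ι) * eps j = 0 := by
  ext X
  rw [eps_mul_apply, zero_apply]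
  split_ifs with h
  · have : X.erase j ≠ {j} := by
      intro h2
      have : j ∈ X.erase j := by rw [h2]; simp
      simp at this
    simp [eps, this]
  · rfl

/-- The part of a series that contains the variable with index `y`. -/
def numOp (y : ι) (F : SetAlg ι) : SetAlg ι := ⟨fun X => if y ∈ X then F X else 0⟩

theorem numOp_apply (y : ι) (F : SetAlg ι) (X : Finset ι) :
    numOp y F X = if y ∈ X then F X else 0 := rfl

/-- `numOp y` is `ε_y ∂/∂ε_y`, a derivation: a point `y` of `X` lies in exactly one of `I` and `X \
I`. -/
theorem numOp_mul (y : ι) (F G : SetAlg ι) :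
    numOp y (F * G) = numOp y F * G + F * numOp y G := by
  ext X
  rw [add_apply, numOp_apply, mul_apply, mul_apply, mul_apply, ← Finset.sum_add_distrib]
  split_ifs with h
  · refine Finset.sum_congr rfl fun I hI => ?_
    rw [numOp_apply, numOp_apply]
    by_cases hy : y ∈ I
    · simp [hy]
    · simp [hy, h]
  · symm
    refine Finset.sum_eq_zero fun I hI => ?_
    rw [Finset.mem_powerset] at hI
    have : y ∉ I := fun h2 => h (hI h2)
    simp [numOp_apply, this, h]

theorem numOp_add (y : ι) (F G : SetAlg ι) : numOp y (F + G) = numOp y F + numOp y G := by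
  ext X
  simp only [numOp_apply, add_apply]
  split_ifs <;> simp

theorem numOp_sum {κ : Type*} (y : ι) (s : Finset κ) (F : κ → SetAlg ι) :
    numOp y (∑ j ∈ s, F j) = ∑ j ∈ s, numOp y (F j) := by
  ext X
  simp only [numOp_apply, sum_apply]
  split_ifs <;> simp

theorem numOp_C (y : ι) (r : ℝ) : numOp y (C r : SetAlg ι) = 0 := by
  ext X
  rw [numOp_apply, C_apply, zero_apply]
  split_ifs with h1 h2
  · simp [h2] at h1
  · rfl
  · rfl

theorem numOp_eps (y j : ι) : numOp y (eps j : SetAlg ι) = if j = y then eps j else 0 := by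
  ext X
  rw [numOp_apply]
  by_cases hX : X = {j}
  · subst hX
    by_cases h : y = j
    · simp [h]
    · simp [h, zero_apply, show j ≠ y from fun h2 => h h2.symm]
  · split_ifs <;> simp [eps, hX, zero_apply]

variable [Fintype ι]

/-- The sum over all walks that start at `z`, visit distinct points of `X` exhausting `X`, with
weights `K` for the steps and `a` for the last point. -/
def walk (K : ι → ι → ℝ) (a : ι → ℝ) (z : ι) (X : Finset ι) : ℝ :=
  if X = ∅ then a z else ∑ x : X, K z x * walk K a x (X.erase x)
termination_by X.card
decreasing_by exact Finset.card_erase_lt_of_mem x.2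

/-- The generating series of `walk`. -/
def W (K : ι → ι → ℝ) (a : ι → ℝ) (z : ι) : SetAlg ι := ⟨walk K a z⟩

theorem W_apply (K : ι → ι → ℝ) (a : ι → ℝ) (z : ι) (X : Finset ι) :
    W K a z X = (if X = ∅ then a z else 0) +
      ∑ j, K z j * if j ∈ X then W K a j (X.erase j) else 0 := by
  change walk K a z X = _
  rw [walk]
  split_ifs with h
  · subst h; simp
  · rw [zero_add]
    simp only [mul_ite, mul_zero, Finset.sum_ite_mem, Finset.univ_inter]
    rw [← Finset.sum_coe_sort X]
    rfl

theorem W_eq (K : ι → ι → ℝ) (a : ι → ℝ) (z : ι) :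
    W K a z = C (a z) + ∑ j, C (K z j) * (eps j * W K a j) := by
  ext X
  rw [W_apply, add_apply, sum_apply, C_apply]
  simp only [C_mul_apply, eps_mul_apply]

/-- The factor `eps j` reduces the coefficient at `X` to coefficients at smaller sets, so the
homogeneous linear system has only the trivial solution. -/
theorem eq_zero_of_fixed (K : ι → ι → ℝ) (Y : ι → SetAlg ι)
    (h : ∀ j, Y j = eps j * ∑ k : ι, C (K j k) * Y k) (j : ι) : Y j = 0 := by
  have key : ∀ n : ℕ, ∀ X : Finset ι, X.card = n → ∀ j, Y j X = 0 := by
    intro n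
    induction n with
    | zero =>
      intro X hX j
      rw [Finset.card_eq_zero] at hX
      subst hX
      rw [h j, eps_mul_apply]; simp
    | succ n ih =>
      intro X hX j
      rw [h j, eps_mul_apply]
      split_ifs with hj
      · rw [sum_apply]
        refine Finset.sum_eq_zero fun k _ => ?_
        rw [C_mul_apply, ih _ (by rw [Finset.card_erase_of_mem hj, hX]; rfl), mul_zero]
      · rfl
  ext X
  exact key _ X rfl j

/-- The generating series of all walks that start with weight `b` and end with weight `a`. -/
def chain (K : ι → ι → ℝ) (b a : ι → ℝ) : SetAlg ι := ∑ j, C (b j) * (eps j * W K a j)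

/-- Reading walks backwards. Algebraically, `b (1 - εK)⁻¹ a` is turned into its transpose by
inserting the linear equations of the two families of walks. -/
theorem chain_swap (K : ι → ι → ℝ) (b a : ι → ℝ) :
    chain K b a = chain (fun i j => K j i) a b := by
  have hb : ∀ j, C (b j) = W (fun i j => K j i) b j -
      ∑ k, C (K k j) * (eps k * W (fun i j => K j i) b k) := fun j =>
    eq_sub_of_add_eq (W_eq (fun i j => K j i) b j).symm
  have ha : ∀ j, C (a j) = W K a j - ∑ k, C (K j k) * (eps k * W K a k) := fun j =>
    eq_sub_of_add_eq (W_eq K a j).symm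
  simp only [chain]
  simp only [hb, ha]
  simp only [sub_mul, Finset.sum_sub_distrib, Finset.sum_mul]
  congr 1
  · exact Finset.sum_congr rfl fun j _ => by ring
  · rw [Finset.sum_comm]
    exact Finset.sum_congr rfl fun j _ => Finset.sum_congr rfl fun k _ => by ring

theorem numOp_eps_W (K : ι → ι → ℝ) (a : ι → ℝ) (y j : ι) :
    numOp y (eps j * W K a j) = (if j = y then eps y * W K a y else 0) +
      eps j * ∑ k, C (K j k) * numOp y (eps k * W K a k) := by
  rw [numOp_mul, numOp_eps]
  congr 1
  · split_ifs with h
    · rw [h]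
    · rw [zero_mul]
  · conv_lhs => rw [W_eq, numOp_add, numOp_C, zero_add, numOp_sum]
    simp only [numOp_mul y (C _), numOp_C, zero_mul, zero_add]

/-- A chain through `y` splits at `y` into a part that arrives and a part that leaves; the product
of set functions keeps the two parts disjoint. -/
theorem numOp_chain (K : ι → ι → ℝ) (b a : ι → ℝ) (y : ι) :
    numOp y (chain K b a) = W (fun i j => K j i) b y * (eps y * W K a y) := by
  set B := W (fun i j => K j i) b
  have hb : ∀ j, C (b j) = B j - ∑ k, C (K k j) * (eps k * B k) := fun j =>
    eq_sub_of_add_eq (W_eq (fun i j => K j i) b j).symm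
  have h1 : numOp y (chain K b a) = ∑ j, C (b j) * numOp y (eps j * W K a j) := by
    rw [chain, numOp_sum]
    simp only [numOp_mul y (C _), numOp_C, zero_mul, zero_add]
  have h2 : ∑ j, (∑ k, C (K k j) * (eps k * B k)) * numOp y (eps j * W K a j)
      = ∑ k, B k * (numOp y (eps k * W K a k) - if k = y then eps y * W K a y else 0) := by
    simp only [Finset.sum_mul]
    rw [Finset.sum_comm]
    refine Finset.sum_congr rfl fun k _ => ?_
    rw [numOp_eps_W K a y k, add_sub_cancel_left, ← mul_assoc, Finset.mul_sum]
    exact Finset.sum_congr rfl fun j _ => by ring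
  rw [h1]
  simp only [hb, sub_mul, Finset.sum_sub_distrib]
  rw [h2]
  simp only [mul_sub, Finset.sum_sub_distrib, sub_sub_cancel]
  simp

theorem eps_mul_numOp_eps_W (K : ι → ι → ℝ) (a : ι → ℝ) (y j : ι) :
    eps j * numOp y (eps j * W K a j) = 0 := by
  rw [numOp_eps_W, mul_add, ← mul_assoc (eps j) (eps j), eps_sq, zero_mul, add_zero]
  split_ifs with h
  · rw [h, ← mul_assoc, eps_sq, zero_mul]
  · rw [mul_zero]

/-- The mechanism of integrable kernels: if the commutator of `K` with multiplication by `x` has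
rank two, so has that of its resolvent. The difference of the two sides solves a homogeneous linear
system, and `eq_zero_of_fixed` applies. -/
theorem mul_numOp_eps_W {K : ι → ι → ℝ} {a a' b b' x : ι → ℝ} (hK0 : ∀ i, K i i = 0)
    (hK : ∀ i j, i ≠ j → (x i - x j) * K i j = a i * b' j - a' i * b j) (y j : ι) :
    C (x j - x y) * numOp y (eps j * W K a j) =
      eps j * W K a j * (W (fun i j => K j i) b' y * (eps y * W K a y))
      - eps j * W K a' j * (W (fun i j => K j i) b y * (eps y * W K a y)) := by
  rw [← numOp_chain, ← numOp_chain, ← sub_eq_zero]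
  set Y : ι → SetAlg ι := fun k => numOp y (eps k * W K a k)
  refine eq_zero_of_fixed K (fun j => C (x j - x y) * Y j - (eps j * W K a j *
    numOp y (chain K b' a) - eps j * W K a' j * numOp y (chain K b a))) (fun j => ?_) j
  have e1 : ∀ c : ι → ℝ, numOp y (chain K c a) = ∑ k, C (c k) * Y k := by
    intro c
    rw [chain, numOp_sum]
    simp only [numOp_mul y (C _), numOp_C, zero_mul, zero_add, Y]
  have e2 : ∀ c : ι → ℝ, ∑ k, C (K j k) * (eps k * W K c k) = W K c j - C (c j) := fun c =>
    eq_sub_of_add_eq' (W_eq K c j).symm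
  have e3 : Y j = (if j = y then eps y * W K a y else 0) + eps j * ∑ k, C (K j k) * Y k :=
    numOp_eps_W K a y j
  have e4 : C (x j - x y) * Y j = eps j * (C (x j - x y) * ∑ k, C (K j k) * Y k) := by
    conv_lhs => rw [e3]
    by_cases h : j = y
    · subst h; simp [C_zero]
    · rw [if_neg h]; ring
  have e5 : eps j * ∑ k, C (K j k) * (C (x k - x y) * Y k)
      = eps j * (C (x j - x y) * ∑ k, C (K j k) * Y k
        - (C (a j) * ∑ k, C (b' k) * Y k - C (a' j) * ∑ k, C (b k) * Y k)) := by
    simp only [Finset.mul_sum, ← Finset.sum_sub_distrib]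
    refine Finset.sum_congr rfl fun k _ => ?_
    -- The commutator hypothesis excludes the diagonal. There `K` vanishes, and the right side is
    -- killed by `eps j * Y j = 0`.
    by_cases h : j = k
    · subst h
      have := eps_mul_numOp_eps_W K a y j
      rw [hK0 j, C_zero]
      linear_combination (C (a j) * C (b' j) - C (a' j) * C (b j)) * this
    · have h2 : C (x j - x k) * C (K j k) = (C (a j) * C (b' k) - C (a' j) * C (b k) : SetAlg ι) := by
        rw [← C_mul, ← C_mul, ← C_mul, ← C_sub, hK j k h]
      rw [C_sub] at h2 ⊢
      rw [C_sub]
      linear_combination -(eps j * Y k) * h2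
  simp only [mul_sub, Finset.sum_sub_distrib]
  rw [e5, e4]
  have e6 : ∀ (c : ι → ℝ) (F : SetAlg ι), ∑ k, C (K j k) * (eps k * W K c k * F)
      = (W K c j - C (c j)) * F := by
    intro c F
    rw [← e2 c, Finset.sum_mul]
    exact Finset.sum_congr rfl fun k _ => by ring
  rw [e6, e6, e1 b', e1 b]
  ring

/-- Split the chain at `z`, then let `numOp y` act as a derivation: `y` lies on the outgoing or on
the incoming walk, and the commutator identity applies to either, with transposed kernel for the
second. -/
theorem mul_numOp_numOp_chain {K : ι → ι → ℝ} {a a' b b' x : ι → ℝ} (hK0 : ∀ i, K i i = 0)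
    (hK : ∀ i j, i ≠ j → (x i - x j) * K i j = a i * b' j - a' i * b j) {y z : ι} (hyz : y ≠ z) :
    C (x z - x y) * numOp y (numOp z (chain K b a)) = eps z * (eps y *
      (W K a z * W (fun i j => K j i) b z *
        (W K a' y * W (fun i j => K j i) b y + W K a y * W (fun i j => K j i) b' y)
      - (W K a' z * W (fun i j => K j i) b z + W K a z * W (fun i j => K j i) b' z)
        * (W K a y * W (fun i j => K j i) b y))) := by
  have h1 := mul_numOp_eps_W hK0 hK y z
  have h2 := mul_numOp_eps_W (K := fun i j => K j i) (a := b) (a' := b') (b := a) (b' := a') (x := x)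
    hK0 (fun i j hij => by linear_combination -hK j i hij.symm) y z
  have h3 : ∀ F : SetAlg ι, numOp y (eps z * F) = eps z * numOp y F := by
    intro F
    rw [numOp_mul, numOp_eps, if_neg hyz.symm, zero_mul, zero_add]
  rw [numOp_chain, numOp_mul]
  rw [h3] at h1 h2 ⊢
  linear_combination (W (fun i j => K j i) b z) * h1 + W K a z * h2

end SetAlg

end

/-! ### Differential equations of the chains under a common translation. -/

noncomputable section

open SetAlg

/-- Two families of solutions of the Airy equation at the points `x t i` that move with unit speed,
and the corresponding kernel. -/
structure AirySystem (ι : Type*) where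
  a : ℝ → ι → ℝ
  a' : ℝ → ι → ℝ
  b : ℝ → ι → ℝ
  b' : ℝ → ι → ℝ
  x : ℝ → ι → ℝ
  K : ℝ → ι → ι → ℝ
  hx : ∀ t i, HasDerivAt (fun t => x t i) 1 t
  ha : ∀ t i, HasDerivAt (fun t => a t i) (a' t i) t
  ha' : ∀ t i, HasDerivAt (fun t => a' t i) (x t i * a t i) t
  hb : ∀ t i, HasDerivAt (fun t => b t i) (b' t i) t
  hb' : ∀ t i, HasDerivAt (fun t => b' t i) (x t i * b t i) t
  hK0 : ∀ t i, K t i i = 0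
  hK : ∀ t i j, i ≠ j → (x t i - x t j) * K t i j = a t i * b' t j - a' t i * b t j
  hKd : ∀ t i j, i ≠ j → HasDerivAt (fun t => K t i j) (-(a t i * b t j)) t

namespace AirySystem

variable {ι : Type*} [DecidableEq ι] [Fintype ι]

/-- The system with the two families of solutions exchanged. -/
def swap (S : AirySystem ι) : AirySystem ι where
  a := S.b
  a' := S.b'
  b := S.a
  b' := S.a'
  x := S.x
  K t i j := S.K t j i
  hx := S.hx
  ha := S.hb
  ha' := S.hb'
  hb := S.ha
  hb' := S.ha'
  hK0 := S.hK0
  hK t i j hij := by linear_combination -S.hK t j i hij.symm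
  hKd t i j hij := (S.hKd t j i hij.symm).congr_deriv (by ring)

variable (S : AirySystem ι)

def A (t : ℝ) (z : ι) : SetAlg ι := W (S.K t) (S.a t) z
def A' (t : ℝ) (z : ι) : SetAlg ι := W (S.K t) (S.a' t) z

/-- The connected chains. -/
def f (t : ℝ) : SetAlg ι := chain (S.K t) (S.b t) (S.a t)

def g (t : ℝ) : SetAlg ι :=
  chain (S.K t) (S.b' t) (S.a t) + chain (S.K t) (S.b t) (S.a' t)

theorem f_swap (t : ℝ) : S.swap.f t = S.f t := (chain_swap _ _ _).symm

theorem g_swap (t : ℝ) : S.swap.g t = S.g t := by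
  rw [g, g, chain_swap (S.K t), chain_swap (S.K t), add_comm]
  rfl

theorem chain_apply (K : ι → ι → ℝ) (b a : ι → ℝ) (X : Finset ι) :
    chain K b a X = ∑ j, b j * if j ∈ X then W K a j (X.erase j) else 0 := by
  simp only [chain, SetAlg.sum_apply, C_mul_apply, eps_mul_apply]

/-- The derivative hits the last weight, which gives `A'`, or a link. A link `K i j` is replaced by
`-a i * b j`: the walk now ends at `i`, and a separate chain starts at `j`. -/
theorem hasDerivAt_A (t : ℝ) (X : Finset ι) : ∀ z, z ∉ X →
    HasDerivAt (fun t => S.A t z X) ((S.A' t z - S.A t z * S.f t) X) t := by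
  induction X using Finset.strongInduction with
  | H X ih =>
    intro z hz
    have e : ∀ t, S.A t z X = (if X = ∅ then S.a t z else 0) +
        ∑ j, S.K t z j * if j ∈ X then S.A t j (X.erase j) else 0 := fun t => W_apply _ _ _ _
    rw [funext e]
    have h0 : HasDerivAt (fun t => if X = ∅ then S.a t z else 0) (C (S.a' t z) X) t := by
      rw [C_apply]
      split_ifs
      · exact S.ha t z
      · exact hasDerivAt_const _ _
    have h1 : ∀ j ∈ Finset.univ, HasDerivAt
        (fun t => S.K t z j * if j ∈ X then S.A t j (X.erase j) else 0)
        ((C (S.K t z j) * (eps j * S.A' t j) - C (S.K t z j) * (eps j * S.A t j) * S.f t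
          - C (S.a t z) * (C (S.b t j) * (eps j * S.A t j)) : SetAlg ι) X) t := by
      intro j _
      have e2 : (C (S.K t z j) * (eps j * S.A t j) * S.f t : SetAlg ι)
        = C (S.K t z j) * (eps j * (S.A t j * S.f t)) := by ring
      rw [e2]
      simp only [SetAlg.sub_apply, C_mul_apply, eps_mul_apply]
      by_cases hj : j ∈ X
      · simp only [if_pos hj]
        have hzj : z ≠ j := fun h => hz (h ▸ hj)
        refine ((S.hKd t z j hzj).fun_mul (ih _ (Finset.erase_ssubset hj) j
          (by simp))).congr_deriv ?_
        simp only [SetAlg.sub_apply]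
        ring
      · simp only [if_neg hj, mul_zero, sub_zero]
        exact hasDerivAt_const _ _
    refine (h0.fun_add (HasDerivAt.fun_sum h1)).congr_deriv ?_
    rw [← SetAlg.sum_apply, ← SetAlg.add_apply]
    congr 1
    simp only [Finset.sum_sub_distrib, ← Finset.mul_sum, ← Finset.sum_mul]
    have k1 : ∑ j, C (S.K t z j) * (eps j * S.A t j) = S.A t z - C (S.a t z) :=
      eq_sub_of_add_eq' (W_eq (S.K t) (S.a t) z).symm
    have k2 : ∑ j, C (S.K t z j) * (eps j * S.A' t j) = S.A' t z - C (S.a' t z) :=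
      eq_sub_of_add_eq' (W_eq (S.K t) (S.a' t) z).symm
    rw [k1, k2]
    have k4 : S.f t = ∑ j, C (S.b t j) * (eps j * S.A t j) := rfl
    linear_combination C (S.a t z) * k4

theorem hasDerivAt_chain_A (t : ℝ) (X : Finset ι) {c : ℝ → ι → ℝ} {c' : ι → ℝ}
    (hc : ∀ i, HasDerivAt (fun t => c t i) (c' i) t) {Y Y' : ℝ → ι → SetAlg ι}
    (hY : ∀ X : Finset ι, ∀ z, z ∉ X → HasDerivAt (fun t => Y t z X) (Y' t z X) t) :
    HasDerivAt (fun t => (∑ j, C (c t j) * (eps j * Y t j) : SetAlg ι) X)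
      ((∑ j, (C (c' j) * (eps j * Y t j) + C (c t j) * (eps j * Y' t j)) : SetAlg ι) X) t := by
  simp only [SetAlg.sum_apply]
  refine HasDerivAt.fun_sum fun j _ => ?_
  simp only [SetAlg.add_apply, C_mul_apply, eps_mul_apply]
  by_cases hj : j ∈ X
  · simp only [if_pos hj]
    exact (hc j).fun_mul (hY _ _ (by simp))
  · simp only [if_neg hj, mul_zero, add_zero]
    exact hasDerivAt_const _ _

/-- `g` collects the derivatives of the two end weights, and cutting a link splits the chain into
two chains. -/
theorem hasDerivAt_f (t : ℝ) (X : Finset ι) :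
    HasDerivAt (fun t => S.f t X) ((S.g t - S.f t * S.f t) X) t := by
  refine (hasDerivAt_chain_A t X (S.hb t) (Y := S.A) (Y' := fun t z => S.A' t z - S.A t z * S.f t)
    (fun X z hz => S.hasDerivAt_A t X z hz)).congr_deriv ?_
  congr 1
  have k : ∑ j, C (S.b t j) * (eps j * (S.A t j * S.f t)) = S.f t * S.f t := by
    have k4 : S.f t = ∑ j, C (S.b t j) * (eps j * S.A t j) := rfl
    generalize S.f t = F at k4 ⊢
    conv_rhs => rw [k4, Finset.sum_mul, ← k4]
    exact Finset.sum_congr rfl fun j _ => by ring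
  simp only [Finset.sum_add_distrib, mul_sub, Finset.sum_sub_distrib, k, ← add_sub_assoc]
  rfl

/-- The last weight now contributes `x j * a j`. Moving the factor `x` back along the walk to the
starting point `z` costs one commutator per link, and these add up to terms with `f` and `g`. -/
theorem hasDerivAt_A' (t : ℝ) (X : Finset ι) : ∀ z, z ∉ X →
    HasDerivAt (fun t => S.A' t z X)
      ((C (S.x t z) * S.A t z - S.A t z * S.g t + S.A' t z * S.f t).coeff X) t := by
  induction X using Finset.strongInduction with
  | H X ih =>
    intro z hz
    have e : ∀ t, S.A' t z X = (if X = ∅ then S.a' t z else 0) +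
        ∑ j, S.K t z j * if j ∈ X then S.A' t j (X.erase j) else 0 := fun t => W_apply _ _ _ _
    rw [funext e]
    have h0 : HasDerivAt (fun t => if X = ∅ then S.a' t z else 0)
        ((C (S.x t z) * C (S.a t z) : SetAlg ι) X) t := by
      rw [C_mul_apply, C_apply]
      split_ifs
      · exact S.ha' t z
      · rw [mul_zero]; exact hasDerivAt_const _ _
    have h1 : ∀ j ∈ Finset.univ, HasDerivAt
        (fun t => S.K t z j * if j ∈ X then S.A' t j (X.erase j) else 0)
        ((C (S.x t z) * (C (S.K t z j) * (eps j * S.A t j))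
          - (C (S.a t z) * (C (S.b' t j) * (eps j * S.A t j))
            - C (S.a' t z) * (C (S.b t j) * (eps j * S.A t j)))
          - C (S.K t z j) * (eps j * S.A t j) * S.g t
          + C (S.K t z j) * (eps j * S.A' t j) * S.f t
          - C (S.a t z) * (C (S.b t j) * (eps j * S.A' t j)) : SetAlg ι) X) t := by
      intro j _
      have e2 : (C (S.K t z j) * (eps j * S.A t j) * S.g t : SetAlg ι)
        = C (S.K t z j) * (eps j * (S.A t j * S.g t)) := by ring
      have e3 : (C (S.K t z j) * (eps j * S.A' t j) * S.f t : SetAlg ι)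
        = C (S.K t z j) * (eps j * (S.A' t j * S.f t)) := by ring
      rw [e2, e3]
      simp only [SetAlg.sub_apply, SetAlg.add_apply, C_mul_apply, eps_mul_apply]
      by_cases hj : j ∈ X
      · simp only [if_pos hj]
        have hzj : z ≠ j := fun h => hz (h ▸ hj)
        refine ((S.hKd t z j hzj).fun_mul (ih _ (Finset.erase_ssubset hj) j
          (by simp))).congr_deriv ?_
        simp only [SetAlg.sub_apply, SetAlg.add_apply, C_mul_apply]
        linear_combination -(S.A t j (X.erase j)) * S.hK t z j hzj
      · simp only [if_neg hj, mul_zero, sub_zero, add_zero]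
        exact hasDerivAt_const _ _
    refine (h0.fun_add (HasDerivAt.fun_sum h1)).congr_deriv ?_
    rw [← SetAlg.sum_apply, ← SetAlg.add_apply]
    congr 1
    simp only [Finset.sum_sub_distrib, Finset.sum_add_distrib, ← Finset.mul_sum, ← Finset.sum_mul]
    have k1 : ∑ j, C (S.K t z j) * (eps j * S.A t j) = S.A t z - C (S.a t z) :=
      eq_sub_of_add_eq' (W_eq (S.K t) (S.a t) z).symm
    have k2 : ∑ j, C (S.K t z j) * (eps j * S.A' t j) = S.A' t z - C (S.a' t z) :=
      eq_sub_of_add_eq' (W_eq (S.K t) (S.a' t) z).symm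
    rw [k1, k2]
    have k3 : S.g t = ∑ j, C (S.b' t j) * (eps j * S.A t j)
      + ∑ j, C (S.b t j) * (eps j * S.A' t j) := rfl
    have k4 : S.f t = ∑ j, C (S.b t j) * (eps j * S.A t j) := rfl
    linear_combination C (S.a t z) * k3 - C (S.a' t z) * k4

theorem HasDerivAt_mul {F G : ℝ → SetAlg ι} {F' G' : SetAlg ι} {t : ℝ} {X : Finset ι}
    (hF : ∀ I, I ⊆ X → HasDerivAt (fun t => F t I) (F' I) t)
    (hG : ∀ I, I ⊆ X → HasDerivAt (fun t => G t I) (G' I) t) :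
    HasDerivAt (fun t => (F t * G t) X) ((F' * G t + F t * G') X) t := by
  simp only [SetAlg.add_apply, SetAlg.mul_apply, ← Finset.sum_add_distrib]
  refine HasDerivAt.fun_sum fun I hI => ?_
  rw [Finset.mem_powerset] at hI
  exact (hF I hI).fun_mul (hG _ Finset.sdiff_subset)

/-- The first derivative of `f`. -/
def f1 (t : ℝ) : SetAlg ι := S.g t - S.f t * S.f t

/-- The first derivative of `A`. -/
def Ad (t : ℝ) (z : ι) : SetAlg ι := S.A' t z - S.A t z * S.f t

def P (t : ℝ) (z : ι) : SetAlg ι := S.A t z * S.swap.A t z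
def P1 (t : ℝ) (z : ι) : SetAlg ι := S.Ad t z * S.swap.A t z + S.A t z * S.swap.Ad t z
def P2 (t : ℝ) (z : ι) : SetAlg ι :=
  2 * (C (S.x t z) - 2 * S.f1 t) * S.P t z + 2 * (S.Ad t z * S.swap.Ad t z)

theorem f1_swap (t : ℝ) : S.swap.f1 t = S.f1 t := by rw [f1, f1, f_swap, g_swap]

theorem two_apply (F : SetAlg ι) (X : Finset ι) : (2 * F : SetAlg ι) X = 2 * F X := by
  rw [two_mul, SetAlg.add_apply, two_mul]

/-- The terms with `g` and `f` combine into a Schrödinger equation `A'' = (x_z - 2 f') A`, whose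
correction `-2 f'` does not depend on `z` and is the same for the swapped system. -/
theorem hasDerivAt_Ad (t : ℝ) {z : ι} {X : Finset ι} (hz : z ∉ X) :
    HasDerivAt (fun t => S.Ad t z X) (((C (S.x t z) - 2 * S.f1 t) * S.A t z).coeff X) t := by
  have hI : ∀ I, I ⊆ X → z ∉ I := fun I h h2 => hz (h h2)
  refine ((S.hasDerivAt_A' t X z hz).fun_sub (HasDerivAt_mul
    (fun I h => S.hasDerivAt_A t I z (hI I h)) (fun I _ => S.hasDerivAt_f t I))).congr_deriv ?_
  rw [← SetAlg.sub_apply]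
  congr 1
  rw [f1]
  ring

theorem hasDerivAt_P (t : ℝ) {z : ι} {X : Finset ι} (hz : z ∉ X) :
    HasDerivAt (fun t => S.P t z X) (S.P1 t z X) t := by
  have hI : ∀ I, I ⊆ X → z ∉ I := fun I h h2 => hz (h h2)
  exact HasDerivAt_mul (fun I h => S.hasDerivAt_A t I z (hI I h))
    (fun I h => S.swap.hasDerivAt_A t I z (hI I h))

theorem hasDerivAt_P1 (t : ℝ) {z : ι} {X : Finset ι} (hz : z ∉ X) :
    HasDerivAt (fun t => S.P1 t z X) (S.P2 t z X) t := by
  have hI : ∀ I, I ⊆ X → z ∉ I := fun I h h2 => hz (h h2)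
  refine ((HasDerivAt_mul (fun I h => S.hasDerivAt_Ad t (hI I h))
    (fun I h => S.swap.hasDerivAt_A t I z (hI I h))).fun_add
    (HasDerivAt_mul (fun I h => S.hasDerivAt_A t I z (hI I h))
    (fun I h => S.swap.hasDerivAt_Ad t (hI I h)))).congr_deriv ?_
  rw [← SetAlg.add_apply]
  congr 1
  rw [f1_swap, P2, P]
  change (C (S.x t z) - 2 * S.f1 t) * S.A t z * S.swap.A t z + S.Ad t z * S.swap.Ad t z +
    (S.Ad t z * S.swap.Ad t z + S.A t z * ((C (S.x t z) - 2 * S.f1 t) * S.swap.A t z)) = _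
  ring

/-- All chains on `insert z X` pass through `z`, where they split into a walk of either family. -/
theorem f_insert (t : ℝ) {z : ι} {X : Finset ι} (hz : z ∉ X) :
    S.f t (insert z X) = S.P t z X := by
  have h := congrArg (fun F : SetAlg ι => F (insert z X)) (numOp_chain (S.K t) (S.b t) (S.a t) z)
  simp only [numOp_apply, if_pos (Finset.mem_insert_self z X)] at h
  rw [f, h, mul_left_comm, eps_mul_apply, if_pos (Finset.mem_insert_self z X),
    Finset.erase_insert hz, mul_comm]
  rfl

theorem f_empty (t : ℝ) : S.f t ∅ = 0 := by
  rw [f, chain_apply]; simp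

theorem f1_empty (t : ℝ) : S.f1 t ∅ = 0 := by
  rw [f1, g, SetAlg.sub_apply, SetAlg.add_apply, chain_apply, chain_apply, SetAlg.mul_apply]; simp [f_empty]

theorem f1_insert (t : ℝ) {z : ι} {X : Finset ι} (hz : z ∉ X) :
    S.f1 t (insert z X) = S.P1 t z X := by
  have h1 := S.hasDerivAt_f t (insert z X)
  simp only [S.f_insert _ hz] at h1
  exact h1.unique (S.hasDerivAt_P t hz)

/-- The second derivative of `f`. -/
def f2 (t : ℝ) : SetAlg ι := ⟨fun X => deriv (fun t => S.f1 t X) t⟩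

theorem hasDerivAt_f1 (t : ℝ) (X : Finset ι) : HasDerivAt (fun t => S.f1 t X) (S.f2 t X) t := by
  have : DifferentiableAt ℝ (fun t => S.f1 t X) t := by
    rcases X.eq_empty_or_nonempty with rfl | ⟨z, hz⟩
    · simp only [f1_empty]; exact differentiableAt_const _
    · rw [← Finset.insert_erase hz]
      simp only [S.f1_insert _ (Finset.notMem_erase z X)]
      exact (S.hasDerivAt_P1 t (Finset.notMem_erase z X)).differentiableAt
  exact this.hasDerivAt

theorem f2_insert (t : ℝ) {z : ι} {X : Finset ι} (hz : z ∉ X) :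
    S.f2 t (insert z X) = S.P2 t z X := by
  have h1 := S.hasDerivAt_f1 t (insert z X)
  simp only [S.f1_insert _ hz] at h1
  exact h1.unique (S.hasDerivAt_P1 t hz)

/-- The third order equation for the chains. -/
theorem hasDerivAt_f2_insert (t : ℝ) {z : ι} {X : Finset ι} (hz : z ∉ X) :
    HasDerivAt (fun t => S.f2 t (insert z X))
      (4 * S.x t z * S.f1 t (insert z X) + 2 * S.f t (insert z X)
        - ∑ I ∈ X.powerset, (8 * (S.f1 t I * S.f1 t (insert z (X \ I)))
          + 4 * (S.f2 t I * S.f t (insert z (X \ I))))) t := by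
  have hI : ∀ I, I ⊆ X → z ∉ I := fun I h h2 => hz (h h2)
  simp only [S.f2_insert _ hz]
  -- With potential `V = x_z - 2 f'`, a product `P` of two solutions of `A'' = V A` satisfies `P'''
  -- = 4 V P' + 2 V' P`.
  have hV : ∀ I, I ⊆ X → HasDerivAt (fun t => (C (S.x t z) - 2 * S.f1 t).coeff I)
      ((1 - 2 * S.f2 t).coeff I) t := by
    intro I _
    simp only [SetAlg.sub_apply, two_apply, C_apply, SetAlg.one_apply]
    refine HasDerivAt.fun_sub ?_ ((S.hasDerivAt_f1 t I).const_mul 2)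
    split_ifs
    · exact S.hx t z
    · exact hasDerivAt_const _ _
  have h1 := HasDerivAt_mul hV (fun I h => S.hasDerivAt_P t (hI I h))
  have h2 := HasDerivAt_mul (fun I h => S.hasDerivAt_Ad t (hI I h))
    (fun I h => S.swap.hasDerivAt_Ad t (hI I h))
  have e : ∀ t, S.P2 t z X = 2 * ((C (S.x t z) - 2 * S.f1 t) * S.P t z).coeff X
      + 2 * (S.Ad t z * S.swap.Ad t z).coeff X := fun t => by
    rw [P2, mul_assoc, SetAlg.add_apply, two_apply, two_apply]
  simp only [e]
  refine ((h1.const_mul 2).fun_add (h2.const_mul 2)).congr_deriv ?_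
  rw [← two_apply, ← two_apply, ← SetAlg.add_apply, f1_swap]
  have e2 : 2 * ((1 - 2 * S.f2 t) * S.P t z + (C (S.x t z) - 2 * S.f1 t) * S.P1 t z)
      + 2 * ((C (S.x t z) - 2 * S.f1 t) * S.A t z * S.swap.Ad t z
        + S.Ad t z * ((C (S.swap.x t z) - 2 * S.f1 t) * S.swap.A t z))
      = C (S.x t z) * (2 * (2 * S.P1 t z)) + 2 * S.P t z
        - (2 * (2 * (2 * (S.f1 t * S.P1 t z))) + 2 * (2 * (S.f2 t * S.P t z))) := by
    rw [P1]
    change 2 * ((1 - 2 * S.f2 t) * S.P t z + (C (S.x t z) - 2 * S.f1 t) *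
      (S.Ad t z * S.swap.A t z + S.A t z * S.swap.Ad t z))
      + 2 * ((C (S.x t z) - 2 * S.f1 t) * S.A t z * S.swap.Ad t z
        + S.Ad t z * ((C (S.x t z) - 2 * S.f1 t) * S.swap.A t z)) = _
    ring
  rw [e2]
  simp only [SetAlg.sub_apply, SetAlg.add_apply, two_apply, C_mul_apply]
  simp only [SetAlg.mul_apply]
  rw [S.f1_insert t hz, S.f_insert t hz, Finset.sum_add_distrib]
  have e3 : ∀ I ∈ X.powerset, 8 * (S.f1 t I * S.f1 t (insert z (X \ I)))
      = 8 * (S.f1 t I * S.P1 t z (X \ I)) := fun I _ => by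
    rw [S.f1_insert t (hI _ Finset.sdiff_subset)]
  have e4 : ∀ I ∈ X.powerset, 4 * (S.f2 t I * S.f t (insert z (X \ I)))
      = 4 * (S.f2 t I * S.P t z (X \ I)) := fun I _ => by
    rw [S.f_insert t (hI _ Finset.sdiff_subset)]
  rw [Finset.sum_congr rfl e3, Finset.sum_congr rfl e4, ← Finset.mul_sum, ← Finset.mul_sum]
  ring

/-- The two point recursion for the chains. -/
theorem f_insert_insert (t : ℝ) {y z : ι} {X : Finset ι} (hy : y ∉ X) (hz : z ∉ X) (hyz : y ≠ z) :
    (S.x t z - S.x t y) * S.f t (insert y (insert z X)) =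
      ∑ I ∈ X.powerset, (S.f t (insert z I) * S.f1 t (insert y (X \ I))
        - S.f1 t (insert z I) * S.f t (insert y (X \ I))) := by
  have h := congrArg (fun F : SetAlg ι => F (insert y (insert z X)))
    (mul_numOp_numOp_chain (S.hK0 t) (S.hK t) hyz)
  have hz' : z ∈ insert y (insert z X) := by simp
  have hy' : y ∈ insert y (insert z X) := by simp
  have hy2 : y ∉ insert z X := by simp [hy, hyz]
  have e1 : (insert y (insert z X)).erase z = insert y X := by
    rw [Finset.insert_comm, Finset.erase_insert]; simp [hz, hyz.symm]
  have hI : ∀ I, I ⊆ X → z ∉ I := fun I h h2 => hz (h h2)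
  have hI' : ∀ I, I ⊆ X → y ∉ I := fun I h h2 => hy (h h2)
  simp only [C_mul_apply, numOp_apply, if_pos hz', if_pos hy', eps_mul_apply, e1,
    if_pos (Finset.mem_insert_self y X), Finset.erase_insert hy] at h
  refine h.trans ?_
  -- In terms of the true derivative `P'` there is an extra `2 P f`, which cancels in the expression
  -- antisymmetric in `y` and `z`.
  have e2 : ∀ z, S.A' t z * S.swap.A t z + S.A t z * S.swap.A' t z
      = S.P1 t z + 2 * (S.P t z * S.f t) := fun z => by
    rw [P1, Ad, Ad, f_swap, P]; ring
  change (S.A t z * S.swap.A t z * (S.A' t y * S.swap.A t y + S.A t y * S.swap.A' t y)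
    - (S.A' t z * S.swap.A t z + S.A t z * S.swap.A' t z) * (S.A t y * S.swap.A t y)) X = _
  rw [e2, e2]
  have e3 : S.A t z * S.swap.A t z * (S.P1 t y + 2 * (S.P t y * S.f t))
      - (S.P1 t z + 2 * (S.P t z * S.f t)) * (S.A t y * S.swap.A t y)
      = S.P t z * S.P1 t y - S.P1 t z * S.P t y := by
    rw [P, P]; ring
  rw [e3, SetAlg.sub_apply, SetAlg.mul_apply, SetAlg.mul_apply, ← Finset.sum_sub_distrib]
  refine Finset.sum_congr rfl fun I hIX => ?_
  rw [Finset.mem_powerset] at hIX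
  rw [S.f_insert t (hI I hIX), S.f1_insert t (hI I hIX),
    S.f_insert t (hI' _ Finset.sdiff_subset), S.f1_insert t (hI' _ Finset.sdiff_subset)]

end AirySystem

end

noncomputable section

open SetAlg

/-! ### Chains as sums over orderings. -/

section Walks

variable {ι κ : Type*} [DecidableEq ι] [Fintype ι] [DecidableEq κ] [Fintype κ]

theorem sum_mem_map (e : κ ↪ ι) (X : Finset κ) (F : ι → ℝ) :
    ∑ j, (if j ∈ X.map e then F j else 0) = ∑ j, if j ∈ X then F (e j) else 0 := by
  rw [Finset.sum_ite_mem, Finset.univ_inter, Finset.sum_map, Finset.sum_ite_mem, Finset.univ_inter]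

theorem W_map (e : κ ↪ ι) (K : ι → ι → ℝ) (a : ι → ℝ) (X : Finset κ) : ∀ z,
    W K a (e z) (X.map e) = W (fun i j => K (e i) (e j)) (fun i => a (e i)) z X := by
  induction X using Finset.strongInduction with
  | H X ih =>
    intro z
    rw [W_apply, W_apply]
    simp only [mul_ite, mul_zero, Finset.map_eq_empty]
    rw [sum_mem_map]
    congr 1
    refine Finset.sum_congr rfl fun j _ => ?_
    split_ifs with hj
    · rw [← Finset.map_erase, ih _ (Finset.erase_ssubset hj)]
    · rfl

theorem chain_map (e : κ ↪ ι) (K : ι → ι → ℝ) (b a : ι → ℝ) (X : Finset κ) :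
    chain K b a (X.map e) =
      chain (fun i j => K (e i) (e j)) (fun i => b (e i)) (fun i => a (e i)) X := by
  rw [AirySystem.chain_apply, AirySystem.chain_apply]
  simp only [mul_ite, mul_zero]
  rw [sum_mem_map]
  refine Finset.sum_congr rfl fun j _ => ?_
  split_ifs with hj
  · rw [← Finset.map_erase, W_map]
  · rfl

/-- The weight of the walk from `z` through the points `w 0, w 1, …`. -/
def pathProd (K : ι → ι → ℝ) (a : ι → ℝ) : (n : ℕ) → ι → (Fin n → ι) → ℝ
  | 0, z, _ => a z
  | n + 1, z, w => K z (w 0) * pathProd K a n (w 0) (fun i => w i.succ)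

omit [DecidableEq ι] [Fintype ι] in
theorem pathProd_eq (K : ι → ι → ℝ) (a : ι → ℝ) (n : ℕ) (v : Fin (n + 1) → ι) :
    pathProd K a n (v 0) (fun i => v i.succ) =
      (∏ i : Fin n, K (v i.castSucc) (v i.succ)) * a (v (Fin.last n)) := by
  induction n with
  | zero => simp [pathProd]
  | succ n ih =>
    rw [pathProd, ih (fun i => v i.succ), Fin.prod_univ_succ, ← mul_assoc]
    rfl

/-- An ordering is its first entry `p` together with an ordering of the rest, which is relabelled by
the transposition of `0` and `p`. -/
theorem sum_perm_succ (n : ℕ) (F : (Fin (n + 1) → Fin (n + 1)) → ℝ) :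
    ∑ w : Equiv.Perm (Fin (n + 1)), F w =
      ∑ p : Fin (n + 1), ∑ w : Equiv.Perm (Fin n),
        F (Fin.cons p fun i => Equiv.swap 0 p (w i).succ) := by
  rw [← Equiv.sum_comp Equiv.Perm.decomposeFin.symm, Fintype.sum_prod_type]
  refine Finset.sum_congr rfl fun p _ => Finset.sum_congr rfl fun w _ => ?_
  congr 1
  ext i
  refine Fin.cases ?_ (fun i => ?_) i
  · simp
  · simp [Equiv.Perm.decomposeFin_symm_apply_succ]

theorem W_univ (K : ι → ι → ℝ) (a : ι → ℝ) (n : ℕ) : ∀ (e : Fin n ↪ ι) (z : ι),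
    W K a z (Finset.univ.map e) = ∑ w : Equiv.Perm (Fin n), pathProd K a n z (fun i => e (w i)) := by
  induction n with
  | zero =>
    intro e z
    rw [W_apply]
    simp [pathProd]
  | succ n ih =>
    intro e z
    rw [W_apply]
    simp only [mul_ite, mul_zero]
    rw [sum_mem_map, sum_perm_succ n (fun w => pathProd K a (n + 1) z (fun i => e (w i)))]
    simp only [Finset.map_eq_empty, Finset.univ_eq_empty_iff, not_isEmpty_of_nonempty, if_false,
      zero_add, Finset.mem_univ, if_true]
    refine Finset.sum_congr rfl fun p _ => ?_
    have he : (Finset.univ.map e).erase (e p) = Finset.univ.map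
        (((Fin.succEmb n).trans (Equiv.swap 0 p).toEmbedding).trans e) := by
      rw [← Finset.map_erase, ← Finset.map_map]
      congr 1
      ext i
      simp only [Finset.mem_erase, Finset.mem_univ, and_true, Finset.mem_map, true_and,
        Function.Embedding.trans_apply, Equiv.coe_toEmbedding, Fin.coe_succEmb]
      constructor
      · intro h
        have h2 : Equiv.swap 0 p i ≠ 0 := by
          intro h3
          apply h
          rw [← Equiv.swap_apply_self 0 p i, h3, Equiv.swap_apply_left]
        obtain ⟨j, hj⟩ := Fin.exists_succ_eq.2 h2
        exact ⟨j, by rw [hj, Equiv.swap_apply_self]⟩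
      · rintro ⟨j, rfl⟩ h
        have := congrArg (Equiv.swap 0 p) h
        rw [Equiv.swap_apply_self, Equiv.swap_apply_right] at this
        exact Fin.succ_ne_zero j this
    rw [he, ih, Finset.mul_sum]
    rfl

theorem chain_univ (n : ℕ) (K : Fin (n + 1) → Fin (n + 1) → ℝ) (b a : Fin (n + 1) → ℝ) :
    chain K b a Finset.univ = ∑ w : Equiv.Perm (Fin (n + 1)),
      b (w 0) * ((∏ i : Fin n, K (w i.castSucc) (w i.succ)) * a (w (Fin.last n))) := by
  simp only [← pathProd_eq]
  -- An additional point `none` serves as the start: its outgoing steps carry the weights `b`, no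
  -- step leads back to it, and a chain becomes a walk from `none`.
  have h := W_univ (ι := Option (Fin (n + 1)))
    (fun i j => j.elim 0 fun j => i.elim (b j) fun i => K i j) (fun i => i.elim 0 a) (n + 1)
    Function.Embedding.some none
  have h1 : chain K b a Finset.univ = W (ι := Option (Fin (n + 1)))
    (fun i j => j.elim 0 fun j => i.elim (b j) fun i => K i j) (fun i => i.elim 0 a) none
    (Finset.univ.map Function.Embedding.some) := by
    rw [AirySystem.chain_apply, W_apply]
    simp only [mul_ite, mul_zero]
    rw [sum_mem_map]
    simp only [Finset.map_eq_empty, Finset.univ_eq_empty_iff, not_isEmpty_of_nonempty, if_false,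
      zero_add]
    refine Finset.sum_congr rfl fun j _ => ?_
    simp only [Finset.mem_univ, if_true]
    rw [← Finset.map_erase]
    have := W_map (ι := Option (Fin (n + 1))) Function.Embedding.some
      (fun i j => j.elim 0 fun j => i.elim (b j) fun i => K i j) (fun i => i.elim 0 a)
      (Finset.univ.erase j) j
    simp only [Function.Embedding.some_apply] at this
    rw [Function.Embedding.some_apply, this]
    rfl
  rw [h1, h]
  refine Finset.sum_congr rfl fun w _ => ?_
  rw [pathProd]
  simp only [Function.Embedding.some_apply]
  have h2 : ∀ (m : ℕ) (z : Fin (n + 1)) (v : Fin m → Fin (n + 1)),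
      pathProd (ι := Option (Fin (n + 1)))
        (fun i j => j.elim 0 fun j => i.elim (b j) fun i => K i j) (fun i => i.elim 0 a) m
        (some z) (fun i => some (v i)) = pathProd K a m z v := by
    intro m
    induction m with
    | zero => intro z v; rfl
    | succ m ih => intro z v; rw [pathProd, pathProd, ih]; rfl
  rw [h2]
  rfl

end Walks

/-! ### Sums over full cycles. -/

section Cycles

variable {n : ℕ}

/-- The permutations that conjugate the rotation to `σ` form a coset of the centraliser of the
rotation, which has `n + 2` elements. -/
theorem card_conj_finRotate (σ : Equiv.Perm (Fin (n + 2))) (hσ : σ.cycleType = {n + 2}) :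
    (Finset.univ.filter fun w : Equiv.Perm (Fin (n + 2)) => w * finRotate (n + 2) * w⁻¹ = σ).card
      = n + 2 := by
  classical
  obtain ⟨w0, hw0⟩ := isConj_iff.1 (Equiv.Perm.isConj_iff_cycleType_eq.2
    ((cycleType_finRotate (n := n)).trans hσ.symm))
  have hc : Nat.card (Subgroup.centralizer {finRotate (n + 2)}) = n + 2 := by
    rw [Equiv.Perm.nat_card_centralizer, cycleType_finRotate]
    simp
  refine Eq.trans ?_ hc
  rw [Nat.card_eq_fintype_card, ← Fintype.card_coe]
  refine Fintype.card_congr ⟨fun w => ⟨w0⁻¹ * w.1, ?_⟩, fun c => ⟨w0 * c.1, ?_⟩, ?_, ?_⟩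
  · obtain ⟨w, hw⟩ := w
    have h := (Finset.mem_filter.1 hw).2
    rw [Subgroup.mem_centralizer_singleton_iff]
    rw [← hw0] at h
    have h2 := congrArg (fun q => w0⁻¹ * q * w) h
    simp only [mul_assoc, inv_mul_cancel, mul_one, inv_mul_cancel_left] at h2
    simp only [mul_assoc]
    rw [h2]
  · have h := c.2
    rw [Subgroup.mem_centralizer_singleton_iff] at h
    simp only [Finset.mem_filter, Finset.mem_univ, true_and]
    rw [← hw0, mul_inv_rev]
    have h3 : c.1 * finRotate (n + 2) * c.1⁻¹ = finRotate (n + 2) := by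
      rw [h, mul_inv_cancel_right]
    calc w0 * c.1 * finRotate (n + 2) * (c.1⁻¹ * w0⁻¹)
        = w0 * (c.1 * finRotate (n + 2) * c.1⁻¹) * w0⁻¹ := by simp only [mul_assoc]
      _ = _ := by rw [h3]
  · intro w; simp
  · intro c; simp

/-- The sum over the full cycles as a sum over all orderings. -/
theorem sum_cycles_eq (K : Fin (n + 2) → Fin (n + 2) → ℝ) :
    ((n + 2 : ℕ) : ℝ) * ∑ σ : Equiv.Perm (Fin (n + 2)) with σ.cycleType = {n + 2},
        ∏ i, K i (σ i) =
      ∑ w : Equiv.Perm (Fin (n + 2)), ∏ k, K (w k) (w (k + 1)) := by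
  have h1 : ∀ w : Equiv.Perm (Fin (n + 2)), ∏ k, K (w k) (w (k + 1))
      = ∏ i, K i ((w * finRotate (n + 2) * w⁻¹) i) := by
    intro w
    refine Eq.trans (Finset.prod_congr rfl fun k _ => ?_)
      (Equiv.prod_comp w fun i => K i ((w * finRotate (n + 2) * w⁻¹) i))
    simp
  simp only [h1]
  rw [← Finset.sum_fiberwise_of_maps_to (s := Finset.univ)
    (t := Finset.univ.filter fun σ : Equiv.Perm (Fin (n + 2)) => σ.cycleType = {n + 2})
    (g := fun w : Equiv.Perm (Fin (n + 2)) => w * finRotate (n + 2) * w⁻¹)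
    (fun w _ => by simp [Equiv.Perm.cycleType_conj, cycleType_finRotate]), Finset.mul_sum]
  refine Finset.sum_congr rfl fun σ hσ => ?_
  rw [Finset.sum_congr rfl fun w hw => by rw [(Finset.mem_filter.1 hw).2], Finset.sum_const,
    card_conj_finRotate σ (Finset.mem_filter.1 hσ).2, nsmul_eq_mul]

/-- Rotating the positions permutes the orderings, so a marked position may be moved anywhere. -/
theorem sum_perm_rotate (F : (Fin (n + 2) → Fin (n + 2)) → Fin (n + 2) → ℝ)
    (hF : ∀ w k j, F (fun i => w (i + j)) k = F w (k + j)) (k : Fin (n + 2)) :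
    ∑ w : Equiv.Perm (Fin (n + 2)), F w k =
      ∑ w : Equiv.Perm (Fin (n + 2)), F w (Fin.last (n + 1)) := by
  rw [← Equiv.sum_comp (Equiv.mulRight (Equiv.addRight (Fin.last (n + 1) - k)))]
  refine Finset.sum_congr rfl fun w _ => ?_
  have := hF w k (Fin.last (n + 1) - k)
  rw [add_sub_cancel] at this
  rw [← this]
  rfl

/-- Differentiating one link opens the cycle into a chain. In the sum over orderings all `n + 2`
links contribute equally, which cancels the overcounting of cycles. -/
theorem hasDerivAt_sum_cycles {a b : Fin (n + 2) → ℝ} {K : ℝ → Fin (n + 2) → Fin (n + 2) → ℝ} {t : ℝ}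
    (hK : ∀ i j, i ≠ j → HasDerivAt (fun t => K t i j) (-(a i * b j)) t) :
    HasDerivAt (fun t => ∑ σ : Equiv.Perm (Fin (n + 2)) with σ.cycleType = {n + 2},
        ∏ i, K t i (σ i)) (-chain (K t) b a Finset.univ) t := by
  have hn : ((n + 2 : ℕ) : ℝ) ≠ 0 := by positivity
  have e : ∀ t, ∑ σ : Equiv.Perm (Fin (n + 2)) with σ.cycleType = {n + 2}, ∏ i, K t i (σ i)
      = ((n + 2 : ℕ) : ℝ)⁻¹ * ∑ w : Equiv.Perm (Fin (n + 2)), ∏ k, K t (w k) (w (k + 1)) :=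
    fun t => by rw [← sum_cycles_eq, inv_mul_cancel_left₀ hn]
  simp only [e]
  set F : (Fin (n + 2) → Fin (n + 2)) → Fin (n + 2) → ℝ := fun w k =>
    (∏ l ∈ Finset.univ.erase k, K t (w l) (w (l + 1))) * -(a (w k) * b (w (k + 1))) with hF
  have h1 : HasDerivAt (fun t => ∑ w : Equiv.Perm (Fin (n + 2)), ∏ k, K t (w k) (w (k + 1)))
      (∑ w : Equiv.Perm (Fin (n + 2)), ∑ k, F w k) t := by
    refine HasDerivAt.fun_sum fun w _ => ?_
    refine (HasDerivAt.fun_finsetProd fun k _ => hK (w k) (w (k + 1)) ?_).congr_deriv ?_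
    · intro h
      have := w.injective h
      simp at this
    · simp [hF]
  refine (h1.const_mul _).congr_deriv ?_
  rw [Finset.sum_comm]
  have h2 : ∀ k, ∑ w : Equiv.Perm (Fin (n + 2)), F w k = -chain (K t) b a Finset.univ := by
    intro k
    rw [sum_perm_rotate F _ k]
    · rw [chain_univ, ← Finset.sum_neg_distrib]
      refine Finset.sum_congr rfl fun w _ => ?_
      have h3 : (Finset.univ : Finset (Fin (n + 2))).erase (Fin.last (n + 1))
          = Finset.univ.map Fin.castSuccEmb := by
        ext i
        simp only [Finset.mem_erase, Finset.mem_univ, and_true, Finset.mem_map, true_and,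
          Fin.coe_castSuccEmb]
        exact Fin.exists_castSucc_eq.symm
      simp only [hF]
      rw [h3, Finset.prod_map, Fin.last_add_one]
      simp only [Fin.coe_castSuccEmb, Fin.coeSucc_eq_succ]
      ring
    · intro w k j
      simp only [hF]
      have h4 : ∏ l ∈ Finset.univ.erase k, K t (w (l + j)) (w (l + 1 + j))
          = ∏ l ∈ Finset.univ.erase (k + j), K t (w l) (w (l + 1)) := by
        refine Finset.prod_nbij (fun l => l + j) ?_ ?_ ?_ ?_
        · intro l hl
          simpa using hl
        · intro l _ l' _ h
          simpa using h
        · intro l hl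
          refine ⟨l - j, ?_, by simp⟩
          simp only [Finset.coe_erase, Set.mem_sdiff, Set.mem_singleton_iff, Finset.coe_univ,
            Set.mem_univ, true_and] at hl ⊢
          intro h
          exact hl (by rw [← h]; simp)
        · intro l _
          rw [add_right_comm]
      rw [h4, add_right_comm]
  simp only [h2, Finset.sum_const, Finset.card_univ, Fintype.card_fin, nsmul_eq_mul]
  rw [inv_mul_cancel_left₀ hn]

/-- The sum over full cycles of the products of the `1 / (x i - x (σ i))` vanishes for at least
three points. -/
theorem sum_cycles_inv_sub_eq_zero {x : Fin (n + 3) → ℝ} (hx : Function.Injective x) :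
    ∑ σ : Equiv.Perm (Fin (n + 3)) with σ.cycleType = {n + 3}, ∏ i, (x i - x (σ i))⁻¹ = 0 := by
  have hn : ((n + 1 + 2 : ℕ) : ℝ) ≠ 0 := by positivity
  have h0 := sum_cycles_eq (n := n + 1) (fun i j => (x i - x j)⁻¹)
  suffices h : ∑ w : Equiv.Perm (Fin (n + 1 + 2)), ∏ k, (x (w k) - x (w (k + 1)))⁻¹ = 0 by
    rw [h] at h0
    exact (mul_eq_zero.1 h0).resolve_left hn
  set G : (Fin (n + 1 + 2) → Fin (n + 1 + 2)) → ℝ := fun w => ∏ k, (x (w k) - x (w (k + 1)))⁻¹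
    with hG
  have hGr : ∀ w j, G (fun i => w (i + j)) = G w := by
    intro w j
    simp only [hG]
    rw [← Equiv.prod_comp (Equiv.addRight j) fun k => (x (w k) - x (w (k + 1)))⁻¹]
    refine Finset.prod_congr rfl fun k _ => ?_
    simp [add_right_comm]
  -- Mark the position of the point `0`; by rotation it may be taken to stand first.
  have h1 : ∀ w : Equiv.Perm (Fin (n + 1 + 2)), G w = ∑ k, if w k = 0 then G w else 0 := by
    intro w
    rw [Finset.sum_eq_single (w.symm 0)]
    · simp
    · intro k _ hk
      rw [if_neg]
      intro h
      exact hk (by rw [← h]; simp)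
    · simp
  change ∑ w : Equiv.Perm (Fin (n + 1 + 2)), G w = 0
  rw [Finset.sum_congr rfl fun w _ => h1 w, Finset.sum_comm]
  refine Finset.sum_eq_zero fun k _ => ?_
  have h2 := sum_perm_rotate (fun w k => if w k = 0 then G w else 0)
    (fun w k j => by simp only [hGr]) k
  have h2' := sum_perm_rotate (fun w k => if w k = 0 then G w else 0)
    (fun w k j => by simp only [hGr]) 0
  rw [h2, ← h2', sum_perm_succ _ (fun w => if w 0 = 0 then G w else 0)]
  simp only [Fin.cons_zero]
  rw [Finset.sum_eq_single 0 (fun p _ hp => by simp [hp]) (by simp)]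
  simp only [if_true, Equiv.swap_self, Equiv.refl_apply]
  set z : Fin (n + 2) → ℝ := fun i => x i.succ with hz
  set y := x 0 with hy
  have hyz : ∀ i, y - z i ≠ 0 := fun i => sub_ne_zero.2 (hx.ne (Fin.succ_ne_zero i).symm)
  have hzi : Function.Injective z := fun i j h => Fin.succ_injective _ (hx h)
  set H : (Fin (n + 2) → Fin (n + 2)) → ℝ := fun e => ∏ k, (z (e k) - z (e (k + 1)))⁻¹ with hH
  -- Partial fractions in `y` close the cycle of the other points and leave a difference of two
  -- simple poles, at the first and at the last of them. Summed over all orderings, the two poles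
  -- agree by rotation.
  have h3 : ∀ e : Equiv.Perm (Fin (n + 2)), G (Fin.cons 0 fun i => (e i).succ)
      = H e * (y - z (e 0))⁻¹ - H e * (y - z (e (Fin.last (n + 1))))⁻¹ := by
    intro e
    have hne : z (e (Fin.last (n + 1))) - z (e 0) ≠ 0 := by
      refine sub_ne_zero.2 (hzi.ne (e.injective.ne ?_))
      exact Fin.last_pos.ne'
    have e1 : G (Fin.cons 0 fun i => (e i).succ) = (y - z (e 0))⁻¹ *
        ((∏ i : Fin (n + 1), (z (e i.castSucc) - z (e i.succ))⁻¹) *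
          (z (e (Fin.last (n + 1))) - y)⁻¹) := by
      simp only [hG]
      rw [Fin.prod_univ_succ, Fin.prod_univ_castSucc]
      simp only [Fin.cons_zero, Fin.cons_succ, ← Fin.succ_castSucc, Fin.succ_last,
        Fin.last_add_one, zero_add]
      congr 2
      refine Finset.prod_congr rfl fun i _ => ?_
      rw [show (i.castSucc.succ : Fin (n + 1 + 2)) + 1 = i.succ.succ by
        rw [Fin.succ_castSucc, Fin.coeSucc_eq_succ], Fin.cons_succ]
    have e2 : H e = (∏ i : Fin (n + 1), (z (e i.castSucc) - z (e i.succ))⁻¹) *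
        (z (e (Fin.last (n + 1))) - z (e 0))⁻¹ := by
      simp only [hH]
      rw [Fin.prod_univ_castSucc, Fin.last_add_one]
      simp only [Fin.coeSucc_eq_succ]
    rw [e1, e2]
    have k1 := hyz (e 0)
    have k2 := hyz (e (Fin.last (n + 1)))
    have k3 : z (e (Fin.last (n + 1))) - y ≠ 0 := by
      rw [← neg_sub]; exact neg_ne_zero.2 k2
    generalize ∏ i : Fin (n + 1), (z (e i.castSucc) - z (e i.succ))⁻¹ = Q
    rw [show (y - z (e (Fin.last (n + 1))))⁻¹ = -(z (e (Fin.last (n + 1))) - y)⁻¹ by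
      rw [← inv_neg, neg_sub]]
    field_simp
    ring
  simp only [h3, Finset.sum_sub_distrib]
  rw [sub_eq_zero]
  have hHr : ∀ w j, H (fun i => w (i + j)) = H w := by
    intro w j
    simp only [hH]
    rw [← Equiv.prod_comp (Equiv.addRight j) fun k => (z (w k) - z (w (k + 1)))⁻¹]
    refine Finset.prod_congr rfl fun k _ => ?_
    simp [add_right_comm]
  exact sum_perm_rotate (fun w k => H w * (y - z (w k))⁻¹) (fun w k j => by simp only [hHr]) 0

end Cycles

end

/-! ### Laplace integrals with frequencies in a cone. -/

noncomputable section

/-- The function `y ↦ ∫ h exp (-∑ t_k y_k)` is integrable over an orthant, and its integral. -/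
theorem integral_pi_Ioi_exp {Ω κ : Type*} [MeasurableSpace Ω] [Fintype κ] {μ : Measure Ω} [SFinite μ]
    {h : Ω → ℂ} {t : Ω → κ → ℂ} (hh : Measurable h) (ht : ∀ k, Measurable fun ω => t ω k)
    (hpos : ∀ ω k, 0 < (t ω k).re) (x : κ → ℝ)
    (hint : Integrable (fun ω => ‖h ω‖ * ∏ k, ((t ω k).re⁻¹ * Real.exp (-((t ω k).re * x k)))) μ) :
    IntegrableOn (fun y : κ → ℝ => ∫ ω, h ω * Complex.exp (-∑ k, t ω k * y k) ∂μ)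
        (Set.univ.pi fun k => Set.Ioi (x k)) ∧
      ∫ y in Set.univ.pi fun k => Set.Ioi (x k), ∫ ω, h ω * Complex.exp (-∑ k, t ω k * y k) ∂μ =
        ∫ ω, h ω * ∏ k, ((t ω k)⁻¹ * Complex.exp (-(t ω k * x k))) ∂μ := by
  have hν : (volume : Measure (κ → ℝ)).restrict (Set.univ.pi fun k => Set.Ioi (x k))
      = Measure.pi fun k => volume.restrict (Set.Ioi (x k)) := by
    rw [volume_pi, Measure.restrict_pi_pi]
  rw [IntegrableOn, hν]
  set ν : Measure (κ → ℝ) := Measure.pi fun k => volume.restrict (Set.Ioi (x k)) with hνdef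
  have hexp : ∀ ω (y : κ → ℝ), Complex.exp (-∑ k, t ω k * y k)
      = ∏ k, Complex.exp (-(t ω k) * y k) := by
    intro ω y
    rw [← Complex.exp_sum, ← Finset.sum_neg_distrib]
    simp only [neg_mul]
  have hmeas : Measurable (fun p : Ω × (κ → ℝ) => h p.1 * Complex.exp (-∑ k, t p.1 k * p.2 k)) := by
    refine (hh.comp measurable_fst).mul (Complex.measurable_exp.comp ?_)
    refine (Finset.measurable_sum _ fun k _ => ?_).neg
    exact ((ht k).comp measurable_fst).mul
      (Complex.measurable_ofReal.comp ((measurable_pi_apply k).comp measurable_snd))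
  have h1 : ∀ ω k, Integrable (fun y : ℝ => Complex.exp (-(t ω k) * y))
      (volume.restrict (Set.Ioi (x k))) := fun ω k =>
    integrableOn_exp_mul_complex_Ioi (by simpa using hpos ω k) (x k)
  have hI : Integrable (Function.uncurry fun (ω : Ω) (y : κ → ℝ) =>
      h ω * Complex.exp (-∑ k, t ω k * y k)) (μ.prod ν) := by
    refine (integrable_prod_iff hmeas.aestronglyMeasurable).2 ⟨Eventually.of_forall fun ω => ?_, ?_⟩
    · simp only [hexp]
      exact (Integrable.fintype_prod (h1 ω)).const_mul _
    · refine hint.congr (Eventually.of_forall fun ω => ?_)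
      simp only [norm_mul, hexp, norm_prod]
      rw [integral_const_mul,
        integral_fintype_prod_eq_prod (fun k (y : ℝ) => ‖Complex.exp (-(t ω k) * y)‖)]
      congr 1
      refine Finset.prod_congr rfl fun k _ => ?_
      have h2 : ∀ y : ℝ, ‖Complex.exp (-(t ω k) * y)‖ = Real.exp (-(t ω k).re * y) := fun y => by
        rw [Complex.norm_exp]; simp
      simp only [h2]
      rw [integral_exp_mul_Ioi (by simpa using hpos ω k)]
      rw [neg_div_neg_eq, div_eq_inv_mul, neg_mul]
  refine ⟨hI.integral_prod_right, ?_⟩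
  rw [← integral_integral_swap hI]
  refine integral_congr_ae (Eventually.of_forall fun ω => ?_)
  simp only [hexp]
  rw [integral_const_mul,
    integral_fintype_prod_eq_prod (fun k (y : ℝ) => Complex.exp (-(t ω k) * y))]
  congr 1
  refine Finset.prod_congr rfl fun k _ => ?_
  rw [integral_exp_mul_complex_Ioi (by simpa using hpos ω k), neg_div_neg_eq, div_eq_inv_mul,
    neg_mul]

/-- A family of complex frequencies `t_i` in the cone `|t| ≤ 2 Re t`, with a density. -/
structure LaplaceRep (ι : Type*) where
  Ω : Type
  [mΩ : MeasurableSpace Ω]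
  μ : Measure Ω
  [sfinite : SFinite μ]
  g : Ω → ℂ
  t : Ω → ι → ℂ
  measurable_g : Measurable g
  measurable_t : ∀ i, Measurable fun ω => t ω i
  norm_pos : ∀ ω i, 0 < ‖t ω i‖
  cone : ∀ ω i, ‖t ω i‖ ≤ 2 * (t ω i).re

namespace LaplaceRep

attribute [instance] LaplaceRep.mΩ LaplaceRep.sfinite

variable {ι : Type*} (R : LaplaceRep ι) (X : Finset ι)

/-- The sum of the moduli of the frequencies. -/
def S (ω : R.Ω) : ℝ := ∑ i ∈ X, ‖R.t ω i‖

/-- The sum of the frequencies. -/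
def T (ω : R.Ω) : ℂ := ∑ i ∈ X, R.t ω i

/-- The Laplace integral of `h`. -/
def ev (h : R.Ω → ℂ) (x : ι → ℝ) : ℂ :=
  ∫ ω, h ω * Complex.exp (-∑ i ∈ X, R.t ω i * x i) ∂(R.μ)

/-- Measurable functions that are integrable against every `exp (-c S)`, `c > 0`. -/
def Tame (h : R.Ω → ℂ) : Prop :=
  Measurable h ∧ ∀ c : ℝ, 0 < c → Integrable (fun ω => ‖h ω‖ * Real.exp (-(c * R.S X ω))) R.μ

variable {R X}

theorem re_pos (ω : R.Ω) (i : ι) : 0 < (R.t ω i).re := by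
  have := R.norm_pos ω i
  have := R.cone ω i
  linarith

theorem ne_zero (ω : R.Ω) (i : ι) : R.t ω i ≠ 0 := norm_pos_iff.1 (R.norm_pos ω i)

theorem S_nonneg (ω : R.Ω) : 0 ≤ R.S X ω := Finset.sum_nonneg fun _ _ => norm_nonneg _

theorem norm_le_S (ω : R.Ω) {i : ι} (hi : i ∈ X) : ‖R.t ω i‖ ≤ R.S X ω :=
  Finset.single_le_sum (f := fun i => ‖R.t ω i‖) (fun _ _ => norm_nonneg _) hi

theorem norm_T_le (ω : R.Ω) : ‖R.T X ω‖ ≤ R.S X ω := norm_sum_le _ _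

theorem S_le_re_T (ω : R.Ω) : R.S X ω ≤ 2 * (R.T X ω).re := by
  rw [S, T, Complex.re_sum, Finset.mul_sum]
  exact Finset.sum_le_sum fun i _ => R.cone ω i

/-- In the cone there is no cancellation: `T` and `S` are comparable, so division by `T` costs no
more than division by `S`. -/
theorem S_le_norm_T (ω : R.Ω) : R.S X ω ≤ 2 * ‖R.T X ω‖ :=
  (S_le_re_T ω).trans (by linarith [Complex.re_le_norm (R.T X ω)])

theorem S_pos (hX : X.Nonempty) (ω : R.Ω) : 0 < R.S X ω :=
  Finset.sum_pos (fun i _ => R.norm_pos ω i) hX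

theorem T_ne_zero (hX : X.Nonempty) (ω : R.Ω) : R.T X ω ≠ 0 := by
  intro h
  have h1 := S_pos hX ω
  have h2 := S_le_norm_T (X := X) ω
  rw [h, norm_zero] at h2
  linarith

variable (R X) in
theorem measurable_S : Measurable (R.S X) :=
  Finset.measurable_sum _ fun i _ => (R.measurable_t i).norm

variable (R X) in
theorem measurable_T : Measurable (R.T X) :=
  Finset.measurable_sum _ fun i _ => R.measurable_t i

theorem measurable_kernel (x : ι → ℝ) :
    Measurable fun ω => Complex.exp (-∑ i ∈ X, R.t ω i * x i) :=
  Complex.measurable_exp.comp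
    (Finset.measurable_sum _ fun i _ => (R.measurable_t i).mul_const _).neg

theorem norm_kernel_le {x : ι → ℝ} {c : ℝ} (hc : ∀ i ∈ X, c ≤ x i) (hc0 : 0 ≤ c) (ω : R.Ω) :
    ‖Complex.exp (-∑ i ∈ X, R.t ω i * x i)‖ ≤ Real.exp (-(c / 2 * R.S X ω)) := by
  rw [Complex.norm_exp, Complex.neg_re, Complex.re_sum]
  refine Real.exp_le_exp.2 (neg_le_neg ?_)
  rw [S, Finset.mul_sum]
  refine Finset.sum_le_sum fun i hi => ?_
  rw [Complex.re_mul_ofReal]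
  have h1 := R.cone ω i
  have h2 := hc i hi
  have h3 := re_pos ω i
  nlinarith

theorem pow_mul_exp_le (k : ℕ) {c : ℝ} (hc : 0 < c) {s : ℝ} (hs : 0 ≤ s) :
    s ^ k ≤ k.factorial / c ^ k * Real.exp (c * s) := by
  have h := Real.pow_div_factorial_le_exp (c * s) (by positivity) k
  rw [div_le_iff₀ (by positivity), mul_pow] at h
  rw [div_mul_eq_mul_div, le_div_iff₀ (by positivity)]
  linarith

theorem rpow_le_exp {α : ℝ} (hα : 0 ≤ α) {c : ℝ} (hc : 0 < c) :
    ∃ C : ℝ, ∀ s : ℝ, 0 ≤ s → s ^ α ≤ C * Real.exp (c * s) := by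
  obtain ⟨k, hk⟩ := exists_nat_ge α
  refine ⟨1 + k.factorial / c ^ k, fun s hs => ?_⟩
  have h1 := pow_mul_exp_le k hc hs
  have h2 : (1 : ℝ) ≤ Real.exp (c * s) := Real.one_le_exp (by positivity)
  have h3 : s ^ α ≤ 1 + s ^ k := by
    rcases le_total s 1 with h | h
    · have := Real.rpow_le_one hs h hα
      have : 0 ≤ s ^ k := by positivity
      linarith
    · have := Real.rpow_le_rpow_of_exponent_le h hk
      rw [Real.rpow_natCast] at this
      linarith
  linarith

namespace Tame

variable {h h' : R.Ω → ℂ}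

/-- Tameness tolerates an arbitrarily small exponential loss, in particular any polynomial factor in
the frequencies. Only small frequencies are a constraint. -/
theorem mono (hh : R.Tame X h) (hm : Measurable h')
    (hb : ∀ ε : ℝ, 0 < ε → ∃ C : ℝ, ∀ ω, ‖h' ω‖ ≤ C * Real.exp (ε * R.S X ω) * ‖h ω‖) :
    R.Tame X h' := by
  refine ⟨hm, fun c hc => ?_⟩
  obtain ⟨C, hC⟩ := hb (c / 2) (by positivity)
  refine ((hh.2 (c / 2) (by positivity)).const_mul C).mono' ?_ (Eventually.of_forall fun ω => ?_)
  · exact (hm.norm.mul (Real.measurable_exp.comp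
      ((R.measurable_S X).const_mul c).neg)).aestronglyMeasurable
  · rw [Real.norm_of_nonneg (by positivity)]
    calc ‖h' ω‖ * Real.exp (-(c * R.S X ω))
        ≤ C * Real.exp (c / 2 * R.S X ω) * ‖h ω‖ * Real.exp (-(c * R.S X ω)) := by
          gcongr; exact hC ω
      _ = C * (‖h ω‖ * (Real.exp (c / 2 * R.S X ω) * Real.exp (-(c * R.S X ω)))) := by ring
      _ = _ := by rw [← Real.exp_add]; ring_nf

theorem mono' (hh : R.Tame X h) (hm : Measurable h') (C : ℝ) (hb : ∀ ω, ‖h' ω‖ ≤ C * ‖h ω‖) :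
    R.Tame X h' := by
  refine hh.mono hm fun ε hε => ⟨|C|, fun ω => (hb ω).trans ?_⟩
  have h1 : (1 : ℝ) ≤ Real.exp (ε * R.S X ω) := Real.one_le_exp (mul_nonneg hε.le (S_nonneg ω))
  calc C * ‖h ω‖ ≤ |C| * 1 * ‖h ω‖ := by rw [mul_one]; gcongr; exact le_abs_self C
    _ ≤ _ := by gcongr

theorem mul_of_rpow_le (hh : R.Tame X h) {f : R.Ω → ℂ} (hm : Measurable f) {α : ℝ} (hα : 0 ≤ α)
    (hb : ∀ ω, ‖f ω‖ ≤ R.S X ω ^ α) : R.Tame X fun ω => h ω * f ω := by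
  refine hh.mono (hh.1.mul hm) fun ε hε => ?_
  obtain ⟨C, hC⟩ := rpow_le_exp hα hε
  refine ⟨C, fun ω => ?_⟩
  rw [norm_mul, mul_comm]
  gcongr
  exact (hb ω).trans (hC _ (S_nonneg ω))

theorem mul_of_le (hh : R.Tame X h) {f : R.Ω → ℂ} (hm : Measurable f)
    (hb : ∀ ω, ‖f ω‖ ≤ R.S X ω) : R.Tame X fun ω => h ω * f ω :=
  hh.mul_of_rpow_le hm zero_le_one fun ω => by simpa using hb ω

theorem mul_t (hh : R.Tame X h) {i : ι} (hi : i ∈ X) : R.Tame X fun ω => h ω * R.t ω i :=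
  hh.mul_of_le (R.measurable_t i) fun ω => norm_le_S ω hi

theorem mul_T (hh : R.Tame X h) : R.Tame X fun ω => h ω * R.T X ω :=
  hh.mul_of_le (R.measurable_T X) norm_T_le

theorem neg (hh : R.Tame X h) : R.Tame X fun ω => -h ω :=
  hh.mono' hh.1.neg 1 fun ω => by simp

theorem add (hh : R.Tame X h) (hh' : R.Tame X h') : R.Tame X fun ω => h ω + h' ω := by
  refine ⟨hh.1.add hh'.1, fun c hc => ((hh.2 c hc).add (hh'.2 c hc)).mono' ?_
    (Eventually.of_forall fun ω => ?_)⟩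
  · exact ((hh.1.add hh'.1).norm.mul (Real.measurable_exp.comp
      ((R.measurable_S X).const_mul c).neg)).aestronglyMeasurable
  · rw [Real.norm_of_nonneg (by positivity), Pi.add_apply, ← add_mul]
    gcongr
    exact norm_add_le _ _

theorem sum {α : Type*} (s : Finset α) {h : α → R.Ω → ℂ} (hh : ∀ a ∈ s, R.Tame X (h a)) :
    R.Tame X fun ω => ∑ a ∈ s, h a ω := by
  classical
  induction s using Finset.induction_on with
  | empty => exact ⟨by simp, fun c _ => by simp⟩
  | insert a s ha ih =>
    simp only [Finset.sum_insert ha]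
    exact (hh a (Finset.mem_insert_self a s)).add
      (ih fun b hb => hh b (Finset.mem_insert_of_mem hb))

theorem integrable (hh : R.Tame X h) {x : ι → ℝ} (hx : ∀ i ∈ X, 0 < x i) :
    Integrable (fun ω => h ω * Complex.exp (-∑ i ∈ X, R.t ω i * x i)) R.μ := by
  obtain ⟨c, hc, hcx⟩ : ∃ c : ℝ, 0 < c ∧ ∀ i ∈ X, c ≤ x i := by
    rcases X.eq_empty_or_nonempty with rfl | hX
    · exact ⟨1, one_pos, by simp⟩
    · obtain ⟨i, hi, h⟩ := X.exists_min_image x hX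
      exact ⟨x i, hx i hi, h⟩
  refine (hh.2 (c / 2) (by positivity)).mono'
    (hh.1.mul (measurable_kernel x)).aestronglyMeasurable (Eventually.of_forall fun ω => ?_)
  rw [norm_mul]
  gcongr
  exact norm_kernel_le hcx hc.le ω

end Tame

theorem ev_add {h h' : R.Ω → ℂ} (hh : R.Tame X h) (hh' : R.Tame X h') {x : ι → ℝ}
    (hx : ∀ i ∈ X, 0 < x i) :
    R.ev X (fun ω => h ω + h' ω) x = R.ev X h x + R.ev X h' x := by
  simp only [ev, add_mul]
  exact integral_add (hh.integrable hx) (hh'.integrable hx)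

theorem ev_sum {α : Type*} (s : Finset α) {h : α → R.Ω → ℂ} (hh : ∀ a ∈ s, R.Tame X (h a))
    {x : ι → ℝ} (hx : ∀ i ∈ X, 0 < x i) :
    R.ev X (fun ω => ∑ a ∈ s, h a ω) x = ∑ a ∈ s, R.ev X (h a) x := by
  simp only [ev, Finset.sum_mul]
  exact integral_finsetSum _ fun a ha => (hh a ha).integrable hx

theorem ev_neg (h : R.Ω → ℂ) (x : ι → ℝ) : R.ev X (fun ω => -h ω) x = -R.ev X h x := by
  simp only [ev, neg_mul]
  exact integral_neg _

theorem ev_const_mul (c : ℂ) (h : R.Ω → ℂ) (x : ι → ℝ) :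
    R.ev X (fun ω => c * h ω) x = c * R.ev X h x := by
  simp only [ev, mul_assoc]
  exact integral_const_mul _ _

theorem kernel_add (x : ι → ℝ) (τ : ℝ) (ω : R.Ω) :
    Complex.exp (-∑ i ∈ X, R.t ω i * ((x i + τ : ℝ) : ℂ)) =
      Complex.exp (-∑ i ∈ X, R.t ω i * x i) * Complex.exp (-(R.T X ω * τ)) := by
  rw [← Complex.exp_add, T, Finset.sum_mul, ← neg_add, ← Finset.sum_add_distrib]
  congr 2
  refine Finset.sum_congr rfl fun i _ => ?_
  push_cast
  ring

/-- A common translation multiplies the kernel by `exp(-T τ)`, so differentiation along translations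
is multiplication of the density by `-T`. -/
theorem hasDerivAt_ev {h : R.Ω → ℂ} (hh : R.Tame X h) {x : ι → ℝ} {τ : ℝ}
    (hx : ∀ i ∈ X, 0 < x i + τ) :
    HasDerivAt (fun τ => R.ev X h fun i => x i + τ)
      (-R.ev X (fun ω => h ω * R.T X ω) fun i => x i + τ) τ := by
  obtain ⟨c, hc, hcx⟩ : ∃ c : ℝ, 0 < c ∧ ∀ i ∈ X, 2 * c ≤ x i + τ := by
    rcases X.eq_empty_or_nonempty with rfl | hX
    · exact ⟨1, one_pos, by simp⟩
    · obtain ⟨i, hi, h⟩ := X.exists_min_image (fun i => x i + τ) hX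
      exact ⟨(x i + τ) / 2, half_pos (hx i hi), fun j hj => by simpa [mul_div_cancel₀] using h j hj⟩
  have hb := (hh.mul_T.2 (c / 2) (by positivity))
  rw [← ev_neg]
  refine (hasDerivAt_integral_of_dominated_loc_of_deriv_le (F' := fun τ ω => -(h ω * R.T X ω) *
      Complex.exp (-∑ i ∈ X, R.t ω i * ((x i + τ : ℝ) : ℂ))) (Metric.ball_mem_nhds τ hc)
    (Eventually.of_forall fun τ' => (hh.1.mul (measurable_kernel _)).aestronglyMeasurable)
    (hh.integrable hx) ((hh.mul_T.neg.1.mul (measurable_kernel _)).aestronglyMeasurable)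
    (Eventually.of_forall fun ω τ' hτ' => ?_) hb
    (Eventually.of_forall fun ω τ' hτ' => ?_)).2
  · rw [norm_mul, norm_neg]
    gcongr
    refine norm_kernel_le (fun i hi => ?_) hc.le ω
    have := hcx i hi
    rw [Metric.mem_ball, Real.dist_eq, abs_lt] at hτ'
    linarith
  · simp only [kernel_add]
    have h1 : HasDerivAt (fun τ : ℝ => Complex.exp (-(R.T X ω * τ)))
        (Complex.exp (-(R.T X ω * τ')) * -(R.T X ω * 1)) τ' :=
      (((Complex.ofRealCLM.hasDerivAt (x := τ')).const_mul (R.T X ω)).neg).cexp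
    refine (((h1.const_mul _).const_mul (h ω))).congr_deriv ?_
    ring

theorem tendsto_ev {h : R.Ω → ℂ} (hh : R.Tame X h) (hX : X.Nonempty) {x : ι → ℝ}
    (hx : ∀ i ∈ X, 0 < x i) :
    Tendsto (fun τ : ℝ => R.ev X h fun i => x i + τ) atTop (nhds 0) := by
  have h0 : (0 : ℂ) = ∫ _ω, (0 : ℂ) ∂(R.μ) := by simp
  rw [h0]
  refine tendsto_integral_filter_of_dominated_convergence
    (fun ω => ‖h ω * Complex.exp (-∑ i ∈ X, R.t ω i * x i)‖)
    (Eventually.of_forall fun τ => (hh.1.mul (measurable_kernel _)).aestronglyMeasurable) ?_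
    (hh.integrable hx).norm (Eventually.of_forall fun ω => ?_)
  · filter_upwards [eventually_ge_atTop 0] with τ hτ
    refine Eventually.of_forall fun ω => ?_
    rw [kernel_add, ← mul_assoc, norm_mul]
    refine mul_le_of_le_one_right (norm_nonneg _) ?_
    rw [Complex.norm_exp, Complex.neg_re, Complex.re_mul_ofReal]
    refine Real.exp_le_one_iff.2 ?_
    have := S_le_re_T (X := X) ω
    have := S_nonneg (X := X) ω
    nlinarith
  · simp only [kernel_add]
    have h1 : Tendsto (fun τ : ℝ => Complex.exp (-(R.T X ω * τ))) atTop (nhds 0) := by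
      rw [tendsto_zero_iff_norm_tendsto_zero]
      simp only [Complex.norm_exp, Complex.neg_re, Complex.re_mul_ofReal]
      refine Real.tendsto_exp_neg_atTop_nhds_zero.comp (tendsto_id.const_mul_atTop ?_)
      have := S_le_re_T (X := X) ω
      have := S_pos hX ω
      linarith
    simpa using (h1.const_mul (Complex.exp (-∑ i ∈ X, R.t ω i * x i))).const_mul (h ω)

/-- Each factor `T` gains a factor `1 / x`. -/
theorem ev_isBigO {h : R.Ω → ℂ} (hh : R.Tame X h) (k : ℕ) :
    (fun x : ℝ => R.ev X (fun ω => h ω * R.T X ω ^ k) fun _ => x)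
      =O[atTop] fun x : ℝ => x ^ (-(k : ℝ)) := by
  refine IsBigO.of_bound (k.factorial / (1 / 4) ^ k *
    ∫ ω, ‖h ω‖ * Real.exp (-(1 / 4 * R.S X ω)) ∂(R.μ)) ?_
  filter_upwards [eventually_ge_atTop 1] with x hx
  have hx0 : (0 : ℝ) < x := by linarith
  rw [Real.norm_of_nonneg (by positivity), Real.rpow_neg hx0.le, Real.rpow_natCast, mul_right_comm,
    mul_comm _ (∫ _, _ ∂_), ← integral_mul_const]
  refine norm_integral_le_of_norm_le ((hh.2 (1 / 4) (by norm_num)).mul_const _)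
    (Eventually.of_forall fun ω => ?_)
  rw [norm_mul, norm_mul, norm_pow, mul_assoc, mul_assoc]
  refine mul_le_mul_of_nonneg_left ?_ (norm_nonneg _)
  have h1 := norm_kernel_le (X := X) (x := fun _ => x) (c := x) (fun _ _ => le_rfl) hx0.le ω
  have h2 := norm_T_le (X := X) ω
  have h3 := S_nonneg (X := X) ω
  have h4 := pow_mul_exp_le k (c := 1 / 4) (by norm_num) (s := x * R.S X ω) (by positivity)
  calc ‖R.T X ω‖ ^ k * ‖Complex.exp (-∑ i ∈ X, R.t ω i * x)‖
      ≤ R.S X ω ^ k * Real.exp (-(x / 2 * R.S X ω)) := by gcongr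
    _ = (x * R.S X ω) ^ k * Real.exp (-(x / 2 * R.S X ω)) * (x ^ k)⁻¹ := by
        rw [mul_pow]; field_simp
    _ ≤ (k.factorial / (1 / 4) ^ k * Real.exp (1 / 4 * (x * R.S X ω))) *
          Real.exp (-(x / 2 * R.S X ω)) * (x ^ k)⁻¹ := by gcongr
    _ = Real.exp (1 / 4 * (x * R.S X ω) + -(x / 2 * R.S X ω)) *
          (k.factorial / (1 / 4) ^ k * (x ^ k)⁻¹) := by
        rw [Real.exp_add]; ring
    _ ≤ _ := by
        gcongr
        nlinarith

end LaplaceRep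

end

/-! ### Integrability of densities near frequency zero. -/

noncomputable section

namespace LaplaceRep

section Fine

variable {ι : Type*} [DecidableEq ι] {R R₁ R₂ : LaplaceRep ι} {X : Finset ι}

variable (R X) in
/-- The weighted integrability properties that are propagated by the convolution below. -/
structure Fine : Prop where
  weak : ∀ z ∈ X, R.Tame X fun ω =>
    R.g ω * (∏ i ∈ X.erase z, (R.t ω i)⁻¹) * ((‖R.t ω z‖ ^ (-(1 / 4) : ℝ) : ℝ) : ℂ)
  strong : 2 ≤ X.card → R.Tame X fun ω => R.g ω * ∏ i ∈ X, (R.t ω i)⁻¹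
  vstrong : 3 ≤ X.card → R.Tame X fun ω => (R.g ω * ∏ i ∈ X, (R.t ω i)⁻¹) * (R.T X ω)⁻¹

theorem measurable_prod_inv (R : LaplaceRep ι) (Y : Finset ι) :
    Measurable fun ω => ∏ i ∈ Y, (R.t ω i)⁻¹ :=
  Finset.measurable_prod _ fun i _ => (R.measurable_t i).inv

theorem measurable_norm_rpow (R : LaplaceRep ι) (i : ι) (α : ℝ) :
    Measurable fun ω => ((‖R.t ω i‖ ^ α : ℝ) : ℂ) :=
  Complex.measurable_ofReal.comp ((R.measurable_t i).norm.pow_const α)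

theorem norm_ofReal_rpow (ω : R.Ω) (i : ι) (α : ℝ) :
    ‖((‖R.t ω i‖ ^ α : ℝ) : ℂ)‖ = ‖R.t ω i‖ ^ α := by
  rw [Complex.norm_real, Real.norm_of_nonneg (by positivity)]

theorem Tame.mul_rpow {h : R.Ω → ℂ} (hh : R.Tame X h) {i : ι} (hi : i ∈ X) {α : ℝ} (hα : 0 ≤ α) :
    R.Tame X fun ω => h ω * ((‖R.t ω i‖ ^ α : ℝ) : ℂ) :=
  hh.mul_of_rpow_le (measurable_norm_rpow R i α) hα fun ω => by
    rw [norm_ofReal_rpow]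
    exact Real.rpow_le_rpow (norm_nonneg _) (norm_le_S ω hi) hα

theorem weak_of_strong (h : R.Tame X fun ω => R.g ω * ∏ i ∈ X, (R.t ω i)⁻¹) {z : ι} (hz : z ∈ X) :
    R.Tame X fun ω =>
      R.g ω * (∏ i ∈ X.erase z, (R.t ω i)⁻¹) * ((‖R.t ω z‖ ^ (-(1 / 4) : ℝ) : ℝ) : ℂ) := by
  refine (h.mul_rpow hz (α := 3 / 4) (by norm_num)).mono' ?_ 1 fun ω => ?_
  · exact ((R.measurable_g.mul (measurable_prod_inv R _)).mul (measurable_norm_rpow R z _))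
  · rw [← Finset.mul_prod_erase X _ hz]
    simp only [norm_mul, norm_ofReal_rpow, norm_inv]
    rw [show (-(1 / 4) : ℝ) = -1 + 3 / 4 by norm_num, Real.rpow_add (R.norm_pos ω z),
      Real.rpow_neg_one]
    exact le_of_eq (by ring)

theorem Fine.of_strong (hX : X.card = 2)
    (h : R.Tame X fun ω => R.g ω * ∏ i ∈ X, (R.t ω i)⁻¹) : R.Fine X :=
  ⟨fun _ hz => weak_of_strong h hz, fun _ => h, fun h3 => absurd h3 (by omega)⟩

theorem Fine.of_vstrong (hX : X.Nonempty)
    (h : R.Tame X fun ω => (R.g ω * ∏ i ∈ X, (R.t ω i)⁻¹) * (R.T X ω)⁻¹) : R.Fine X := by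
  have hs : R.Tame X fun ω => R.g ω * ∏ i ∈ X, (R.t ω i)⁻¹ := by
    have := h.mul_T
    simpa only [inv_mul_cancel_right₀ (T_ne_zero hX _)] using this
  exact ⟨fun _ hz => weak_of_strong hs hz, fun _ => hs, fun _ => h⟩

theorem Fine.partial (h : R.Fine X) {z : ι} (hz : z ∈ X) :
    R.Tame X fun ω => R.g ω * ∏ i ∈ X.erase z, (R.t ω i)⁻¹ := by
  refine ((h.weak z hz).mul_rpow hz (α := 1 / 4) (by norm_num)).mono'
    (R.measurable_g.mul (measurable_prod_inv R _)) 1 fun ω => ?_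
  simp only [norm_mul, norm_ofReal_rpow]
  rw [one_mul, mul_assoc, ← Real.rpow_add (R.norm_pos ω z)]
  simp

theorem Tame.mul_prod {h : R.Ω → ℂ} (hh : R.Tame X h) {Y : Finset ι} (hY : Y ⊆ X) :
    R.Tame X fun ω => h ω * ∏ i ∈ Y, R.t ω i := by
  induction Y using Finset.induction_on with
  | empty => simpa using hh
  | insert a s ha ih =>
    have := (ih ((Finset.subset_insert a s).trans hY)).mul_t (hY (Finset.mem_insert_self a s))
    refine this.mono' (hh.1.mul (Finset.measurable_prod _ fun i _ => R.measurable_t i)) 1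
      fun ω => ?_
    rw [Finset.prod_insert ha, one_mul, mul_assoc, mul_comm (R.t ω a)]

theorem Fine.tame (h : R.Fine X) (hX : X.Nonempty) : R.Tame X R.g := by
  obtain ⟨z, hz⟩ := hX
  have := (h.partial hz).mul_prod (Finset.erase_subset z X)
  refine this.mono' R.measurable_g 1 fun ω => ?_
  rw [one_mul, mul_assoc, ← Finset.prod_mul_distrib, Finset.prod_eq_one, mul_one]
  exact fun i _ => inv_mul_cancel₀ (ne_zero ω i)

/-- The representation with no mass. -/
def zero (ι : Type*) : LaplaceRep ι where
  Ω := Unit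
  μ := 0
  g := fun _ => 0
  t := fun _ _ => 1
  measurable_g := measurable_const
  measurable_t := fun _ => measurable_const
  norm_pos := by simp
  cone := by simp

theorem tame_zero {h : (zero ι).Ω → ℂ} : (zero ι).Tame X h :=
  ⟨measurable_of_countable (α := Unit) h, fun _ _ => integrable_zero_measure⟩

theorem fine_zero : (zero ι).Fine X :=
  ⟨fun _ _ => tame_zero, fun _ => tame_zero, fun _ => tame_zero⟩

theorem measurableEmbedding_inl {α β : Type*} [MeasurableSpace α] [MeasurableSpace β] :
    MeasurableEmbedding (Sum.inl : α → α ⊕ β) :=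
  ⟨Sum.inl_injective, measurable_inl, fun _ hs => measurableSet_inl_image.2 hs⟩

theorem measurableEmbedding_inr {α β : Type*} [MeasurableSpace α] [MeasurableSpace β] :
    MeasurableEmbedding (Sum.inr : β → α ⊕ β) :=
  ⟨Sum.inr_injective, measurable_inr, fun _ hs => measurableSet_inr_image.2 hs⟩

/-- The disjoint union of two representations. -/
def add (R₁ R₂ : LaplaceRep ι) : LaplaceRep ι where
  Ω := R₁.Ω ⊕ R₂.Ω
  μ := R₁.μ.map Sum.inl + R₂.μ.map Sum.inr
  g := Sum.elim R₁.g R₂.g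
  t := Sum.elim R₁.t R₂.t
  measurable_g := R₁.measurable_g.sumElim R₂.measurable_g
  measurable_t := fun i => by
    refine (measurable_fun_sum ?_ ?_)
    · exact R₁.measurable_t i
    · exact R₂.measurable_t i
  norm_pos := fun ω i => by
    rcases ω with ω | ω
    · exact R₁.norm_pos ω i
    · exact R₂.norm_pos ω i
  cone := fun ω i => by
    rcases ω with ω | ω
    · exact R₁.cone ω i
    · exact R₂.cone ω i

theorem integrable_add_iff {f : (add R₁ R₂).Ω → ℝ} :
    Integrable f (add R₁ R₂).μ ↔
      Integrable (fun ω => f (Sum.inl ω)) R₁.μ ∧ Integrable (fun ω => f (Sum.inr ω)) R₂.μ := by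
  refine integrable_add_measure.trans (and_congr ?_ ?_)
  · exact MeasurableEmbedding.integrable_map_iff measurableEmbedding_inl
  · exact MeasurableEmbedding.integrable_map_iff measurableEmbedding_inr

theorem tame_add {h : (add R₁ R₂).Ω → ℂ} (h1 : R₁.Tame X fun ω => h (Sum.inl ω))
    (h2 : R₂.Tame X fun ω => h (Sum.inr ω)) : (add R₁ R₂).Tame X h :=
  ⟨measurable_fun_sum h1.1 h2.1, fun c hc => integrable_add_iff.2 ⟨h1.2 c hc, h2.2 c hc⟩⟩

theorem Fine.add (h1 : R₁.Fine X) (h2 : R₂.Fine X) : (LaplaceRep.add R₁ R₂).Fine X :=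
  ⟨fun z hz => tame_add (h1.weak z hz) (h2.weak z hz),
    fun h => tame_add (h1.strong h) (h2.strong h), fun h => tame_add (h1.vstrong h) (h2.vstrong h)⟩

theorem ev_add_rep {x : ι → ℝ} (hx : ∀ i ∈ X, 0 < x i) (h1 : R₁.Tame X R₁.g)
    (h2 : R₂.Tame X R₂.g) :
    (add R₁ R₂).ev X (add R₁ R₂).g x = R₁.ev X R₁.g x + R₂.ev X R₂.g x := by
  have i1 := h1.integrable hx
  have i2 := h2.integrable hx
  refine (integral_add_measure ?_ ?_).trans (congrArg₂ _ ?_ ?_)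
  · exact (MeasurableEmbedding.integrable_map_iff measurableEmbedding_inl).2 i1
  · exact (MeasurableEmbedding.integrable_map_iff measurableEmbedding_inr).2 i2
  · exact MeasurableEmbedding.integral_map measurableEmbedding_inl _
  · exact MeasurableEmbedding.integral_map measurableEmbedding_inr _

variable (X) in
/-- The functions of points in general position that are fine Laplace integrals. -/
def IsFine (F : (ι → ℝ) → ℝ) : Prop :=
  ∃ R : LaplaceRep ι, R.Fine X ∧
    ∀ x : ι → ℝ, Function.Injective x → (∀ i, 0 < x i) → (F x : ℂ) = R.ev X R.g x

theorem IsFine.add (hX : X.Nonempty) {F G : (ι → ℝ) → ℝ} (hF : IsFine X F) (hG : IsFine X G) :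
    IsFine X fun x => F x + G x := by
  obtain ⟨R₁, h1, e1⟩ := hF
  obtain ⟨R₂, h2, e2⟩ := hG
  refine ⟨LaplaceRep.add R₁ R₂, h1.add h2, fun x hx hx0 => ?_⟩
  rw [ev_add_rep (fun i _ => hx0 i) (h1.tame hX) (h2.tame hX), ← e1 x hx hx0, ← e2 x hx hx0,
    Complex.ofReal_add]

theorem IsFine.sum (hX : X.Nonempty) {α : Type*} (s : Finset α) {F : α → (ι → ℝ) → ℝ}
    (hF : ∀ a ∈ s, IsFine X (F a)) : IsFine X fun x => ∑ a ∈ s, F a x := by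
  classical
  induction s using Finset.induction_on with
  | empty => exact ⟨zero ι, fine_zero, fun x _ _ => by
      simp only [Finset.sum_empty, Complex.ofReal_zero]
      exact (integral_zero_measure _).symm⟩
  | insert a s ha ih =>
    simp only [Finset.sum_insert ha]
    exact (hF a (Finset.mem_insert_self a s)).add hX
      (ih fun b hb => hF b (Finset.mem_insert_of_mem hb))

theorem IsFine.congr {F G : (ι → ℝ) → ℝ} (hF : IsFine X F)
    (h : ∀ x : ι → ℝ, Function.Injective x → (∀ i, 0 < x i) → F x = G x) : IsFine X G := by
  obtain ⟨R, hR, e⟩ := hF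
  exact ⟨R, hR, fun x hx hx0 => by rw [← h x hx hx0, e x hx hx0]⟩

end Fine

/-! ### The exchange relation for Laplace integrals. -/

section Conv

/-- Weighted arithmetic-geometric mean inequality. The weights `3/4` and `1/4` are powers that the
two factors of an exchange term can afford. -/
theorem add_inv_le {p q : ℝ} (hp : 0 < p) (hq : 0 < q) :
    (p + q)⁻¹ ≤ p ^ (-(3 / 4) : ℝ) * q ^ (-(1 / 4) : ℝ) := by
  rw [Real.rpow_neg hp.le, Real.rpow_neg hq.le, ← mul_inv]
  refine inv_anti₀ (by positivity) ?_
  have := Real.geom_mean_le_arith_mean2_weighted (w₁ := 3 / 4) (w₂ := 1 / 4) (by norm_num)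
    (by norm_num) hp.le hq.le (by norm_num)
  linarith

/-- The density of the interpolation parameter. -/
def interpWeight (θ : ℝ) : ℝ :=
  (1 - θ) ^ (-(3 / 4) : ℝ) * θ ^ (-(1 / 4) : ℝ) + θ ^ (-(3 / 4) : ℝ) * (1 - θ) ^ (-(1 / 4) : ℝ)

theorem rpow_mul_rpow_le {p q : ℝ} (hp : 0 < p) (hq : 0 < q) (hpq : p + q = 1) :
    p ^ (-(3 / 4) : ℝ) * q ^ (-(1 / 4) : ℝ)
      ≤ 2 * (p ^ (-(3 / 4) : ℝ) + q ^ (-(3 / 4) : ℝ)) := by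
  have hp1 : 0 < p ^ (-(3 / 4) : ℝ) := by positivity
  have hq1 : 0 < q ^ (-(3 / 4) : ℝ) := by positivity
  have key : ∀ r : ℝ, 1 / 2 ≤ r → ∀ α : ℝ, 0 ≤ α → α ≤ 1 → r ^ (-α) ≤ 2 := by
    intro r hr α h0 h1
    calc r ^ (-α) ≤ (1 / 2 : ℝ) ^ (-α) :=
          Real.rpow_le_rpow_of_nonpos (by norm_num) hr (by linarith)
      _ ≤ (1 / 2 : ℝ) ^ (-1 : ℝ) :=
          Real.rpow_le_rpow_of_exponent_ge (by norm_num) (by norm_num) (by linarith)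
      _ = 2 := by rw [Real.rpow_neg_one]; norm_num
  rcases le_total p (1 / 2) with h | h
  · have := key q (by linarith) (1 / 4) (by norm_num) (by norm_num)
    nlinarith
  · have h2 := key p h (3 / 4) (by norm_num) (by norm_num)
    have h3 : q ^ (-(1 / 4) : ℝ) ≤ q ^ (-(3 / 4) : ℝ) :=
      Real.rpow_le_rpow_of_exponent_ge hq (by linarith) (by norm_num)
    have h4 : 0 < q ^ (-(1 / 4) : ℝ) := by positivity
    nlinarith

theorem integrable_interpWeight : Integrable interpWeight (volume.restrict (Set.Ioo 0 1)) := by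
  have h1 : IntegrableOn (fun θ : ℝ => θ ^ (-(3 / 4) : ℝ)) (Set.Ioo 0 1) :=
    (intervalIntegral.integrableOn_Ioo_rpow_iff one_pos).2 (by norm_num)
  have h2 : IntegrableOn (fun θ : ℝ => (1 - θ) ^ (-(3 / 4) : ℝ)) (Set.Ioo 0 1) := by
    have h3 : IntervalIntegrable (fun θ : ℝ => θ ^ (-(3 / 4) : ℝ)) volume 0 1 :=
      intervalIntegral.intervalIntegrable_rpow' (by norm_num)
    have h4 := (h3.comp_sub_left 1).symm
    simp only [sub_zero, sub_self] at h4
    exact ((intervalIntegrable_iff_integrableOn_Ioo_of_le zero_le_one).1 h4)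
  refine ((h1.add h2).const_mul 4).mono' ?_ ?_
  · refine Measurable.aestronglyMeasurable ?_
    unfold interpWeight
    fun_prop
  · refine (ae_restrict_mem measurableSet_Ioo).mono fun θ hθ => ?_
    have hp : 0 < 1 - θ := by linarith [hθ.2]
    have hq : 0 < θ := hθ.1
    have e1 := rpow_mul_rpow_le hp hq (by ring)
    have e2 := rpow_mul_rpow_le hq hp (by ring)
    rw [Real.norm_of_nonneg (by unfold interpWeight; positivity)]
    simp only [interpWeight, Pi.add_apply]
    linarith

/-- Clamping to the unit interval. -/
def clamp (θ : ℝ) : ℝ := max 0 (min θ 1)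

theorem clamp_nonneg (θ : ℝ) : 0 ≤ clamp θ := le_max_left _ _

theorem clamp_le_one (θ : ℝ) : clamp θ ≤ 1 := max_le zero_le_one (min_le_right _ _)

theorem clamp_of_mem {θ : ℝ} (h : θ ∈ Set.Ioo (0 : ℝ) 1) : clamp θ = θ := by
  rw [clamp, min_eq_left h.2.le, max_eq_right h.1.le]

theorem measurable_clamp : Measurable clamp :=
  measurable_const.max (measurable_id.min measurable_const)

theorem re_interp (a b : ℂ) (θ : ℝ) :
    (a + θ * (b - a)).re = (1 - θ) * a.re + θ * b.re := by
  simp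
  ring

/-- The cone is convex, so it is preserved when frequencies are interpolated. -/
theorem interp_cone {a b : ℂ} (ha : ‖a‖ ≤ 2 * a.re) (hb : ‖b‖ ≤ 2 * b.re) {θ : ℝ} (h0 : 0 ≤ θ)
    (h1 : θ ≤ 1) : ‖a + θ * (b - a)‖ ≤ 2 * (a + θ * (b - a)).re := by
  rw [re_interp]
  calc ‖a + θ * (b - a)‖ = ‖((1 - θ : ℝ) : ℂ) * a + (θ : ℂ) * b‖ := by
        congr 1; push_cast; ring
    _ ≤ (1 - θ) * ‖a‖ + θ * ‖b‖ := by
        refine (norm_add_le _ _).trans ?_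
        rw [norm_mul, norm_mul, Complex.norm_real, Complex.norm_real,
          Real.norm_of_nonneg (by linarith), Real.norm_of_nonneg h0]
    _ ≤ _ := by nlinarith

theorem le_norm_interp {a b : ℂ} (ha : ‖a‖ ≤ 2 * a.re) (hb : ‖b‖ ≤ 2 * b.re) {θ : ℝ} (h0 : 0 ≤ θ)
    (h1 : θ ≤ 1) : ((1 - θ) * ‖a‖ + θ * ‖b‖) ≤ 2 * ‖a + θ * (b - a)‖ := by
  have := Complex.re_le_norm (a + θ * (b - a))
  rw [re_interp] at this
  nlinarith

theorem interp_norm_pos {a b : ℂ} (ha : 0 < a.re) (hb : 0 < b.re) {θ : ℝ} (h0 : 0 ≤ θ)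
    (h1 : θ ≤ 1) : 0 < ‖a + θ * (b - a)‖ := by
  have h2 := Complex.re_le_norm (a + θ * (b - a))
  have h3 : 0 < (a + θ * (b - a)).re := by
    rw [re_interp]
    rcases h0.eq_or_lt with h | h
    · rw [← h]; simpa using ha
    · have := mul_nonneg (sub_nonneg.2 h1) ha.le
      positivity
  linarith

/-- The divided difference that arises when two frequencies `s`, `t` are exchanged. -/
theorem interp_bound {s t : ℂ} (hs : 0 < ‖s‖) (ht : 0 < ‖t‖) (hs2 : ‖s‖ ≤ 2 * s.re)
    (ht2 : ‖t‖ ≤ 2 * t.re) {θ : ℝ} (hθ : θ ∈ Set.Ioo (0 : ℝ) 1) :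
    ‖t - s‖ * (‖s + θ * (t - s)‖⁻¹ * ‖t + θ * (s - t)‖⁻¹)
        ≤ 4 * interpWeight θ * (‖s‖ ^ (-(3 / 4) : ℝ) * ‖t‖ ^ (-(1 / 4) : ℝ)) ∧
      ‖t - s‖ * (‖s + θ * (t - s)‖⁻¹ * ‖t + θ * (s - t)‖⁻¹)
        ≤ 4 * interpWeight θ * (‖t‖ ^ (-(3 / 4) : ℝ) * ‖s‖ ^ (-(1 / 4) : ℝ)) := by
  obtain ⟨h0, h1⟩ := hθ
  have h1' : 0 < 1 - θ := by linarith
  set a := ‖s‖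
  set b := ‖t‖
  set u := (1 - θ) * a + θ * b with hu
  set v := θ * a + (1 - θ) * b with hv
  have hu0 : 0 < u := by positivity
  have hv0 : 0 < v := by positivity
  have k1 : ‖s + θ * (t - s)‖⁻¹ ≤ 2 * u⁻¹ := by
    have := le_norm_interp hs2 ht2 h0.le h1.le
    rw [show 2 * u⁻¹ = (u / 2)⁻¹ by rw [inv_div]; ring]
    exact inv_anti₀ (by positivity) (by linarith)
  have k2 : ‖t + θ * (s - t)‖⁻¹ ≤ 2 * v⁻¹ := by
    have := le_norm_interp ht2 hs2 h0.le h1.le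
    rw [show 2 * v⁻¹ = (v / 2)⁻¹ by rw [inv_div]; ring]
    exact inv_anti₀ (by positivity) (by linarith)
  have k3 : ‖t - s‖ ≤ u + v := (norm_sub_le _ _).trans (le_of_eq (by rw [hu, hv]; ring))
  -- `u` and `v` bound the two interpolated moduli up to a factor `2`, and `‖t - s‖ ≤ ‖s‖ + ‖t‖ = u
  -- + v`; finally `(u + v) / (u v) = u⁻¹ + v⁻¹`.
  have k4 : ‖t - s‖ * (‖s + θ * (t - s)‖⁻¹ * ‖t + θ * (s - t)‖⁻¹) ≤ 4 * (u⁻¹ + v⁻¹) := by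
    calc _ ≤ (u + v) * (2 * u⁻¹ * (2 * v⁻¹)) := by gcongr
      _ = _ := by field_simp; ring
  have m1 := add_inv_le (mul_pos h1' hs) (mul_pos h0 ht)
  have m2 := add_inv_le (mul_pos h0 hs) (mul_pos h1' ht)
  have m3 := add_inv_le (mul_pos h0 ht) (mul_pos h1' hs)
  have m4 := add_inv_le (mul_pos h1' ht) (mul_pos h0 hs)
  rw [Real.mul_rpow h1'.le hs.le, Real.mul_rpow h0.le ht.le] at m1
  rw [Real.mul_rpow h0.le hs.le, Real.mul_rpow h1'.le ht.le] at m2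
  rw [Real.mul_rpow h0.le ht.le, Real.mul_rpow h1'.le hs.le, add_comm (θ * _)] at m3
  rw [Real.mul_rpow h1'.le ht.le, Real.mul_rpow h0.le hs.le, add_comm ((1 - θ) * _)] at m4
  constructor
  · refine k4.trans ?_
    rw [mul_assoc]
    refine mul_le_mul_of_nonneg_left ((add_le_add m1 m2).trans (le_of_eq ?_)) (by norm_num)
    rw [interpWeight]
    ring
  · refine k4.trans ?_
    rw [mul_assoc]
    refine mul_le_mul_of_nonneg_left ((add_le_add m3 m4).trans (le_of_eq ?_)) (by norm_num)
    rw [interpWeight]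
    ring

variable {ι : Type*} [DecidableEq ι]

/-- The representation of the exchange terms: the frequency `s` of `R₁` at `z` and `t` of `R₂` at `y`
are replaced by the interpolations between them. -/
def conv (R₁ R₂ : LaplaceRep ι) (y z : ι) (I J : Finset ι) : LaplaceRep ι where
  Ω := (R₁.Ω × R₂.Ω) × ℝ
  μ := (R₁.μ.prod R₂.μ).prod (volume.restrict (Set.Ioo 0 1))
  g := fun ω => -(R₁.g ω.1.1 * (R₂.g ω.1.2 * R₂.T (insert y J) ω.1.2) *
    (R₂.t ω.1.2 y - R₁.t ω.1.1 z))
  -- Clamping keeps the frequencies in the cone for every real value of the parameter, although only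
  -- `(0, 1)` carries mass.
  t := fun ω i =>
    if i = y then R₁.t ω.1.1 z + (clamp ω.2 : ℂ) * (R₂.t ω.1.2 y - R₁.t ω.1.1 z)
    else if i = z then R₂.t ω.1.2 y + (clamp ω.2 : ℂ) * (R₁.t ω.1.1 z - R₂.t ω.1.2 y)
    else if i ∈ I then R₁.t ω.1.1 i else R₂.t ω.1.2 i
  measurable_g := by
    have h1 : Measurable fun ω : (R₁.Ω × R₂.Ω) × ℝ => ω.1.1 := measurable_fst.comp measurable_fst
    have h2 : Measurable fun ω : (R₁.Ω × R₂.Ω) × ℝ => ω.1.2 := measurable_snd.comp measurable_fst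
    exact ((((R₁.measurable_g.comp h1).mul ((R₂.measurable_g.comp h2).mul
      ((R₂.measurable_T _).comp h2))).mul (((R₂.measurable_t y).comp h2).sub
      ((R₁.measurable_t z).comp h1)))).neg
  measurable_t := fun i => by
    have h1 : Measurable fun ω : (R₁.Ω × R₂.Ω) × ℝ => ω.1.1 := measurable_fst.comp measurable_fst
    have h2 : Measurable fun ω : (R₁.Ω × R₂.Ω) × ℝ => ω.1.2 := measurable_snd.comp measurable_fst
    have h3 : Measurable fun ω : (R₁.Ω × R₂.Ω) × ℝ => (clamp ω.2 : ℂ) :=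
      Complex.measurable_ofReal.comp (measurable_clamp.comp measurable_snd)
    have ms := (R₁.measurable_t z).comp h1
    have mt := (R₂.measurable_t y).comp h2
    split_ifs
    · exact ms.add (h3.mul (mt.sub ms))
    · exact mt.add (h3.mul (ms.sub mt))
    · exact (R₁.measurable_t i).comp h1
    · exact (R₂.measurable_t i).comp h2
  norm_pos := fun ω i => by
    split_ifs
    · exact interp_norm_pos (re_pos _ _) (re_pos _ _) (clamp_nonneg _) (clamp_le_one _)
    · exact interp_norm_pos (re_pos _ _) (re_pos _ _) (clamp_nonneg _) (clamp_le_one _)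
    · exact R₁.norm_pos _ _
    · exact R₂.norm_pos _ _
  cone := fun ω i => by
    split_ifs
    · exact interp_cone (R₁.cone _ _) (R₂.cone _ _) (clamp_nonneg _) (clamp_le_one _)
    · exact interp_cone (R₂.cone _ _) (R₁.cone _ _) (clamp_nonneg _) (clamp_le_one _)
    · exact R₁.cone _ _
    · exact R₂.cone _ _

variable {R₁ R₂ : LaplaceRep ι} {y z : ι} {I J : Finset ι}

/-- The configuration of indices in the exchange relation. -/
structure Config (y z : ι) (I J : Finset ι) : Prop where
  ne : y ≠ z
  yI : y ∉ I
  zI : z ∉ I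
  yJ : y ∉ J
  zJ : z ∉ J
  disj : Disjoint I J

theorem conv_t_y (ω : (R₁.Ω × R₂.Ω) × ℝ) : (conv R₁ R₂ y z I J).t ω y =
    R₁.t ω.1.1 z + (clamp ω.2 : ℂ) * (R₂.t ω.1.2 y - R₁.t ω.1.1 z) := if_pos rfl

variable (hc : Config y z I J)
include hc

theorem conv_t_z (ω : (R₁.Ω × R₂.Ω) × ℝ) : (conv R₁ R₂ y z I J).t ω z =
    R₂.t ω.1.2 y + (clamp ω.2 : ℂ) * (R₁.t ω.1.1 z - R₂.t ω.1.2 y) :=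
  (if_neg hc.ne.symm).trans (if_pos rfl)

theorem conv_t_I (ω : (R₁.Ω × R₂.Ω) × ℝ) {i : ι} (hi : i ∈ I) :
    (conv R₁ R₂ y z I J).t ω i = R₁.t ω.1.1 i :=
  (if_neg (ne_of_mem_of_not_mem hi hc.yI)).trans
    ((if_neg (ne_of_mem_of_not_mem hi hc.zI)).trans (if_pos hi))

theorem conv_t_J (ω : (R₁.Ω × R₂.Ω) × ℝ) {i : ι} (hi : i ∈ J) :
    (conv R₁ R₂ y z I J).t ω i = R₂.t ω.1.2 i :=
  (if_neg (ne_of_mem_of_not_mem hi hc.yJ)).trans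
    ((if_neg (ne_of_mem_of_not_mem hi hc.zJ)).trans
      (if_neg (Finset.disjoint_right.1 hc.disj hi)))

theorem Config.sum_eq {M : Type*} [AddCommMonoid M] (F : ι → M) :
    ∑ i ∈ insert y (insert z (I ∪ J)), F i = F y + (F z + (∑ i ∈ I, F i + ∑ i ∈ J, F i)) := by
  rw [Finset.sum_insert, Finset.sum_insert, Finset.sum_union hc.disj]
  · simp [hc.zI, hc.zJ]
  · simp [hc.yI, hc.yJ, hc.ne]

theorem Config.prod_eq {M : Type*} [CommMonoid M] (F : ι → M) :
    ∏ i ∈ insert y (insert z (I ∪ J)), F i = F y * (F z * ((∏ i ∈ I, F i) * ∏ i ∈ J, F i)) := by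
  rw [Finset.prod_insert, Finset.prod_insert, Finset.prod_union hc.disj]
  · simp [hc.zI, hc.zJ]
  · simp [hc.yI, hc.yJ, hc.ne]

/-- The two interpolations together retain the total size of the frequencies up to a factor, so
tameness of the two factors passes to the product. -/
theorem conv_S_ge (ω : (R₁.Ω × R₂.Ω) × ℝ) :
    R₁.S (insert z I) ω.1.1 + R₂.S (insert y J) ω.1.2
      ≤ 2 * (conv R₁ R₂ y z I J).S (insert y (insert z (I ∪ J))) ω := by
  simp only [S]
  have e1 : ∑ i ∈ I, ‖(conv R₁ R₂ y z I J).t ω i‖ = ∑ i ∈ I, ‖R₁.t ω.1.1 i‖ :=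
    Finset.sum_congr rfl fun i hi => by rw [conv_t_I hc ω hi]
  have e2 : ∑ i ∈ J, ‖(conv R₁ R₂ y z I J).t ω i‖ = ∑ i ∈ J, ‖R₂.t ω.1.2 i‖ :=
    Finset.sum_congr rfl fun i hi => by rw [conv_t_J hc ω hi]
  rw [hc.sum_eq, conv_t_y, conv_t_z hc, Finset.sum_insert hc.zI, Finset.sum_insert hc.yJ, e1, e2]
  have h1 := le_norm_interp (R₁.cone ω.1.1 z) (R₂.cone ω.1.2 y) (clamp_nonneg ω.2)
    (clamp_le_one ω.2)
  have h2 := le_norm_interp (R₂.cone ω.1.2 y) (R₁.cone ω.1.1 z) (clamp_nonneg ω.2)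
    (clamp_le_one ω.2)
  have h3 : 0 ≤ ∑ i ∈ I, ‖R₁.t ω.1.1 i‖ := Finset.sum_nonneg fun _ _ => norm_nonneg _
  have h4 : 0 ≤ ∑ i ∈ J, ‖R₂.t ω.1.2 i‖ := Finset.sum_nonneg fun _ _ => norm_nonneg _
  linarith

theorem conv_tame {h : (R₁.Ω × R₂.Ω) × ℝ → ℂ} (hm : Measurable h) {h₁ : R₁.Ω → ℂ} {h₂ : R₂.Ω → ℂ}
    (hh₁ : R₁.Tame (insert z I) h₁) (hh₂ : R₂.Tame (insert y J) h₂) (C : ℝ)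
    (hb : ∀ ω : (R₁.Ω × R₂.Ω) × ℝ, ω.2 ∈ Set.Ioo (0 : ℝ) 1 →
      ‖h ω‖ ≤ C * (‖h₁ ω.1.1‖ * ‖h₂ ω.1.2‖ * interpWeight ω.2)) :
    (conv R₁ R₂ y z I J).Tame (insert y (insert z (I ∪ J))) h := by
  refine ⟨hm, fun c hc0 => ?_⟩
  have hint := (((hh₁.2 (c / 2) (by positivity)).mul_prod
    (hh₂.2 (c / 2) (by positivity))).mul_prod integrable_interpWeight).const_mul C
  refine hint.mono' ?_ ?_
  · exact (hm.norm.mul (Real.measurable_exp.comp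
      (((conv R₁ R₂ y z I J).measurable_S _).const_mul c).neg)).aestronglyMeasurable
  · have hae : ∀ᵐ ω : (R₁.Ω × R₂.Ω) × ℝ ∂((R₁.μ.prod R₂.μ).prod (volume.restrict (Set.Ioo 0 1))),
        ω.2 ∈ Set.Ioo (0 : ℝ) 1 :=
      Measure.quasiMeasurePreserving_snd.ae (ae_restrict_mem measurableSet_Ioo)
    refine hae.mono fun ω hω => ?_
    rw [Real.norm_of_nonneg (by positivity)]
    have h1 := conv_S_ge hc ω
    have h2 : Real.exp (-(c * (conv R₁ R₂ y z I J).S (insert y (insert z (I ∪ J))) ω))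
        ≤ Real.exp (-(c / 2 * R₁.S (insert z I) ω.1.1)) *
          Real.exp (-(c / 2 * R₂.S (insert y J) ω.1.2)) := by
      rw [← Real.exp_add]
      refine Real.exp_le_exp.2 ?_
      nlinarith
    calc ‖h ω‖ * Real.exp (-(c * (conv R₁ R₂ y z I J).S (insert y (insert z (I ∪ J))) ω))
        ≤ ‖h ω‖ * (Real.exp (-(c / 2 * R₁.S (insert z I) ω.1.1)) *
          Real.exp (-(c / 2 * R₂.S (insert y J) ω.1.2))) := by gcongr
      _ ≤ (C * (‖h₁ ω.1.1‖ * ‖h₂ ω.1.2‖ * interpWeight ω.2)) *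
          (Real.exp (-(c / 2 * R₁.S (insert z I) ω.1.1)) *
          Real.exp (-(c / 2 * R₂.S (insert y J) ω.1.2))) := by
          gcongr; exact hb ω hω
      _ = _ := by ring

theorem conv_norm_le {ω : (R₁.Ω × R₂.Ω) × ℝ} (hω : ω.2 ∈ Set.Ioo (0 : ℝ) 1) {q : ℝ}
    (hq : ‖R₁.t ω.1.1 z‖ ^ (-(3 / 4) : ℝ) * ‖R₂.t ω.1.2 y‖ ^ (-(1 / 4) : ℝ) = q ∨
      ‖R₂.t ω.1.2 y‖ ^ (-(3 / 4) : ℝ) * ‖R₁.t ω.1.1 z‖ ^ (-(1 / 4) : ℝ) = q) :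
    ‖(conv R₁ R₂ y z I J).g ω *
        ∏ i ∈ insert y (insert z (I ∪ J)), ((conv R₁ R₂ y z I J).t ω i)⁻¹‖ ≤
      ‖R₁.g ω.1.1‖ * ‖R₂.g ω.1.2‖ * R₂.S (insert y J) ω.1.2 * (4 * interpWeight ω.2 * q) *
        (‖∏ i ∈ I, (R₁.t ω.1.1 i)⁻¹‖ * ‖∏ i ∈ J, (R₂.t ω.1.2 i)⁻¹‖) := by
  have e1 : ∏ i ∈ I, ((conv R₁ R₂ y z I J).t ω i)⁻¹ = ∏ i ∈ I, (R₁.t ω.1.1 i)⁻¹ :=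
    Finset.prod_congr rfl fun i hi => by rw [conv_t_I hc ω hi]
  have e2 : ∏ i ∈ J, ((conv R₁ R₂ y z I J).t ω i)⁻¹ = ∏ i ∈ J, (R₂.t ω.1.2 i)⁻¹ :=
    Finset.prod_congr rfl fun i hi => by rw [conv_t_J hc ω hi]
  rw [hc.prod_eq, conv_t_y, conv_t_z hc, e1, e2, clamp_of_mem hω]
  have hb := interp_bound (R₁.norm_pos ω.1.1 z) (R₂.norm_pos ω.1.2 y) (R₁.cone ω.1.1 z)
    (R₂.cone ω.1.2 y) hω
  have hb' : ‖R₂.t ω.1.2 y - R₁.t ω.1.1 z‖ *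
      (‖R₁.t ω.1.1 z + ω.2 * (R₂.t ω.1.2 y - R₁.t ω.1.1 z)‖⁻¹ *
        ‖R₂.t ω.1.2 y + ω.2 * (R₁.t ω.1.1 z - R₂.t ω.1.2 y)‖⁻¹) ≤ 4 * interpWeight ω.2 * q := by
    rcases hq with rfl | rfl
    · exact hb.1
    · exact hb.2
  have hT := norm_T_le (X := insert y J) ω.1.2
  have hS := S_nonneg (X := insert y J) ω.1.2
  simp only [conv, norm_neg, norm_mul, norm_inv]
  calc _ = ‖R₁.g ω.1.1‖ * ‖R₂.g ω.1.2‖ * ‖R₂.T (insert y J) ω.1.2‖ *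
        (‖R₂.t ω.1.2 y - R₁.t ω.1.1 z‖ *
      (‖R₁.t ω.1.1 z + ω.2 * (R₂.t ω.1.2 y - R₁.t ω.1.1 z)‖⁻¹ *
        ‖R₂.t ω.1.2 y + ω.2 * (R₁.t ω.1.1 z - R₂.t ω.1.2 y)‖⁻¹)) *
        (‖∏ i ∈ I, (R₁.t ω.1.1 i)⁻¹‖ * ‖∏ i ∈ J, (R₂.t ω.1.2 i)⁻¹‖) := by ring
    _ ≤ _ := by gcongr

omit hc in
theorem norm_mul_prod_erase {R : LaplaceRep ι} {a : ι} {Y : Finset ι} (ha : a ∉ Y) (ω : R.Ω)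
    (β : ℝ) : ‖R.g ω * (∏ i ∈ (insert a Y).erase a, (R.t ω i)⁻¹) * ((‖R.t ω a‖ ^ β : ℝ) : ℂ)‖ =
      ‖R.g ω‖ * ‖∏ i ∈ Y, (R.t ω i)⁻¹‖ * ‖R.t ω a‖ ^ β := by
  rw [Finset.erase_insert ha, norm_mul, norm_mul, norm_ofReal_rpow]

omit hc in
theorem conv_measurable_strong : Measurable fun ω : (R₁.Ω × R₂.Ω) × ℝ =>
    (conv R₁ R₂ y z I J).g ω *
      ∏ i ∈ insert y (insert z (I ∪ J)), ((conv R₁ R₂ y z I J).t ω i)⁻¹ :=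
  (conv R₁ R₂ y z I J).measurable_g.mul (measurable_prod_inv _ _)

/-- The density of the exchange term contains the factor `T` of `R₂`, which comes from the
derivative. It is bounded by a multiple of the total `T` and so pays for the additional `T⁻¹`. -/
theorem conv_vstrong {β₁ β₂ : ℝ} (h₁ : R₁.Tame (insert z I) fun ω =>
      R₁.g ω * (∏ i ∈ (insert z I).erase z, (R₁.t ω i)⁻¹) * ((‖R₁.t ω z‖ ^ β₁ : ℝ) : ℂ))
    (h₂ : R₂.Tame (insert y J) fun ω =>
      R₂.g ω * (∏ i ∈ (insert y J).erase y, (R₂.t ω i)⁻¹) * ((‖R₂.t ω y‖ ^ β₂ : ℝ) : ℂ))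
    (hβ : (β₁ = -(3 / 4) ∧ β₂ = -(1 / 4)) ∨ (β₁ = -(1 / 4) ∧ β₂ = -(3 / 4))) :
    (conv R₁ R₂ y z I J).Fine (insert y (insert z (I ∪ J))) := by
  refine Fine.of_vstrong ⟨y, Finset.mem_insert_self _ _⟩ (conv_tame hc
    ((conv_measurable_strong).mul ((conv R₁ R₂ y z I J).measurable_T _).inv) h₁ h₂ 16
    fun ω hω => ?_)
  rw [norm_mul, norm_inv, norm_mul_prod_erase (R := R₁) hc.zI, norm_mul_prod_erase (R := R₂) hc.yJ]
  set q := ‖R₁.t ω.1.1 z‖ ^ β₁ * ‖R₂.t ω.1.2 y‖ ^ β₂ with hq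
  have hle := conv_norm_le hc hω (q := q) (by
    rcases hβ with ⟨h, h'⟩ | ⟨h, h'⟩
    · left; rw [hq, h, h']
    · right; rw [hq, h, h', mul_comm])
  have hS1 := conv_S_ge (R₁ := R₁) (R₂ := R₂) hc ω
  have hS2 := S_nonneg (X := insert z I) ω.1.1
  have hS3 := S_le_norm_T (X := insert y (insert z (I ∪ J))) (R := conv R₁ R₂ y z I J) ω
  have hT : 0 < ‖(conv R₁ R₂ y z I J).T (insert y (insert z (I ∪ J))) ω‖ :=
    norm_pos_iff.2 (T_ne_zero ⟨y, Finset.mem_insert_self _ _⟩ _)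
  rw [← div_eq_mul_inv, div_le_iff₀ hT]
  refine hle.trans ?_
  have hw : 0 ≤ interpWeight ω.2 := by
    have h1 := hω.1
    have h2 : 0 < 1 - ω.2 := by linarith [hω.2]
    unfold interpWeight
    positivity
  have hA : 0 ≤ ‖R₁.g ω.1.1‖ * ‖R₂.g ω.1.2‖ * (interpWeight ω.2 * q) *
        (‖∏ i ∈ I, (R₁.t ω.1.1 i)⁻¹‖ * ‖∏ i ∈ J, (R₂.t ω.1.2 i)⁻¹‖) := by positivity
  have hB : R₂.S (insert y J) ω.1.2
      ≤ 4 * ‖(conv R₁ R₂ y z I J).T (insert y (insert z (I ∪ J))) ω‖ := by linarith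
  calc _ = 4 * R₂.S (insert y J) ω.1.2 * (‖R₁.g ω.1.1‖ * ‖R₂.g ω.1.2‖ * (interpWeight ω.2 * q) *
        (‖∏ i ∈ I, (R₁.t ω.1.1 i)⁻¹‖ * ‖∏ i ∈ J, (R₂.t ω.1.2 i)⁻¹‖)) := by ring
    _ ≤ 4 * (4 * ‖(conv R₁ R₂ y z I J).T (insert y (insert z (I ∪ J))) ω‖) *
        (‖R₁.g ω.1.1‖ * ‖R₂.g ω.1.2‖ * (interpWeight ω.2 * q) *
        (‖∏ i ∈ I, (R₁.t ω.1.1 i)⁻¹‖ * ‖∏ i ∈ J, (R₂.t ω.1.2 i)⁻¹‖)) := by gcongr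
    _ = _ := by rw [hq]; ring

omit hc in
theorem Fine.three_quarters {R : LaplaceRep ι} {X : Finset ι} (h : R.Fine X) (hX : 2 ≤ X.card)
    {a : ι} (ha : a ∈ X) : R.Tame X fun ω =>
      R.g ω * (∏ i ∈ X.erase a, (R.t ω i)⁻¹) * ((‖R.t ω a‖ ^ (-(3 / 4) : ℝ) : ℝ) : ℂ) := by
  refine ((h.strong hX).mul_rpow ha (α := 1 / 4) (by norm_num)).mono' ?_ 1 fun ω => ?_
  · exact ((R.measurable_g.mul (measurable_prod_inv R _)).mul (measurable_norm_rpow R a _))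
  · rw [← Finset.mul_prod_erase X _ ha]
    simp only [norm_mul, norm_ofReal_rpow, norm_inv]
    rw [show (-(3 / 4) : ℝ) = -1 + 1 / 4 by norm_num, Real.rpow_add (R.norm_pos ω a),
      Real.rpow_neg_one]
    exact le_of_eq (by ring)

/-- `interp_bound` may put the worse power `-3/4` on either of the two exchanged frequencies. A
factor with at least two points can bear it by its `strong` property, while `-1/4` is always
available by `weak`. If both factors have one point, `-3/4` goes to `R₂`, where the derivative has
produced an extra power of the frequency. -/
theorem conv_fine (h₁ : R₁.Fine (insert z I)) (h₂ : R₂.Fine (insert y J)) :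
    (conv R₁ R₂ y z I J).Fine (insert y (insert z (I ∪ J))) := by
  have w1 := h₁.weak z (Finset.mem_insert_self _ _)
  have w2 := h₂.weak y (Finset.mem_insert_self _ _)
  rcases J.eq_empty_or_nonempty with hJ | hJ
  · rcases I.eq_empty_or_nonempty with hI | hI
    · subst hI hJ
      refine Fine.of_strong (by simp [hc.ne]) (conv_tame hc (conv_measurable_strong) w1
        (w2.mul_rpow (Finset.mem_insert_self _ _) (α := 1 / 2) (by norm_num)) 4 fun ω hω => ?_)
      refine (conv_norm_le hc hω (Or.inr rfl)).trans (le_of_eq ?_)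
      rw [norm_mul_prod_erase (R := R₁) hc.zI, norm_mul, norm_mul_prod_erase (R := R₂) hc.yJ,
        norm_ofReal_rpow]
      -- `S` is just `‖t_y‖` here, and `1 - 3/4 = -1/4 + 1/2`.
      have e1 : R₂.S (insert y ∅) ω.1.2 * ‖R₂.t ω.1.2 y‖ ^ (-(3 / 4) : ℝ)
          = ‖R₂.t ω.1.2 y‖ ^ (-(1 / 4) : ℝ) * ‖R₂.t ω.1.2 y‖ ^ (1 / 2 : ℝ) := by
        rw [← Real.rpow_add (R₂.norm_pos _ _)]
        simp only [S, insert_empty_eq, Finset.sum_singleton]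
        nth_rewrite 1 [← Real.rpow_one ‖R₂.t ω.1.2 y‖]
        rw [← Real.rpow_add (R₂.norm_pos _ _)]
        norm_num
      linear_combination 4 * ‖R₁.g ω.1.1‖ * ‖R₂.g ω.1.2‖ * interpWeight ω.2 *
        ‖R₁.t ω.1.1 z‖ ^ (-(1 / 4) : ℝ) * (‖∏ i ∈ (∅ : Finset ι), (R₁.t ω.1.1 i)⁻¹‖ *
          ‖∏ i ∈ (∅ : Finset ι), (R₂.t ω.1.2 i)⁻¹‖) * e1
    · have hc2 : 2 ≤ (insert z I).card := by
        rw [Finset.card_insert_of_notMem hc.zI]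
        have := hI.card_pos
        omega
      exact conv_vstrong hc (h₁.three_quarters hc2 (Finset.mem_insert_self _ _)) w2
        (Or.inl ⟨rfl, rfl⟩)
  · have hc2 : 2 ≤ (insert y J).card := by
      rw [Finset.card_insert_of_notMem hc.yJ]
      have := hJ.card_pos
      omega
    exact conv_vstrong hc w1 (h₂.three_quarters hc2 (Finset.mem_insert_self _ _))
      (Or.inr ⟨rfl, rfl⟩)

omit hc in
-- The left integrand, including the prefactors, is the `θ`-derivative of the exponential: a divided
-- difference becomes an average over exponentials.
theorem integral_interp (s t : ℂ) (p q : ℝ) :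
    ((q - p : ℝ) : ℂ) * ((t - s) * ∫ θ : ℝ in Set.Ioo (0 : ℝ) 1, Complex.exp
      (-((s + θ * (t - s)) * p + (t + θ * (s - t)) * q))) =
      Complex.exp (-(t * p + s * q)) - Complex.exp (-(s * p + t * q)) := by
  rw [← mul_assoc, ← integral_const_mul, ← integral_Ioc_eq_integral_Ioo,
    ← intervalIntegral.integral_of_le zero_le_one,
    intervalIntegral.integral_eq_sub_of_hasDerivAt
      (f := fun θ : ℝ => Complex.exp (-((s + θ * (t - s)) * p + (t + θ * (s - t)) * q)))]
  · simp
  · intro θ _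
    have h1 : HasDerivAt (fun θ : ℝ => (θ : ℂ)) 1 θ := Complex.ofRealCLM.hasDerivAt
    have h2 := (((((h1.mul_const (t - s)).const_add s).mul_const (p : ℂ)).fun_add
      (((h1.mul_const (s - t)).const_add t).mul_const (q : ℂ))).fun_neg).cexp
    refine h2.congr_deriv ?_
    push_cast
    ring
  · refine Continuous.intervalIntegrable ?_ _ _
    fun_prop

/-- By Fubini and `integral_interp`. The density `g T` of the second factor represents minus its
translation derivative, so this is the antisymmetrisation in `y, z` of a term of the exchange
relation. -/
theorem conv_ev (h₁ : R₁.Fine (insert z I)) (h₂ : R₂.Fine (insert y J)) {x : ι → ℝ}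
    (hx : ∀ i, 0 < x i) :
    ((x z - x y : ℝ) : ℂ) *
        (conv R₁ R₂ y z I J).ev (insert y (insert z (I ∪ J))) (conv R₁ R₂ y z I J).g x =
      R₁.ev (insert z I) R₁.g (x ∘ Equiv.swap y z) *
          R₂.ev (insert y J) (fun ω => R₂.g ω * R₂.T (insert y J) ω) (x ∘ Equiv.swap y z)
        - R₁.ev (insert z I) R₁.g x *
          R₂.ev (insert y J) (fun ω => R₂.g ω * R₂.T (insert y J) ω) x := by
  have hf := (conv_fine hc h₁ h₂).tame ⟨y, Finset.mem_insert_self _ _⟩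
  have hint := hf.integrable (x := x) fun i _ => hx i
  have t1 := h₁.tame ⟨z, Finset.mem_insert_self _ _⟩
  have t2 := (h₂.tame ⟨y, Finset.mem_insert_self _ _⟩).mul_T
  have hswI : ∀ i ∈ I, (x ∘ Equiv.swap y z) i = x i := fun i hi => by
    rw [Function.comp_apply, Equiv.swap_apply_of_ne_of_ne (ne_of_mem_of_not_mem hi hc.yI)
      (ne_of_mem_of_not_mem hi hc.zI)]
  have hswJ : ∀ i ∈ J, (x ∘ Equiv.swap y z) i = x i := fun i hi => by
    rw [Function.comp_apply, Equiv.swap_apply_of_ne_of_ne (ne_of_mem_of_not_mem hi hc.yJ)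
      (ne_of_mem_of_not_mem hi hc.zJ)]
  set A : R₁.Ω → ℂ := fun ω => ∑ i ∈ I, R₁.t ω i * x i with hA
  set B : R₂.Ω → ℂ := fun ω => ∑ i ∈ J, R₂.t ω i * x i with hB
  have k1 : ∀ ω, ∑ i ∈ insert z I, R₁.t ω i * x i = R₁.t ω z * x z + A ω := fun ω => by
    rw [Finset.sum_insert hc.zI]
  have k2 : ∀ ω, ∑ i ∈ insert y J, R₂.t ω i * x i = R₂.t ω y * x y + B ω := fun ω => by
    rw [Finset.sum_insert hc.yJ]
  have k3 : ∀ ω, ∑ i ∈ insert z I, R₁.t ω i * ((x ∘ Equiv.swap y z) i : ℝ)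
      = R₁.t ω z * x y + A ω := fun ω => by
    rw [Finset.sum_insert hc.zI, Finset.sum_congr rfl fun i hi => by rw [hswI i hi]]
    simp [hA]
  have k4 : ∀ ω, ∑ i ∈ insert y J, R₂.t ω i * ((x ∘ Equiv.swap y z) i : ℝ)
      = R₂.t ω y * x z + B ω := fun ω => by
    rw [Finset.sum_insert hc.yJ, Finset.sum_congr rfl fun i hi => by rw [hswJ i hi]]
    simp [hB]
  have k5 : ∀ ω : (R₁.Ω × R₂.Ω) × ℝ, ω.2 ∈ Set.Ioo (0 : ℝ) 1 →
      ∑ i ∈ insert y (insert z (I ∪ J)), (conv R₁ R₂ y z I J).t ω i * x i =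
        ((R₁.t ω.1.1 z + ω.2 * (R₂.t ω.1.2 y - R₁.t ω.1.1 z)) * x y +
          (R₂.t ω.1.2 y + ω.2 * (R₁.t ω.1.1 z - R₂.t ω.1.2 y)) * x z) + (A ω.1.1 + B ω.1.2) := by
    intro ω hω
    have e1 : ∑ i ∈ I, (conv R₁ R₂ y z I J).t ω i * x i = A ω.1.1 :=
      Finset.sum_congr rfl fun i hi => by rw [conv_t_I hc ω hi]
    have e2 : ∑ i ∈ J, (conv R₁ R₂ y z I J).t ω i * x i = B ω.1.2 :=
      Finset.sum_congr rfl fun i hi => by rw [conv_t_J hc ω hi]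
    rw [hc.sum_eq, conv_t_y, conv_t_z hc, e1, e2, clamp_of_mem hω]
    ring
  have e3 : (conv R₁ R₂ y z I J).ev (insert y (insert z (I ∪ J))) (conv R₁ R₂ y z I J).g x =
      ∫ w : R₁.Ω × R₂.Ω, ∫ θ : ℝ in Set.Ioo (0 : ℝ) 1,
        (conv R₁ R₂ y z I J).g (w, θ) * Complex.exp
          (-∑ i ∈ insert y (insert z (I ∪ J)), (conv R₁ R₂ y z I J).t (w, θ) i * x i)
        ∂(volume : Measure ℝ) ∂(R₁.μ.prod R₂.μ) :=
    integral_prod _ hint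
  rw [e3, ← integral_const_mul]
  have i1 := t1.integrable (x := x) fun i _ => hx i
  have i2 := t2.integrable (x := x) fun i _ => hx i
  have i3 := t1.integrable (x := x ∘ Equiv.swap y z) fun i _ => hx _
  have i4 := t2.integrable (x := x ∘ Equiv.swap y z) fun i _ => hx _
  simp only [ev]
  rw [← integral_prod_mul, ← integral_prod_mul, ← integral_sub (by exact i3.mul_prod i4)
    (i1.mul_prod i2)]
  refine integral_congr_ae (Eventually.of_forall fun w => ?_)
  simp only [k1, k2, k3, k4]
  have e4 : ∫ θ : ℝ in Set.Ioo (0 : ℝ) 1, (conv R₁ R₂ y z I J).g (w, θ) * Complex.exp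
          (-∑ i ∈ insert y (insert z (I ∪ J)), (conv R₁ R₂ y z I J).t (w, θ) i * x i) =
      ∫ θ : ℝ in Set.Ioo (0 : ℝ) 1, (-(R₁.g w.1 * (R₂.g w.2 * R₂.T (insert y J) w.2) *
        (R₂.t w.2 y - R₁.t w.1 z)) * Complex.exp (-(A w.1 + B w.2))) *
        Complex.exp (-((R₁.t w.1 z + θ * (R₂.t w.2 y - R₁.t w.1 z)) * x y +
          (R₂.t w.2 y + θ * (R₁.t w.1 z - R₂.t w.2 y)) * x z)) := by
    refine setIntegral_congr_fun measurableSet_Ioo fun θ hθ => ?_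
    have := k5 (w, θ) hθ
    simp only at this ⊢
    rw [this, neg_add _ (A w.1 + B w.2), Complex.exp_add]
    simp only [conv]
    ring
  rw [e4, integral_const_mul]
  have e5 := integral_interp (R₁.t w.1 z) (R₂.t w.2 y) (x y) (x z)
  have x1 : Complex.exp (-(R₁.t w.1 z * x z + A w.1)) * Complex.exp (-(R₂.t w.2 y * x y + B w.2))
      = Complex.exp (-(A w.1 + B w.2)) *
        Complex.exp (-(R₂.t w.2 y * x y + R₁.t w.1 z * x z)) := by
    rw [← Complex.exp_add, ← Complex.exp_add]; ring_nf
  have x2 : Complex.exp (-(R₁.t w.1 z * x y + A w.1)) * Complex.exp (-(R₂.t w.2 y * x z + B w.2))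
      = Complex.exp (-(A w.1 + B w.2)) *
        Complex.exp (-(R₁.t w.1 z * x y + R₂.t w.2 y * x z)) := by
    rw [← Complex.exp_add, ← Complex.exp_add]; ring_nf
  linear_combination (-(R₁.g w.1 * (R₂.g w.2 * R₂.T (insert y J) w.2)) *
    Complex.exp (-(A w.1 + B w.2))) * e5 +
    (R₁.g w.1 * (R₂.g w.2 * R₂.T (insert y J) w.2)) * (x1 - x2)

end Conv

end LaplaceRep

end

/-! ### Chains of the Airy kernel. -/

noncomputable section

open SetAlg

section Shift

variable {ι κ : Type*}

/-- The derivative along a common translation of all the variables. -/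
def shiftD (F : (ι → ℝ) → ℝ) (x : ι → ℝ) : ℝ := deriv (fun τ : ℝ => F fun i => x i + τ) 0

theorem shiftD_eq {F : (ι → ℝ) → ℝ} {x : ι → ℝ} {c τ : ℝ}
    (h : HasDerivAt (fun τ : ℝ => F fun i => x i + τ) c τ) : shiftD F (fun i => x i + τ) = c := by
  have h1 : HasDerivAt (fun s : ℝ => F fun i => x i + (τ + s)) c 0 := by
    have h2 : HasDerivAt (fun τ : ℝ => F fun i => x i + τ) c (τ + 0) := by simpa using h
    exact HasDerivAt.comp_const_add τ 0 h2
  simp only [← add_assoc] at h1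
  exact h1.deriv

theorem shiftD_comp (F : (κ → ℝ) → ℝ) (e : κ → ι) (x : ι → ℝ) :
    shiftD (fun x : ι → ℝ => F (x ∘ e)) x = shiftD F (x ∘ e) := rfl

end Shift

section Chains

variable {ι : Type*} [DecidableEq ι] [Fintype ι]

/-- The chain sums of the Airy kernel. -/
def airyChain (X : Finset ι) (x : ι → ℝ) : ℝ :=
  chain (fun i j => airyK (x i) (x j)) (fun i => airyBi (x i)) (fun i => airyAi (x i)) X

/-- The denominator is invariant under translation, and by the Airy equation the numerator
differentiates to `(y - x) Ai Bi`. -/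
theorem hasDerivAt_airyK {x y t : ℝ} (h : x ≠ y) :
    HasDerivAt (fun t => airyK (x + t) (y + t)) (-(airyAi (x + t) * airyBi (y + t))) t := by
  have hx : x - y ≠ 0 := sub_ne_zero.2 h
  have a1 := (hasDerivAt_airyAi (x + t)).comp_const_add x t
  have a2 := (hasDerivAt_airyAi' (x + t)).comp_const_add x t
  have b1 := (hasDerivAt_airyBi (y + t)).comp_const_add y t
  have b2 := (hasDerivAt_airyBi' (y + t)).comp_const_add y t
  have h1 := ((a1.fun_mul b2).fun_sub (a2.fun_mul b1)).div_const (x - y)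
  have e : (fun t => airyK (x + t) (y + t)) = fun t =>
      (airyAi (x + t) * airyBi' (y + t) - airyAi' (x + t) * airyBi (y + t)) / (x - y) := by
    funext t
    rw [airyK, deriv_airyAi, deriv_airyBi, add_sub_add_right_eq_sub]
  rw [e]
  refine h1.congr_deriv ?_
  field_simp
  ring

/-- The Airy functions at the points `x i + t`. -/
def airySystem {x : ι → ℝ} (hx : Function.Injective x) : AirySystem ι where
  a t i := airyAi (x i + t)
  a' t i := airyAi' (x i + t)
  b t i := airyBi (x i + t)
  b' t i := airyBi' (x i + t)
  x t i := x i + t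
  K t i j := airyK (x i + t) (x j + t)
  hx t i := (hasDerivAt_id t).const_add (x i)
  ha t i := (hasDerivAt_airyAi (x i + t)).comp_const_add (x i) t
  ha' t i := (hasDerivAt_airyAi' (x i + t)).comp_const_add (x i) t
  hb t i := (hasDerivAt_airyBi (x i + t)).comp_const_add (x i) t
  hb' t i := (hasDerivAt_airyBi' (x i + t)).comp_const_add (x i) t
  -- Division by zero gives `0` on the diagonal, so there are no steps from a point to itself.
  hK0 t i := by simp [airyK]
  hK t i j hij := by
    have : x i + t - (x j + t) ≠ 0 := by
      rw [add_sub_add_right_eq_sub]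
      exact sub_ne_zero.2 (hx.ne hij)
    rw [airyK, deriv_airyAi, deriv_airyBi, mul_div_cancel₀ _ this]
  hKd t i j hij := hasDerivAt_airyK (hx.ne hij)

variable {x : ι → ℝ} (hx : Function.Injective x) (X : Finset ι)

theorem airySystem_f (t : ℝ) : (airySystem hx).f t X = airyChain X fun i => x i + t := rfl

theorem airySystem_f1 (t : ℝ) :
    (airySystem hx).f1 t X = shiftD (airyChain X) fun i => x i + t :=
  (shiftD_eq (F := airyChain X) ((airySystem hx).hasDerivAt_f t X)).symm

theorem airySystem_f2 (t : ℝ) :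
    (airySystem hx).f2 t X = shiftD (shiftD (airyChain X)) fun i => x i + t := by
  refine (shiftD_eq (F := shiftD (airyChain X)) ?_).symm
  have := (airySystem hx).hasDerivAt_f1 t X
  simpa only [airySystem_f1] using this

include hx in
/-- The exchange relation. -/
theorem airyChain_insert_insert {y z : ι} (hy : y ∉ X) (hz : z ∉ X) (hyz : y ≠ z) :
    (x z - x y) * airyChain (insert y (insert z X)) x =
      ∑ I ∈ X.powerset, (airyChain (insert z I) x * shiftD (airyChain (insert y (X \ I))) x
        - shiftD (airyChain (insert z I)) x * airyChain (insert y (X \ I)) x) := by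
  have h := (airySystem hx).f_insert_insert 0 hy hz hyz
  simp only [airySystem_f1, airySystem_f, add_zero] at h
  simpa [airySystem] using h

include hx in
/-- The third order differential equation under a common translation. -/
theorem hasDerivAt_airyChain_three {z : ι} (hz : z ∉ X) :
    shiftD (shiftD (shiftD (airyChain (insert z X)))) x =
      4 * x z * shiftD (airyChain (insert z X)) x + 2 * airyChain (insert z X) x
        - ∑ I ∈ X.powerset, (8 * (shiftD (airyChain I) x *
            shiftD (airyChain (insert z (X \ I))) x)
          + 4 * (shiftD (shiftD (airyChain I)) x * airyChain (insert z (X \ I)) x)) := by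
  have h := (airySystem hx).hasDerivAt_f2_insert 0 hz
  simp only [airySystem_f1, airySystem_f2, airySystem_f] at h
  have h2 := shiftD_eq (F := shiftD (shiftD (airyChain (insert z X)))) h
  simp only [add_zero] at h2
  rw [h2]
  simp [airySystem]

theorem airyChain_map {κ : Type*} [DecidableEq κ] [Fintype κ] (e : κ ↪ ι) (Y : Finset κ)
    (x : ι → ℝ) : airyChain (Y.map e) x = airyChain Y (x ∘ e) := chain_map e _ _ _ Y

theorem airyChain_swap {y z : ι} {I : Finset ι} (hy : y ∉ I) (hz : z ∉ I) (x : ι → ℝ) :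
    airyChain (insert y I) x = airyChain (insert z I) (x ∘ Equiv.swap y z) := by
  have h := airyChain_map (Equiv.swap y z).toEmbedding (insert z I) x
  have h2 : (insert z I).map (Equiv.swap y z).toEmbedding = insert y I := by
    rw [Finset.map_insert]
    congr 1
    · simp
    · ext i
      simp only [Finset.mem_map_equiv, Equiv.symm_swap]
      by_cases h1 : i = y
      · subst h1; simp [hy, hz]
      by_cases h3 : i = z
      · subst h3; simp [hy, hz]
      rw [Equiv.swap_apply_of_ne_of_ne h1 h3]
  rw [← h2, h]
  rfl

theorem airyChain_empty (x : ι → ℝ) : airyChain ∅ x = 0 := by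
  rw [airyChain, AirySystem.chain_apply]; simp

theorem airyChain_singleton (i : ι) (x : ι → ℝ) : airyChain {i} x = airyP (x i) := by
  rw [airyChain, AirySystem.chain_apply, Finset.sum_eq_single i]
  · rw [if_pos (Finset.mem_singleton_self i), W_apply, airyP_eq]
    simp [mul_comm]
  · intro j _ hj
    simp [hj]
  · simp

end Chains

/-! ### The one point function and its leading term as Laplace integrals. -/

section RayRep

/-- A positive real number that agrees with `r` for `r > 0`. -/
def posPart' (r : ℝ) : ℝ := if 0 < r then r else 1

theorem posPart'_pos (r : ℝ) : 0 < posPart' r := by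
  unfold posPart'; split_ifs with h
  · exact h
  · exact one_pos

theorem posPart'_of_pos {r : ℝ} (h : 0 < r) : posPart' r = r := if_pos h

theorem measurable_posPart' : Measurable posPart' :=
  Measurable.ite measurableSet_Ioi measurable_id measurable_const

theorem norm_airyOmega : ‖airyOmega‖ = 1 := by
  have h : ‖airyOmega‖ ^ 3 = 1 := by rw [← norm_pow, airyOmega_cube]; simp
  exact (pow_eq_one_iff_of_nonneg (norm_nonneg _) (by norm_num)).1 h

theorem norm_airyNu : ‖airyNu‖ = 1 := by
  have h : ‖airyNu‖ ^ 3 = 1 := by rw [← norm_pow, airyNu_cube]; simp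
  exact (pow_eq_one_iff_of_nonneg (norm_nonneg _) (by norm_num)).1 h

/-- The choice between a complex number and its conjugate. -/
def conjIf (s : Bool) (w : ℂ) : ℂ := if s then w else (starRingEnd ℂ) w

theorem norm_conjIf (s : Bool) (w : ℂ) : ‖conjIf s w‖ = ‖w‖ := by
  cases s <;> simp [conjIf]

theorem re_conjIf (s : Bool) (w : ℂ) : (conjIf s w).re = w.re := by
  cases s <;> simp [conjIf]

/-- The representation of the product of the two Airy functions (`b = 1 / 12`) and of its leading term
(`b = 0`). -/
def airyRep (ι : Type*) (b : ℝ) : LaplaceRep ι where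
  Ω := ℝ × Bool
  μ := (volume.restrict (Set.Ioi 0)).prod Measure.count
  g := fun ω => ((1 / (4 * √Real.pi) * (posPart' ω.1 ^ (-1 / 2 : ℝ) * Real.exp (-(b * posPart' ω.1 ^ 3))) : ℝ) : ℂ)
    * conjIf ω.2 airyNu
  t := fun ω _ => (posPart' ω.1 : ℂ) * conjIf ω.2 airyOmega
  measurable_g := by
    refine Measurable.mul (Complex.measurable_ofReal.comp ?_)
      ((measurable_of_countable fun s : Bool => conjIf s airyNu).comp measurable_snd)
    have := measurable_posPart'
    fun_prop
  measurable_t := fun _ => (Complex.measurable_ofReal.comp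
    (measurable_posPart'.comp measurable_fst)).mul
      ((measurable_of_countable fun s : Bool => conjIf s airyOmega).comp measurable_snd)
  norm_pos := fun ω _ => by
    rw [norm_mul, norm_conjIf, norm_airyOmega, mul_one, Complex.norm_real]
    exact norm_pos_iff.2 (posPart'_pos _).ne'
  cone := fun ω _ => by
    rw [norm_mul, norm_conjIf, norm_airyOmega, mul_one, Complex.norm_real,
      Real.norm_of_nonneg (posPart'_pos _).le, Complex.re_ofReal_mul, re_conjIf]
    simp only [airyOmega]
    linarith

variable {ι : Type*} {b : ℝ}

theorem airyRep_norm_t (ω : ℝ × Bool) (i : ι) : ‖(airyRep ι b).t ω i‖ = posPart' ω.1 := by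
  simp only [airyRep]
  rw [norm_mul, norm_conjIf, norm_airyOmega, mul_one, Complex.norm_real,
      Real.norm_of_nonneg (posPart'_pos _).le]

theorem airyRep_norm_g (ω : ℝ × Bool) : ‖(airyRep ι b).g ω‖ =
    1 / (4 * √Real.pi) * (posPart' ω.1 ^ (-1 / 2 : ℝ) * Real.exp (-(b * posPart' ω.1 ^ 3))) := by
  simp only [airyRep]
  have := posPart'_pos ω.1
  rw [norm_mul, norm_conjIf, norm_airyNu, mul_one, Complex.norm_real,
      Real.norm_of_nonneg (by positivity)]

theorem airyRep_tame {X : Finset ι} (hX : X.Nonempty) {h : ℝ × Bool → ℂ} (hm : Measurable h)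
    {α C : ℝ} (hα : -1 < α) (k : ℕ)
    (hb : ∀ ω : ℝ × Bool, 0 < ω.1 → ‖h ω‖ ≤ C * (ω.1 ^ α * (1 + ω.1) ^ k)) :
    (airyRep ι b).Tame X h := by
  refine ⟨hm, fun c hc => ?_⟩
  have hn : (1 : ℝ) ≤ X.card := by exact_mod_cast hX.card_pos
  have hS : ∀ ω : ℝ × Bool, 0 < ω.1 → ω.1 ≤ (airyRep ι b).S X ω := by
    intro ω hω
    simp only [LaplaceRep.S]
    rw [Finset.sum_congr rfl fun i _ => airyRep_norm_t ω i, Finset.sum_const, nsmul_eq_mul,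
      posPart'_of_pos hω]
    nlinarith
  have h1 : Integrable (fun r : ℝ => |C| * (k.factorial / (c / 2) ^ k * Real.exp (c / 2)) *
      (r ^ α * Real.exp (-(c / 2) * r))) (volume.restrict (Set.Ioi 0)) := by
    refine Integrable.const_mul ?_ _
    have := integrableOn_rpow_mul_exp_neg_mul_rpow (s := α) (p := 1) (b := c / 2) hα zero_lt_one
      (by positivity)
    simpa [IntegrableOn] using this
  refine (h1.comp_fst (Measure.count : Measure Bool)).mono' ?_ ?_
  · exact (hm.norm.mul (Real.measurable_exp.comp
      (((airyRep ι b).measurable_S X).const_mul c).neg)).aestronglyMeasurable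
  · have hae : ∀ᵐ ω : ℝ × Bool ∂((volume.restrict (Set.Ioi 0)).prod Measure.count),
        0 < ω.1 :=
      Measure.quasiMeasurePreserving_fst.ae (ae_restrict_mem measurableSet_Ioi)
    refine hae.mono fun ω hω => ?_
    rw [Real.norm_of_nonneg (by positivity)]
    have h2 := hb ω hω
    have h3 := hS ω hω
    have h4 := LaplaceRep.pow_mul_exp_le k (c := c / 2) (by positivity) (s := 1 + ω.1)
      (by positivity)
    calc ‖h ω‖ * Real.exp (-(c * (airyRep ι b).S X ω))
        ≤ (C * (ω.1 ^ α * (1 + ω.1) ^ k)) * Real.exp (-(c * (airyRep ι b).S X ω)) := by gcongr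
      _ ≤ (|C| * (ω.1 ^ α * (k.factorial / (c / 2) ^ k * Real.exp (c / 2 * (1 + ω.1))))) *
          Real.exp (-(c * ω.1)) := by
          gcongr
          exact le_abs_self C
      _ = |C| * (k.factorial / (c / 2) ^ k) * (ω.1 ^ α) *
          (Real.exp (c / 2 * (1 + ω.1)) * Real.exp (-(c * ω.1))) := by ring
      _ = |C| * (k.factorial / (c / 2) ^ k) * (ω.1 ^ α) *
          (Real.exp (c / 2) * Real.exp (-(c / 2) * ω.1)) := by
          rw [← Real.exp_add, ← Real.exp_add]; ring_nf
      _ = _ := by ring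

theorem airyRep_ev {X : Finset ι} (i : ι) (hX : X = {i}) (hb0 : 0 ≤ b) {h : ℝ × Bool → ℂ}
    (ht : (airyRep ι b).Tame X h) {x : ι → ℝ} (hx : ∀ i, 0 < x i) :
    (airyRep ι b).ev X h x =
      (∫ r in Set.Ioi (0 : ℝ), h (r, true) * Complex.exp (-(r * airyOmega * x i))) +
      ∫ r in Set.Ioi (0 : ℝ), h (r, false) *
        Complex.exp (-(r * (starRingEnd ℂ) airyOmega * x i)) := by
  subst hX
  have hint := ht.integrable (x := x) fun i _ => hx i
  have e1 : (airyRep ι b).ev {i} h x = ∫ s : Bool, ∫ r in Set.Ioi (0 : ℝ), h (r, s) *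
      Complex.exp (-∑ i ∈ {i}, (airyRep ι b).t (r, s) i * x i) ∂volume ∂Measure.count :=
    integral_prod_symm _ hint
  rw [e1, integral_fintype Integrable.of_finite]
  simp only [Finset.sum_singleton, Fintype.sum_bool, measureReal_def, Measure.count_singleton,
    ENNReal.toReal_one, one_smul]
  congr 1
  · refine setIntegral_congr_fun measurableSet_Ioi fun r hr => ?_
    simp [airyRep, posPart'_of_pos hr, conjIf]
  · refine setIntegral_congr_fun measurableSet_Ioi fun r hr => ?_
    simp [airyRep, posPart'_of_pos hr, conjIf]

/-- The density behaves like `r^(-1/2)` at zero, and the extra `-1/4` leaves the integrable power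
`r^(-3/4)`. The stronger conditions are void for a single point. -/
theorem airyRep_fine {X : Finset ι} [DecidableEq ι] {i : ι} (hX : X = {i}) (hb : 0 ≤ b) :
    (airyRep ι b).Fine X := by
  subst hX
  refine ⟨fun z hz => ?_, fun h => by simp at h, fun h => by simp at h⟩
  rw [Finset.mem_singleton] at hz
  subst hz
  refine airyRep_tame ⟨z, by simp⟩ (((airyRep ι b).measurable_g.mul
    (LaplaceRep.measurable_prod_inv _ _)).mul (LaplaceRep.measurable_norm_rpow _ _ _))
    (α := -(3 / 4)) (C := 1 / (4 * √Real.pi)) (by norm_num) 0 fun ω hω => ?_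
  rw [norm_mul, norm_mul, airyRep_norm_g]
  erw [LaplaceRep.norm_ofReal_rpow (R := airyRep ι b) ω z]
  rw [airyRep_norm_t]
  simp only [Finset.erase_singleton, Finset.prod_empty, norm_one, mul_one, pow_zero]
  rw [posPart'_of_pos hω, mul_assoc, mul_right_comm]
  refine mul_le_mul_of_nonneg_left ?_ (by positivity)
  rw [← Real.rpow_add hω]
  norm_num
  exact mul_le_of_le_one_right (by positivity) (Real.exp_le_one_iff.2 (by
    have : 0 < ω.1 ^ 3 := by positivity
    nlinarith))

/-- The real part in `airyP` is half the sum over the ray and its conjugate, which is the role of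
the Boolean. -/
theorem airyRep_ev_airyP {X : Finset ι} [DecidableEq ι] {i : ι} (hX : X = {i}) {x : ι → ℝ}
    (hx : ∀ i, 0 < x i) :
    (airyP (x i) : ℂ) = (airyRep ι (1 / 12)).ev X (airyRep ι (1 / 12)).g x := by
  rw [airyRep_ev i hX (by norm_num)
    ((airyRep_fine hX (by norm_num)).tame (by rw [hX]; exact ⟨i, by simp⟩)) hx]
  have e1 : ∫ r in Set.Ioi (0 : ℝ), (airyRep ι (1 / 12)).g (r, true) *
      Complex.exp (-(r * airyOmega * x i)) =
      1 / (4 * √Real.pi) * (airyNu * cubicMoment (1 / 12) (-1 / 2) airyOmega (x i)) := by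
    rw [cubicMoment, ← integral_const_mul, ← integral_const_mul]
    refine setIntegral_congr_fun measurableSet_Ioi fun r hr => ?_
    simp only [airyRep, posPart'_of_pos hr, conjIf, if_true]
    rw [sub_eq_add_neg, Complex.exp_add]
    push_cast
    ring_nf
  have e2 : ∫ r in Set.Ioi (0 : ℝ), (airyRep ι (1 / 12)).g (r, false) *
      Complex.exp (-(r * (starRingEnd ℂ) airyOmega * x i)) =
      (starRingEnd ℂ) (1 / (4 * √Real.pi) *
        (airyNu * cubicMoment (1 / 12) (-1 / 2) airyOmega (x i))) := by
    rw [← e1, ← integral_conj]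
    refine setIntegral_congr_fun measurableSet_Ioi fun r hr => ?_
    simp only [airyRep, conjIf, if_true, map_mul, Complex.conj_ofReal, ← Complex.exp_conj, map_neg]
    simp
  rw [e1, e2, Complex.add_conj, airyP]
  have h3 : (1 / (4 * (√Real.pi : ℂ))) = ((1 / (4 * √Real.pi) : ℝ) : ℂ) := by push_cast; ring
  rw [h3, Complex.re_ofReal_mul]
  congr 1
  ring

theorem airyNu_re_pos : 0 < airyNu.re := by
  simp only [airyNu]; positivity

/-- The leading term of the product of the Airy functions. -/
theorem airyRep_ev_zero {X : Finset ι} [DecidableEq ι] {i : ι} (hX : X = {i}) {x : ι → ℝ}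
    (hx : ∀ i, 0 < x i) :
    ((1 / 2 * x i ^ (-1 / 2 : ℝ) : ℝ) : ℂ) = (airyRep ι 0).ev X (airyRep ι 0).g x := by
  rw [airyRep_ev i hX le_rfl
    ((airyRep_fine hX le_rfl).tame (by rw [hX]; exact ⟨i, by simp⟩)) hx]
  have hxi := hx i
  have hpi : (√Real.pi : ℂ) ≠ 0 := by
    exact_mod_cast (Real.sqrt_pos.2 Real.pi_pos).ne'
  have hnn : airyNu * (starRingEnd ℂ) airyNu = 1 := by
    rw [Complex.mul_conj, Complex.normSq_eq_norm_sq, norm_airyNu]; simp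
  have hre : 0 < (airyOmega * x i).re := by
    rw [Complex.re_mul_ofReal]; simp [airyOmega, hxi]
  have h4 : airyOmega * x i ≠ 0 := fun h => by rw [h] at hre; simp at hre
  have e0 : ∫ r in Set.Ioi (0 : ℝ), ((r ^ (-1 / 2 : ℝ) : ℝ) : ℂ) *
      Complex.exp (-((airyOmega * x i) * r)) =
      √Real.pi * ((x i ^ (-1 / 2 : ℝ) : ℝ) : ℂ) * (starRingEnd ℂ) airyNu := by
    have h0 := integral_comp_rpow_Ioi (fun s : ℝ => Complex.exp (-(airyOmega * x i) * s ^ 2))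
      (p := 1 / 2) (by norm_num)
    rw [integral_gaussian_complex_Ioi hre] at h0
    have h1 : ∫ r in Set.Ioi (0 : ℝ), ((r ^ (-1 / 2 : ℝ) : ℝ) : ℂ) *
        Complex.exp (-((airyOmega * x i) * r)) = (Real.pi / (airyOmega * x i)) ^ (1 / 2 : ℂ) := by
      have h0' : (Real.pi / (airyOmega * x i)) ^ (1 / 2 : ℂ)
          = 2 * ((Real.pi / (airyOmega * x i)) ^ (1 / 2 : ℂ) / 2) := by ring
      rw [h0', ← h0, ← integral_const_mul]
      refine setIntegral_congr_fun measurableSet_Ioi fun r hr => ?_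
      have hr0 : (0 : ℝ) < r := hr
      have h2 : ((r ^ (1 / 2 : ℝ) : ℝ) : ℂ) ^ 2 = r := by
        rw [← Complex.ofReal_pow, ← Real.rpow_natCast, ← Real.rpow_mul hr0.le]
        norm_num
      simp only [h2]
      rw [show (1 / 2 - 1 : ℝ) = -1 / 2 by norm_num, abs_of_pos (by norm_num : (0 : ℝ) < 1 / 2),
        Complex.real_smul]
      push_cast
      ring_nf
    rw [h1]
    have h2 : airyOmega = airyNu ^ 2 := airyNu_sq.symm
    have h3 : ((x i ^ (-1 / 2 : ℝ) : ℝ) : ℂ) ^ 2 * x i = 1 := by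
      have : (x i ^ (-1 / 2 : ℝ)) ^ 2 * x i = 1 := by
        rw [← Real.rpow_natCast, ← Real.rpow_mul hxi.le]
        norm_num
        rw [Real.rpow_neg_one, inv_mul_cancel₀ hxi.ne']
      exact_mod_cast this
    have h9 : (√Real.pi : ℂ) ^ 2 = Real.pi := by
      exact_mod_cast Real.sq_sqrt Real.pi_pos.le
    have h5 : Real.pi / (airyOmega * x i)
        = (√Real.pi * ((x i ^ (-1 / 2 : ℝ) : ℝ) : ℂ) * (starRingEnd ℂ) airyNu) ^ 2 := by
      rw [div_eq_iff h4, mul_pow, mul_pow, h2, h9]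
      have h5 : (airyNu * (starRingEnd ℂ) airyNu) ^ 2 = 1 := by rw [hnn, one_pow]
      linear_combination -(Real.pi : ℂ) * h5
        - Real.pi * (airyNu * (starRingEnd ℂ) airyNu) ^ 2 * h3
    rw [h5, show (1 / 2 : ℂ) = ((2 : ℕ) : ℂ)⁻¹ by norm_num]
    have h7 : 0 < (√Real.pi * ((x i ^ (-1 / 2 : ℝ) : ℝ) : ℂ) * (starRingEnd ℂ) airyNu).re := by
      rw [← Complex.ofReal_mul, Complex.re_ofReal_mul, Complex.conj_re]
      have := airyNu_re_pos
      have := Real.pi_pos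
      positivity
    -- Positive real part selects the principal branch of the square root.
    have h8 := Complex.abs_arg_lt_pi_div_two_iff.2 (Or.inl h7)
    rw [abs_lt] at h8
    refine Complex.pow_cpow_nat_inv (by norm_num) ?_ ?_
    · push_cast; linarith [h8.1]
    · push_cast; linarith [h8.2]
  have e1 : ∫ r in Set.Ioi (0 : ℝ), (airyRep ι 0).g (r, true) *
      Complex.exp (-(r * airyOmega * x i)) =
      ((1 / 4 * x i ^ (-1 / 2 : ℝ) : ℝ) : ℂ) := by
    have e3 : ∫ r in Set.Ioi (0 : ℝ), (airyRep ι 0).g (r, true) *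
      Complex.exp (-(r * airyOmega * x i)) = 1 / (4 * √Real.pi) * airyNu *
        ∫ r in Set.Ioi (0 : ℝ), ((r ^ (-1 / 2 : ℝ) : ℝ) : ℂ) *
      Complex.exp (-((airyOmega * x i) * r)) := by
      rw [← integral_const_mul]
      refine setIntegral_congr_fun measurableSet_Ioi fun r hr => ?_
      simp only [airyRep, posPart'_of_pos hr, conjIf, if_true]
      push_cast
      rw [zero_mul, neg_zero, Complex.exp_zero]
      ring_nf
    rw [e3, e0]
    generalize hq : ((x i ^ (-1 / 2 : ℝ) : ℝ) : ℂ) = Q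
    rw [Complex.ofReal_mul, hq]
    push_cast
    calc 1 / (4 * (√Real.pi : ℂ)) * airyNu * (√Real.pi * Q * (starRingEnd ℂ) airyNu)
        = (√Real.pi / √Real.pi) * (1 / 4) * Q * (airyNu * (starRingEnd ℂ) airyNu) := by ring
      _ = _ := by rw [hnn, div_self hpi]; ring
  have e2 : ∫ r in Set.Ioi (0 : ℝ), (airyRep ι 0).g (r, false) *
      Complex.exp (-(r * (starRingEnd ℂ) airyOmega * x i)) =
      (starRingEnd ℂ) ((1 / 4 * x i ^ (-1 / 2 : ℝ) : ℝ) : ℂ) := by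
    rw [← e1, ← integral_conj]
    refine setIntegral_congr_fun measurableSet_Ioi fun r hr => ?_
    simp only [airyRep, conjIf, if_true, map_mul, Complex.conj_ofReal, ← Complex.exp_conj, map_neg]
    simp
  rw [e1, e2, Complex.conj_ofReal]
  push_cast
  ring

end RayRep

/-! ### All chains are Laplace integrals: induction with the exchange relation. -/

section Existence

open LaplaceRep

variable {ι : Type*} [DecidableEq ι] [Fintype ι]

theorem LaplaceRep.Fine.shiftD_eq {R : LaplaceRep ι} {X : Finset ι} {F : (ι → ℝ) → ℝ}
    {h : R.Ω → ℂ} (hh : R.Tame X h)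
    (hF : ∀ x : ι → ℝ, Function.Injective x → (∀ i, 0 < x i) → (F x : ℂ) = R.ev X h x)
    (x : ι → ℝ) (hx : Function.Injective x) (hx0 : ∀ i, 0 < x i) :
    (shiftD F x : ℂ) = R.ev X (fun ω => -(h ω * R.T X ω)) x := by
  have hnear : ∀ᶠ τ : ℝ in nhds 0, ∀ i, 0 < x i + τ := by
    rw [eventually_all]
    intro i
    have : Tendsto (fun τ : ℝ => x i + τ) (nhds 0) (nhds (x i + 0)) :=
      (continuous_const.add continuous_id).tendsto 0
    rw [add_zero] at this
    exact this.eventually_const_lt (hx0 i)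
  have h1 := (hasDerivAt_ev hh (x := x) (τ := 0) (by simpa using fun i _ => hx0 i)).complex_re
  have h2 : HasDerivAt (fun τ : ℝ => F fun i => x i + τ)
      (-R.ev X (fun ω => h ω * R.T X ω) fun i => x i + 0).re 0 := by
    refine h1.congr_of_eventuallyEq (hnear.mono fun τ hτ => ?_)
    have := hF (fun i => x i + τ) (fun i j hij => hx (by simpa using hij)) hτ
    simp only [← this, Complex.ofReal_re]
  have h4 : HasDerivAt (fun τ : ℝ => ((F fun i => x i + τ : ℝ) : ℂ))
      (-R.ev X (fun ω => h ω * R.T X ω) fun i => x i + 0) 0 := by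
    refine (hasDerivAt_ev hh (x := x) (τ := 0)
      (by simpa using fun i _ => hx0 i)).congr_of_eventuallyEq (hnear.mono fun τ hτ => ?_)
    exact hF (fun i => x i + τ) (fun i j hij => hx (by simpa using hij)) hτ
  have h5 := h4.unique h2.ofReal_comp
  have h3 : shiftD F x = (-R.ev X (fun ω => h ω * R.T X ω) fun i => x i + 0).re := by
    simpa using _root_.shiftD_eq h2
  rw [h3, ← h5, ev_neg]
  simp

/-- The chain sums are Laplace integrals. -/
theorem isFine_airyChain (X : Finset ι) (hX : X.Nonempty) : IsFine X (airyChain X) := by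
  induction X using Finset.strongInduction with
  | H X ih =>
    obtain ⟨y, hy⟩ := hX
    obtain ⟨Y, hyY, rfl⟩ : ∃ Y, y ∉ Y ∧ X = insert y Y :=
      ⟨X.erase y, Finset.notMem_erase y X, (Finset.insert_erase hy).symm⟩
    rcases Y.eq_empty_or_nonempty with rfl | ⟨z, hz⟩
    · have e : insert y (∅ : Finset ι) = {y} := rfl
      rw [e]
      refine ⟨airyRep ι (1 / 12), airyRep_fine rfl (by norm_num), fun x _ hx0 => ?_⟩
      rw [airyChain_singleton]
      exact airyRep_ev_airyP rfl hx0
    obtain ⟨X, hzX, rfl⟩ : ∃ X, z ∉ X ∧ Y = insert z X :=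
      ⟨Y.erase z, Finset.notMem_erase z Y, (Finset.insert_erase hz).symm⟩
    have hyX : y ∉ X := fun h => hyY (Finset.mem_insert_of_mem h)
    have hyz : y ≠ z := fun h => hyY (by rw [h]; exact Finset.mem_insert_self _ _)
    -- In the exchange relation the subtracted sum is the first sum with `y` and `z` exchanged and
    -- `I` replaced by its complement. So `F` is a sum of divided differences of the `Q I`, each of
    -- which `conv` represents.
    set Q : Finset ι → (ι → ℝ) → ℝ := fun I x =>
      airyChain (insert z I) x * shiftD (airyChain (insert y (X \ I))) x with hQ
    have hsum : IsFine (insert y (insert z X)) fun x => ∑ I ∈ X.powerset,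
        (Q I x - Q I (x ∘ Equiv.swap y z)) / (x z - x y) := by
      refine IsFine.sum ⟨y, Finset.mem_insert_self _ _⟩ _ fun I hI => ?_
      rw [Finset.mem_powerset] at hI
      have hc : Config y z I (X \ I) :=
        ⟨hyz, fun h => hyX (hI h), fun h => hzX (hI h), by simp [hyX], by simp [hzX],
          Finset.disjoint_sdiff⟩
      have hlt1 : insert z I ⊂ insert y (insert z X) :=
        (Finset.insert_subset_insert z hI).trans_ssubset (Finset.ssubset_insert hyY)
      have hlt2 : insert y (X \ I) ⊂ insert y (insert z X) := by
        refine ⟨Finset.insert_subset_insert y (Finset.sdiff_subset.trans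
          (Finset.subset_insert z X)), fun h => ?_⟩
        have := h (Finset.mem_insert_of_mem (Finset.mem_insert_self z X))
        simp [hyz.symm, hzX] at this
      obtain ⟨R₁, f1, e1⟩ := ih _ hlt1 ⟨z, Finset.mem_insert_self _ _⟩
      obtain ⟨R₂, f2, e2⟩ := ih _ hlt2 ⟨y, Finset.mem_insert_self _ _⟩
      refine ⟨conv R₁ R₂ y z I (X \ I), ?_, fun x hx hx0 => ?_⟩
      · have := conv_fine hc f1 f2
        rwa [Finset.union_sdiff_of_subset hI] at this
      · have h1 := conv_ev hc f1 f2 hx0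
        have t2 := f2.tame ⟨y, Finset.mem_insert_self _ _⟩
        have d2 := LaplaceRep.Fine.shiftD_eq t2 e2
        simp only [ev_neg] at d2
        have hxs : Function.Injective (x ∘ Equiv.swap y z) := hx.comp (Equiv.injective _)
        have hxs0 : ∀ i, 0 < (x ∘ Equiv.swap y z) i := fun i => hx0 _
        rw [Finset.union_sdiff_of_subset hI, ← e1 x hx hx0, ← e1 _ hxs hxs0,
          ← neg_eq_iff_eq_neg.2 (d2 x hx hx0), ← neg_eq_iff_eq_neg.2 (d2 _ hxs hxs0)] at h1
        have hne : x z - x y ≠ 0 := sub_ne_zero.2 (hx.ne hyz.symm)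
        have hne' : ((x z - x y : ℝ) : ℂ) ≠ 0 := by exact_mod_cast hne
        rw [Complex.ofReal_div, div_eq_iff hne', mul_comm, h1]
        simp only [hQ]
        push_cast
        ring
    refine hsum.congr fun x hx hx0 => ?_
    have hne : x z - x y ≠ 0 := sub_ne_zero.2 (hx.ne hyz.symm)
    have hR := airyChain_insert_insert hx X hyX hzX hyz
    have hsw : ∑ I ∈ X.powerset, shiftD (airyChain (insert z I)) x * airyChain (insert y (X \ I)) x
        = ∑ I ∈ X.powerset, Q I (x ∘ Equiv.swap y z) := by
      refine Finset.sum_nbij' (fun I => X \ I) (fun I => X \ I) (by simp) (by simp)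
        (fun I hI => Finset.sdiff_sdiff_eq_self (Finset.mem_powerset.1 hI))
        (fun I hI => Finset.sdiff_sdiff_eq_self (Finset.mem_powerset.1 hI)) fun I hI => ?_
      rw [Finset.mem_powerset] at hI
      simp only [hQ]
      rw [Finset.sdiff_sdiff_eq_self hI, ← airyChain_swap (by simp [hyX]) (by simp [hzX]), mul_comm]
      congr 1
      have hfun : airyChain (insert z I) = fun x => airyChain (insert y I) (x ∘ Equiv.swap y z) := by
        funext x
        rw [Equiv.swap_comm]
        exact airyChain_swap (fun h => hzX (hI h)) (fun h => hyX (hI h)) x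
      rw [hfun]
      exact shiftD_comp (airyChain (insert y I)) (Equiv.swap y z) x
    rw [← Finset.sum_div, div_eq_iff hne, Finset.sum_sub_distrib, ← hsw, mul_comm, hR,
      Finset.sum_sub_distrib]

end Existence

end

noncomputable section

/-! ### Symbol classes at infinity. -/

section Symbols

/-- Functions with `n` derivatives near infinity, the `k`-th of which is `O(x ^ (m - k))`. -/
def SymbN : ℕ → ℝ → (ℝ → ℝ) → Prop
  | 0, m, f => f =O[atTop] fun x : ℝ => x ^ m
  | n + 1, m, f => (f =O[atTop] fun x : ℝ => x ^ m) ∧ (∀ᶠ x in atTop, DifferentiableAt ℝ f x) ∧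
      SymbN n (m - 1) (deriv f)

/-- Symbols of order `m` at infinity. -/
def Symb (m : ℝ) (f : ℝ → ℝ) : Prop := ∀ n, SymbN n m f

theorem eventually_nhds_of_atTop {p : ℝ → Prop} (h : ∀ᶠ x in atTop, p x) :
    ∀ᶠ x in atTop, ∀ᶠ y in nhds x, p y := by
  obtain ⟨a, ha⟩ := eventually_atTop.1 h
  filter_upwards [eventually_gt_atTop a] with x hx
  filter_upwards [lt_mem_nhds hx] with y hy
  exact ha y hy.le

theorem deriv_eventuallyEq {f g : ℝ → ℝ} (h : f =ᶠ[atTop] g) : deriv f =ᶠ[atTop] deriv g :=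
  (eventually_nhds_of_atTop h).mono fun _ hx => Filter.EventuallyEq.deriv_eq hx

theorem rpow_isBigO_rpow {m m' : ℝ} (h : m ≤ m') :
    (fun x : ℝ => x ^ m) =O[atTop] fun x : ℝ => x ^ m' := by
  refine IsBigO.of_bound 1 ?_
  filter_upwards [eventually_ge_atTop 1] with x hx
  rw [one_mul, Real.norm_of_nonneg (by positivity), Real.norm_of_nonneg (by positivity)]
  exact Real.rpow_le_rpow_of_exponent_le hx h

theorem rpow_mul_rpow_eventuallyEq (m m' : ℝ) :
    (fun x : ℝ => x ^ m * x ^ m') =ᶠ[atTop] fun x : ℝ => x ^ (m + m') := by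
  filter_upwards [eventually_gt_atTop 0] with x hx
  rw [Real.rpow_add hx]

namespace SymbN

theorem pred {n : ℕ} : ∀ {m : ℝ} {f : ℝ → ℝ}, SymbN (n + 1) m f → SymbN n m f := by
  induction n with
  | zero => exact fun h => h.1
  | succ n ih => exact fun h => ⟨h.1, h.2.1, ih h.2.2⟩

theorem congr {n : ℕ} : ∀ {m : ℝ} {f g : ℝ → ℝ}, SymbN n m f → f =ᶠ[atTop] g → SymbN n m g := by
  induction n with
  | zero => exact fun h e => IsBigO.congr' h e EventuallyEq.rfl
  | succ n ih =>
    intro m f g h e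
    refine ⟨h.1.congr' e EventuallyEq.rfl, ?_, ih h.2.2 (deriv_eventuallyEq e)⟩
    filter_upwards [h.2.1, eventually_nhds_of_atTop e] with x hx hx'
    exact hx.congr_of_eventuallyEq (EventuallyEq.symm hx')

theorem mono {n : ℕ} : ∀ {m m' : ℝ} {f : ℝ → ℝ}, SymbN n m f → m ≤ m' → SymbN n m' f := by
  induction n with
  | zero => exact fun h e => IsBigO.trans h (rpow_isBigO_rpow e)
  | succ n ih => exact fun h e => ⟨h.1.trans (rpow_isBigO_rpow e), h.2.1, ih h.2.2 (by linarith)⟩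

theorem add {n : ℕ} : ∀ {m : ℝ} {f g : ℝ → ℝ}, SymbN n m f → SymbN n m g →
    SymbN n m fun x => f x + g x := by
  induction n with
  | zero => exact fun h h' => IsBigO.add h h'
  | succ n ih =>
    intro m f g h h'
    refine ⟨h.1.add h'.1, ?_, (ih h.2.2 h'.2.2).congr ?_⟩
    · filter_upwards [h.2.1, h'.2.1] with x hx hx' using hx.add hx'
    · filter_upwards [h.2.1, h'.2.1] with x hx hx' using (deriv_fun_add hx hx').symm

theorem mul {n : ℕ} : ∀ {m m' : ℝ} {f g : ℝ → ℝ}, SymbN n m f → SymbN n m' g →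
    SymbN n (m + m') fun x => f x * g x := by
  induction n with
  | zero =>
    intro m m' f g h h'
    exact (IsBigO.mul h h').congr' EventuallyEq.rfl (rpow_mul_rpow_eventuallyEq m m')
  | succ n ih =>
    intro m m' f g h h'
    refine ⟨(h.1.mul h'.1).congr' EventuallyEq.rfl (rpow_mul_rpow_eventuallyEq m m'), ?_, ?_⟩
    · filter_upwards [h.2.1, h'.2.1] with x hx hx' using hx.mul hx'
    · have h1 := ih h.2.2 h'.pred
      have h2 := ih h.pred h'.2.2
      rw [show m - 1 + m' = m + m' - 1 by ring] at h1
      rw [show m + (m' - 1) = m + m' - 1 by ring] at h2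
      refine (h1.add h2).congr ?_
      filter_upwards [h.2.1, h'.2.1] with x hx hx' using (deriv_fun_mul hx hx').symm

end SymbN

theorem Symb.isBigO {m : ℝ} {f : ℝ → ℝ} (h : Symb m f) : f =O[atTop] fun x : ℝ => x ^ m := h 0

theorem Symb.congr {m : ℝ} {f g : ℝ → ℝ} (h : Symb m f) (e : f =ᶠ[atTop] g) : Symb m g :=
  fun n => (h n).congr e

theorem Symb.mono {m m' : ℝ} {f : ℝ → ℝ} (h : Symb m f) (e : m ≤ m') : Symb m' f :=
  fun n => (h n).mono e

theorem Symb.add {m : ℝ} {f g : ℝ → ℝ} (h : Symb m f) (h' : Symb m g) : Symb m fun x => f x + g x :=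
  fun n => (h n).add (h' n)

theorem Symb.mul {m m' : ℝ} {f g : ℝ → ℝ} (h : Symb m f) (h' : Symb m' g) :
    Symb (m + m') fun x => f x * g x := fun n => (h n).mul (h' n)

theorem Symb.hasDerivAt {m : ℝ} {f f' : ℝ → ℝ} (h : Symb m f)
    (hd : ∀ᶠ x in atTop, HasDerivAt f (f' x) x) : Symb (m - 1) f' :=
  fun n => (h (n + 1)).2.2.congr (hd.mono fun _ hx => hx.deriv)

theorem hasDerivAt_rpow_eventually (m : ℝ) :
    ∀ᶠ x : ℝ in atTop, HasDerivAt (fun x : ℝ => x ^ m) (m * x ^ (m - 1)) x := by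
  filter_upwards [eventually_gt_atTop 0] with x hx
  exact Real.hasDerivAt_rpow_const (Or.inl hx.ne')

theorem Symb.const_mul_rpow (c m : ℝ) : Symb m fun x => c * x ^ m := by
  intro n
  induction n generalizing c m with
  | zero => exact (isBigO_refl _ _).const_mul_left c
  | succ n ih =>
    have hd : ∀ᶠ x : ℝ in atTop, HasDerivAt (fun x : ℝ => c * x ^ m) (c * m * x ^ (m - 1)) x :=
      (hasDerivAt_rpow_eventually m).mono fun x hx => (hx.const_mul c).congr_deriv (by ring)
    exact ⟨(isBigO_refl _ _).const_mul_left c, hd.mono fun x hx => hx.differentiableAt,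
      (ih (c * m) (m - 1)).congr (hd.mono fun x hx => hx.deriv.symm)⟩

theorem Symb.rpow (m : ℝ) : Symb m fun x => x ^ m := by simpa using Symb.const_mul_rpow 1 m

theorem Symb.const (c : ℝ) : Symb 0 fun _ => c := by simpa using Symb.const_mul_rpow c 0

theorem Symb.const_mul {m : ℝ} {f : ℝ → ℝ} (c : ℝ) (h : Symb m f) : Symb m fun x => c * f x := by
  simpa using (Symb.const c).mul h

theorem Symb.neg {m : ℝ} {f : ℝ → ℝ} (h : Symb m f) : Symb m fun x => -f x := by
  simpa using h.const_mul (-1)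

theorem Symb.sub {m : ℝ} {f g : ℝ → ℝ} (h : Symb m f) (h' : Symb m g) : Symb m fun x => f x - g x := by
  simpa [sub_eq_add_neg] using h.add h'.neg

theorem Symb.zero (m : ℝ) : Symb m fun _ => 0 := by simpa using Symb.const_mul_rpow 0 m

theorem Symb.sum {α : Type*} (s : Finset α) {m : ℝ} {f : α → ℝ → ℝ} (h : ∀ a ∈ s, Symb m (f a)) :
    Symb m fun x => ∑ a ∈ s, f a x := by
  classical
  induction s using Finset.induction_on with
  | empty => simpa using Symb.zero m
  | insert a s ha ih =>
    simp only [Finset.sum_insert ha]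
    exact (h a (Finset.mem_insert_self a s)).add (ih fun b hb => h b (Finset.mem_insert_of_mem hb))

/-- The inverse of an elliptic symbol. -/
theorem Symb.inv {m : ℝ} {f : ℝ → ℝ} (h : Symb m f) {c : ℝ} (hc : 0 < c)
    (hf : ∀ᶠ x in atTop, c * x ^ m ≤ |f x|) : Symb (-m) fun x => (f x)⁻¹ := by
  have hne : ∀ᶠ x in atTop, f x ≠ 0 := by
    filter_upwards [hf, eventually_gt_atTop 0] with x hx hx0 h0
    rw [h0, abs_zero] at hx
    have : 0 < c * x ^ m := by positivity
    linarith
  have hO : (fun x => (f x)⁻¹) =O[atTop] fun x : ℝ => x ^ (-m) := by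
    refine IsBigO.of_bound c⁻¹ ?_
    filter_upwards [hf, eventually_gt_atTop 0] with x hx hx0
    rw [norm_inv, Real.norm_eq_abs, Real.norm_of_nonneg (by positivity), Real.rpow_neg hx0.le,
      ← mul_inv]
    exact inv_anti₀ (by positivity) hx
  intro n
  induction n with
  | zero => exact hO
  | succ n ih =>
    have hd : ∀ᶠ x in atTop, HasDerivAt (fun x => (f x)⁻¹) (-deriv f x / f x ^ 2) x := by
      filter_upwards [(h 1).2.1, hne] with x hx hx0
      exact hx.hasDerivAt.fun_inv hx0
    refine ⟨hO, hd.mono fun x hx => hx.differentiableAt, ?_⟩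
    have hd2 : Symb (m - 1) (deriv f) := fun n => (h (n + 1)).2.2
    have h2 := (hd2.neg n).mul (ih.mul ih)
    rw [show m - 1 + (-m + -m) = -m - 1 by ring] at h2
    refine h2.congr (hd.mono fun x hx => ?_)
    rw [hx.deriv]
    ring

/-- A function that tends to zero is estimated by its derivative. -/
theorem isBigO_of_deriv {u u' : ℝ → ℝ} {s : ℝ} (hs : 0 < s) (h0 : Tendsto u atTop (nhds 0))
    (hd : ∀ᶠ x in atTop, HasDerivAt u (u' x) x) (hu : u' =O[atTop] fun x : ℝ => x ^ (-s - 1)) :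
    u =O[atTop] fun x : ℝ => x ^ (-s) := by
  obtain ⟨C, hC⟩ := hu.bound
  obtain ⟨a, ha⟩ := eventually_atTop.1 ((hC.and hd).and (eventually_gt_atTop 0))
  have hpow : Tendsto (fun x : ℝ => C / s * x ^ (-s)) atTop (nhds 0) := by
    simpa using (tendsto_rpow_neg_atTop hs).const_mul (C / s)
  have hdp : ∀ x : ℝ, a ≤ x → HasDerivAt (fun x : ℝ => C / s * x ^ (-s)) (-(C * x ^ (-s - 1))) x := by
    intro x hx
    have := (Real.hasDerivAt_rpow_const (p := -s) (Or.inl (ha x hx).2.ne')).const_mul (C / s)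
    refine this.congr_deriv ?_
    field_simp
  have hb : ∀ x, a ≤ x → |u' x| ≤ C * x ^ (-s - 1) := by
    intro x hx
    have h1 := (ha x hx).1.1
    have := (ha x hx).2
    rwa [Real.norm_eq_abs, Real.norm_of_nonneg (by positivity)] at h1
  -- The functions `u ± (C/s) x^(-s)` are monotone in opposite directions and tend to `0`, which
  -- encloses `u`.
  have hanti : AntitoneOn (fun x => u x + C / s * x ^ (-s)) (Set.Ici a) := by
    refine antitoneOn_of_hasDerivWithinAt_nonpos (convex_Ici a)
      (fun x hx => ((ha x hx).1.2.fun_add (hdp x hx)).continuousAt.continuousWithinAt)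
      (fun x hx => ((ha x (interior_subset hx)).1.2.fun_add
        (hdp x (interior_subset hx))).hasDerivWithinAt) fun x hx => ?_
    have := abs_le.1 (hb x (interior_subset hx))
    linarith
  have hmono : MonotoneOn (fun x => u x - C / s * x ^ (-s)) (Set.Ici a) := by
    refine monotoneOn_of_hasDerivWithinAt_nonneg (convex_Ici a)
      (fun x hx => ((ha x hx).1.2.fun_sub (hdp x hx)).continuousAt.continuousWithinAt)
      (fun x hx => ((ha x (interior_subset hx)).1.2.fun_sub
        (hdp x (interior_subset hx))).hasDerivWithinAt) fun x hx => ?_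
    have := abs_le.1 (hb x (interior_subset hx))
    linarith
  have l1 : Tendsto (fun x => u x + C / s * x ^ (-s)) atTop (nhds 0) := by simpa using h0.add hpow
  have l2 : Tendsto (fun x => u x - C / s * x ^ (-s)) atTop (nhds 0) := by simpa using h0.sub hpow
  refine IsBigO.of_bound (C / s) ?_
  filter_upwards [eventually_ge_atTop a] with x hx
  have hx0 := (ha x hx).2
  rw [Real.norm_eq_abs, Real.norm_of_nonneg (by positivity), abs_le]
  constructor
  · have : 0 ≤ u x + C / s * x ^ (-s) := le_of_tendsto l1 (by
      filter_upwards [eventually_ge_atTop x] with y hy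
      exact hanti hx (hx.trans hy) hy)
    linarith
  · have : u x - C / s * x ^ (-s) ≤ 0 := ge_of_tendsto l2 (by
      filter_upwards [eventually_ge_atTop x] with y hy
      exact hmono hx (hx.trans hy) hy)
    linarith

/-- Inversion of the operator `4 x d / dx + 2` on functions that are `o(x ^ (-1 / 2))`. -/
theorem Symb.of_euler {d d' ρ : ℝ → ℝ} {m m₀ : ℝ} (hm₀ : m₀ < -1 / 2) (hm : m < -1 / 2)
    (h0 : d =O[atTop] fun x : ℝ => x ^ m₀) (hd : ∀ᶠ x in atTop, HasDerivAt d (d' x) x)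
    (he : ∀ᶠ x in atTop, 4 * x * d' x + 2 * d x = ρ x) (hρ : Symb m ρ) : Symb m d := by
  -- `x^(1/2)` is the integrating factor. The kernel of the operator is spanned by `x^(-1/2)`, which
  -- the a priori order `m₀ < -1/2` excludes.
  have h1 : Tendsto (fun x : ℝ => x ^ (1 / 2 : ℝ) * d x) atTop (nhds 0) := by
    have h2 : (fun x : ℝ => x ^ (1 / 2 : ℝ) * d x) =O[atTop] fun x : ℝ => x ^ (-(-1 / 2 - m₀)) := by
      refine ((isBigO_refl _ _).mul h0).congr' EventuallyEq.rfl
        ((rpow_mul_rpow_eventuallyEq _ _).trans ?_)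
      rw [show (1 / 2 : ℝ) + m₀ = -(-1 / 2 - m₀) by ring]
    exact h2.trans_tendsto (tendsto_rpow_neg_atTop (by linarith))
  have h2 : ∀ᶠ x : ℝ in atTop, HasDerivAt (fun x : ℝ => x ^ (1 / 2 : ℝ) * d x)
      (1 / 4 * (x ^ (-1 / 2 : ℝ) * ρ x)) x := by
    filter_upwards [hd, he, eventually_gt_atTop 0, hasDerivAt_rpow_eventually (1 / 2)]
      with x hx he hx0 hp
    refine (hp.fun_mul hx).congr_deriv ?_
    rw [← he, show (1 / 2 - 1 : ℝ) = -1 / 2 by norm_num]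
    have : x ^ (1 / 2 : ℝ) = x * x ^ (-1 / 2 : ℝ) := by
      nth_rewrite 2 [← Real.rpow_one x]
      rw [← Real.rpow_add hx0]; norm_num
    rw [this]
    ring
  have h3 : (fun x : ℝ => x ^ (1 / 2 : ℝ) * d x) =O[atTop] fun x : ℝ => x ^ (-(-1 / 2 - m)) := by
    refine isBigO_of_deriv (by linarith) h1 h2 ?_
    refine (((isBigO_refl (fun x : ℝ => x ^ (-1 / 2 : ℝ)) atTop).mul hρ.isBigO).const_mul_left
      (1 / 4)).congr' EventuallyEq.rfl ((rpow_mul_rpow_eventuallyEq _ _).trans ?_)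
    rw [show -1 / 2 + m = -(-1 / 2 - m) - 1 by ring]
  have h4 : d =O[atTop] fun x : ℝ => x ^ m := by
    have h5 := ((isBigO_refl (fun x : ℝ => x ^ (-1 / 2 : ℝ)) atTop).mul h3)
    refine h5.congr' ?_ ((rpow_mul_rpow_eventuallyEq _ _).trans ?_)
    · filter_upwards [eventually_gt_atTop 0] with x hx
      rw [← mul_assoc, ← Real.rpow_add hx]
      norm_num
    · rw [show -1 / 2 + -(-1 / 2 - m) = m by ring]
  -- The size of `d` is settled; the equation expresses `d'` by `d` and `ρ`, so the bounds on
  -- derivatives follow by induction on their number.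
  have hd' : d' =ᶠ[atTop] fun x => x ^ (-1 : ℝ) * (1 / 4 * (ρ x - 2 * d x)) := by
    filter_upwards [he, eventually_gt_atTop 0] with x he hx
    rw [← he, Real.rpow_neg_one]
    field_simp
    ring
  intro n
  induction n with
  | zero => exact h4
  | succ n ih =>
    refine ⟨h4, hd.mono fun x hx => hx.differentiableAt, ?_⟩
    have h6 := (Symb.const (-2) n).mul ih
    rw [zero_add] at h6
    have h7 := (Symb.rpow (-1) n).mul ((Symb.const (1 / 4) n).mul ((hρ n).add h6))
    rw [show -1 + (0 + m) = m - 1 by ring] at h7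
    refine h7.congr ?_
    filter_upwards [hd', hd] with x h8 h9
    rw [h9.deriv, h8]
    ring

end Symbols

/-! ### Asymptotic expansions in steps of `3/2`. -/

section Expansions

/-- Finite sums of powers in steps of `3 / 2`. -/
def powSum (α : ℝ) (c : ℕ → ℝ) (N : ℕ) (x : ℝ) : ℝ :=
  ∑ k ∈ Finset.range N, c k * x ^ (α - 3 * (k : ℝ) / 2)

/-- `f` has the asymptotic expansion with coefficients `c` to order `N`. -/
def HasExp (α : ℝ) (c : ℕ → ℝ) (N : ℕ) (f : ℝ → ℝ) : Prop :=
  Symb (α - 3 * (N : ℝ) / 2) fun x => f x - powSum α c N x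

theorem powSum_succ (α : ℝ) (c : ℕ → ℝ) (N : ℕ) (x : ℝ) :
    powSum α c (N + 1) x = powSum α c N x + c N * x ^ (α - 3 * (N : ℝ) / 2) :=
  Finset.sum_range_succ _ _

theorem powSum_succ' (α : ℝ) (c : ℕ → ℝ) (N : ℕ) (x : ℝ) :
    powSum α c (N + 1) x = c 0 * x ^ α + powSum (α - 3 / 2) (fun k => c (k + 1)) N x := by
  rw [powSum, Finset.sum_range_succ', add_comm]
  congr 1
  · simp
  · refine Finset.sum_congr rfl fun k _ => ?_
    congr 2
    push_cast
    ring

theorem powSum_add (α : ℝ) (c d : ℕ → ℝ) (N : ℕ) (x : ℝ) :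
    powSum α (fun k => c k + d k) N x = powSum α c N x + powSum α d N x := by
  simp only [powSum, add_mul, Finset.sum_add_distrib]

theorem powSum_const_mul (α : ℝ) (a : ℝ) (c : ℕ → ℝ) (N : ℕ) (x : ℝ) :
    powSum α (fun k => a * c k) N x = a * powSum α c N x := by
  simp only [powSum, mul_assoc, Finset.mul_sum]

theorem mul_powSum (α : ℝ) (c : ℕ → ℝ) (N : ℕ) {x : ℝ} (hx : 0 < x) :
    x * powSum α c N x = powSum (α + 1) c N x := by
  rw [powSum, Finset.mul_sum]
  refine Finset.sum_congr rfl fun k _ => ?_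
  rw [show α + 1 - 3 * (k : ℝ) / 2 = α - 3 * (k : ℝ) / 2 + 1 by ring, Real.rpow_add_one hx.ne']
  ring

theorem hasDerivAt_powSum (α : ℝ) (c : ℕ → ℝ) (N : ℕ) {x : ℝ} (hx : 0 < x) :
    HasDerivAt (powSum α c N) (powSum (α - 1) (fun k => (α - 3 * (k : ℝ) / 2) * c k) N x) x := by
  refine (HasDerivAt.fun_sum fun (k : ℕ) _ => (Real.hasDerivAt_rpow_const
    (p := α - 3 * (k : ℝ) / 2) (Or.inl hx.ne')).const_mul (c k)).congr_deriv ?_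
  refine Finset.sum_congr rfl fun k _ => ?_
  rw [show α - 1 - 3 * (k : ℝ) / 2 = α - 3 * (k : ℝ) / 2 - 1 by ring]
  ring

theorem sym_powSum (α : ℝ) (c : ℕ → ℝ) (N : ℕ) : Symb α (powSum α c N) :=
  Symb.sum _ fun k _ => (Symb.const_mul_rpow _ _).mono (by
    have : (0 : ℝ) ≤ k := k.cast_nonneg
    linarith)

theorem HasExp.sym {α : ℝ} {c : ℕ → ℝ} {N : ℕ} {f : ℝ → ℝ} (h : HasExp α c N f) : Symb α f := by
  have h1 : Symb α fun x => f x - powSum α c N x := Symb.mono h (by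
    have : (0 : ℝ) ≤ N := N.cast_nonneg
    linarith)
  simpa using h1.add (sym_powSum α c N)

theorem HasExp.sum {ι : Type*} (s : Finset ι) {α : ℝ} {c : ι → ℕ → ℝ} {N : ℕ} {f : ι → ℝ → ℝ}
    (h : ∀ i ∈ s, HasExp α (c i) N (f i)) :
    HasExp α (fun k => ∑ i ∈ s, c i k) N fun x => ∑ i ∈ s, f i x := by
  refine Symb.congr (Symb.sum s h) (Eventually.of_forall fun x => ?_)
  simp only [powSum, Finset.sum_mul]
  rw [Finset.sum_comm, Finset.sum_sub_distrib]

theorem HasExp.mul {α β : ℝ} {c d : ℕ → ℝ} {N : ℕ} {f g : ℝ → ℝ} (hf : HasExp α c N f)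
    (hg : HasExp β d N g) :
    HasExp (α + β) (fun k => ∑ p ∈ Finset.HasAntidiagonal.antidiagonal k, c p.1 * d p.2) N fun x => f x * g x := by
  have h1 := hf.sym.mul hg
  have h2 := Symb.mul hf (sym_powSum β d N)
  have h3 : Symb (α + β - 3 * (N : ℝ) / 2) fun x => ∑ p ∈ (Finset.range N ×ˢ Finset.range N).filter
      (fun p => ¬ p.1 + p.2 < N), (c p.1 * d p.2) * x ^ (α + β - 3 * ((p.1 + p.2 : ℕ) : ℝ) / 2) := by
    refine Symb.sum _ fun p hp => (Symb.const_mul_rpow _ _).mono ?_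
    have : N ≤ p.1 + p.2 := not_lt.1 (Finset.mem_filter.1 hp).2
    have : (N : ℝ) ≤ ((p.1 + p.2 : ℕ) : ℝ) := by exact_mod_cast this
    linarith
  rw [show α + (β - 3 * (N : ℝ) / 2) = α + β - 3 * (N : ℝ) / 2 by ring] at h1
  rw [show α - 3 * (N : ℝ) / 2 + β = α + β - 3 * (N : ℝ) / 2 by ring] at h2
  refine ((h1.add h2).add h3).congr ?_
  filter_upwards [eventually_gt_atTop 0] with x hx
  have e1 : powSum α c N x * powSum β d N x = ∑ p ∈ Finset.range N ×ˢ Finset.range N,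
      (c p.1 * d p.2) * x ^ (α + β - 3 * ((p.1 + p.2 : ℕ) : ℝ) / 2) := by
    rw [powSum, powSum, Finset.sum_mul_sum, Finset.sum_product]
    refine Finset.sum_congr rfl fun i _ => Finset.sum_congr rfl fun j _ => ?_
    rw [show α + β - 3 * ((i + j : ℕ) : ℝ) / 2 = (α - 3 * (i : ℝ) / 2) + (β - 3 * (j : ℝ) / 2) by
      push_cast; ring, Real.rpow_add hx]
    ring
  have e2 : powSum (α + β) (fun k => ∑ p ∈ Finset.HasAntidiagonal.antidiagonal k, c p.1 * d p.2) N x =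
      ∑ p ∈ (Finset.range N ×ˢ Finset.range N).filter (fun p => p.1 + p.2 < N),
        (c p.1 * d p.2) * x ^ (α + β - 3 * ((p.1 + p.2 : ℕ) : ℝ) / 2) := by
    rw [← Finset.sum_fiberwise_of_maps_to (t := Finset.range N) (g := fun p : ℕ × ℕ => p.1 + p.2)
      (fun p hp => Finset.mem_range.2 (Finset.mem_filter.1 hp).2), powSum]
    refine Finset.sum_congr rfl fun k hk => ?_
    rw [Finset.sum_mul]
    have e3 : ((Finset.range N ×ˢ Finset.range N).filter (fun p => p.1 + p.2 < N)).filter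
        (fun p => p.1 + p.2 = k) = Finset.HasAntidiagonal.antidiagonal k := by
      ext p
      simp only [Finset.mem_filter, Finset.mem_product, Finset.mem_range, Finset.HasAntidiagonal.mem_antidiagonal]
        at hk ⊢
      omega
    rw [e3]
    refine Finset.sum_congr rfl fun p hp => ?_
    rw [Finset.HasAntidiagonal.mem_antidiagonal.1 hp]
  have e4 := Finset.sum_filter_add_sum_filter_not (Finset.range N ×ˢ Finset.range N)
    (fun p => p.1 + p.2 < N)
    (fun p => (c p.1 * d p.2) * x ^ (α + β - 3 * ((p.1 + p.2 : ℕ) : ℝ) / 2))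
  rw [← e1, ← e2] at e4
  linear_combination e4

/-- One more term of the expansion from the differential equation. -/
theorem HasExp.step {q q₁ q₂ r r₁ : ℝ → ℝ} {c s : ℕ → ℝ} {M : ℕ}
    (hq : HasExp (-1 / 2) c (M + 1) q) (hr : HasExp (-1) s (M + 1) r)
    (h1 : ∀ᶠ x in atTop, HasDerivAt q (q₁ x) x) (h2 : ∀ᶠ x in atTop, HasDerivAt q₁ (q₂ x) x)
    (h3 : ∀ᶠ x in atTop, HasDerivAt q₂ (4 * x * q₁ x + 2 * q x - 6 * r₁ x) x)
    (h4 : ∀ᶠ x in atTop, HasDerivAt r (r₁ x) x)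
    (rec0 : c 1 = s 0)
    (rec1 : ∀ k : ℕ, 6 * ((k : ℝ) + 2) * c (k + 2) = 6 * (1 + 3 * ((k : ℝ) + 1) / 2) * s (k + 1) -
      (-1 / 2 - 3 * (k : ℝ) / 2) * (-1 / 2 - 3 * (k : ℝ) / 2 - 1) * (-1 / 2 - 3 * (k : ℝ) / 2 - 2)
        * c k) :
    HasExp (-1 / 2) c (M + 2) q := by
  set c₁ : ℕ → ℝ := fun k => (-1 / 2 - 3 * (k : ℝ) / 2) * c k with hc₁
  set c₂ : ℕ → ℝ := fun k => (-1 / 2 - 1 - 3 * (k : ℝ) / 2) * c₁ k with hc₂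
  set c₃ : ℕ → ℝ := fun k => (-1 / 2 - 1 - 1 - 3 * (k : ℝ) / 2) * c₂ k with hc₃
  set s₁ : ℕ → ℝ := fun k => (-1 - 3 * (k : ℝ) / 2) * s k with hs₁
  set d : ℝ → ℝ := fun x => q x - powSum (-1 / 2) c (M + 2) x with hd
  have hM0 : (0 : ℝ) ≤ M := M.cast_nonneg
  have d1 : ∀ᶠ x in atTop, HasDerivAt d (q₁ x - powSum (-1 / 2 - 1) c₁ (M + 2) x) x := by
    filter_upwards [h1, eventually_gt_atTop 0] with x hx hx0
    exact hx.fun_sub (hasDerivAt_powSum _ _ _ hx0)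
  have d2 : ∀ᶠ x in atTop, HasDerivAt (fun x => q₁ x - powSum (-1 / 2 - 1) c₁ (M + 2) x)
      (q₂ x - powSum (-1 / 2 - 1 - 1) c₂ (M + 2) x) x := by
    filter_upwards [h2, eventually_gt_atTop 0] with x hx hx0
    exact hx.fun_sub (hasDerivAt_powSum _ _ _ hx0)
  have d3 : ∀ᶠ x in atTop, HasDerivAt (fun x => q₂ x - powSum (-1 / 2 - 1 - 1) c₂ (M + 2) x)
      (4 * x * q₁ x + 2 * q x - 6 * r₁ x - powSum (-1 / 2 - 1 - 1 - 1) c₃ (M + 2) x) x := by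
    filter_upwards [h3, eventually_gt_atTop 0] with x hx hx0
    exact hx.fun_sub (hasDerivAt_powSum _ _ _ hx0)
  have r1 : ∀ᶠ x in atTop, HasDerivAt (fun x => r x - powSum (-1) s (M + 1) x)
      (r₁ x - powSum (-1 - 1) s₁ (M + 1) x) x := by
    filter_upwards [h4, eventually_gt_atTop 0] with x hx hx0
    exact hx.fun_sub (hasDerivAt_powSum _ _ _ hx0)
  -- Removing one further term from the remainder does not spoil the order already known.
  have hdsym : Symb (-1 / 2 - 3 * ((M + 1 : ℕ) : ℝ) / 2) d := by
    refine Symb.congr (Symb.sub hq (Symb.const_mul_rpow (c (M + 1)) _))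
      (Eventually.of_forall fun x => ?_)
    simp only [hd]
    rw [powSum_succ _ _ (M + 1)]
    ring
  have hd3 := ((hdsym.hasDerivAt d1).hasDerivAt d2).hasDerivAt d3
  have hr1 := Symb.hasDerivAt hr r1
  have hlast := (Symb.const_mul_rpow (c₃ M) (-1 / 2 - 3 * ((M + 2 : ℕ) : ℝ) / 2)).add
    ((Symb.const_mul_rpow (c₃ (M + 1)) (-1 / 2 - 3 * ((M + 3 : ℕ) : ℝ) / 2)).mono
      (m' := -1 / 2 - 3 * ((M + 2 : ℕ) : ℝ) / 2) (by push_cast; linarith))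
  -- The remainder satisfies `4 x d' + 2 d = d''' + 6 (remainder of r)' + two last terms`. The known
  -- order of `d` enters only through `d'''`, so every term on the right is better by at least
  -- `3/2`.
  refine Symb.of_euler (m₀ := -1 / 2 - 3 * ((M + 1 : ℕ) : ℝ) / 2) (by push_cast; linarith)
    (by push_cast; linarith) hdsym.isBigO d1 ?_
    (((hd3.mono (m' := -1 / 2 - 3 * ((M + 2 : ℕ) : ℝ) / 2) (by push_cast; linarith)).add
      ((hr1.mono (m' := -1 / 2 - 3 * ((M + 2 : ℕ) : ℝ) / 2)
        (by push_cast; linarith)).const_mul 6)).add hlast)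
  filter_upwards [eventually_gt_atTop 0] with x hx
  have k1 : 4 * x * powSum (-1 / 2 - 1) c₁ (M + 2) x + 2 * powSum (-1 / 2) c (M + 2) x
      = powSum (-1 / 2) (fun k => 4 * c₁ k + 2 * c k) (M + 2) x := by
    rw [powSum_add, powSum_const_mul, powSum_const_mul, mul_assoc, mul_powSum _ _ _ hx]
    norm_num
  -- On the term with index `k` the operator `4 x d/dx + 2` acts as `-6 k`. The term `k = 0` drops
  -- out, so `c 0` remains free.
  have k2 : powSum (-1 / 2) (fun k => 4 * c₁ k + 2 * c k) (M + 2) x =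
      powSum (-2) (fun k => 4 * c₁ (k + 1) + 2 * c (k + 1)) (M + 1) x := by
    rw [powSum_succ']
    simp only [hc₁]
    norm_num
    left
    ring
  have k3 : powSum (-1 / 2 - 1 - 1 - 1) c₃ (M + 2) x = powSum (-7 / 2) c₃ M x +
      c₃ M * x ^ (-1 / 2 - 3 * ((M + 2 : ℕ) : ℝ) / 2) +
      c₃ (M + 1) * x ^ (-1 / 2 - 3 * ((M + 3 : ℕ) : ℝ) / 2) := by
    rw [powSum_succ, powSum_succ]
    push_cast
    ring_nf
  have k4 : 6 * powSum (-1 - 1) s₁ (M + 1) x + powSum (-7 / 2) c₃ M x =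
      powSum (-2) (fun k => 4 * c₁ (k + 1) + 2 * c (k + 1)) (M + 1) x := by
    rw [← powSum_const_mul, powSum_succ', powSum_succ']
    have e1 : powSum (-2 - 3 / 2) (fun k => 4 * c₁ (k + 1 + 1) + 2 * c (k + 1 + 1)) M x =
        powSum (-2 - 3 / 2) (fun k => 6 * s₁ (k + 1) + c₃ k) M x := by
      congr 1
      funext k
      simp only [hc₁, hs₁, hc₃, hc₂]
      push_cast
      linear_combination -(rec1 k)
    rw [e1, powSum_add]
    simp only [hs₁, hc₁]
    norm_num
    rw [rec0]
    ring
  linear_combination -k1 - k2 + k4 + k3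

end Expansions

end

noncomputable section

open SetAlg LaplaceRep

/-! ### Laplace integrals on the diagonal as symbols. -/

section LaplaceSymbols

variable {ι : Type*} {R : LaplaceRep ι} {X : Finset ι}

theorem hasDerivAt_ev_diag {h : R.Ω → ℂ} (hh : R.Tame X h) {x : ℝ} (hx : 0 < x) :
    HasDerivAt (fun x : ℝ => R.ev X h fun _ => x) (-R.ev X (fun ω => h ω * R.T X ω) fun _ => x) x := by
  have := hasDerivAt_ev hh (x := fun _ => 0) (τ := x) (by simpa using fun _ _ => hx)
  simpa only [zero_add] using this

/-- Every derivative in `x` brings down another factor `T`, worth `1/x`. -/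
theorem symbN_ev {h : R.Ω → ℂ} (hh : R.Tame X h) (n : ℕ) : ∀ k : ℕ, R.Tame X (fun ω => h ω * R.T X ω ^ k) →
    SymbN n (-(k : ℝ)) fun x => (R.ev X (fun ω => h ω * R.T X ω ^ k) fun _ => x).re := by
  induction n with
  | zero =>
    intro k _
    refine IsBigO.trans (IsBigO.of_bound 1 (Eventually.of_forall fun x => ?_)) (ev_isBigO hh k)
    rw [one_mul]
    exact Complex.abs_re_le_norm _
  | succ n ih =>
    intro k hk
    have hd : ∀ᶠ x : ℝ in atTop, HasDerivAt
        (fun x : ℝ => (R.ev X (fun ω => h ω * R.T X ω ^ k) fun _ => x).re)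
        (-(R.ev X (fun ω => h ω * R.T X ω ^ (k + 1)) fun _ => x).re) x := by
      filter_upwards [eventually_gt_atTop 0] with x hx
      refine ((hasDerivAt_ev_diag hk hx).complex_re).congr_deriv ?_
      simp only [pow_succ, mul_assoc, Complex.neg_re]
    have hk1 : R.Tame X fun ω => h ω * R.T X ω ^ (k + 1) := by
      simpa only [pow_succ, mul_assoc] using hk.mul_T
    refine ⟨?_, hd.mono fun x hx => hx.differentiableAt, ?_⟩
    · refine IsBigO.trans (IsBigO.of_bound 1 (Eventually.of_forall fun x => ?_)) (ev_isBigO hh k)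
      rw [one_mul]
      exact Complex.abs_re_le_norm _
    · have h1 := (Symb.const (-1) n).mul (ih (k + 1) hk1)
      refine (h1.congr ?_).mono (m' := -(k : ℝ) - 1) (by push_cast; linarith)
      filter_upwards [hd] with x hx
      rw [hx.deriv]
      ring

theorem tame_mul_pow {h : R.Ω → ℂ} (hh : R.Tame X h) (k : ℕ) :
    R.Tame X fun ω => h ω * R.T X ω ^ k := by
  induction k with
  | zero => simpa using hh
  | succ k ih => simpa only [pow_succ, mul_assoc] using ih.mul_T

theorem symb_ev {h : R.Ω → ℂ} (hh : R.Tame X h) (k : ℕ) :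
    Symb (-(k : ℝ)) fun x => (R.ev X (fun ω => h ω * R.T X ω ^ k) fun _ => x).re :=
  fun n => symbN_ev hh n k (tame_mul_pow hh k)

/-- A function that decays along translations is recovered from its derivative. -/
theorem eq_ev_of_shiftD {F G : (ι → ℝ) → ℝ} {h : R.Ω → ℂ} (hX : X.Nonempty)
    (hh : R.Tame X fun ω => h ω * (R.T X ω)⁻¹) {x : ι → ℝ} (hx : ∀ i, 0 < x i)
    (hd : ∀ τ : ℝ, 0 ≤ τ → HasDerivAt (fun τ : ℝ => F fun i => x i + τ) (G fun i => x i + τ) τ)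
    (hG : ∀ τ : ℝ, 0 ≤ τ → ((G fun i => x i + τ : ℝ) : ℂ) = R.ev X h fun i => x i + τ)
    (hlim : Tendsto (fun τ : ℝ => F fun i => x i + τ) atTop (nhds 0)) :
    (F x : ℂ) = -R.ev X (fun ω => h ω * (R.T X ω)⁻¹) x := by
  -- `D` is constant along the translation, because the extra `T⁻¹` is cancelled by differentiation,
  -- and it tends to `0`.
  set D : ℝ → ℂ := fun τ => ((F fun i => x i + τ : ℝ) : ℂ) +
    R.ev X (fun ω => h ω * (R.T X ω)⁻¹) fun i => x i + τ with hD
  have hD0 : ∀ τ : ℝ, 0 ≤ τ → HasDerivAt D 0 τ := by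
    intro τ hτ
    refine ((hd τ hτ).ofReal_comp.fun_add
      (hasDerivAt_ev hh fun i _ => add_pos_of_pos_of_nonneg (hx i) hτ)).congr_deriv ?_
    rw [hG τ hτ]
    simp only [inv_mul_cancel_right₀ (T_ne_zero hX _), add_neg_cancel]
  have hconst : ∀ τ : ℝ, 0 ≤ τ → D τ = D 0 := by
    intro τ hτ
    exact constant_of_has_deriv_right_zero (a := 0) (b := τ)
      (fun s hs => (hD0 s hs.1).continuousAt.continuousWithinAt)
      (fun s hs => (hD0 s hs.1).hasDerivWithinAt) τ ⟨hτ, le_rfl⟩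
  have hlimD : Tendsto D atTop (nhds 0) := by
    have h1 : Tendsto (fun τ : ℝ => ((F fun i => x i + τ : ℝ) : ℂ)) atTop (nhds ((0 : ℝ) : ℂ)) :=
      (Complex.continuous_ofReal.tendsto 0).comp hlim
    simpa using h1.add (tendsto_ev hh hX fun i _ => hx i)
  have h0 : D 0 = 0 := by
    refine tendsto_nhds_unique (tendsto_const_nhds.congr' ?_) hlimD
    filter_upwards [eventually_ge_atTop 0] with τ hτ using (hconst τ hτ).symm
  have h2 : D 0 = (F x : ℂ) + R.ev X (fun ω => h ω * (R.T X ω)⁻¹) x := by simp [hD]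
  rw [h2] at h0
  exact eq_neg_of_add_eq_zero_left h0

end LaplaceSymbols

/-! ### Asymptotics of the product `Ai Bi`. -/

section AiryProduct

/-- The difference of the densities of the product of the Airy functions and of its leading term. -/
def airyDelta (ω : ℝ × Bool) : ℂ :=
  (airyRep (Fin 1) (1 / 12)).g ω - (airyRep (Fin 1) 0).g ω

theorem airyRep_g_eq {ι : Type*} (ω : ℝ × Bool) : (airyRep ι (1 / 12)).g ω =
    (airyRep ι 0).g ω * (Real.exp (-(1 / 12 * posPart' ω.1 ^ 3)) : ℝ) := by
  simp only [airyRep]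
  push_cast
  simp
  ring

theorem norm_exp_neg_sub_one_le {s : ℝ} (hs : 0 ≤ s) :
    ‖((Real.exp (-s) : ℝ) : ℂ) - 1‖ ≤ s := by
  rw [← Complex.ofReal_one, ← Complex.ofReal_sub, Complex.norm_real, Real.norm_eq_abs, abs_le]
  have h1 := Real.add_one_le_exp (-s)
  have h2 : Real.exp (-s) ≤ 1 := Real.exp_le_one_iff.2 (by linarith)
  constructor <;> linarith

theorem airyRep_norm_g_zero {ι : Type*} {ω : ℝ × Bool} (hω : 0 < ω.1) :
    ‖(airyRep ι 0).g ω‖ = 1 / (4 * √Real.pi) * ω.1 ^ (-1 / 2 : ℝ) := by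
  rw [airyRep_norm_g, posPart'_of_pos hω]; simp

theorem measurable_airyDelta : Measurable airyDelta :=
  (airyRep (Fin 1) (1 / 12)).measurable_g.sub (airyRep (Fin 1) 0).measurable_g

theorem norm_airyDelta_le {ω : ℝ × Bool} (hω : 0 < ω.1) :
    ‖airyDelta ω‖ ≤ 1 / (4 * √Real.pi) * (ω.1 ^ (-1 / 2 : ℝ) * ω.1 ^ 3) := by
  have e : airyDelta ω = (airyRep (Fin 1) 0).g ω *
      (((Real.exp (-(1 / 12 * ω.1 ^ 3)) : ℝ) : ℂ) - 1) := by
    rw [airyDelta, airyRep_g_eq, mul_sub, mul_one, posPart'_of_pos hω]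
  rw [e, norm_mul, airyRep_norm_g_zero hω, mul_assoc]
  have h1 : 0 < ω.1 ^ 3 := by positivity
  have := norm_exp_neg_sub_one_le (s := 1 / 12 * ω.1 ^ 3) (by positivity)
  gcongr
  linarith

theorem airyRep_T (ω : ℝ × Bool) (b : ℝ) :
    (airyRep (Fin 1) b).T Finset.univ ω = (airyRep (Fin 1) b).t ω 0 := by
  simp [LaplaceRep.T]

/-- The regularised density has three more powers of decay at zero. -/
theorem tame_airyDelta : (airyRep (Fin 1) (1 / 12)).Tame Finset.univ fun ω =>
    airyDelta ω * ((airyRep (Fin 1) (1 / 12)).T Finset.univ ω)⁻¹ ^ 3 := by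
  refine airyRep_tame ⟨0, by simp⟩ (measurable_airyDelta.mul
    (((airyRep (Fin 1) (1 / 12)).measurable_T _).inv.pow_const 3)) (α := -1 / 2)
    (C := 1 / (4 * √Real.pi)) (by norm_num) 0 fun ω hω => ?_
  rw [norm_mul, norm_pow, norm_inv, airyRep_T, airyRep_norm_t, posPart'_of_pos hω]
  have h1 : 0 < ω.1 ^ 3 := by positivity
  calc ‖airyDelta ω‖ * ω.1⁻¹ ^ 3
      ≤ 1 / (4 * √Real.pi) * (ω.1 ^ (-1 / 2 : ℝ) * ω.1 ^ 3) * ω.1⁻¹ ^ 3 := by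
        gcongr; exact norm_airyDelta_le hω
    _ = _ := by
        rw [inv_pow, pow_zero]
        field_simp

theorem fin_one_univ : (Finset.univ : Finset (Fin 1)) = {0} := rfl

theorem airyRep_tame_g {b : ℝ} (hb : 0 ≤ b) :
    (airyRep (Fin 1) b).Tame Finset.univ (airyRep (Fin 1) b).g :=
  (airyRep_fine fin_one_univ hb).tame ⟨0, by simp⟩

theorem airyP_sub_eq_ev {x : Fin 1 → ℝ} (hx : ∀ i, 0 < x i) :
    ((airyP (x 0) - 1 / 2 * x 0 ^ (-1 / 2 : ℝ) : ℝ) : ℂ) =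
      (airyRep (Fin 1) (1 / 12)).ev Finset.univ airyDelta x := by
  rw [Complex.ofReal_sub, airyRep_ev_airyP fin_one_univ hx, airyRep_ev_zero fin_one_univ hx]
  have h1 := (airyRep_tame_g (b := 1 / 12) (by norm_num)).integrable (x := x) fun i _ => hx i
  have h2 := (airyRep_tame_g (b := 0) le_rfl).integrable (x := x) fun i _ => hx i
  refine (integral_sub h1 h2).symm.trans (integral_congr_ae (Eventually.of_forall fun ω => ?_))
  simp only [airyDelta]
  rw [sub_mul]
  rfl

/-- Of the regularised density three powers of `T` can be split off with a tame remainder, each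
worth `1/x`. The sharp order `-7/2` will come from the expansion. -/
theorem symb_airyP_sub : Symb (-3) fun x => airyP x - 1 / 2 * x ^ (-1 / 2 : ℝ) := by
  have h := symb_ev tame_airyDelta 3
  rw [Nat.cast_ofNat] at h
  refine h.congr ?_
  filter_upwards [eventually_gt_atTop 0] with x hx
  have h1 := airyP_sub_eq_ev (x := fun _ => x) fun _ => hx
  rw [← Complex.ofReal_re (airyP x - 1 / 2 * x ^ (-1 / 2 : ℝ)), h1]
  congr 1
  refine integral_congr_ae (Eventually.of_forall fun ω => ?_)
  have hT : (airyRep (Fin 1) (1 / 12)).T Finset.univ ω ≠ 0 :=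
    LaplaceRep.T_ne_zero ⟨0, by simp⟩ ω
  simp only
  congr 1
  exact (mul_assoc _ _ _).trans (by rw [← mul_pow, inv_mul_cancel₀ hT, one_pow, mul_one])

/-- The derivative of the product of the Airy functions. -/
def airyP' (x : ℝ) : ℝ := airyAi' x * airyBi x + airyAi x * airyBi' x

/-- The second derivative of the product of the Airy functions. -/
def airyP'' (x : ℝ) : ℝ := 2 * x * airyP x + 2 * (airyAi' x * airyBi' x)

theorem hasDerivAt_airyP' (x : ℝ) : HasDerivAt airyP (airyP' x) x := by
  have h := (hasDerivAt_airyAi x).fun_mul (hasDerivAt_airyBi x)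
  have e : airyP = fun x => airyAi x * airyBi x := funext airyP_eq
  rw [e]
  exact h

theorem hasDerivAt_airyP'' (x : ℝ) : HasDerivAt airyP' (airyP'' x) x := by
  have h := ((hasDerivAt_airyAi' x).fun_mul (hasDerivAt_airyBi x)).fun_add
    ((hasDerivAt_airyAi x).fun_mul (hasDerivAt_airyBi' x))
  refine h.congr_deriv ?_
  rw [airyP'', airyP_eq]
  ring

theorem symb_airyP'_add : Symb (-4) fun x => airyP' x + 1 / 4 * x ^ (-3 / 2 : ℝ) := by
  have h := symb_airyP_sub.hasDerivAt (f' := fun x => airyP' x + 1 / 4 * x ^ (-3 / 2 : ℝ)) (by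
    filter_upwards [hasDerivAt_rpow_eventually (-1 / 2)] with x hx
    refine ((hasDerivAt_airyP' x).fun_sub (hx.const_mul (1 / 2))).congr_deriv ?_
    rw [show (-1 / 2 - 1 : ℝ) = -3 / 2 by norm_num]
    ring)
  exact h.mono (by norm_num)

theorem symb_airyP''_sub : Symb (-5) fun x => airyP'' x - 3 / 8 * x ^ (-5 / 2 : ℝ) := by
  have h := symb_airyP'_add.hasDerivAt (f' := fun x => airyP'' x - 3 / 8 * x ^ (-5 / 2 : ℝ)) (by
    filter_upwards [hasDerivAt_rpow_eventually (-3 / 2)] with x hx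
    refine ((hasDerivAt_airyP'' x).fun_add (hx.const_mul (1 / 4))).congr_deriv ?_
    rw [show (-3 / 2 - 1 : ℝ) = -5 / 2 by norm_num]
    ring)
  exact h.mono (by norm_num)

theorem symb_airyP : Symb (-1 / 2) airyP := by
  simpa using (symb_airyP_sub.mono (m' := -1 / 2) (by norm_num)).add
    (Symb.const_mul_rpow (1 / 2) (-1 / 2))

theorem symb_airyP' : Symb (-3 / 2) airyP' := by
  simpa using (symb_airyP'_add.mono (m' := -3 / 2) (by norm_num)).sub
    (Symb.const_mul_rpow (1 / 4) (-3 / 2))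

theorem symb_airyP'' : Symb (-5 / 2) airyP'' := by
  simpa using (symb_airyP''_sub.mono (m' := -5 / 2) (by norm_num)).add
    (Symb.const_mul_rpow (3 / 8) (-5 / 2))

theorem Symb.tendsto_zero {m : ℝ} {f : ℝ → ℝ} (h : Symb m f) (hm : m < 0) :
    Tendsto f atTop (nhds 0) :=
  h.isBigO.trans_tendsto (by simpa using tendsto_rpow_neg_atTop (neg_pos.2 hm))

theorem tendsto_airyP_mul : Tendsto (fun x : ℝ => airyP x * x ^ (1 / 2 : ℝ)) atTop (nhds (1 / 2)) := by
  have h := ((symb_airyP_sub.mul (Symb.rpow (1 / 2))).tendsto_zero (by norm_num)).add_const (1 / 2)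
  rw [zero_add] at h
  refine h.congr' ?_
  filter_upwards [eventually_gt_atTop 0] with x hx
  have : x ^ (-1 / 2 : ℝ) * x ^ (1 / 2 : ℝ) = 1 := by rw [← Real.rpow_add hx]; norm_num
  linear_combination -(1 / 2) * this

theorem eventually_airyP_ge : ∀ᶠ x : ℝ in atTop, 1 / 4 * x ^ (-1 / 2 : ℝ) ≤ airyP x := by
  filter_upwards [tendsto_airyP_mul.eventually_const_lt (show (1 / 4 : ℝ) < 1 / 2 by norm_num),
    eventually_gt_atTop 0] with x h hx
  have : x ^ (-1 / 2 : ℝ) * x ^ (1 / 2 : ℝ) = 1 := by rw [← Real.rpow_add hx]; norm_num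
  have h0 : 0 < x ^ (-1 / 2 : ℝ) := by positivity
  nlinarith

theorem eventually_airyP_pos : ∀ᶠ x : ℝ in atTop, 0 < airyP x := by
  filter_upwards [eventually_airyP_ge, eventually_gt_atTop 0] with x h hx
  have h0 : 0 < x ^ (-1 / 2 : ℝ) := by positivity
  linarith

theorem tendsto_airyP_div (x y : ℝ) :
    Tendsto (fun τ => airyP (y + τ) / airyP (x + τ)) atTop (nhds 1) := by
  have hx : Tendsto (fun τ : ℝ => x + τ) atTop atTop := tendsto_atTop_add_const_left _ _ tendsto_id
  have hy : Tendsto (fun τ : ℝ => y + τ) atTop atTop := tendsto_atTop_add_const_left _ _ tendsto_id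
  have h1 := (tendsto_airyP_mul.comp hy).div (tendsto_airyP_mul.comp hx) (by norm_num)
  have h2 : Tendsto (fun τ : ℝ => (1 + (x - y) * (y + τ)⁻¹) ^ (1 / 2 : ℝ)) atTop (nhds 1) := by
    have h3 : Tendsto (fun τ : ℝ => 1 + (x - y) * (y + τ)⁻¹) atTop (nhds 1) := by
      simpa using ((tendsto_inv_atTop_zero.comp hy).const_mul (x - y)).const_add 1
    simpa using h3.rpow_const (p := 1 / 2) (Or.inl one_ne_zero)
  have h4 := h1.mul h2
  norm_num at h4
  refine h4.congr' ?_
  filter_upwards [hx.eventually_gt_atTop 0, hy.eventually_gt_atTop 0,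
    hx.eventually eventually_airyP_pos] with τ hx hy hp
  change airyP (y + τ) * (y + τ) ^ (1 / 2 : ℝ) / (airyP (x + τ) * (x + τ) ^ (1 / 2 : ℝ)) * _ = _
  have e : 1 + (x - y) * (y + τ)⁻¹ = (x + τ) / (y + τ) := by field_simp; ring
  rw [e, Real.div_rpow hx.le hy.le]
  have h5 : 0 < (x + τ) ^ (1 / 2 : ℝ) := by positivity
  have h6 : 0 < (y + τ) ^ (1 / 2 : ℝ) := by positivity
  field_simp

/-- With the Wronskian, the mixed products are functions of `P'` alone, so the estimates below need
only `P = Ai Bi` and its derivatives. -/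
theorem airyAi_mul_airyBi' (x : ℝ) : airyAi x * airyBi' x = (1 + airyP' x) / 2 := by
  have := wronskian_airy x
  rw [airyP']
  linarith

theorem airyAi'_mul_airyBi (x : ℝ) : airyAi' x * airyBi x = (airyP' x - 1) / 2 := by
  have := wronskian_airy x
  rw [airyP']
  linarith

end AiryProduct

/-! ### The correlators as Laplace integrals. -/

section Correlators

/-- After conjugation by `Ai` the kernel depends only on `P` and `P'`; as `P' → 0` and the ratio of
values of `P` tends to `1`, the numerator tends to `1`. -/
theorem tendsto_airyK_ratio (x y : ℝ) :
    Tendsto (fun τ => airyK (x + τ) (y + τ) * (airyAi (y + τ) / airyAi (x + τ))) atTop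
      (nhds (x - y)⁻¹) := by
  have hx : Tendsto (fun τ : ℝ => x + τ) atTop atTop := tendsto_atTop_add_const_left _ _ tendsto_id
  have hy : Tendsto (fun τ : ℝ => y + τ) atTop atTop := tendsto_atTop_add_const_left _ _ tendsto_id
  have hP' := symb_airyP'.tendsto_zero (by norm_num)
  have h1 : Tendsto (fun τ => ((1 + airyP' (y + τ)) / 2 - airyP (y + τ) / airyP (x + τ) *
      ((airyP' (x + τ) - 1) / 2)) * (x - y)⁻¹) atTop
      (nhds (((1 + 0) / 2 - 1 * ((0 - 1) / 2)) * (x - y)⁻¹)) :=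
    ((((hP'.comp hy).const_add 1).div_const 2).sub ((tendsto_airyP_div x y).mul
      (((hP'.comp hx).sub_const 1).div_const 2))).mul_const _
  norm_num at h1
  refine h1.congr' ?_
  filter_upwards [hx.eventually eventually_airyP_pos] with τ hp
  rw [airyP_eq] at hp
  have hA : airyAi (x + τ) ≠ 0 := fun h => by rw [h] at hp; simp at hp
  have hB : airyBi (x + τ) ≠ 0 := fun h => by rw [h] at hp; simp at hp
  rw [← airyAi_mul_airyBi', ← airyAi'_mul_airyBi, airyP_eq, airyP_eq, airyK, deriv_airyAi,
    deriv_airyBi, add_sub_add_right_eq_sub, div_eq_mul_inv _ (x - y)]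
  field_simp

theorem sum_cycles_two (F : Fin 2 → Fin 2 → ℝ) :
    ∑ σ : Equiv.Perm (Fin 2) with σ.cycleType = {2}, ∏ i, F i (σ i) = F 0 1 * F 1 0 := by
  have h := sum_cycles_eq (n := 0) F
  have h2 : ∑ w : Equiv.Perm (Fin (0 + 2)), ∏ k, F (w k) (w (k + 1)) = 2 * (F 0 1 * F 1 0) := by
    rw [show (Finset.univ : Finset (Equiv.Perm (Fin (0 + 2)))) = {1, Equiv.swap 0 1} by decide]
    rw [Finset.sum_pair (by decide)]
    simp [Fin.prod_univ_two]
    ring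
  rw [h2] at h
  norm_num at h
  simpa using h

/-- The correlators tend to zero along translations. -/
theorem tendsto_airyW {n : ℕ} {x : Fin (n + 2) → ℝ} (hx : Function.Injective x) :
    Tendsto (fun τ : ℝ => airyW (n + 2) fun i => x i + τ) atTop (nhds 0) := by
  have hprod : ∀ σ : Equiv.Perm (Fin (n + 2)), Tendsto
      (fun τ : ℝ => ∏ i, airyK (x i + τ) (x (σ i) + τ)) atTop (nhds (∏ i, (x i - x (σ i))⁻¹)) := by
    intro σ
    have h := tendsto_finsetProd Finset.univ fun (i : Fin (n + 2)) _ => tendsto_airyK_ratio (x i) (x (σ i))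
    refine h.congr' ?_
    have hA : ∀ᶠ τ : ℝ in atTop, ∀ i, airyAi (x i + τ) ≠ 0 := by
      rw [eventually_all]
      intro i
      have hxi : Tendsto (fun τ : ℝ => x i + τ) atTop atTop :=
        tendsto_atTop_add_const_left _ _ tendsto_id
      filter_upwards [hxi.eventually eventually_airyP_pos] with τ hp h
      rw [airyP_eq, h] at hp
      simp at hp
    -- Along a permutation the conjugating ratios multiply to `1`, so the products of kernels and of
    -- conjugated kernels agree.
    filter_upwards [hA] with τ hτ
    rw [Finset.prod_mul_distrib, Finset.prod_div_distrib,
      Equiv.prod_comp σ fun i => airyAi (x i + τ), div_self, mul_one]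
    exact Finset.prod_ne_zero_iff.2 fun i _ => hτ i
  have hsum := tendsto_finsetSum (Finset.univ.filter fun σ : Equiv.Perm (Fin (n + 2)) =>
    σ.cycleType = {n + 2}) fun σ _ => hprod σ
  have hW := (hsum.const_mul ((-1) ^ (n + 2))).const_sub
    (-(if n = 0 then 1 / (x 0 - x 1) ^ 2 else 0))
  -- For two points the limit of the cyclic sum is `-1 / (x 0 - x 1)^2` and cancels the explicit
  -- double pole; for more points it vanishes by itself.
  have h0 : -(if n = 0 then 1 / (x 0 - x 1) ^ 2 else 0) - (-1) ^ (n + 2) *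
      ∑ σ : Equiv.Perm (Fin (n + 2)) with σ.cycleType = {n + 2}, ∏ i, (x i - x (σ i))⁻¹ = 0 := by
    rcases n with _ | n
    · have h01 : x 0 - x 1 ≠ 0 := sub_ne_zero.2 (hx.ne (by decide))
      have h10 : x 1 - x 0 ≠ 0 := sub_ne_zero.2 (hx.ne (by decide))
      have := sum_cycles_two fun i j => (x i - x j)⁻¹
      simp only [zero_add] at this ⊢
      rw [this]
      have e : (x 1 - x 0)⁻¹ = -(x 0 - x 1)⁻¹ := by rw [← inv_neg, neg_sub]
      rw [e, if_pos trivial, one_div, ← inv_pow]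
      ring
    · rw [sum_cycles_inv_sub_eq_zero hx]
      simp
  rw [h0] at hW
  refine hW.congr fun τ => ?_
  simp only [airyW, add_sub_add_right_eq_sub]

theorem hasDerivAt_airyW {n : ℕ} {x : Fin (n + 2) → ℝ} (hx : Function.Injective x) (t : ℝ) :
    HasDerivAt (fun τ : ℝ => airyW (n + 2) fun i => x i + τ)
      ((-1) ^ (n + 2) * airyChain Finset.univ fun i => x i + t) t := by
  have h := hasDerivAt_sum_cycles (t := t) (a := fun i => airyAi (x i + t))
    (b := fun i => airyBi (x i + t)) (K := fun t i j => airyK (x i + t) (x j + t))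
    fun i j hij => hasDerivAt_airyK (hx.ne hij)
  have h2 := (h.const_mul ((-1) ^ (n + 2))).const_sub
    (-(if n = 0 then 1 / (x 0 - x 1) ^ 2 else 0))
  refine (h2.congr_deriv ?_).congr_of_eventuallyEq (Eventually.of_forall fun τ => ?_)
  · rw [airyChain]; ring
  · simp only [airyW, add_sub_add_right_eq_sub]

/-- The correlators of at least three points as Laplace integrals. -/
theorem airyW_eq_ev {n : ℕ} {R : LaplaceRep (Fin (n + 3))} (hR : R.Fine Finset.univ)
    (he : ∀ x : Fin (n + 3) → ℝ, Function.Injective x → (∀ i, 0 < x i) →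
      (airyChain Finset.univ x : ℂ) = R.ev Finset.univ R.g x)
    {x : Fin (n + 3) → ℝ} (hx : Function.Injective x) (hx0 : ∀ i, 0 < x i) :
    (airyW (n + 3) x : ℂ) =
      R.ev Finset.univ (fun ω => (-1) ^ n * (R.g ω * (R.T Finset.univ ω)⁻¹)) x := by
  have hne : (Finset.univ : Finset (Fin (n + 3))).Nonempty := ⟨0, by simp⟩
  have h3 := hR.vstrong (by simp)
  have ht : R.Tame Finset.univ fun ω => R.g ω * (R.T Finset.univ ω)⁻¹ := by
    refine (h3.mul_prod (Finset.Subset.refl _)).mono' (R.measurable_g.mul (R.measurable_T _).inv) 1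
      fun ω => ?_
    rw [one_mul]
    refine le_of_eq (congrArg _ ?_)
    have : (∏ i, (R.t ω i)⁻¹) * ∏ i, R.t ω i = 1 := by
      rw [← Finset.prod_mul_distrib, Finset.prod_eq_one]
      exact fun i _ => inv_mul_cancel₀ (ne_zero ω i)
    linear_combination -(R.g ω * (R.T Finset.univ ω)⁻¹) * this
  have hinj : ∀ τ : ℝ, Function.Injective fun i => x i + τ := fun τ i j h => hx (by simpa using h)
  have h := eq_ev_of_shiftD (R := R) (X := Finset.univ) (F := fun x => (-1) ^ (n + 3) * airyW (n + 3) x)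
    (G := airyChain Finset.univ) (h := R.g) hne ht hx0
    (fun τ _ => ((hasDerivAt_airyW (n := n + 1) hx τ).const_mul _).congr_deriv (by
      rw [← mul_assoc, ← mul_pow]; simp))
    (fun τ hτ => he _ (hinj τ) fun i => add_pos_of_pos_of_nonneg (hx0 i) hτ)
    (by simpa using (tendsto_airyW (n := n + 1) hx).const_mul ((-1 : ℝ) ^ (n + 3)))
  rw [ev_const_mul]
  push_cast at h
  have h5 : ((-1 : ℂ) ^ n) * (-1) ^ n = 1 := by rw [← mul_pow]; simp
  have h6 : ((-1 : ℂ)) ^ (n + 3) = -(-1) ^ n := by ring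
  rw [h6] at h
  linear_combination (-(-1 : ℂ) ^ n) * h - (airyW (n + 3) x : ℂ) * h5

/-- From `P'' = 2 x P + 2 Ai' Bi'` one has `W_1 = P''/2 - 2 x P`, which makes the decay of the
regularised `W_1` visible. -/
theorem airyWReg_one_eq (x : ℝ) (hx : 0 < x) : airyWReg 1 (fun _ => x) =
    1 / 2 * airyP'' x - 2 * (x * (airyP x - 1 / 2 * x ^ (-1 / 2 : ℝ))) := by
  have h : x * x ^ (-1 / 2 : ℝ) = √x := by
    rw [Real.sqrt_eq_rpow]
    nth_rewrite 1 [← Real.rpow_one x]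
    rw [← Real.rpow_add hx]; norm_num
  simp only [airyWReg, airyW, deriv_airyAi, deriv_airyBi]
  rw [airyP'', mul_assoc x, ← airyP_eq]
  linear_combination -h

/-- By the Airy equation `(Ai' Bi')' = x P'`, hence `W_1' = -P`: the one point case of `∂W_n =
(-1)^n F_n`. -/
theorem hasDerivAt_airyWReg_one {x : ℝ} (hx : 0 < x) :
    HasDerivAt (fun x => airyWReg 1 fun _ => x) (-(airyP x - 1 / 2 * x ^ (-1 / 2 : ℝ))) x := by
  have h1 := (((hasDerivAt_airyAi' x).fun_mul (hasDerivAt_airyBi' x)).fun_sub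
    ((hasDerivAt_id x).fun_mul (hasDerivAt_airyP' x))).fun_add
      (Real.hasDerivAt_rpow_const (p := 1 / 2) (Or.inl hx.ne'))
  refine (h1.congr_deriv ?_).congr_of_eventuallyEq (Eventually.of_forall fun y => ?_)
  · rw [airyP', show (1 / 2 - 1 : ℝ) = -1 / 2 by norm_num]
    simp only [id]
    ring
  · simp only [airyWReg, airyW, deriv_airyAi, deriv_airyBi, id]
    rw [mul_assoc y, ← airyP_eq, Real.sqrt_eq_rpow]

theorem airyWReg_one_eq_ev_of {R : LaplaceRep (Fin 1)} {h : R.Ω → ℂ}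
    (ht : R.Tame Finset.univ fun ω => h ω * (R.T Finset.univ ω)⁻¹)
    (he : ∀ x : Fin 1 → ℝ, (∀ i, 0 < x i) →
      ((airyP (x 0) - 1 / 2 * x 0 ^ (-1 / 2 : ℝ) : ℝ) : ℂ) = R.ev Finset.univ h x)
    {x : Fin 1 → ℝ} (hx0 : ∀ i, 0 < x i) :
    ((airyWReg 1 x : ℝ) : ℂ) = R.ev Finset.univ (fun ω => h ω * (R.T Finset.univ ω)⁻¹) x := by
  have hne : (Finset.univ : Finset (Fin 1)).Nonempty := ⟨0, by simp⟩
  have hconst : ∀ y : Fin 1 → ℝ, y = fun _ => y 0 := fun y => by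
    funext i; rw [Subsingleton.elim i 0]
  have hx : Tendsto (fun τ : ℝ => x 0 + τ) atTop atTop :=
    tendsto_atTop_add_const_left _ _ tendsto_id
  have hd : ∀ τ : ℝ, 0 ≤ τ → HasDerivAt (fun τ => -airyWReg 1 fun i => x i + τ)
      (airyP (x 0 + τ) - 1 / 2 * (x 0 + τ) ^ (-1 / 2 : ℝ)) τ := by
    intro τ hτ
    have h1 := (hasDerivAt_airyWReg_one (add_pos_of_pos_of_nonneg (hx0 0) hτ)).neg
    have h2 := HasDerivAt.comp_const_add (x 0) τ h1
    refine (h2.congr_deriv (neg_neg _)).congr_of_eventuallyEq (Eventually.of_forall fun s => ?_)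
    exact congrArg (fun y => -airyWReg 1 y) (hconst fun i => x i + s)
  have hlim : Tendsto (fun τ : ℝ => -airyWReg 1 fun i => x i + τ) atTop (nhds 0) := by
    have h1 := ((symb_airyP''.const_mul (1 / 2)).tendsto_zero (by norm_num)).sub
      (((((Symb.rpow 1).mul symb_airyP_sub).const_mul 2)).tendsto_zero (by norm_num))
    have h2 := (h1.comp hx).neg
    rw [sub_zero, neg_zero] at h2
    refine h2.congr' ?_
    filter_upwards [hx.eventually_gt_atTop 0] with τ hτ
    rw [hconst fun i => x i + τ, airyWReg_one_eq _ hτ]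
    simp only [Function.comp_apply, Real.rpow_one]
  obtain ⟨F, hF⟩ : ∃ F : (Fin 1 → ℝ) → ℝ, ∀ y, F y = -airyWReg 1 y := ⟨_, fun _ => rfl⟩
  obtain ⟨G, hG⟩ : ∃ G : (Fin 1 → ℝ) → ℝ, ∀ y, G y = airyP (y 0) - 1 / 2 * y 0 ^ (-1 / 2 : ℝ) :=
    ⟨_, fun _ => rfl⟩
  have h := eq_ev_of_shiftD (R := R) (F := F) (G := G) (h := h) hne ht hx0
    (fun τ hτ => by
      have e : (fun τ => F fun i => x i + τ) = fun τ => -airyWReg 1 fun i => x i + τ :=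
        funext fun s => hF _
      rw [e, hG]
      exact hd τ hτ)
    (fun τ hτ => by
      rw [hG]
      exact he (fun i => x i + τ) fun i => add_pos_of_pos_of_nonneg (hx0 i) hτ)
    (by
      have e : (fun τ => F fun i => x i + τ) = fun τ => -airyWReg 1 fun i => x i + τ :=
        funext fun s => hF _
      rw [e]
      exact hlim)
  rw [hF, Complex.ofReal_neg] at h
  exact neg_injective h

theorem tame_airyDelta_inv : (airyRep (Fin 1) (1 / 12)).Tame Finset.univ fun ω =>
    airyDelta ω * ((airyRep (Fin 1) (1 / 12)).T Finset.univ ω)⁻¹ := by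
  refine Eq.mp (congrArg _ (funext fun ω => ?_)) tame_airyDelta.mul_T.mul_T
  have := inv_mul_cancel₀ (T_ne_zero (R := airyRep (Fin 1) (1 / 12)) (X := Finset.univ) ⟨0, by simp⟩ ω)
  generalize ((airyRep (Fin 1) (1 / 12)).T Finset.univ ω)⁻¹ = u at *
  generalize (airyRep (Fin 1) (1 / 12)).T Finset.univ ω = v at *
  linear_combination airyDelta ω * u * (u * v + 1) * this

theorem airyWReg_one_eq_ev {x : Fin 1 → ℝ} (hx0 : ∀ i, 0 < x i) :
    (airyWReg 1 x : ℂ) = (airyRep (Fin 1) (1 / 12)).ev Finset.univ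
      (fun ω => airyDelta ω * ((airyRep (Fin 1) (1 / 12)).T Finset.univ ω)⁻¹) x :=
  airyWReg_one_eq_ev_of tame_airyDelta_inv (fun _ hy => airyP_sub_eq_ev hy) hx0

end Correlators

end

/-! ### The two point function and its leading term. -/

noncomputable section

open SetAlg LaplaceRep

section AiryPair

theorem config_pair : Config (0 : Fin 2) 1 ∅ ∅ :=
  ⟨by decide, by simp, by simp, by simp, by simp, by simp⟩

theorem pair_univ : (insert 0 (insert 1 (∅ ∪ ∅)) : Finset (Fin 2)) = Finset.univ := by decide

/-- The representation of the pair correlator (`b = 1 / 12`) and of its leading term (`b = 0`). -/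
abbrev airyPair (b : ℝ) : LaplaceRep (Fin 2) :=
  LaplaceRep.conv (airyRep (Fin 2) b) (airyRep (Fin 2) b) 0 1 ∅ ∅

theorem airyPair_fine {b : ℝ} (hb : 0 ≤ b) : (airyPair b).Fine Finset.univ := by
  rw [← pair_univ]
  exact conv_fine config_pair (airyRep_fine (i := 1) (by simp) hb) (airyRep_fine (i := 0) (by simp) hb)

theorem LaplaceRep.ev_mul_T_eq {R : LaplaceRep (Fin 2)} {i : Fin 2} {X : Finset (Fin 2)}
    (hR : R.Tame X R.g) {u u' : ℝ → ℝ}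
    (hu : ∀ x : Fin 2 → ℝ, (∀ i, 0 < x i) → (u (x i) : ℂ) = R.ev X R.g x)
    (hd : ∀ t : ℝ, 0 < t → HasDerivAt u (u' t) t) {x : Fin 2 → ℝ} (hx : ∀ i, 0 < x i) :
    R.ev X (fun ω => R.g ω * R.T X ω) x = -(u' (x i) : ℂ) := by
  have h1 := hasDerivAt_ev hR (x := x) (τ := 0) (by simpa using fun i _ => hx i)
  simp only [add_zero] at h1
  have h2 : HasDerivAt (fun τ : ℝ => ((u (x i + τ) : ℝ) : ℂ)) (u' (x i) : ℂ) 0 := by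
    have := HasDerivAt.comp_const_add (x i) 0 (by simpa using hd (x i) (hx i))
    exact this.ofReal_comp
  have h3 : (fun τ : ℝ => ((u (x i + τ) : ℝ) : ℂ)) =ᶠ[nhds 0] fun τ => R.ev X R.g fun i => x i + τ := by
    have : ∀ᶠ τ : ℝ in nhds 0, ∀ i, 0 < x i + τ := by
      rw [eventually_all]
      intro i
      have hc : Continuous fun τ : ℝ => x i + τ := by fun_prop
      exact hc.continuousAt.eventually (lt_mem_nhds (by simpa using hx i))
    filter_upwards [this] with τ hτ
    exact hu _ hτ
  have h4 := h2.unique (h1.congr_of_eventuallyEq h3)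
  rw [h4, neg_neg]

/-- The exchange construction applied to one point functions `u`. It gives the two point chain for
`u = P` and, since it is uniform in `b`, the leading term for `u = x^(-1/2) / 2`. -/
theorem airyPair_ev {b : ℝ} (hb : 0 ≤ b) {u u' : ℝ → ℝ}
    (hu : ∀ (i : Fin 2) (x : Fin 2 → ℝ), (∀ i, 0 < x i) →
      (u (x i) : ℂ) = (airyRep (Fin 2) b).ev (insert i ∅) (airyRep (Fin 2) b).g x)
    (hd : ∀ t : ℝ, 0 < t → HasDerivAt u (u' t) t) {x : Fin 2 → ℝ} (hx : ∀ i, 0 < x i) :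
    ((x 1 - x 0 : ℝ) : ℂ) * (airyPair b).ev Finset.univ (airyPair b).g x =
      (u (x 1) : ℂ) * u' (x 0) - u (x 0) * u' (x 1) := by
  have hf : ∀ i : Fin 2, (airyRep (Fin 2) b).Fine (insert i ∅) := fun i =>
    airyRep_fine (i := i) (by simp) hb
  have ht : ∀ i : Fin 2, (airyRep (Fin 2) b).Tame (insert i ∅) (airyRep (Fin 2) b).g := fun i =>
    (hf i).tame ⟨i, by simp⟩
  have h := conv_ev config_pair (hf 1) (hf 0) hx
  have hx' : ∀ i, 0 < (x ∘ Equiv.swap (0 : Fin 2) 1) i := fun i => hx _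
  rw [pair_univ, ← hu 1 x hx, ← hu 1 _ hx', ev_mul_T_eq (ht 0) (hu 0) hd hx,
    ev_mul_T_eq (ht 0) (hu 0) hd hx'] at h
  rw [h]
  simp only [Function.comp_apply, Equiv.swap_apply_left, Equiv.swap_apply_right]
  ring

theorem airyPair_ev_airyChain {x : Fin 2 → ℝ} (hx : Function.Injective x) (hx0 : ∀ i, 0 < x i) :
    (airyChain Finset.univ x : ℂ) = (airyPair (1 / 12)).ev Finset.univ (airyPair (1 / 12)).g x := by
  have h1 := airyPair_ev (b := 1 / 12) (by norm_num) (u := airyP) (u' := airyP')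
    (fun i x hx => airyRep_ev_airyP (by simp) hx) (fun t _ => hasDerivAt_airyP' t) hx0
  have h2 := airyChain_insert_insert hx ∅ (y := 0) (z := 1) (by simp) (by simp) (by decide)
  have h3 : ∀ i : Fin 2, shiftD (airyChain (insert i ∅)) x = airyP' (x i) := by
    intro i
    have e : (airyChain (insert i ∅) : (Fin 2 → ℝ) → ℝ) = fun x => airyP (x i) := by
      funext x; rw [insert_empty_eq, airyChain_singleton]
    rw [e]
    have := HasDerivAt.comp_const_add (x i) 0 (hasDerivAt_airyP' (x i + 0))
    have h4 := shiftD_eq (F := fun x : Fin 2 → ℝ => airyP (x i)) (x := x) this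
    simpa using h4
  rw [Finset.powerset_empty, Finset.sum_singleton, Finset.empty_sdiff, h3, h3] at h2
  rw [insert_empty_eq, insert_empty_eq, airyChain_singleton, airyChain_singleton] at h2
  have e : ({0, 1} : Finset (Fin 2)) = Finset.univ := by decide
  rw [e] at h2
  have h01 : ((x 1 - x 0 : ℝ) : ℂ) ≠ 0 := by
    exact_mod_cast sub_ne_zero.2 (hx.ne (by decide))
  refine mul_left_cancel₀ h01 ?_
  rw [h1, ← Complex.ofReal_mul, h2]
  push_cast
  ring

/-- The leading term of the derivative of the pair correlator. -/
def airyPairLead (x : Fin 2 → ℝ) : ℝ := -(1 / (8 * √(x 0) ^ 3 * √(x 1) ^ 3))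

theorem half_rpow_eq {t : ℝ} (ht : 0 < t) : 1 / 2 * t ^ (-1 / 2 : ℝ) = 1 / (2 * √t) := by
  rw [show (-1 / 2 : ℝ) = -(1 / 2) by norm_num, Real.rpow_neg ht.le, ← Real.sqrt_eq_rpow]
  ring

theorem hasDerivAt_half_rpow {t : ℝ} (ht : 0 < t) :
    HasDerivAt (fun t : ℝ => 1 / 2 * t ^ (-1 / 2 : ℝ)) (-(1 / (4 * √t ^ 3))) t := by
  have h := (Real.hasDerivAt_rpow_const (p := -1 / 2) (Or.inl ht.ne')).const_mul (1 / 2)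
  refine h.congr_deriv ?_
  have h2 : t ^ (-1 / 2 - 1 : ℝ) = (√t ^ 3)⁻¹ := by
    rw [Real.sqrt_eq_rpow, ← Real.rpow_natCast, ← Real.rpow_mul ht.le, ← Real.rpow_neg ht.le]
    norm_num
  rw [h2]
  ring

theorem airyPair_ev_lead {x : Fin 2 → ℝ} (hx : x 0 ≠ x 1) (hx0 : ∀ i, 0 < x i) :
    (airyPairLead x : ℂ) = (airyPair 0).ev Finset.univ (airyPair 0).g x := by
  have h1 := airyPair_ev (b := 0) le_rfl (u := fun t : ℝ => 1 / 2 * t ^ (-1 / 2 : ℝ))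
    (u' := fun t => -(1 / (4 * √t ^ 3)))
    (fun i x hx => airyRep_ev_zero (by simp) hx) (x := x) (fun t ht => hasDerivAt_half_rpow ht) hx0
  have h01 : ((x 1 - x 0 : ℝ) : ℂ) ≠ 0 := by
    exact_mod_cast sub_ne_zero.2 hx.symm
  refine mul_left_cancel₀ h01 ?_
  rw [h1]
  simp only [half_rpow_eq (hx0 0), half_rpow_eq (hx0 1), airyPairLead]
  rw [← Complex.ofReal_mul, ← Complex.ofReal_mul, ← Complex.ofReal_mul, ← Complex.ofReal_sub]
  refine congrArg _ ?_
  clear h1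
  have a0 := Real.sqrt_pos.2 (hx0 0)
  have b0 := Real.sqrt_pos.2 (hx0 1)
  have a2 := Real.sq_sqrt (hx0 0).le
  have b2 := Real.sq_sqrt (hx0 1).le
  generalize √(x 0) = a at *
  generalize √(x 1) = b at *
  rw [← a2, ← b2]
  field_simp
  ring

/-- The leading term of the pair correlator. -/
def airyWLead (x : Fin 2 → ℝ) : ℝ := 1 / (4 * √(x 0) * √(x 1) * (√(x 0) + √(x 1)) ^ 2)

theorem hasDerivAt_airyWLead {x : Fin 2 → ℝ} (hx : ∀ i, 0 < x i) {τ : ℝ} (hτ : 0 ≤ τ) :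
    HasDerivAt (fun τ => airyWLead fun i => x i + τ) (airyPairLead fun i => x i + τ) τ := by
  have h0 : ∀ i, 0 < x i + τ := fun i => add_pos_of_pos_of_nonneg (hx i) hτ
  have hs : ∀ i, HasDerivAt (fun τ => √(x i + τ)) (1 / (2 * √(x i + τ))) τ := fun i =>
    HasDerivAt.comp_const_add (x i) τ (Real.hasDerivAt_sqrt (h0 i).ne')
  have a0 := Real.sqrt_pos.2 (h0 0)
  have b0 := Real.sqrt_pos.2 (h0 1)
  have h1 := (((hs 0).const_mul 4).fun_mul (hs 1)).fun_mul (((hs 0).fun_add (hs 1)).fun_pow 2)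
  have h2 := h1.fun_inv (by positivity)
  refine (h2.congr_deriv ?_).congr_of_eventuallyEq (Eventually.of_forall fun s => ?_)
  · simp only [airyPairLead]
    generalize √(x 0 + τ) = a at *
    generalize √(x 1 + τ) = b at *
    field_simp
    push_cast
    ring
  · simp only [airyWLead, one_div]

theorem tendsto_airyWLead (x : Fin 2 → ℝ) :
    Tendsto (fun τ : ℝ => airyWLead fun i => x i + τ) atTop (nhds 0) := by
  have hs : ∀ i, Tendsto (fun τ => √(x i + τ)) atTop atTop := fun i =>
    Real.tendsto_sqrt_atTop.comp (tendsto_atTop_add_const_left _ _ tendsto_id)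
  have h1 := (((hs 0).const_mul_atTop (show (0 : ℝ) < 4 by norm_num)).atTop_mul_atTop₀ (hs 1)).atTop_mul_atTop₀
    ((tendsto_pow_atTop (two_ne_zero)).comp ((hs 0).atTop_add_atTop (hs 1)))
  refine h1.inv_tendsto_atTop.congr fun τ => ?_
  simp [airyWLead]

/-- The difference of the densities of the pair correlator and of its leading term. -/
def airyDeltaPair (ω : (airyPair (1 / 12)).Ω) : ℂ :=
  (airyPair (1 / 12)).g ω - (airyPair 0).g ω

theorem airyPair_g_eq (ω : (airyPair (1 / 12)).Ω) : (airyPair (1 / 12)).g ω =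
    (airyPair 0).g ω * (Real.exp (-(1 / 12 * (posPart' ω.1.1.1 ^ 3 + posPart' ω.1.2.1 ^ 3))) : ℝ) := by
  have e : (airyPair (1 / 12)).g ω = -((airyRep (Fin 2) (1 / 12)).g ω.1.1 *
      ((airyRep (Fin 2) (1 / 12)).g ω.1.2 * (airyRep (Fin 2) 0).T (insert 0 ∅) ω.1.2) *
    ((airyRep (Fin 2) 0).t ω.1.2 0 - (airyRep (Fin 2) 0).t ω.1.1 1)) := rfl
  have e0 : (airyPair 0).g ω = -((airyRep (Fin 2) 0).g ω.1.1 *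
      ((airyRep (Fin 2) 0).g ω.1.2 * (airyRep (Fin 2) 0).T (insert 0 ∅) ω.1.2) *
    ((airyRep (Fin 2) 0).t ω.1.2 0 - (airyRep (Fin 2) 0).t ω.1.1 1)) := rfl
  have g1 : (airyRep (Fin 2) (1 / 12)).g ω.1.1 = (airyRep (Fin 2) 0).g ω.1.1 *
    (Real.exp (-(1 / 12 * posPart' ω.1.1.1 ^ 3)) : ℝ) := airyRep_g_eq ω.1.1
  have g2 : (airyRep (Fin 2) (1 / 12)).g ω.1.2 = (airyRep (Fin 2) 0).g ω.1.2 *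
    (Real.exp (-(1 / 12 * posPart' ω.1.2.1 ^ 3)) : ℝ) := airyRep_g_eq ω.1.2
  refine e.trans (Eq.trans ?_ (congrArg (· * ((Real.exp (-(1 / 12 * (posPart' ω.1.1.1 ^ 3 +
    posPart' ω.1.2.1 ^ 3))) : ℝ) : ℂ)) e0.symm))
  rw [g1, g2, mul_add, neg_add, Real.exp_add]
  push_cast
  ring

theorem measurable_airyDeltaPair : Measurable airyDeltaPair :=
  (airyPair (1 / 12)).measurable_g.sub (airyPair 0).measurable_g

theorem tame_posPart_rpow {X : Finset (Fin 2)} (hX : X.Nonempty) {b α : ℝ} (hα : -1 < α) :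
    (airyRep (Fin 2) b).Tame X fun ω : ℝ × Bool =>
      ((posPart' ω.1 ^ α * (1 + posPart' ω.1 ^ 2) : ℝ) : ℂ) := by
  have hm : Measurable fun ω : ℝ × Bool => posPart' ω.1 := measurable_posPart'.comp measurable_fst
  refine airyRep_tame hX (by fun_prop) (C := 1) hα 2 fun ω hω => ?_
  rw [posPart'_of_pos hω, Complex.norm_real, Real.norm_of_nonneg (by positivity), one_mul]
  gcongr
  nlinarith

/-- The factor `exp(-(ρ^3 + ρ'^3)/12) - 1` is of third order in the frequencies and pays for `T⁻¹`,
which `Fine` does not provide for only two points. -/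
theorem tame_airyDeltaPair : (airyPair (1 / 12)).Tame Finset.univ fun ω =>
    (airyDeltaPair ω * ∏ i, ((airyPair (1 / 12)).t ω i)⁻¹) *
      ((airyPair (1 / 12)).T Finset.univ ω)⁻¹ := by
  have hm : Measurable fun ω => (airyDeltaPair ω * ∏ i, ((airyPair (1 / 12)).t ω i)⁻¹) *
      ((airyPair (1 / 12)).T Finset.univ ω)⁻¹ :=
    (measurable_airyDeltaPair.mul (measurable_prod_inv _ _)).mul
      ((airyPair (1 / 12)).measurable_T _).inv
  rw [← pair_univ] at hm ⊢
  refine conv_tame config_pair hm (tame_posPart_rpow ⟨1, by simp⟩ (α := -(3 / 4)) (by norm_num))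
    (tame_posPart_rpow ⟨0, by simp⟩ (α := -(1 / 4)) (by norm_num))
    (4 / 3 * (1 / (4 * √Real.pi)) ^ 2) fun ω hω => ?_
  set c : ℝ := 1 / (4 * √Real.pi) with hc
  set ρ := posPart' ω.1.1.1 with hρ
  set ρ' := posPart' ω.1.2.1 with hρ'
  have hρ0 : 0 < ρ := posPart'_pos _
  have hρ0' : 0 < ρ' := posPart'_pos _
  have hc0 : 0 < c := by positivity
  have hw : 0 ≤ interpWeight ω.2 := by
    have h1 := hω.1
    have h2 : 0 < 1 - ω.2 := by linarith [hω.2]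
    unfold interpWeight
    positivity
  have n1 : ‖(airyRep (Fin 2) 0).t ω.1.1 1‖ = ρ := airyRep_norm_t _ _
  have n2 : ‖(airyRep (Fin 2) 0).t ω.1.2 0‖ = ρ' := airyRep_norm_t _ _
  have n3 : ‖(airyRep (Fin 2) 0).g ω.1.1‖ = c * ρ ^ (-1 / 2 : ℝ) := by
    refine (airyRep_norm_g _).trans ?_
    simp [hc, hρ]
  have n4 : ‖(airyRep (Fin 2) 0).g ω.1.2‖ = c * ρ' ^ (-1 / 2 : ℝ) := by
    refine (airyRep_norm_g _).trans ?_
    simp [hc, hρ']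
  have s1 : (airyRep (Fin 2) 0).S (insert 1 ∅) ω.1.1 = ρ := by
    rw [← n1]; simp [LaplaceRep.S]
  have s2 : (airyRep (Fin 2) 0).S (insert 0 ∅) ω.1.2 = ρ' := by
    rw [← n2]; simp [LaplaceRep.S]
  have k1 := conv_norm_le (R₁ := airyRep (Fin 2) 0) (R₂ := airyRep (Fin 2) 0) config_pair hω
    (Or.inr rfl)
  have k2 := conv_S_ge (R₁ := airyRep (Fin 2) 0) (R₂ := airyRep (Fin 2) 0) config_pair ω
  have k3 := S_le_norm_T (R := airyPair 0) (X := insert 0 (insert 1 (∅ ∪ ∅))) ω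
  rw [n1, n2, n3, n4, s2, Finset.prod_empty, Finset.prod_empty, norm_one, mul_one, mul_one] at k1
  rw [s1, s2] at k2
  have k4 : ρ + ρ' ≤ 4 * ‖(airyPair 0).T (insert 0 (insert 1 (∅ ∪ ∅))) ω‖ := by linarith
  have k5 := norm_exp_neg_sub_one_le (s := 1 / 12 * (ρ ^ 3 + ρ' ^ 3)) (by positivity)
  have e : (airyDeltaPair ω * ∏ i ∈ insert 0 (insert 1 (∅ ∪ ∅)), ((airyPair (1 / 12)).t ω i)⁻¹) *
      ((airyPair (1 / 12)).T (insert 0 (insert 1 (∅ ∪ ∅))) ω)⁻¹ =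
      ((airyPair 0).g ω * ∏ i ∈ insert 0 (insert 1 (∅ ∪ ∅)), ((airyPair 0).t ω i)⁻¹) *
        (((Real.exp (-(1 / 12 * (ρ ^ 3 + ρ' ^ 3))) : ℝ) : ℂ) - 1) *
        ((airyPair 0).T (insert 0 (insert 1 (∅ ∪ ∅))) ω)⁻¹ := by
    have e1 : airyDeltaPair ω = (airyPair 0).g ω *
        (((Real.exp (-(1 / 12 * (ρ ^ 3 + ρ' ^ 3))) : ℝ) : ℂ) - 1) := by
      rw [mul_sub, mul_one]
      exact congrArg (· - (airyPair 0).g ω) (airyPair_g_eq ω)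
    have e2 : ∏ i ∈ insert 0 (insert 1 (∅ ∪ ∅)), ((airyPair (1 / 12)).t ω i)⁻¹ =
        ∏ i ∈ insert 0 (insert 1 (∅ ∪ ∅)), ((airyPair 0).t ω i)⁻¹ := rfl
    have e3 : (airyPair (1 / 12)).T (insert 0 (insert 1 (∅ ∪ ∅))) ω =
      (airyPair 0).T (insert 0 (insert 1 (∅ ∪ ∅))) ω := rfl
    rw [e1, e2, e3]
    ring
  rw [e, norm_mul, norm_mul, norm_inv]
  have hT : 0 < ‖(airyPair 0).T (insert 0 (insert 1 (∅ ∪ ∅))) ω‖ := by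
    have : 0 < ρ + ρ' := by positivity
    linarith
  generalize ‖(airyPair 0).T (insert 0 (insert 1 (∅ ∪ ∅))) ω‖ = T at *
  rw [← div_eq_mul_inv, div_le_iff₀ hT, Complex.norm_real, Complex.norm_real,
    Real.norm_of_nonneg (by positivity), Real.norm_of_nonneg (by positivity)]
  have p1 : ρ ^ (-1 / 2 : ℝ) * ρ ^ (-(1 / 4) : ℝ) = ρ ^ (-(3 / 4) : ℝ) := by
    rw [← Real.rpow_add hρ0]; norm_num
  have p2 : ρ' ^ (-1 / 2 : ℝ) * (ρ' * ρ' ^ (-(3 / 4) : ℝ)) = ρ' ^ (-(1 / 4) : ℝ) := by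
    nth_rewrite 2 [← Real.rpow_one ρ']
    rw [← Real.rpow_add hρ0', ← Real.rpow_add hρ0']; norm_num
  -- Split one factor `ρ + ρ' ≤ 4 T` off the cubes; the rest grows polynomially in each frequency
  -- and is harmless.
  have p3 : 1 / 12 * (ρ ^ 3 + ρ' ^ 3) ≤ 1 / 3 * T * ((1 + ρ ^ 2) * (1 + ρ' ^ 2)) := by
    have q1 : ρ ^ 3 + ρ' ^ 3 ≤ (ρ + ρ') * ((1 + ρ ^ 2) * (1 + ρ' ^ 2)) := by
      have : 0 ≤ (ρ + ρ') * (1 + ρ * ρ' + ρ ^ 2 * ρ' ^ 2) := by positivity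
      nlinarith
    have q2 : (ρ + ρ') * ((1 + ρ ^ 2) * (1 + ρ' ^ 2)) ≤ 4 * T * ((1 + ρ ^ 2) * (1 + ρ' ^ 2)) := by
      gcongr
    linarith
  calc _ ≤ (c * ρ ^ (-1 / 2 : ℝ) * (c * ρ' ^ (-1 / 2 : ℝ)) * ρ' *
        (4 * interpWeight ω.2 * (ρ' ^ (-(3 / 4) : ℝ) * ρ ^ (-(1 / 4) : ℝ)))) *
        (1 / 3 * T * ((1 + ρ ^ 2) * (1 + ρ' ^ 2))) := by
        refine mul_le_mul k1 (k5.trans p3) (norm_nonneg _) (by positivity)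
    _ = 4 / 3 * c ^ 2 * interpWeight ω.2 * T * ((1 + ρ ^ 2) * (1 + ρ' ^ 2)) *
        (ρ ^ (-1 / 2 : ℝ) * ρ ^ (-(1 / 4) : ℝ)) *
        (ρ' ^ (-1 / 2 : ℝ) * (ρ' * ρ' ^ (-(3 / 4) : ℝ))) := by ring
    _ = _ := by rw [p1, p2]; ring

end AiryPair

end

/-! ### Integration of Laplace integrals over orthants. -/

noncomputable section

open SetAlg LaplaceRep

section Orthant

variable {ι κ : Type*} [Fintype ι] [Fintype κ]

/-- Coincidences of coordinates lie in finitely many hyperplanes, so representations valid at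
distinct points suffice under integrals. -/
theorem ae_injective : ∀ᵐ y : κ → ℝ, Function.Injective y := by
  classical
  have h : ∀ i j : κ, i ≠ j → ∀ᵐ y : κ → ℝ, y i ≠ y j := by
    intro i j hij
    set f : (κ → ℝ) →ₗ[ℝ] ℝ := LinearMap.proj (R := ℝ) (φ := fun _ : κ => ℝ) i -
      LinearMap.proj (R := ℝ) (φ := fun _ : κ => ℝ) j with hf
    have hs : LinearMap.ker f ≠ ⊤ := by
      intro h
      have h1 : (Pi.single i 1 : κ → ℝ) ∈ LinearMap.ker f := h ▸ Submodule.mem_top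
      rw [LinearMap.mem_ker] at h1
      simp [hf, Pi.single_eq_of_ne hij.symm] at h1
    have h0 := Measure.addHaar_submodule (volume : Measure (κ → ℝ)) _ hs
    rw [ae_iff]
    refine measure_mono_null (fun y hy => ?_) h0
    simp only [ne_eq, not_not, Set.mem_ofPred_eq] at hy
    simp [hf, hy]
  have h2 : ∀ᵐ y : κ → ℝ, ∀ i j, i ≠ j → y i ≠ y j := by
    simp only [ae_all_iff]
    exact h
  filter_upwards [h2] with y hy i j hij
  by_contra hne
  exact hy i j hne hij

variable {R : LaplaceRep ι}

/-- Integration of a Laplace integral over the variables `s k`. -/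
theorem LaplaceRep.integral_orthant {h : R.Ω → ℂ} (hh : Measurable h) (s : κ → ι)
    {P : (κ → ℝ) → ι → ℝ} {d : R.Ω → ℂ} (hd : Measurable d)
    (hP : ∀ ω y, ∑ i, R.t ω i * P y i = d ω + ∑ k, R.t ω (s k) * y k) {x : κ → ℝ}
    (hx : ∀ i, 0 < P x i)
    (ht : R.Tame Finset.univ fun ω => h ω * ∏ k, (R.t ω (s k))⁻¹) :
    IntegrableOn (fun y => R.ev Finset.univ h (P y)) (Set.univ.pi fun k => Set.Ioi (x k)) ∧
      ∫ y in Set.univ.pi fun k => Set.Ioi (x k), R.ev Finset.univ h (P y) =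
        R.ev Finset.univ (fun ω => h ω * ∏ k, (R.t ω (s k))⁻¹) (P x) := by
  have e1 : ∀ y, R.ev Finset.univ h (P y) = ∫ ω, (h ω * Complex.exp (-d ω)) *
      Complex.exp (-∑ k, R.t ω (s k) * y k) ∂(R.μ) := by
    intro y
    refine integral_congr_ae (Eventually.of_forall fun ω => ?_)
    simp only
    rw [hP, neg_add, Complex.exp_add, mul_assoc]
  simp only [e1]
  have hint := ht.integrable (x := P x) fun i _ => hx i
  have e2 : ∀ ω, Complex.exp (-d ω) * ∏ k, Complex.exp (-(R.t ω (s k) * x k)) =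
      Complex.exp (-∑ i, R.t ω i * P x i) := by
    intro ω
    rw [hP, neg_add, Complex.exp_add, ← Finset.sum_neg_distrib, Complex.exp_sum]
  have hm : Measurable fun ω => ‖h ω * Complex.exp (-d ω)‖ * ∏ k, ((R.t ω (s k)).re⁻¹ *
      Real.exp (-((R.t ω (s k)).re * x k))) := by
    have h1 := hd
    have h2 := fun k => R.measurable_t (s k)
    refine (hh.mul (Complex.measurable_exp.comp hd.neg)).norm.mul
      (Finset.measurable_prod _ fun k _ => ?_)
    have h3 : Measurable fun ω => (R.t ω (s k)).re := Complex.measurable_re.comp (h2 k)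
    exact h3.inv.mul (Real.measurable_exp.comp (h3.mul_const _).neg)
  have key := integral_pi_Ioi_exp (μ := R.μ) (h := fun ω => h ω * Complex.exp (-d ω))
    (t := fun ω k => R.t ω (s k)) (hh.mul (Complex.measurable_exp.comp hd.neg))
    (fun k => R.measurable_t (s k)) (fun ω k => re_pos ω (s k)) x (by
      -- In the cone `(Re t)⁻¹ ≤ 2 |t|⁻¹`, one factor `2` per integrated variable.
      refine (hint.norm.const_mul (2 ^ Fintype.card κ)).mono' hm.aestronglyMeasurable
        (Eventually.of_forall fun ω => ?_)
      have hp : ∀ k, 0 < (R.t ω (s k)).re := fun k => re_pos ω (s k)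
      have h0 : 0 ≤ ∏ k, ((R.t ω (s k)).re⁻¹ * Real.exp (-((R.t ω (s k)).re * x k))) :=
        Finset.prod_nonneg fun k _ => mul_nonneg (inv_nonneg.2 (hp k).le) (Real.exp_pos _).le
      rw [Real.norm_of_nonneg (by positivity), ← e2]
      simp only [norm_mul, norm_prod, norm_inv]
      have h1 : ∏ k, ((R.t ω (s k)).re⁻¹ * Real.exp (-((R.t ω (s k)).re * x k))) ≤
          ∏ k, (2 * (‖R.t ω (s k)‖⁻¹ * ‖Complex.exp (-(R.t ω (s k) * x k))‖)) := by
        refine Finset.prod_le_prod (fun k _ => mul_nonneg (inv_nonneg.2 (hp k).le)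
          (Real.exp_pos _).le) fun k _ => ?_
        have e3 : ‖Complex.exp (-(R.t ω (s k) * x k))‖ = Real.exp (-((R.t ω (s k)).re * x k)) := by
          rw [Complex.norm_exp, Complex.neg_re, Complex.re_mul_ofReal]
        rw [e3, ← mul_assoc]
        refine mul_le_mul_of_nonneg_right ?_ (Real.exp_pos _).le
        have := R.cone ω (s k)
        have := R.norm_pos ω (s k)
        rw [inv_le_iff_one_le_mul₀ (hp k)]
        rw [← div_eq_mul_inv, div_mul_eq_mul_div, le_div_iff₀ this]
        linarith
      have h2 : ∏ k, (2 * (‖R.t ω (s k)‖⁻¹ * ‖Complex.exp (-(R.t ω (s k) * x k))‖)) =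
          2 ^ Fintype.card κ * ((∏ k, ‖R.t ω (s k)‖⁻¹) *
            ∏ k, ‖Complex.exp (-(R.t ω (s k) * x k))‖) := by
        rw [Finset.prod_mul_distrib, Finset.prod_const, Finset.card_univ, Finset.prod_mul_distrib]
      rw [h2] at h1
      calc _ ≤ ‖h ω‖ * ‖Complex.exp (-d ω)‖ * (2 ^ Fintype.card κ *
            ((∏ k, ‖R.t ω (s k)‖⁻¹) * ∏ k, ‖Complex.exp (-(R.t ω (s k) * x k))‖)) := by gcongr
        _ = _ := by ring)
  refine ⟨key.1, key.2.trans (integral_congr_ae (Eventually.of_forall fun ω => ?_))⟩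
  simp only
  rw [Finset.prod_mul_distrib, ← e2]
  ring

theorem LaplaceRep.integral_orthant_real {F : (ι → ℝ) → ℝ} {h : R.Ω → ℂ} (hh : Measurable h)
    (hF : ∀ x, Function.Injective x → (∀ i, 0 < x i) → (F x : ℂ) = R.ev Finset.univ h x) (s : κ → ι)
    {P : (κ → ℝ) → ι → ℝ} {d : R.Ω → ℂ} (hd : Measurable d)
    (hP : ∀ ω y, ∑ i, R.t ω i * P y i = d ω + ∑ k, R.t ω (s k) * y k) {x : κ → ℝ}
    (hx : ∀ i, 0 < P x i)
    (hpos : ∀ y : κ → ℝ, (∀ k, x k < y k) → ∀ i, 0 < P y i)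
    (hinj : ∀ y : κ → ℝ, Function.Injective y → (∀ k, x k < y k) → Function.Injective (P y))
    (ht : R.Tame Finset.univ fun ω => h ω * ∏ k, (R.t ω (s k))⁻¹) :
    IntegrableOn (fun y => F (P y)) (Set.univ.pi fun k => Set.Ioi (x k)) ∧
      ((∫ y in Set.univ.pi fun k => Set.Ioi (x k), F (P y) : ℝ) : ℂ) =
        R.ev Finset.univ (fun ω => h ω * ∏ k, (R.t ω (s k))⁻¹) (P x) := by
  obtain ⟨h1, h2⟩ := integral_orthant hh s hd hP hx ht
  have hms : MeasurableSet (Set.univ.pi fun k => Set.Ioi (x k)) :=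
    MeasurableSet.univ_pi fun _ => measurableSet_Ioi
  have hae : (fun y => R.ev Finset.univ h (P y)) =ᵐ[volume.restrict (Set.univ.pi fun k => Set.Ioi (x k))]
      fun y => ((F (P y) : ℝ) : ℂ) := by
    filter_upwards [ae_restrict_mem hms, ae_restrict_of_ae ae_injective] with y hy hyi
    rw [Set.mem_univ_pi] at hy
    exact (hF _ (hinj y hyi hy) (hpos y hy)).symm
  constructor
  · have h3 : Integrable (fun y => ((F (P y) : ℝ) : ℂ))
      (volume.restrict (Set.univ.pi fun k => Set.Ioi (x k))) := h1.congr hae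
    exact h3.re
  · rw [← h2, integral_congr_ae hae]
    exact integral_complex_ofReal.symm

/-- Integration over all the variables. -/
theorem LaplaceRep.integral_full {F : (ι → ℝ) → ℝ} {h : R.Ω → ℂ} (hh : Measurable h)
    (hF : ∀ x, Function.Injective x → (∀ i, 0 < x i) → (F x : ℂ) = R.ev Finset.univ h x) {x : ι → ℝ}
    (hx : ∀ i, 0 < x i) (ht : R.Tame Finset.univ fun ω => h ω * ∏ k, (R.t ω k)⁻¹) :
    IntegrableOn F (Set.univ.pi fun k => Set.Ioi (x k)) ∧
      ((∫ y in Set.univ.pi fun k => Set.Ioi (x k), F y : ℝ) : ℂ) =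
        R.ev Finset.univ (fun ω => h ω * ∏ k, (R.t ω k)⁻¹) x :=
  integral_orthant_real hh hF id (P := id) (d := 0) measurable_zero (by simp) hx
    (fun y hy i => (hx i).trans (hy i)) (fun y hy _ => hy) ht

theorem prod_succAbove_eq {m : ℕ} {M : Type*} [CommMonoid M] (i : Fin (m + 1)) (f : Fin (m + 1) → M) :
    ∏ k, f (i.succAbove k) = ∏ j ∈ Finset.univ.erase i, f j := by
  have e : Finset.univ.erase i = (Finset.univ : Finset (Fin m)).map i.succAboveEmb := by
    ext j
    simp only [Finset.mem_erase, Finset.mem_univ, and_true, Finset.mem_map, true_and,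
      Fin.coe_succAboveEmb]
    exact Fin.exists_succAbove_eq_iff.symm
  rw [e, Finset.prod_map]
  rfl

/-- Integration over all the variables but one. -/
theorem LaplaceRep.integral_insertNth {m : ℕ} {R : LaplaceRep (Fin (m + 1))}
    {F : (Fin (m + 1) → ℝ) → ℝ} {h : R.Ω → ℂ} (hh : Measurable h)
    (hF : ∀ x, Function.Injective x → (∀ i, 0 < x i) → (F x : ℂ) = R.ev Finset.univ h x)
    (i : Fin (m + 1)) {x : ℝ} (hx : 0 < x)
    (ht : R.Tame Finset.univ fun ω => h ω * ∏ k ∈ Finset.univ.erase i, (R.t ω k)⁻¹) :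
    IntegrableOn (fun y => F (i.insertNth x y)) (Set.univ.pi fun _ => Set.Ioi x) ∧
      ((∫ y in Set.univ.pi fun _ => Set.Ioi x, F (i.insertNth x y) : ℝ) : ℂ) =
        R.ev Finset.univ (fun ω => h ω * ∏ k ∈ Finset.univ.erase i, (R.t ω k)⁻¹) fun _ => x := by
  have e : i.insertNth x (fun _ : Fin m => x) = fun _ : Fin (m + 1) => x := by
    funext j
    rcases Fin.eq_self_or_eq_succAbove i j with rfl | ⟨k, rfl⟩ <;> simp
  have e2 : ∀ ω, ∏ k ∈ Finset.univ.erase i, (R.t ω k)⁻¹ = ∏ k, (R.t ω (i.succAbove k))⁻¹ :=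
    fun ω => (prod_succAbove_eq i fun j => (R.t ω j)⁻¹).symm
  simp only [e2] at ht ⊢
  have := integral_orthant_real hh hF (i.succAbove) (P := fun y : Fin m → ℝ => i.insertNth x y)
    (d := fun ω => R.t ω i * x) ((R.measurable_t i).mul_const _) (fun ω y => by
      rw [Fin.sum_univ_succAbove _ i]; simp) (x := fun _ => x) (by rw [e]; exact fun _ => hx)
    (fun y hy j => by
      rcases Fin.eq_self_or_eq_succAbove i j with rfl | ⟨k, rfl⟩
      · simpa using hx
      · simpa using hx.trans (hy k))
    (fun y hyi hy => by
      intro j k hjk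
      rcases Fin.eq_self_or_eq_succAbove i j with hj | ⟨j, rfl⟩ <;>
        rcases Fin.eq_self_or_eq_succAbove i k with hk | ⟨k, rfl⟩
      · rw [hj, hk]
      · subst hj
        simp only [Fin.insertNth_apply_same, Fin.insertNth_apply_succAbove] at hjk
        exact absurd hjk (hy k).ne
      · subst hk
        simp only [Fin.insertNth_apply_same, Fin.insertNth_apply_succAbove] at hjk
        exact absurd hjk (hy j).ne'
      · simp only [Fin.insertNth_apply_succAbove] at hjk
        rw [hyi hjk])
    ht
  rw [e] at this
  exact this

end Orthant

end

/-! ### Partially integrated chains. -/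

noncomputable section

open SetAlg LaplaceRep

section ChainIntegrals

theorem shiftD_iterate_comp {ι κ : Type*} (F : (κ → ℝ) → ℝ) (e : κ → ι) (k : ℕ) (x : ι → ℝ) :
    shiftD^[k] (fun x : ι → ℝ => F (x ∘ e)) x = shiftD^[k] F (x ∘ e) := by
  induction k generalizing F with
  | zero => rfl
  | succ k ih =>
    rw [Function.iterate_succ_apply, Function.iterate_succ_apply, ← ih]
    rfl

/-- A representation of the chain sum over all the points. -/
def airyChainRep (m : ℕ) : LaplaceRep (Fin (m + 1)) :=
  (isFine_airyChain (Finset.univ : Finset (Fin (m + 1))) ⟨0, Finset.mem_univ _⟩).choose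

variable {m : ℕ}

theorem airyChainRep_fine : (airyChainRep m).Fine Finset.univ :=
  (isFine_airyChain (Finset.univ : Finset (Fin (m + 1))) ⟨0, Finset.mem_univ _⟩).choose_spec.1

theorem airyChainRep_ev (x : Fin (m + 1) → ℝ) (hx : Function.Injective x) (hx0 : ∀ i, 0 < x i) :
    (airyChain Finset.univ x : ℂ) = (airyChainRep m).ev Finset.univ (airyChainRep m).g x :=
  (isFine_airyChain (Finset.univ : Finset (Fin (m + 1))) ⟨0, Finset.mem_univ _⟩).choose_spec.2 x hx hx0

/-- The density of the `k`-th translation derivative of the chain sum. -/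
def airyChainDensity (m k : ℕ) (ω : (airyChainRep m).Ω) : ℂ :=
  (airyChainRep m).g ω * (-(airyChainRep m).T Finset.univ ω) ^ k

theorem airyChainDensity_succ (k : ℕ) : airyChainDensity m (k + 1) = fun ω =>
    -(airyChainDensity m k ω * (airyChainRep m).T Finset.univ ω) := by
  funext ω
  rw [airyChainDensity, airyChainDensity, pow_succ]
  ring

theorem measurable_airyChainDensity (k : ℕ) : Measurable (airyChainDensity m k) :=
  (airyChainRep m).measurable_g.mul (((airyChainRep m).measurable_T _).neg.pow_const k)

theorem LaplaceRep.Tame.mul_neg_T_pow {ι : Type*} {R : LaplaceRep ι} {X : Finset ι} {h : R.Ω → ℂ}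
    (hh : R.Tame X h) (k : ℕ) : R.Tame X fun ω => h ω * (-R.T X ω) ^ k := by
  induction k with
  | zero => simpa using hh
  | succ k ih =>
    have := ih.mul_T.neg
    have e : (fun ω => h ω * (-R.T X ω) ^ (k + 1)) = fun ω => -(h ω * (-R.T X ω) ^ k * R.T X ω) := by
      funext ω; rw [pow_succ]; ring
    rw [e]; exact this

theorem tame_airyChainDensity (k : ℕ) :
    (airyChainRep m).Tame Finset.univ (airyChainDensity m k) :=
  (airyChainRep_fine.tame ⟨0, Finset.mem_univ _⟩).mul_neg_T_pow k

theorem tame_airyChainDensity_erase (i : Fin (m + 1)) (k : ℕ) :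
    (airyChainRep m).Tame Finset.univ fun ω =>
      airyChainDensity m k ω * ∏ j ∈ Finset.univ.erase i, ((airyChainRep m).t ω j)⁻¹ := by
  have h := ((airyChainRep_fine (m := m)).partial (Finset.mem_univ i)).mul_neg_T_pow k
  have e : (fun ω => airyChainDensity m k ω * ∏ j ∈ Finset.univ.erase i, ((airyChainRep m).t ω j)⁻¹) =
      fun ω => ((airyChainRep m).g ω * ∏ j ∈ Finset.univ.erase i, ((airyChainRep m).t ω j)⁻¹) *
        (-(airyChainRep m).T Finset.univ ω) ^ k := by
    funext ω; rw [airyChainDensity]; ring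
  rw [e]; exact h

/-- `T = ∑ t i` cancels one inverse frequency in each term: a total translation derivative
integrates to boundary terms. -/
theorem airyChainDensity_succ_mul_prod (k : ℕ) (ω : (airyChainRep m).Ω) :
    airyChainDensity m (k + 1) ω * ∏ j, ((airyChainRep m).t ω j)⁻¹ =
      ∑ i, -(airyChainDensity m k ω * ∏ j ∈ Finset.univ.erase i, ((airyChainRep m).t ω j)⁻¹) := by
  rw [airyChainDensity_succ]
  simp only [LaplaceRep.T]
  rw [Finset.mul_sum, ← Finset.sum_neg_distrib, Finset.sum_mul]
  refine Finset.sum_congr rfl fun i hi => ?_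
  rw [← Finset.mul_prod_erase Finset.univ _ hi]
  have := inv_mul_cancel₀ (LaplaceRep.ne_zero ω i)
  linear_combination (-(airyChainDensity m k ω) *
    ∏ j ∈ Finset.univ.erase i, ((airyChainRep m).t ω j)⁻¹) * this

/-- At least one derivative is present, and after it only products over all points but one occur. So
no case distinction is needed for a single point, where the undifferentiated density would fail. -/
theorem tame_airyChainDensity_prod (k : ℕ) :
    (airyChainRep m).Tame Finset.univ fun ω =>
      airyChainDensity m (k + 1) ω * ∏ j, ((airyChainRep m).t ω j)⁻¹ := by
  simp only [airyChainDensity_succ_mul_prod]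
  exact Tame.sum _ fun i _ => (tame_airyChainDensity_erase i k).neg

theorem shiftD_iterate_airyChain (k : ℕ) (x : Fin (m + 1) → ℝ) (hx : Function.Injective x)
    (hx0 : ∀ i, 0 < x i) :
    (shiftD^[k] (airyChain Finset.univ) x : ℂ) =
      (airyChainRep m).ev Finset.univ (airyChainDensity m k) x := by
  induction k generalizing x with
  | zero =>
    rw [Function.iterate_zero, id, airyChainRep_ev x hx hx0]
    congr 1
    funext ω
    simp [airyChainDensity]
  | succ k ih =>
    rw [Function.iterate_succ_apply', airyChainDensity_succ]
    exact (tame_airyChainDensity k : (airyChainRep m).Tame _ _) |> fun h =>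
      LaplaceRep.Fine.shiftD_eq h ih x hx hx0

/-- The integral of the `k`-th translation derivative of the chain sum over all the points but the
first. -/
def airyA (m k : ℕ) (x : ℝ) : ℝ :=
  ∫ y in Set.univ.pi fun _ : Fin m => Set.Ioi x,
    shiftD^[k] (airyChain (Finset.univ : Finset (Fin (m + 1)))) (Fin.cons x y)

/-- The integral of the `k + 1`-st translation derivative of the chain sum over all the points. -/
def airyU (m k : ℕ) (x : ℝ) : ℝ :=
  ∫ y in Set.univ.pi fun _ : Fin m => Set.Ioi x,
    shiftD^[k + 1] (airyChain (Finset.univ : Finset (Fin m))) y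

theorem shiftD_iterate_airyChain_comp {κ ι : Type*} [DecidableEq κ] [Fintype κ] [DecidableEq ι]
    [Fintype ι] (e : κ ↪ ι) (Y : Finset κ) (k : ℕ) (x : ι → ℝ) :
    shiftD^[k] (airyChain (Y.map e)) x = shiftD^[k] (airyChain Y) (x ∘ e) := by
  rw [← shiftD_iterate_comp]
  exact congrArg (fun F => shiftD^[k] F x) (funext fun x => airyChain_map e Y x)

/-- Chain sums are symmetric, so it does not matter which point is kept fixed. -/
theorem shiftD_iterate_airyChain_insertNth (i : Fin (m + 1)) (k : ℕ) (x : ℝ) (y : Fin m → ℝ) :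
    shiftD^[k] (airyChain (Finset.univ : Finset (Fin (m + 1)))) (i.insertNth x y) =
      shiftD^[k] (airyChain Finset.univ) (Fin.cons x y : Fin (m + 1) → ℝ) := by
  have h := shiftD_iterate_airyChain_comp i.cycleRange.toEmbedding Finset.univ k
    (Fin.cons x y : Fin (m + 1) → ℝ)
  rw [Finset.map_univ_equiv] at h
  rw [h]
  exact congrArg (shiftD^[k] (airyChain Finset.univ)) (Fin.cons_comp_cycleRange x y i).symm

theorem integrable_airyA (k : ℕ) {x : ℝ} (hx : 0 < x) :
    IntegrableOn (fun y : Fin m → ℝ => shiftD^[k] (airyChain (Finset.univ : Finset (Fin (m + 1))))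
      (Fin.cons x y)) (Set.univ.pi fun _ => Set.Ioi x) := by
  have := (integral_insertNth (measurable_airyChainDensity k) (shiftD_iterate_airyChain (m := m) k) 0 hx
    (tame_airyChainDensity_erase 0 k)).1
  simpa only [Fin.insertNth_zero'] using this

theorem airyA_eq_ev (i : Fin (m + 1)) (k : ℕ) {x : ℝ} (hx : 0 < x) :
    (airyA m k x : ℂ) = (airyChainRep m).ev Finset.univ (fun ω => airyChainDensity m k ω *
      ∏ j ∈ Finset.univ.erase i, ((airyChainRep m).t ω j)⁻¹) fun _ => x := by
  have := (integral_insertNth (measurable_airyChainDensity k) (shiftD_iterate_airyChain (m := m) k) i hx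
    (tame_airyChainDensity_erase i k)).2
  simp only [shiftD_iterate_airyChain_insertNth] at this
  exact this

/-- `x` is both the fixed point and the lower limit of all the integrals; moving it is a common
translation. -/
theorem hasDerivAt_airyA (k : ℕ) {x : ℝ} (hx : 0 < x) :
    HasDerivAt (airyA m k) (airyA m (k + 1) x) x := by
  have h1 := hasDerivAt_ev_diag (tame_airyChainDensity_erase (m := m) 0 k) hx
  rw [← ev_neg] at h1
  have e : (fun ω => -((airyChainDensity m k ω * ∏ j ∈ Finset.univ.erase 0,
      ((airyChainRep m).t ω j)⁻¹) * (airyChainRep m).T Finset.univ ω)) = fun ω =>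
      airyChainDensity m (k + 1) ω * ∏ j ∈ Finset.univ.erase 0, ((airyChainRep m).t ω j)⁻¹ := by
    funext ω
    rw [airyChainDensity_succ]
    ring
  rw [e, ← airyA_eq_ev 0 (k + 1) hx] at h1
  have h2 : HasDerivAt (fun x => ((airyA m k x : ℝ) : ℂ)) (airyA m (k + 1) x : ℂ) x := by
    refine h1.congr_of_eventuallyEq ?_
    filter_upwards [lt_mem_nhds hx] with y hy
    exact airyA_eq_ev 0 k hy
  have h3 := Complex.reCLM.hasFDerivAt.comp_hasDerivAt x h2
  exact h3

theorem integrable_airyU (k : ℕ) {x : ℝ} (hx : 0 < x) :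
    IntegrableOn (shiftD^[k + 1] (airyChain (Finset.univ : Finset (Fin m))))
      (Set.univ.pi fun _ => Set.Ioi x) := by
  rcases m with _ | m
  · exact Integrable.of_finite
  · exact (integral_full (measurable_airyChainDensity (k + 1))
      (shiftD_iterate_airyChain (m := m) (k + 1)) (x := fun _ => x) (fun _ => hx)
      (tame_airyChainDensity_prod k)).1

theorem airyU_zero (k : ℕ) (x : ℝ) : airyU 0 k x = 0 := by
  have h : ∀ k, ∀ y : Fin 0 → ℝ, shiftD^[k] (airyChain (Finset.univ : Finset (Fin 0))) y = 0 := by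
    intro k
    induction k with
    | zero => intro y; exact airyChain_empty y
    | succ k ih =>
      intro y
      rw [Function.iterate_succ_apply', shiftD]
      simp only [ih]
      simp
  rw [airyU]
  simp only [h]
  simp

theorem airyU_succ_eq_ev (k : ℕ) {x : ℝ} (hx : 0 < x) :
    (airyU (m + 1) k x : ℂ) = (airyChainRep m).ev Finset.univ (fun ω => airyChainDensity m (k + 1) ω *
      ∏ j, ((airyChainRep m).t ω j)⁻¹) fun _ => x :=
  (integral_full (measurable_airyChainDensity (k + 1))
      (shiftD_iterate_airyChain (m := m) (k + 1)) (x := fun _ => x) (fun _ => hx)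
      (tame_airyChainDensity_prod k)).2

/-- One boundary term for each point, all equal by symmetry. -/
theorem airyU_succ (k : ℕ) {x : ℝ} (hx : 0 < x) : airyU (m + 1) k x = -((m + 1) * airyA m k x) := by
  have h := airyU_succ_eq_ev (m := m) k hx
  simp only [airyChainDensity_succ_mul_prod] at h
  rw [ev_sum _ (fun i _ => (tame_airyChainDensity_erase i k).neg) fun _ _ => hx] at h
  simp only [ev_neg, ← airyA_eq_ev _ k hx, Finset.sum_const, Finset.card_univ, Fintype.card_fin] at h
  rw [nsmul_eq_mul] at h
  have : ((airyU (m + 1) k x : ℝ) : ℂ) = ((-((m + 1) * airyA m k x) : ℝ) : ℂ) := by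
    rw [h]; push_cast; ring
  exact_mod_cast this

end ChainIntegrals

end

/-! ### The third order equation after integration. -/

noncomputable section

open SetAlg LaplaceRep

section ProductIntegrals

theorem volume_restrict_orthant {κ : Type*} [Fintype κ] (x : ℝ) :
    (volume : Measure (κ → ℝ)).restrict (Set.univ.pi fun _ => Set.Ioi x) =
      Measure.pi fun _ => volume.restrict (Set.Ioi x) := by
  rw [volume_pi, Measure.restrict_pi_pi]

/-- The integral over an orthant of a product of functions of complementary sets of variables. -/
theorem integral_mul_orthant {α β κ : Type*} [Fintype α] [Fintype β] [Fintype κ] (e : α ⊕ β ≃ κ)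
    {F : (α → ℝ) → ℝ} {G : (β → ℝ) → ℝ} {x : ℝ}
    (hF : IntegrableOn F (Set.univ.pi fun _ => Set.Ioi x))
    (hG : IntegrableOn G (Set.univ.pi fun _ => Set.Ioi x)) :
    IntegrableOn (fun y : κ → ℝ => F (fun i => y (e (Sum.inl i))) * G (fun i => y (e (Sum.inr i))))
        (Set.univ.pi fun _ => Set.Ioi x) ∧
      ∫ y in Set.univ.pi fun _ : κ => Set.Ioi x,
          F (fun i => y (e (Sum.inl i))) * G (fun i => y (e (Sum.inr i))) =
        (∫ y in Set.univ.pi fun _ => Set.Ioi x, F y) * ∫ y in Set.univ.pi fun _ => Set.Ioi x, G y := by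
  rw [IntegrableOn, volume_restrict_orthant] at hF hG ⊢
  rw [volume_restrict_orthant, volume_restrict_orthant]
  set μ : Measure ℝ := volume.restrict (Set.Ioi x)
  set Φ := (MeasurableEquiv.piCongrLeft (fun _ : κ => ℝ) e).symm.trans
    (MeasurableEquiv.sumPiEquivProdPi fun _ : α ⊕ β => ℝ) with hΦ
  have hmp : MeasurePreserving Φ (Measure.pi fun _ : κ => μ)
      ((Measure.pi fun _ : α => μ).prod (Measure.pi fun _ : β => μ)) :=
    (measurePreserving_sumPiEquivProdPi (X := fun _ : α ⊕ β => ℝ) fun _ => μ).comp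
      ((measurePreserving_piCongrLeft (fun _ : κ => μ) e).symm _)
  have hFG := hF.mul_prod hG
  exact ⟨(hmp.integrable_comp_of_integrable hFG),
    (hmp.integral_comp' fun p : (α → ℝ) × (β → ℝ) => F p.1 * G p.2).trans (integral_prod_mul F G)⟩

end ProductIntegrals

section ChainEquation

variable {m : ℕ}

theorem univ_fin_succ_eq : insert 0 ((Finset.univ : Finset (Fin m)).map (Fin.succEmb m)) = Finset.univ := by
  ext i
  rcases Fin.eq_zero_or_eq_succ i with rfl | ⟨j, rfl⟩ <;> simp

theorem sum_powerset_map (Φ : Finset (Fin (m + 1)) → ℝ) :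
    ∑ I ∈ ((Finset.univ : Finset (Fin m)).map (Fin.succEmb m)).powerset, Φ I =
      ∑ J : Finset (Fin m), Φ (J.map (Fin.succEmb m)) := by
  symm
  refine Finset.sum_bij (fun J _ => J.map (Fin.succEmb m)) (fun J _ => ?_) (fun J _ K _ h => ?_)
    (fun I hI => ?_) fun _ _ => rfl
  · rw [Finset.mem_powerset]
    exact Finset.map_subset_map.2 (Finset.subset_univ J)
  · exact Finset.map_injective _ h
  · obtain ⟨J, _, hJ⟩ := Finset.subset_map_iff.1 (Finset.mem_powerset.1 hI)
    exact ⟨J, Finset.mem_univ _, hJ.symm⟩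

/-- The splitting of the indices into a set and its complement. -/
abbrev splitEquiv (J : Finset (Fin m)) : Fin J.card ⊕ Fin Jᶜ.card ≃ Fin m := finSumEquivOfFinset rfl rfl

theorem splitEquiv_inl_mem (J : Finset (Fin m)) (i : Fin J.card) : splitEquiv J (Sum.inl i) ∈ J := by
  rw [splitEquiv, finSumEquivOfFinset_inl]; exact Finset.orderEmbOfFin_mem _ _ _

theorem splitEquiv_inr_mem (J : Finset (Fin m)) (i : Fin Jᶜ.card) :
    splitEquiv J (Sum.inr i) ∈ Jᶜ := by
  rw [splitEquiv, finSumEquivOfFinset_inr]; exact Finset.orderEmbOfFin_mem _ _ _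

theorem exists_splitEquiv_inl {J : Finset (Fin m)} {j : Fin m} (hj : j ∈ J) :
    ∃ i, splitEquiv J (Sum.inl i) = j := by
  obtain ⟨i | i, hi⟩ := (splitEquiv J).surjective j
  · exact ⟨i, hi⟩
  · have := splitEquiv_inr_mem J i
    rw [hi, Finset.mem_compl] at this
    exact absurd hj this

theorem exists_splitEquiv_inr {J : Finset (Fin m)} {j : Fin m} (hj : j ∉ J) :
    ∃ i, splitEquiv J (Sum.inr i) = j := by
  obtain ⟨i | i, hi⟩ := (splitEquiv J).surjective j
  · have := splitEquiv_inl_mem J i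
    rw [hi] at this
    exact absurd this hj
  · exact ⟨i, hi⟩

theorem shiftD_airyChain_map_succ (J : Finset (Fin m)) (k : ℕ) (x : ℝ) (y : Fin m → ℝ) :
    shiftD^[k] (airyChain (J.map (Fin.succEmb m))) (Fin.cons x y : Fin (m + 1) → ℝ) =
      shiftD^[k] (airyChain Finset.univ) fun i => y (splitEquiv J (Sum.inl i)) := by
  set ψ : Fin J.card ↪ Fin (m + 1) := ⟨fun i => (splitEquiv J (Sum.inl i)).succ, fun i j h => by
    simpa using h⟩ with hψ
  have e : J.map (Fin.succEmb m) = Finset.univ.map ψ := by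
    ext i
    simp only [Finset.mem_map, Finset.mem_univ, true_and, hψ, Fin.coe_succEmb]
    constructor
    · rintro ⟨j, hj, rfl⟩
      obtain ⟨i, rfl⟩ := exists_splitEquiv_inl hj
      exact ⟨i, rfl⟩
    · rintro ⟨j, rfl⟩
      exact ⟨_, splitEquiv_inl_mem J j, rfl⟩
  rw [e, shiftD_iterate_airyChain_comp]
  rfl

theorem shiftD_airyChain_insert_zero (J : Finset (Fin m)) (k : ℕ) (x : ℝ) (y : Fin m → ℝ) :
    shiftD^[k] (airyChain (insert 0 ((Finset.univ : Finset (Fin m)).map (Fin.succEmb m) \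
        J.map (Fin.succEmb m)))) (Fin.cons x y : Fin (m + 1) → ℝ) =
      shiftD^[k] (airyChain (Finset.univ : Finset (Fin (Jᶜ.card + 1))))
        (Fin.cons x fun i => y (splitEquiv J (Sum.inr i))) := by
  set φ : Fin (Jᶜ.card + 1) ↪ Fin (m + 1) :=
    ⟨Fin.cons 0 fun i => (splitEquiv J (Sum.inr i)).succ, fun i j h => by
      rcases Fin.eq_zero_or_eq_succ i with rfl | ⟨i, rfl⟩ <;>
        rcases Fin.eq_zero_or_eq_succ j with rfl | ⟨j, rfl⟩
      · rfl
      · simp only [Fin.cons_zero, Fin.cons_succ] at h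
        exact absurd h.symm (Fin.succ_ne_zero _)
      · simp only [Fin.cons_zero, Fin.cons_succ] at h
        exact absurd h (Fin.succ_ne_zero _)
      · simpa using h⟩ with hφ
  have e : insert 0 ((Finset.univ : Finset (Fin m)).map (Fin.succEmb m) \ J.map (Fin.succEmb m)) =
      Finset.univ.map φ := by
    ext i
    simp only [Finset.mem_map, Finset.mem_univ, true_and, Finset.mem_insert, Finset.mem_sdiff]
    rcases Fin.eq_zero_or_eq_succ i with rfl | ⟨i, rfl⟩
    · simp only [true_or, true_iff]
      exact ⟨0, rfl⟩
    · constructor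
      · rintro (h | ⟨_, h⟩)
        · exact absurd h (Fin.succ_ne_zero _)
        · have hi : i ∉ J := fun hi => h ⟨i, hi, rfl⟩
          obtain ⟨j, rfl⟩ := exists_splitEquiv_inr hi
          exact ⟨j.succ, rfl⟩
      · rintro ⟨j, hj⟩
        right
        rcases Fin.eq_zero_or_eq_succ j with rfl | ⟨j, rfl⟩
        · exact absurd hj.symm (Fin.succ_ne_zero _)
        · have h1 : splitEquiv J (Sum.inr j) = i := Fin.succ_injective _ hj
          refine ⟨⟨i, rfl⟩, ?_⟩
          rintro ⟨k, hk, hk2⟩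
          have h2 : k = i := Fin.succ_injective _ hk2
          have h3 := splitEquiv_inr_mem J j
          rw [h1, Finset.mem_compl] at h3
          exact h3 (h2 ▸ hk)
  rw [e, shiftD_iterate_airyChain_comp]
  refine congrArg _ (funext fun i => ?_)
  rcases Fin.eq_zero_or_eq_succ i with rfl | ⟨i, rfl⟩ <;> simp [hφ]

theorem integral_airyChain_mul (J : Finset (Fin m)) (j k : ℕ) {x : ℝ} (hx : 0 < x) :
    IntegrableOn (fun y : Fin m → ℝ =>
        shiftD^[j + 1] (airyChain (J.map (Fin.succEmb m))) (Fin.cons x y : Fin (m + 1) → ℝ) *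
        shiftD^[k] (airyChain (insert 0 ((Finset.univ : Finset (Fin m)).map (Fin.succEmb m) \
          J.map (Fin.succEmb m)))) (Fin.cons x y : Fin (m + 1) → ℝ)) (Set.univ.pi fun _ => Set.Ioi x) ∧
      ∫ y in Set.univ.pi fun _ : Fin m => Set.Ioi x,
        shiftD^[j + 1] (airyChain (J.map (Fin.succEmb m))) (Fin.cons x y : Fin (m + 1) → ℝ) *
        shiftD^[k] (airyChain (insert 0 ((Finset.univ : Finset (Fin m)).map (Fin.succEmb m) \
          J.map (Fin.succEmb m)))) (Fin.cons x y : Fin (m + 1) → ℝ) =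
      airyU J.card j x * airyA (m - J.card) k x := by
  have hc : m - J.card = Jᶜ.card := by rw [Finset.card_compl, Fintype.card_fin]
  rw [hc]
  simp only [shiftD_airyChain_map_succ, shiftD_airyChain_insert_zero]
  exact integral_mul_orthant (splitEquiv J) (integrable_airyU j hx) (integrable_airyA k hx)

/-- The differential equations of the partially integrated chain sums. -/
theorem airyA_three {x : ℝ} (hx : 0 < x) : airyA m 3 x = 4 * x * airyA m 1 x + 2 * airyA m 0 x -
    ∑ k ∈ Finset.range (m + 1), (m.choose k : ℝ) *
      (8 * (airyU k 0 x * airyA (m - k) 1 x) + 4 * (airyU k 1 x * airyA (m - k) 0 x)) := by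
  have h8 := fun J : Finset (Fin m) => integral_airyChain_mul J 0 1 hx
  have h4 := fun J : Finset (Fin m) => integral_airyChain_mul J 1 0 hx
  have hms : MeasurableSet (Set.univ.pi fun _ : Fin m => Set.Ioi x) :=
    MeasurableSet.univ_pi fun _ => measurableSet_Ioi
  -- The pointwise equation with the distinguished point `0` placed at `x`. In each quadratic term
  -- one factor depends on the variables in `J`, the other on those in the complement, so its
  -- integral factors.
  have key : ∀ᵐ y : Fin m → ℝ ∂(volume.restrict (Set.univ.pi fun _ : Fin m => Set.Ioi x)),
      shiftD^[3] (airyChain (Finset.univ : Finset (Fin (m + 1)))) (Fin.cons x y) =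
      4 * x * shiftD^[1] (airyChain (Finset.univ : Finset (Fin (m + 1)))) (Fin.cons x y) +
      2 * shiftD^[0] (airyChain (Finset.univ : Finset (Fin (m + 1)))) (Fin.cons x y) -
      ∑ J : Finset (Fin m), (8 * (shiftD^[0 + 1] (airyChain (J.map (Fin.succEmb m)))
          (Fin.cons x y : Fin (m + 1) → ℝ) *
        shiftD^[1] (airyChain (insert 0 ((Finset.univ : Finset (Fin m)).map (Fin.succEmb m) \
          J.map (Fin.succEmb m)))) (Fin.cons x y : Fin (m + 1) → ℝ)) +
        4 * (shiftD^[1 + 1] (airyChain (J.map (Fin.succEmb m))) (Fin.cons x y : Fin (m + 1) → ℝ) *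
        shiftD^[0] (airyChain (insert 0 ((Finset.univ : Finset (Fin m)).map (Fin.succEmb m) \
          J.map (Fin.succEmb m)))) (Fin.cons x y : Fin (m + 1) → ℝ))) := by
    filter_upwards [ae_restrict_mem hms, ae_restrict_of_ae ae_injective] with y hy hyi
    rw [Set.mem_univ_pi] at hy
    have hinj : Function.Injective (Fin.cons x y : Fin (m + 1) → ℝ) :=
      Fin.cons_injective_iff.2 ⟨by rintro ⟨i, hi⟩; exact (hy i).ne' hi, hyi⟩
    have h := hasDerivAt_airyChain_three hinj
      ((Finset.univ : Finset (Fin m)).map (Fin.succEmb m)) (z := 0) (by simp)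
    rw [univ_fin_succ_eq, sum_powerset_map] at h
    exact h
  have i1 := (integrable_airyA (m := m) 1 hx).const_mul (4 * x)
  have i0 := (integrable_airyA (m := m) 0 hx).const_mul 2
  have iJ := fun J : Finset (Fin m) => ((h8 J).1.const_mul 8).add ((h4 J).1.const_mul 4)
  -- The integrals depend on `J` only through its cardinality, whence the binomial coefficients.
  have hsum := Finset.sum_powerset_apply_card (fun k => 8 * (airyU k 0 x * airyA (m - k) 1 x) +
    4 * (airyU k 1 x * airyA (m - k) 0 x)) (x := (Finset.univ : Finset (Fin m)))
  rw [Finset.card_univ, Fintype.card_fin, Finset.powerset_univ] at hsum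
  simp only [nsmul_eq_mul] at hsum
  rw [← hsum]
  refine (integral_congr_ae key).trans ((integral_sub (i1.add i0)
    (integrable_finsetSum _ fun J _ => iJ J)).trans (congrArg₂ (· - ·) ((integral_add i1 i0).trans
      (congrArg₂ (· + ·) (integral_const_mul _ _) (integral_const_mul _ _)))
    ((integral_finsetSum _ fun J _ => iJ J).trans (Finset.sum_congr rfl fun J _ => ?_))))
  rw [← (h8 J).2, ← (h4 J).2, ← integral_const_mul, ← integral_const_mul]
  exact integral_add ((h8 J).1.const_mul 8) ((h4 J).1.const_mul 4)

end ChainEquation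

end

/-! ### The primitives on the diagonal. -/

noncomputable section

open SetAlg LaplaceRep

section Primitives

/-- A primitive in terms of a representation of the regularised correlator. -/
theorem airyPhi_of_rep {n : ℕ} {R : LaplaceRep (Fin (n + 1))} {h : R.Ω → ℂ} (hh : Measurable h)
    (ht : R.Tame Finset.univ fun ω => (h ω * ∏ i, (R.t ω i)⁻¹) * (R.T Finset.univ ω)⁻¹)
    (he : ∀ x : Fin (n + 1) → ℝ, Function.Injective x → (∀ i, 0 < x i) →
      (airyWReg (n + 1) x : ℂ) =
        R.ev Finset.univ (fun ω => (-1) ^ n * (h ω * (R.T Finset.univ ω)⁻¹)) x) :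
    (∀ x : Fin (n + 1) → ℝ, (∀ i, 0 < x i) →
      IntegrableOn (airyWReg (n + 1)) (Set.univ.pi fun i => Set.Ioi (x i))) ∧
    ∃ H₁ : ℝ → ℝ, (∀ x : ℝ, 0 < x → HasDerivAt
        (fun x => airyPhi (n + 1) (fun _ => x) - airyPhiLead (n + 1) fun _ => x) (H₁ x) x ∧
      HasDerivAt H₁ (-(R.ev Finset.univ
        (fun ω => (h ω * ∏ i, (R.t ω i)⁻¹) * R.T Finset.univ ω) fun _ => x).re) x) ∧
      Tendsto (fun x => airyPhi (n + 1) (fun _ => x) - airyPhiLead (n + 1) fun _ => x) atTop (nhds 0) ∧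
      Tendsto H₁ atTop (nhds 0) := by
  have hne : (Finset.univ : Finset (Fin (n + 1))).Nonempty := ⟨0, Finset.mem_univ _⟩
  set k : R.Ω → ℂ := fun ω => (h ω * ∏ i, (R.t ω i)⁻¹) * (R.T Finset.univ ω)⁻¹ with hk
  have hm : Measurable fun ω => (-1) ^ n * (h ω * (R.T Finset.univ ω)⁻¹) :=
    (hh.mul (R.measurable_T _).inv).const_mul _
  have e0 : (fun ω => (-1) ^ n * (h ω * (R.T Finset.univ ω)⁻¹) * ∏ i, (R.t ω i)⁻¹) =
      fun ω => (-1) ^ n * k ω := by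
    funext ω; rw [hk]; ring
  have ht0 : R.Tame Finset.univ fun ω =>
      (-1) ^ n * (h ω * (R.T Finset.univ ω)⁻¹) * ∏ i, (R.t ω i)⁻¹ := by
    rw [e0]
    exact ht.mono' (ht.1.const_mul _) 1 fun ω => by simp
  have hfull := fun (x : Fin (n + 1) → ℝ) (hx : ∀ i, 0 < x i) =>
    integral_full (F := airyWReg (n + 1)) hm he hx ht0
  have hk1 : (fun ω => k ω * R.T Finset.univ ω) = fun ω => h ω * ∏ i, (R.t ω i)⁻¹ := by
    funext ω
    rw [hk]
    simp only
    rw [mul_assoc _ (R.T Finset.univ ω)⁻¹, inv_mul_cancel₀ (T_ne_zero hne ω), mul_one]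
  -- The signs `(-1)^(n+1)` of the primitive and `(-1)^n` of the correlator combine to `-1`.
  have hH : ∀ x : ℝ, 0 < x → airyPhi (n + 1) (fun _ => x) - airyPhiLead (n + 1) (fun _ => x) =
      -(R.ev Finset.univ k fun _ => x).re := by
    intro x hx
    have h1 := (hfull (fun _ => x) fun _ => hx).2
    rw [e0, ev_const_mul] at h1
    have h2 : (((-1) ^ (n + 1) * ∫ y in Set.univ.pi fun _ : Fin (n + 1) => Set.Ioi x,
        airyWReg (n + 1) y : ℝ) : ℂ) = -R.ev Finset.univ k fun _ => x := by
      push_cast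
      rw [h1]
      have h3 : ((-1 : ℂ) ^ n) * (-1) ^ n = 1 := by rw [← mul_pow]; simp
      linear_combination -(R.ev Finset.univ k fun _ => x) * h3
    rw [airyPhi, add_sub_cancel_left, ← Complex.ofReal_re (_ * _), h2, Complex.neg_re]
  have hkT : R.Tame Finset.univ fun ω => h ω * ∏ i, (R.t ω i)⁻¹ := hk1 ▸ ht.mul_T
  have hre : ∀ {f : ℝ → ℂ} {c : ℂ} {x : ℝ}, HasDerivAt f c x →
      HasDerivAt (fun x => (f x).re) c.re x := fun hf =>
    Complex.reCLM.hasFDerivAt.comp_hasDerivAt _ hf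
  have hlim : ∀ {l : R.Ω → ℂ}, R.Tame Finset.univ l →
      Tendsto (fun x : ℝ => (R.ev Finset.univ l fun _ => x).re) atTop (nhds 0) := by
    intro l hl
    have h1 := tendsto_ev hl hne (x := fun _ => 1) fun _ _ => one_pos
    have h2 := ((Complex.continuous_re.tendsto 0).comp h1).comp
      (tendsto_atTop_add_const_right _ (-1 : ℝ) tendsto_id)
    refine h2.congr fun x => ?_
    simp
  refine ⟨fun x hx => (hfull x hx).1, fun x => (R.ev Finset.univ
    (fun ω => h ω * ∏ i, (R.t ω i)⁻¹) fun _ => x).re, fun x hx => ⟨?_, ?_⟩, ?_, hlim hkT⟩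
  · have h1 := (hre (hasDerivAt_ev_diag ht hx)).neg
    rw [Complex.neg_re, neg_neg, hk1] at h1
    refine h1.congr_of_eventuallyEq ?_
    filter_upwards [lt_mem_nhds hx] with y hy
    exact hH y hy
  · have h1 := hre (hasDerivAt_ev_diag hkT hx)
    rw [Complex.neg_re] at h1
    exact h1
  · have h1 := (hlim ht).neg
    rw [neg_zero] at h1
    refine h1.congr' ?_
    filter_upwards [eventually_gt_atTop 0] with y hy
    exact (hH y hy).symm

/-- The second derivatives of the regularised primitives. -/
def airyPhiDD : ℕ → ℝ → ℝ
  | 0, x => -(airyP x - 1 / 2 * x ^ (-1 / 2 : ℝ))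
  | 1, x => -(2 * airyA 1 0 x + 1 / 2 * x ^ (-2 : ℝ))
  | n + 2, x => -((n + 3) * airyA (n + 2) 0 x)

/-- The convergence of the integrals and the derivatives of the regularised primitives. -/
def PrimitiveFacts (n : ℕ) : Prop :=
  (∀ x : Fin (n + 1) → ℝ, (∀ i, 0 < x i) →
      IntegrableOn (airyWReg (n + 1)) (Set.univ.pi fun i => Set.Ioi (x i))) ∧
    ∃ H₁ : ℝ → ℝ, (∀ x : ℝ, 0 < x → HasDerivAt
        (fun x => airyPhi (n + 1) (fun _ => x) - airyPhiLead (n + 1) fun _ => x) (H₁ x) x ∧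
      HasDerivAt H₁ (airyPhiDD n x) x) ∧
      Tendsto (fun x => airyPhi (n + 1) (fun _ => x) - airyPhiLead (n + 1) fun _ => x) atTop (nhds 0) ∧
      Tendsto H₁ atTop (nhds 0) ∧ Symb (-2) (airyPhiDD n)

/-- The regularised primitive has density `-h / (T ∏ t)`. Its second derivative has this density
times `T^2`, which is worth two powers of `1/x`. -/
theorem PrimitiveFacts.of_rep {n : ℕ} {R : LaplaceRep (Fin (n + 1))} {h : R.Ω → ℂ} (hh : Measurable h)
    (ht : R.Tame Finset.univ fun ω => (h ω * ∏ i, (R.t ω i)⁻¹) * (R.T Finset.univ ω)⁻¹)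
    (he : ∀ x : Fin (n + 1) → ℝ, Function.Injective x → (∀ i, 0 < x i) →
      (airyWReg (n + 1) x : ℂ) =
        R.ev Finset.univ (fun ω => (-1) ^ n * (h ω * (R.T Finset.univ ω)⁻¹)) x)
    (hd : ∀ x : ℝ, 0 < x → -(R.ev Finset.univ
        (fun ω => (h ω * ∏ i, (R.t ω i)⁻¹) * R.T Finset.univ ω) fun _ => x) = (airyPhiDD n x : ℂ)) :
    PrimitiveFacts n := by
  obtain ⟨h1, H₁, h2, h3, h4⟩ := airyPhi_of_rep hh ht he
  refine ⟨h1, H₁, fun x hx => ⟨(h2 x hx).1, (h2 x hx).2.congr_deriv ?_⟩, h3, h4, ?_⟩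
  · rw [← Complex.neg_re, hd x hx, Complex.ofReal_re]
  · have h5 := (symb_ev ht 2).neg
    rw [Nat.cast_ofNat] at h5
    refine h5.congr ?_
    filter_upwards [eventually_gt_atTop 0] with x hx
    rw [← Complex.ofReal_re (airyPhiDD n x), ← hd x hx, Complex.neg_re]
    refine congrArg (fun f => -(LaplaceRep.ev _ Finset.univ f fun _ => x).re) (funext fun ω => ?_)
    have := inv_mul_cancel₀ (T_ne_zero (R := R) (X := Finset.univ) ⟨0, Finset.mem_univ _⟩ ω)
    linear_combination (h ω * (∏ i, (R.t ω i)⁻¹) * R.T Finset.univ ω) * this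

/-- With three or more points the `vstrong` property is precisely the required tameness, and the
second derivative is `airyU` with one derivative. -/
theorem primitiveFacts_add_two (n : ℕ) : PrimitiveFacts (n + 2) := by
  have hf := airyChainRep_fine (m := n + 2)
  refine PrimitiveFacts.of_rep (airyChainRep (n + 2)).measurable_g (hf.vstrong (by simp))
    (fun x hx hx0 => ?_) fun x hx => ?_
  · have h := airyW_eq_ev hf airyChainRep_ev hx hx0
    have e : ((-1 : ℂ)) ^ (n + 2) = (-1) ^ n := by ring
    rw [e]
    exact h
  · have h1 := airyU_succ_eq_ev (m := n + 2) 0 hx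
    have h2 := airyU_succ (m := n + 2) 0 hx
    rw [← ev_neg]
    have e : (fun ω => -((airyChainRep (n + 2)).g ω * (∏ i, ((airyChainRep (n + 2)).t ω i)⁻¹) *
        (airyChainRep (n + 2)).T Finset.univ ω)) = fun ω =>
        airyChainDensity (n + 2) (0 + 1) ω * ∏ j, ((airyChainRep (n + 2)).t ω j)⁻¹ := by
      funext ω; rw [airyChainDensity]; ring
    rw [e, ← h1, h2, airyPhiDD]
    push_cast
    ring_nf

theorem primitiveFacts_zero : PrimitiveFacts 0 := by
  have hT := fun ω : (airyRep (Fin 1) (1 / 12)).Ω => inv_mul_cancel₀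
    (T_ne_zero (R := airyRep (Fin 1) (1 / 12)) (X := Finset.univ) ⟨0, Finset.mem_univ _⟩ ω)
  have hprod : ∀ ω : (airyRep (Fin 1) (1 / 12)).Ω, ∏ i, ((airyRep (Fin 1) (1 / 12)).t ω i)⁻¹ =
      ((airyRep (Fin 1) (1 / 12)).T Finset.univ ω)⁻¹ := fun ω => by
    rw [Fin.prod_univ_one]; exact congrArg _ (airyRep_T ω _).symm
  refine PrimitiveFacts.of_rep (R := airyRep (Fin 1) (1 / 12)) (h := airyDelta) measurable_airyDelta
    ?_ (fun x _ hx0 => ?_) fun x hx => ?_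
  · refine Eq.mp (congrArg _ (funext fun ω => ?_)) tame_airyDelta.mul_T
    rw [hprod]
    have := hT ω
    generalize ((airyRep (Fin 1) (1 / 12)).T Finset.univ ω)⁻¹ = u at *
    generalize (airyRep (Fin 1) (1 / 12)).T Finset.univ ω = v at *
    linear_combination airyDelta ω * u ^ 2 * this
  · rw [airyWReg_one_eq_ev hx0]
    simp only [pow_zero, one_mul]
  · have h := airyP_sub_eq_ev (x := fun _ => x) fun _ => hx
    rw [airyPhiDD, Complex.ofReal_neg, h]
    refine congrArg _ (congrArg (fun f => LaplaceRep.ev _ Finset.univ f fun _ => x) (funext fun ω => ?_))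
    rw [hprod, mul_assoc]
    exact (congrArg (airyDelta ω * ·) (hT ω)).trans (mul_one _)

theorem LaplaceRep.ev_prod_mul_T {m : ℕ} {R : LaplaceRep (Fin (m + 1))} {h : R.Ω → ℂ}
    (ht : ∀ i, R.Tame Finset.univ fun ω => h ω * ∏ j ∈ Finset.univ.erase i, (R.t ω j)⁻¹)
    {x : Fin (m + 1) → ℝ} (hx : ∀ i, 0 < x i) :
    R.ev Finset.univ (fun ω => (h ω * ∏ i, (R.t ω i)⁻¹) * R.T Finset.univ ω) x =
      ∑ i, R.ev Finset.univ (fun ω => h ω * ∏ j ∈ Finset.univ.erase i, (R.t ω j)⁻¹) x := by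
  rw [← ev_sum _ (fun i _ => ht i) fun i _ => hx i]
  congr 1
  funext ω
  simp only [LaplaceRep.T]
  rw [Finset.mul_sum]
  refine Finset.sum_congr rfl fun i hi => ?_
  rw [← Finset.mul_prod_erase Finset.univ _ hi]
  have := inv_mul_cancel₀ (LaplaceRep.ne_zero ω i)
  linear_combination (h ω * ∏ j ∈ Finset.univ.erase i, (R.t ω j)⁻¹) * this

theorem tame_airyDeltaPair_erase (i : Fin 2) : (airyPair (1 / 12)).Tame Finset.univ fun ω =>
    airyDeltaPair ω * ∏ j ∈ Finset.univ.erase i, ((airyPair (1 / 12)).t ω j)⁻¹ := by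
  refine Eq.mp (congrArg _ (funext fun ω => ?_))
    (tame_airyDeltaPair.mul_T.mul_t (Finset.mem_univ i))
  rw [← Finset.mul_prod_erase Finset.univ _ (Finset.mem_univ i)]
  have h1 := inv_mul_cancel₀ (LaplaceRep.ne_zero (R := airyPair (1 / 12)) ω i)
  have h2 := inv_mul_cancel₀ (LaplaceRep.T_ne_zero (R := airyPair (1 / 12)) (X := Finset.univ)
      ⟨0, Finset.mem_univ _⟩ ω)
  generalize ((airyPair (1 / 12)).T Finset.univ ω)⁻¹ = u at *
  generalize (airyPair (1 / 12)).T Finset.univ ω = v at *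
  generalize ((airyPair (1 / 12)).t ω i)⁻¹ = a at *
  generalize (airyPair (1 / 12)).t ω i = b at *
  generalize (∏ j ∈ Finset.univ.erase i, ((airyPair (1 / 12)).t ω j)⁻¹) = P
  linear_combination airyDeltaPair ω * P * a * b * h2 + airyDeltaPair ω * P * h1

theorem airyPair_tame_g {b : ℝ} (hb : 0 ≤ b) (b' : ℝ) :
    (airyPair b').Tame Finset.univ (airyPair b).g :=
  (airyPair_fine hb).tame ⟨0, Finset.mem_univ _⟩

theorem airyPair_ev_congr (b b' : ℝ) (h : ((ℝ × Bool) × ℝ × Bool) × ℝ → ℂ) (x : Fin 2 → ℝ) :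
    (airyPair b).ev Finset.univ h x = (airyPair b').ev Finset.univ h x := rfl

theorem LaplaceRep.ev_sub {ι : Type*} {R : LaplaceRep ι} {X : Finset ι} {h h' : R.Ω → ℂ}
    (hh : R.Tame X h) (hh' : R.Tame X h') {x : ι → ℝ} (hx : ∀ i ∈ X, 0 < x i) :
    R.ev X (fun ω => h ω - h' ω) x = R.ev X h x - R.ev X h' x := by
  simp only [sub_eq_add_neg]
  rw [ev_add hh hh'.neg hx, ev_neg]

theorem airyDeltaPair_ev {x : Fin 2 → ℝ} (hx : Function.Injective x) (hx0 : ∀ i, 0 < x i) :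
    ((airyChain Finset.univ x - airyPairLead x : ℝ) : ℂ) =
      (airyPair (1 / 12)).ev Finset.univ airyDeltaPair x := by
  have h1 := airyPair_tame_g (b := 1 / 12) (by norm_num) (1 / 12)
  have h2 := airyPair_tame_g (b := 0) le_rfl (1 / 12)
  have e1 := airyPair_ev_congr 0 (1 / 12) (airyPair 0).g x
  have e2 : (airyChain Finset.univ x : ℂ) = _ := airyPair_ev_airyChain hx hx0
  have e3 : (airyPairLead x : ℂ) = _ := airyPair_ev_lead (hx.ne (by decide)) hx0
  rw [Complex.ofReal_sub, e2, e3, e1]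
  exact (ev_sub h1 h2 fun i _ => hx0 i).symm

theorem integral_airyPairLead (i : Fin 2) {x : ℝ} (hx : 0 < x) :
    IntegrableOn (fun y : Fin 1 → ℝ => airyPairLead (i.insertNth x y)) (Set.univ.pi fun _ => Set.Ioi x) ∧
    ∫ y in Set.univ.pi fun _ : Fin 1 => Set.Ioi x, airyPairLead (i.insertNth x y) =
      -(1 / 4 * x ^ (-2 : ℝ)) := by
  have e : ∀ y : Fin 1 → ℝ, airyPairLead (i.insertNth x y) =
      -(1 / 8 * (√x ^ 3)⁻¹) * ∏ k : Fin 1, (√(y k) ^ 3)⁻¹ := by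
    intro y
    fin_cases i
    · simp [airyPairLead]
      ring
    · have h0 : Fin.insertNth (α := fun _ => ℝ) (1 : Fin 2) x y 0 = y 0 :=
        Fin.insertNth_apply_succAbove (α := fun _ => ℝ) (1 : Fin 2) x y 0
      simp [airyPairLead, h0]
      ring
  have e2 : ∀ t ∈ Set.Ioi x, t ^ (-3 / 2 : ℝ) = (√t ^ 3)⁻¹ := fun t ht => by
    have ht : 0 < t := hx.trans ht
    rw [Real.sqrt_eq_rpow, ← Real.rpow_natCast, ← Real.rpow_mul ht.le, ← Real.rpow_neg ht.le]
    norm_num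
  have hi : IntegrableOn (fun t : ℝ => (√t ^ 3)⁻¹) (Set.Ioi x) :=
    (integrableOn_Ioi_rpow_of_lt (a := -3 / 2) (by norm_num) hx).congr_fun e2 measurableSet_Ioi
  have hv : ∫ t in Set.Ioi x, (√t ^ 3)⁻¹ = 2 * x ^ (-1 / 2 : ℝ) := by
    rw [← setIntegral_congr_fun measurableSet_Ioi e2, integral_Ioi_rpow_of_lt (by norm_num) hx]
    norm_num
    ring
  simp only [e]
  rw [IntegrableOn, volume_restrict_orthant]
  refine ⟨(Integrable.fintype_prod fun _ => hi).const_mul _, ?_⟩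
  rw [integral_const_mul, integral_fintype_prod_eq_prod (fun (_ : Fin 1) (t : ℝ) => (√t ^ 3)⁻¹),
    Fin.prod_univ_one, hv]
  have e3 : (√x ^ 3)⁻¹ = x ^ (-3 / 2 : ℝ) := by
    rw [Real.sqrt_eq_rpow, ← Real.rpow_natCast, ← Real.rpow_mul hx.le, ← Real.rpow_neg hx.le]
    norm_num
  have e4 : x ^ (-3 / 2 : ℝ) * x ^ (-1 / 2 : ℝ) = x ^ (-2 : ℝ) := by
    rw [← Real.rpow_add hx]; norm_num
  rw [e3]
  linear_combination -(1 / 4) * e4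

theorem airyWReg_two_eq_ev {x : Fin 2 → ℝ} (hx : Function.Injective x) (hx0 : ∀ i, 0 < x i) :
    (airyWReg 2 x : ℂ) = (airyPair (1 / 12)).ev Finset.univ
      (fun ω => (-1) ^ 1 * (airyDeltaPair ω * ((airyPair (1 / 12)).T Finset.univ ω)⁻¹)) x := by
  have ht : (airyPair (1 / 12)).Tame Finset.univ fun ω =>
      airyDeltaPair ω * ((airyPair (1 / 12)).T Finset.univ ω)⁻¹ := by
    refine Eq.mp (congrArg _ (funext fun ω => ?_))
      (tame_airyDeltaPair.mul_prod (Finset.Subset.refl _))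
    have : (∏ i, ((airyPair (1 / 12)).t ω i)⁻¹) * ∏ i, (airyPair (1 / 12)).t ω i = 1 := by
      rw [← Finset.prod_mul_distrib, Finset.prod_eq_one]
      exact fun i _ => inv_mul_cancel₀ (ne_zero ω i)
    linear_combination (airyDeltaPair ω * ((airyPair (1 / 12)).T Finset.univ ω)⁻¹) * this
  have hinj : ∀ τ : ℝ, Function.Injective fun i => x i + τ := fun τ i j h => hx (by simpa using h)
  obtain ⟨F, hF⟩ : ∃ F : (Fin 2 → ℝ) → ℝ, ∀ y, F y = airyWReg 2 y := ⟨_, fun _ => rfl⟩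
  obtain ⟨G, hG⟩ : ∃ G : (Fin 2 → ℝ) → ℝ, ∀ y, G y = airyChain Finset.univ y - airyPairLead y :=
    ⟨_, fun _ => rfl⟩
  have hF2 : ∀ y, F y = airyW 2 y - airyWLead y := fun y => hF y
  have e : (fun τ => F fun i => x i + τ) = fun τ =>
      (airyW 2 fun i => x i + τ) - airyWLead fun i => x i + τ := funext fun s => hF2 _
  have h := eq_ev_of_shiftD (R := airyPair (1 / 12)) (F := F) (G := G) (h := airyDeltaPair)
    ⟨0, Finset.mem_univ _⟩ ht hx0
    (fun τ hτ => by
      rw [e, hG]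
      refine ((hasDerivAt_airyW (n := 0) hx τ).fun_sub (hasDerivAt_airyWLead hx0 hτ)).congr_deriv ?_
      ring)
    (fun τ hτ => by
      rw [hG]
      exact airyDeltaPair_ev (hinj τ) fun i => add_pos_of_pos_of_nonneg (hx0 i) hτ)
    (by
      rw [e]
      simpa using (tendsto_airyW (n := 0) hx).sub (tendsto_airyWLead x))
  rw [← hF, h, ← ev_neg]
  congr 1
  funext ω
  ring

/-- The factor `T` gives two boundary terms. Each is `airyA 1 0` minus the integral of the leading
term, which contributes `x^(-2) / 4`. -/
theorem primitiveFacts_one : PrimitiveFacts 1 := by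
  refine PrimitiveFacts.of_rep (R := airyPair (1 / 12)) (h := airyDeltaPair) measurable_airyDeltaPair
    tame_airyDeltaPair (fun x hx hx0 => airyWReg_two_eq_ev hx hx0) fun x hx => ?_
  rw [ev_prod_mul_T tame_airyDeltaPair_erase fun _ => hx]
  have h : ∀ i : Fin 2, (airyPair (1 / 12)).ev Finset.univ (fun ω => airyDeltaPair ω *
      ∏ j ∈ Finset.univ.erase i, ((airyPair (1 / 12)).t ω j)⁻¹) (fun _ => x) =
      ((airyA 1 0 x + 1 / 4 * x ^ (-2 : ℝ) : ℝ) : ℂ) := by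
    intro i
    have h1 := (integral_insertNth (R := airyPair (1 / 12))
      (F := fun x => airyChain Finset.univ x - airyPairLead x) measurable_airyDeltaPair
      (fun x hx hx0 => airyDeltaPair_ev hx hx0) i hx (tame_airyDeltaPair_erase i)).2
    rw [← h1]
    congr 1
    obtain ⟨i1, h2⟩ := integral_airyPairLead i hx
    have i2 := integrable_airyA (m := 1) 0 hx
    simp only [← shiftD_iterate_airyChain_insertNth i] at i2
    have h3 : airyA 1 0 x = ∫ y in Set.univ.pi fun _ : Fin 1 => Set.Ioi x,
        shiftD^[0] (airyChain (Finset.univ : Finset (Fin (1 + 1)))) (i.insertNth x y) := by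
      simp only [shiftD_iterate_airyChain_insertNth i]
      rfl
    have h4 := integral_sub i2 i1
    rw [h2, ← h3] at h4
    rw [← sub_neg_eq_add, ← h4]
    rfl
  rw [Fin.sum_univ_two, h, h, airyPhiDD]
  push_cast
  ring

theorem primitiveFacts (n : ℕ) : PrimitiveFacts n := by
  rcases n with _ | _ | n
  · exact primitiveFacts_zero
  · exact primitiveFacts_one
  · exact primitiveFacts_add_two n

/-- The integrals that define the primitives converge absolutely. -/
theorem integrableOn_airyWReg (n : ℕ) (x : Fin n → ℝ) (hx : ∀ i, 0 < x i) :
    IntegrableOn (airyWReg n) (Set.univ.pi fun i => Set.Ioi (x i)) := by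
  rcases n with _ | n
  · exact Integrable.of_finite
  · exact (primitiveFacts n).1 x hx

end Primitives

end

/-! ### The universal coefficients and the expansion of the diagonal primitives. -/

noncomputable section

open Polynomial

section Coefficients

/-- The factor produced by three derivatives of `x ^ (-1 / 2 - 3 k / 2)`. -/
def thirdFactor (k : ℕ) : ℝ :=
  (-1 / 2 - 3 * (k : ℝ) / 2) * (-1 / 2 - 3 * (k : ℝ) / 2 - 1) * (-1 / 2 - 3 * (k : ℝ) / 2 - 2)

/-- The coefficients of the expansion of the second logarithmic derivative, graded by the number of
points. -/
def airyPoly : ℕ → ℝ[X]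
  | 0 => C (-1 / 2) * X
  | 1 => C (1 / 4) * X ^ 2
  | k + 2 => C (1 / (6 * ((k : ℝ) + 2))) * (C (6 * (1 + 3 * ((k : ℝ) + 1) / 2)) *
      ∑ i : Fin (k + 2), airyPoly i * airyPoly (k + 1 - i) - C (thirdFactor k) * airyPoly k)
termination_by k => k
decreasing_by all_goals omega

theorem airyPoly_add_two (k : ℕ) : C (6 * ((k : ℝ) + 2)) * airyPoly (k + 2) =
    C (6 * (1 + 3 * ((k : ℝ) + 1) / 2)) *
      ∑ p ∈ Finset.HasAntidiagonal.antidiagonal (k + 1), airyPoly p.1 * airyPoly p.2 -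
        C (thirdFactor k) * airyPoly k := by
  have h : (6 * ((k : ℝ) + 2)) * (1 / (6 * ((k : ℝ) + 2))) = 1 := by field_simp
  rw [airyPoly, ← mul_assoc, ← Polynomial.C_mul, h, C_1, one_mul,
    Finset.Nat.sum_antidiagonal_eq_sum_range_succ (fun i j => airyPoly i * airyPoly j),
    Finset.sum_range]

theorem natDegree_airyPoly_le (k : ℕ) : (airyPoly k).natDegree ≤ k + 1 := by
  induction k using Nat.strongRec with
  | _ k ih =>
    match k with
    | 0 => rw [airyPoly]; exact (natDegree_C_mul_le _ _).trans natDegree_X_le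
    | 1 => rw [airyPoly]; exact (natDegree_C_mul_le _ _).trans (natDegree_X_pow_le 2)
    | k + 2 =>
      rw [airyPoly]
      refine (natDegree_C_mul_le _ _).trans ((natDegree_sub_le _ _).trans (max_le ?_ ?_))
      · refine (natDegree_C_mul_le _ _).trans (natDegree_sum_le_of_forall_le _ _ fun i _ => ?_)
        refine natDegree_mul_le.trans ?_
        have h1 := ih i i.2
        have h2 := ih (k + 1 - i) (by omega)
        have := i.2
        omega
      · refine (natDegree_C_mul_le _ _).trans ?_
        have := ih k (by omega)
        omega

theorem coeff_zero_airyPoly (k : ℕ) : (airyPoly k).coeff 0 = 0 := by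
  induction k using Nat.strongRec with
  | _ k ih =>
    match k with
    | 0 => rw [airyPoly]; simp
    | 1 => rw [airyPoly]; simp
    | k + 2 =>
      rw [airyPoly, mul_coeff_zero, coeff_sub, mul_coeff_zero, mul_coeff_zero, ih k (by omega),
        finsetSum_coeff, Finset.sum_eq_zero fun i _ => by rw [mul_coeff_zero, ih i i.2, zero_mul]]
      simp

/-- The products that enter the recursion of the coefficients. -/
def airyPolySq (k : ℕ) : ℝ[X] :=
  ∑ p ∈ Finset.HasAntidiagonal.antidiagonal k, airyPoly p.1 * airyPoly p.2

/-- The coefficient at `k = 1` is forced by the differential equation as well; this is the condition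
`rec0` of `HasExp.step`. -/
theorem airyPolySq_zero : airyPolySq 0 = airyPoly 1 := by
  simp only [airyPolySq, Finset.Nat.antidiagonal_zero, Finset.sum_singleton, airyPoly]
  rw [mul_mul_mul_comm, ← Polynomial.C_mul, show (-1 / 2 * (-1 / 2) : ℝ) = 1 / 4 by norm_num, sq]

/-- A linear functional of the coefficients satisfies the recursion. -/
theorem airyPoly_rec (φ : ℝ[X] →ₗ[ℝ] ℝ) (k : ℕ) : 6 * ((k : ℝ) + 2) * φ (airyPoly (k + 2)) =
    6 * (1 + 3 * ((k : ℝ) + 1) / 2) * φ (airyPolySq (k + 1)) -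
      (-1 / 2 - 3 * (k : ℝ) / 2) * (-1 / 2 - 3 * (k : ℝ) / 2 - 1) * (-1 / 2 - 3 * (k : ℝ) / 2 - 2)
        * φ (airyPoly k) := by
  have h := congrArg φ (airyPoly_add_two k)
  simp only [← smul_eq_C_mul, map_sub, map_smul, smul_eq_mul] at h
  exact h

end Coefficients

section OneVariable

/-- The terms of the second logarithmic derivative, graded by the number of points, and their
derivatives. -/
def airyQ : ℕ → ℕ → ℝ → ℝ
  | 0, _, _ => 0
  | l + 1, k, x => -(airyA l k x / l.factorial)

theorem hasDerivAt_airyQ (l k : ℕ) {x : ℝ} (hx : 0 < x) :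
    HasDerivAt (airyQ l k) (airyQ l (k + 1) x) x := by
  rcases l with _ | l
  · exact hasDerivAt_const x (0 : ℝ)
  · exact ((hasDerivAt_airyA k hx).div_const _).neg

theorem airyU_eq (l k : ℕ) {x : ℝ} (hx : 0 < x) : airyU l k x = l.factorial * airyQ l k x := by
  rcases l with _ | l
  · rw [airyU_zero, airyQ, mul_zero]
  · rw [airyU_succ k hx, airyQ, Nat.factorial_succ]
    have : (l.factorial : ℝ) ≠ 0 := by positivity
    push_cast
    field_simp

theorem airyA_eq (l k : ℕ) (x : ℝ) : airyA l k x = -(l.factorial * airyQ (l + 1) k x) := by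
  have : (l.factorial : ℝ) ≠ 0 := by positivity
  rw [airyQ]
  field_simp

theorem airyA_zero {x : ℝ} : airyA 0 0 x = airyP x := by
  have h : ∀ y : Fin 0 → ℝ, airyChain (Finset.univ : Finset (Fin (0 + 1))) (Fin.cons x y) = airyP x :=
    fun y => airyChain_singleton (0 : Fin 1) _
  rw [airyA]
  simp only [Function.iterate_zero, id, h]
  rw [volume_restrict_orthant, integral_const]
  simp [measureReal_def]

/-- The normalisation by factorials turns the binomial sum into a Cauchy product. Its weights `8`
and `4` on `q_i q_j'` and `q_i' q_j` average to `6` by symmetry, which makes the quadratic term a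
total derivative. -/
theorem airyQ_three (l : ℕ) {x : ℝ} (hx : 0 < x) : airyQ l 3 x = 4 * x * airyQ l 1 x +
    2 * airyQ l 0 x - 6 * ∑ p ∈ Finset.HasAntidiagonal.antidiagonal l,
      (airyQ p.1 1 x * airyQ p.2 0 x + airyQ p.1 0 x * airyQ p.2 1 x) := by
  rcases l with _ | m
  · simp [airyQ]
  have hsw : ∑ p ∈ Finset.HasAntidiagonal.antidiagonal (m + 1), airyQ p.1 1 x * airyQ p.2 0 x =
      ∑ p ∈ Finset.HasAntidiagonal.antidiagonal (m + 1), airyQ p.1 0 x * airyQ p.2 1 x := by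
    rw [← Finset.Nat.sum_antidiagonal_swap]
    exact Finset.sum_congr rfl fun p _ => mul_comm _ _
  have h := airyA_three (m := m) hx
  have hk : ∀ k ∈ Finset.range (m + 1), (m.choose k : ℝ) *
      (8 * (airyU k 0 x * airyA (m - k) 1 x) + 4 * (airyU k 1 x * airyA (m - k) 0 x)) =
      -(m.factorial * (8 * (airyQ k 0 x * airyQ (m + 1 - k) 1 x) +
        4 * (airyQ k 1 x * airyQ (m + 1 - k) 0 x))) := by
    intro k hk
    have hkm : k ≤ m := Nat.lt_succ_iff.1 (Finset.mem_range.1 hk)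
    rw [airyU_eq _ _ hx, airyU_eq _ _ hx, airyA_eq, airyA_eq, ← Nat.sub_add_comm hkm,
      ← Nat.choose_mul_factorial_mul_factorial hkm]
    push_cast
    ring
  have hr : ∑ k ∈ Finset.range (m + 1), (8 * (airyQ k 0 x * airyQ (m + 1 - k) 1 x) +
        4 * (airyQ k 1 x * airyQ (m + 1 - k) 0 x)) =
      ∑ p ∈ Finset.HasAntidiagonal.antidiagonal (m + 1), (8 * (airyQ p.1 0 x * airyQ p.2 1 x) +
        4 * (airyQ p.1 1 x * airyQ p.2 0 x)) := by
    rw [Finset.Nat.sum_antidiagonal_eq_sum_range_succ (fun i j => 8 * (airyQ i 0 x * airyQ j 1 x) +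
        4 * (airyQ i 1 x * airyQ j 0 x)), Finset.sum_range_succ _ (m + 1)]
    simp [airyQ]
  rw [Finset.sum_congr rfl hk, Finset.sum_neg_distrib, ← Finset.mul_sum, hr, Finset.sum_add_distrib,
    ← Finset.mul_sum, ← Finset.mul_sum, hsw, airyA_eq, airyA_eq, airyA_eq] at h
  rw [Finset.sum_add_distrib, hsw]
  have hm : (m.factorial : ℝ) ≠ 0 := by positivity
  refine mul_left_cancel₀ hm ?_
  linear_combination -h

/-- The leading terms subtracted from `Φ_1` and `Φ_2` are exactly the first two terms of the
expansion, those of `airyPoly 0` and `airyPoly 1`. -/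
theorem airyPhiDD_eq (n : ℕ) (x : ℝ) : airyPhiDD n x = ((n + 1).factorial : ℝ) *
    (airyQ (n + 1) 0 x - powSum (-1 / 2) (fun k => (airyPoly k).coeff (n + 1)) 2 x) := by
  have h2 : (-1 / 2 - 3 * ((1 : ℕ) : ℝ) / 2 : ℝ) = -2 := by norm_num
  have h1 : (-1 / 2 - 3 * ((0 : ℕ) : ℝ) / 2 : ℝ) = -1 / 2 := by norm_num
  rw [powSum, Finset.sum_range_succ, Finset.sum_range_one, h1, h2, airyPoly, airyPoly,
    Polynomial.coeff_C_mul, Polynomial.coeff_C_mul, Polynomial.coeff_X, Polynomial.coeff_X_pow]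
  rcases n with _ | _ | n
  · rw [airyPhiDD, airyQ, airyA_zero]
    norm_num
    ring
  · rw [airyPhiDD, airyQ]
    norm_num
    ring
  · rw [airyPhiDD, airyQ, if_neg (by omega), if_neg (by omega), Nat.factorial_succ (n + 2)]
    have : ((n + 2).factorial : ℝ) ≠ 0 := by positivity
    push_cast
    field_simp
    ring

/-- The initial order is the symbol bound of `PrimitiveFacts`, and each use of the differential
equation gains one term. The induction runs over all `l` together, since the quadratic term mixes
them. -/
theorem hasExp_airyQ (M l : ℕ) :
    HasExp (-1 / 2) (fun k => (airyPoly k).coeff l) (M + 1) (airyQ l 0) := by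
  induction M generalizing l with
  | zero =>
    rcases l with _ | n
    · refine (Symb.zero _).congr (Eventually.of_forall fun x => ?_)
      simp [powSum, coeff_zero_airyPoly, airyQ]
    · obtain ⟨-, H₁, -, -, -, h⟩ := primitiveFacts n
      have h1 := (h.const_mul (1 / ((n + 1).factorial : ℝ))).add
        (Symb.const_mul_rpow ((airyPoly 1).coeff (n + 1)) (-2))
      rw [HasExp]
      norm_num
      refine h1.congr ?_
      refine Eventually.of_forall fun x => ?_
      have : ((n + 1).factorial : ℝ) ≠ 0 := by positivity
      simp only
      rw [airyPhiDD_eq n x, powSum_succ]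
      have h2 : (-1 / 2 - 3 * ((1 : ℕ) : ℝ) / 2 : ℝ) = -2 := by norm_num
      rw [h2]
      field_simp
      ring
  | succ M ih =>
    refine HasExp.step (q₁ := airyQ l 1) (q₂ := airyQ l 2)
      (r := fun x => ∑ p ∈ Finset.HasAntidiagonal.antidiagonal l, airyQ p.1 0 x * airyQ p.2 0 x)
      (r₁ := fun x => ∑ p ∈ Finset.HasAntidiagonal.antidiagonal l,
        (airyQ p.1 1 x * airyQ p.2 0 x + airyQ p.1 0 x * airyQ p.2 1 x))
      (s := fun k => (airyPolySq k).coeff l) (ih l) ?_ ?_ ?_ ?_ ?_ ?_ ?_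
    · have h := HasExp.sum (Finset.HasAntidiagonal.antidiagonal l) fun p _ => (ih p.1).mul (ih p.2)
      rw [show (-1 / 2 + -1 / 2 : ℝ) = -1 by norm_num] at h
      have e : (fun k => ∑ p ∈ Finset.HasAntidiagonal.antidiagonal l,
          ∑ i ∈ Finset.HasAntidiagonal.antidiagonal k,
            (airyPoly i.1).coeff p.1 * (airyPoly i.2).coeff p.2) = fun k => (airyPolySq k).coeff l := by
        funext k
        rw [airyPolySq, Polynomial.finsetSum_coeff, Finset.sum_comm]
        exact Finset.sum_congr rfl fun i _ => (Polynomial.coeff_mul _ _ _).symm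
      rw [e] at h
      exact h
    · filter_upwards [eventually_gt_atTop 0] with x hx using hasDerivAt_airyQ l 0 hx
    · filter_upwards [eventually_gt_atTop 0] with x hx using hasDerivAt_airyQ l 1 hx
    · filter_upwards [eventually_gt_atTop 0] with x hx
      exact (hasDerivAt_airyQ l 2 hx).congr_deriv (airyQ_three l hx)
    · filter_upwards [eventually_gt_atTop 0] with x hx
      exact HasDerivAt.fun_sum fun p _ => (hasDerivAt_airyQ p.1 0 hx).fun_mul (hasDerivAt_airyQ p.2 0 hx)
    · rw [airyPolySq_zero]
    · exact airyPoly_rec (Polynomial.lcoeff ℝ l)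

end OneVariable

end

/-! ### The Riccati equation of the logarithmic derivatives. -/

noncomputable section

open LaplaceRep

section Riccati

/-- The case `l = 1` of the expansion: `airyPoly 1` has no linear coefficient, so the first
correction is three powers smaller. -/
theorem symb_airyP_sub_sharp : Symb (-7 / 2) fun x => airyP x - 1 / 2 * x ^ (-1 / 2 : ℝ) := by
  have h : Symb (-1 / 2 - 3 * ((2 : ℕ) : ℝ) / 2) _ := hasExp_airyQ 1 1
  rw [show (-1 / 2 - 3 * ((2 : ℕ) : ℝ) / 2 : ℝ) = -7 / 2 by norm_num] at h
  refine h.neg.congr (Eventually.of_forall fun x => ?_)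
  simp only [powSum, Finset.sum_range_succ, Finset.sum_range_zero, airyPoly, airyQ, airyA_zero,
    Polynomial.coeff_C_mul, Polynomial.coeff_X, Polynomial.coeff_X_pow]
  norm_num
  ring

theorem symb_airyP'_add_sharp : Symb (-9 / 2) fun x => airyP' x + 1 / 4 * x ^ (-3 / 2 : ℝ) := by
  have h := symb_airyP_sub_sharp.hasDerivAt (f' := fun x => airyP' x + 1 / 4 * x ^ (-3 / 2 : ℝ)) (by
    filter_upwards [hasDerivAt_rpow_eventually (-1 / 2)] with x hx
    refine ((hasDerivAt_airyP' x).fun_sub (hx.const_mul (1 / 2))).congr_deriv ?_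
    rw [show (-1 / 2 - 1 : ℝ) = -3 / 2 by norm_num]
    ring)
  exact h.mono (by norm_num)

theorem symb_airyP_inv : Symb (1 / 2) fun x => (airyP x)⁻¹ := by
  have h := symb_airyP.inv (c := 1 / 4) (by norm_num) (by
    filter_upwards [eventually_airyP_ge] with x hx using hx.trans (le_abs_self _))
  exact h.mono (by norm_num)

/-- The logarithmic derivatives of `Ai` (`ε = 1`) and `Bi` (`ε = -1`). -/
def airyV (ε x : ℝ) : ℝ := (airyP' x - ε) / (2 * airyP x)

/-- The second logarithmic derivatives of `Ai` (`ε = 1`) and `Bi` (`ε = -1`). -/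
def airyR (ε x : ℝ) : ℝ := x - airyV ε x ^ 2

theorem symb_airyV_add (ε : ℝ) : Symb (-1) fun x => airyV ε x + ε * x ^ (1 / 2 : ℝ) := by
  have h1 := ((symb_airyP_sub_sharp.mul (Symb.rpow (1 / 2))).const_mul (2 * ε)).mono
    (m' := -3 / 2) (by norm_num)
  have h2 := ((symb_airyP'.add h1).mul symb_airyP_inv).const_mul (1 / 2)
  refine (h2.mono (by norm_num)).congr ?_
  filter_upwards [eventually_airyP_pos, eventually_gt_atTop 0] with x hp hx
  have e : x ^ (-1 / 2 : ℝ) * x ^ (1 / 2 : ℝ) = 1 := by rw [← Real.rpow_add hx]; norm_num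
  rw [airyV]
  generalize x ^ (-1 / 2 : ℝ) = u at *
  generalize x ^ (1 / 2 : ℝ) = v at *
  field_simp
  linear_combination -ε * e

/-- From `4 P^2 R = 4 x P^2 - P'^2 + 2 ε P' - 1` and `P^2 = 1/(4x) + O(x^(-4))`. The crude order
`-3` of `P - x^(-1/2)/2` would not suffice here. -/
theorem symb_airyR_add (ε : ℝ) (hε : ε ^ 2 = 1) :
    Symb (-2) fun x => airyR ε x + ε / 2 * x ^ (-1 / 2 : ℝ) := by
  have h1 : Symb (-7 / 2 - 1 / 2) fun x => airyP x ^ 2 - 1 / 4 * x ^ (-1 : ℝ) := by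
    have h := symb_airyP_sub_sharp.mul (symb_airyP.add (Symb.const_mul_rpow (1 / 2) (-1 / 2)))
    refine (h.mono (by norm_num)).congr ?_
    filter_upwards [eventually_gt_atTop 0] with x hx
    have e : x ^ (-1 / 2 : ℝ) * x ^ (-1 / 2 : ℝ) = x ^ (-1 : ℝ) := by
      rw [← Real.rpow_add hx]; norm_num
    linear_combination (-1 / 4) * e
  have h2 := (((Symb.rpow 1).mul h1).const_mul 4).mono (m' := -3) (by norm_num)
  have h3 := (symb_airyP'.mul symb_airyP').mono (m' := -3) (by norm_num)
  have h4 := (symb_airyP'_add_sharp.const_mul (2 * ε)).mono (m' := -3) (by norm_num)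
  have h5 := ((h1.mul (Symb.rpow (-1 / 2))).const_mul (2 * ε)).mono (m' := -3) (by norm_num)
  have h6 := ((((h2.sub h3).add h4).add h5).mul (symb_airyP_inv.mul symb_airyP_inv)).const_mul (1 / 4)
  refine (h6.mono (by norm_num)).congr ?_
  filter_upwards [eventually_airyP_pos, eventually_gt_atTop 0] with x hp hx
  have e : x * x ^ (-1 : ℝ) = 1 := by rw [Real.rpow_neg_one, mul_inv_cancel₀ hx.ne']
  have e2 : x ^ (-1 : ℝ) * x ^ (-1 / 2 : ℝ) = x ^ (-3 / 2 : ℝ) := by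
    rw [← Real.rpow_add hx]; norm_num
  rw [airyR, airyV, Real.rpow_one]
  generalize x ^ (-1 / 2 : ℝ) = u at *
  generalize x ^ (-3 / 2 : ℝ) = v at *
  generalize x ^ (-1 : ℝ) = w at *
  field_simp
  linear_combination 16 * hε - 16 * e - 8 * ε * e2

/-- `R = V'` with `V' = x - V^2` satisfies the same third order equation as the series `∑ ε^l q_l`,
so the coefficients obey the recursion of `airyPoly` evaluated at `ε`. -/
theorem hasExp_airyR {ε : ℝ} (hε : ε ^ 2 = 1)
    (hV : ∀ᶠ x in atTop, HasDerivAt (airyV ε) (airyR ε x) x) (M : ℕ) :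
    HasExp (-1 / 2) (fun k => (airyPoly k).eval ε) (M + 1) (airyR ε) := by
  induction M with
  | zero =>
    have h := symb_airyR_add ε hε
    rw [HasExp, show (-1 / 2 - 3 * ((0 + 1 : ℕ) : ℝ) / 2 : ℝ) = -2 by norm_num]
    refine h.congr (Eventually.of_forall fun x => ?_)
    simp only [powSum, zero_add, Finset.sum_range_one, airyPoly, Polynomial.eval_mul, Polynomial.eval_C,
      Polynomial.eval_X, Nat.cast_zero, mul_zero, zero_div, sub_zero]
    ring
  | succ M ih =>
    have hR : ∀ᶠ x in atTop, HasDerivAt (airyR ε) (1 - 2 * airyV ε x * airyR ε x) x := by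
      filter_upwards [hV] with x hx
      refine ((hasDerivAt_id x).fun_sub (hx.fun_pow 2)).congr_deriv ?_
      push_cast
      ring
    have hR2 : ∀ᶠ x in atTop, HasDerivAt (fun x => 1 - 2 * airyV ε x * airyR ε x)
        (-2 * airyR ε x ^ 2 - 2 * airyV ε x * (1 - 2 * airyV ε x * airyR ε x)) x := by
      filter_upwards [hV, hR] with x hx hx2
      refine (((hx.const_mul 2).fun_mul hx2).const_sub 1).congr_deriv ?_
      ring
    refine HasExp.step (q₁ := fun x => 1 - 2 * airyV ε x * airyR ε x)
      (q₂ := fun x => -2 * airyR ε x ^ 2 - 2 * airyV ε x * (1 - 2 * airyV ε x * airyR ε x))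
      (r := fun x => airyR ε x * airyR ε x)
      (r₁ := fun x => 2 * airyR ε x * (1 - 2 * airyV ε x * airyR ε x))
      (s := fun k => (airyPolySq k).eval ε) ih ?_ hR hR2 ?_ ?_ ?_ ?_
    · have h := ih.mul ih
      rw [show (-1 / 2 + -1 / 2 : ℝ) = -1 by norm_num] at h
      simp only [airyPolySq, Polynomial.eval_finsetSum, Polynomial.eval_mul]
      exact h
    · filter_upwards [hV, hR, hR2] with x h h1 h2
      have h3 := ((h1.fun_pow 2).const_mul (-2)).fun_sub ((h.const_mul 2).fun_mul h2)
      refine h3.congr_deriv ?_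
      push_cast
      -- Eliminating `V` by `V^2 = x - R` and `2 V R = 1 - R'` leaves `R''' = 4 x R' + 2 R - 12 R
      -- R'`.
      have e : airyV ε x ^ 2 = x - airyR ε x := by rw [airyR]; ring
      linear_combination (4 - 8 * airyV ε x * airyR ε x) * e
    · filter_upwards [hR] with x h
      refine (h.fun_mul h).congr_deriv ?_
      ring
    · rw [airyPolySq_zero]
    · exact airyPoly_rec (Polynomial.leval ε)

end Riccati

/-! ### Integrating the expansions twice. -/

section Integration

/-- The factor produced by integrating `x ^ (-2 - 3 m / 2)` twice. -/
def twiceFactor (m : ℕ) : ℝ := (1 + 3 * (m : ℝ) / 2) * (3 * (m : ℝ) / 2)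

/-- An expansion may be integrated twice. -/
theorem isBigO_integrate_twice {G G₁ G₂ : ℝ → ℝ} {c : ℕ → ℝ} {M : ℕ} (hG : Tendsto G atTop (nhds 0))
    (hG₁ : Tendsto G₁ atTop (nhds 0)) (hd : ∀ᶠ x in atTop, HasDerivAt G (G₁ x) x)
    (hd₁ : ∀ᶠ x in atTop, HasDerivAt G₁ (G₂ x) x)
    (h : (fun x => G₂ x - ∑ m ∈ Finset.Icc 1 M, c m * x ^ (-2 - 3 * (m : ℝ) / 2)) =O[atTop]
      fun x : ℝ => x ^ (-2 - 3 * ((M : ℝ) + 1) / 2)) :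
    (fun x => G x - ∑ m ∈ Finset.Icc 1 M, c m / twiceFactor m * x ^ (-(3 * (m : ℝ) / 2))) =O[atTop]
      fun x : ℝ => x ^ (-(3 * ((M : ℝ) + 1) / 2)) := by
  have hM : (0 : ℝ) ≤ M := M.cast_nonneg
  have hpos : ∀ m ∈ Finset.Icc 1 M, (0 : ℝ) < m := fun m hm => by
    exact_mod_cast (Finset.mem_Icc.1 hm).1
  have hlim : ∀ (s : ℝ) (a : ℕ → ℝ), 0 ≤ s → Tendsto
      (fun x : ℝ => ∑ m ∈ Finset.Icc 1 M, a m * x ^ (-(s + 3 * (m : ℝ) / 2))) atTop (nhds 0) := by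
    intro s a hs
    have h0 := tendsto_finsetSum (Finset.Icc 1 M) fun (m : ℕ) hm =>
      ((tendsto_rpow_neg_atTop (y := s + 3 * (m : ℝ) / 2)
        (by have := hpos m hm; positivity)).const_mul (a m))
    simpa using h0
  have hder : ∀ (s : ℝ) (a : ℕ → ℝ), ∀ᶠ x : ℝ in atTop, HasDerivAt
      (fun x : ℝ => ∑ m ∈ Finset.Icc 1 M, a m * x ^ (-(s + 3 * (m : ℝ) / 2)))
      (∑ m ∈ Finset.Icc 1 M, -(s + 3 * (m : ℝ) / 2) * a m * x ^ (-(s + 1 + 3 * (m : ℝ) / 2))) x := by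
    intro s a
    filter_upwards [eventually_gt_atTop 0] with x hx
    refine (HasDerivAt.fun_sum fun (m : ℕ) _ => ((Real.hasDerivAt_rpow_const
      (p := -(s + 3 * (m : ℝ) / 2)) (Or.inl hx.ne')).const_mul (a m))).congr_deriv ?_
    refine Finset.sum_congr rfl fun m _ => ?_
    rw [show -(s + 3 * (m : ℝ) / 2) - 1 = -(s + 1 + 3 * (m : ℝ) / 2) by ring]
    ring
  -- Both `G₁` and the integrated powers tend to `0`, so there is no constant of integration;
  -- likewise for `G` below.
  have h1 : (fun x => G₁ x - ∑ m ∈ Finset.Icc 1 M, -(c m / (1 + 3 * (m : ℝ) / 2)) *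
      x ^ (-(1 + 3 * (m : ℝ) / 2))) =O[atTop] fun x : ℝ => x ^ (-(1 + 3 * ((M : ℝ) + 1) / 2)) := by
    refine isBigO_of_deriv (by positivity) (by
      simpa only [sub_zero] using hG₁.sub (hlim 1 (fun m => -(c m / (1 + 3 * (m : ℝ) / 2))) zero_le_one)) ?_ ?_
      (u' := fun x => G₂ x - ∑ m ∈ Finset.Icc 1 M, c m * x ^ (-2 - 3 * (m : ℝ) / 2))
    · filter_upwards [hd₁, hder 1 fun m => -(c m / (1 + 3 * (m : ℝ) / 2))] with x hx1 hx2
      refine (hx1.fun_sub hx2).congr_deriv (congrArg _ (Finset.sum_congr rfl fun m hm => ?_))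
      have := hpos m hm
      rw [show -(1 + 1 + 3 * (m : ℝ) / 2) = -2 - 3 * (m : ℝ) / 2 by ring]
      field_simp
    · rw [show -(1 + 3 * ((M : ℝ) + 1) / 2) - 1 = -2 - 3 * ((M : ℝ) + 1) / 2 by ring]
      exact h
  have h2 := hlim 0 (fun m => c m / twiceFactor m) le_rfl
  have h3 := hder 0 (fun m => c m / twiceFactor m)
  simp only [zero_add] at h2 h3
  refine isBigO_of_deriv (by positivity) (by simpa using hG.sub h2) ?_ ?_
      (u' := fun x => G₁ x - ∑ m ∈ Finset.Icc 1 M, -(c m / (1 + 3 * (m : ℝ) / 2)) *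
      x ^ (-(1 + 3 * (m : ℝ) / 2)))
  · filter_upwards [hd, h3] with x hx1 hx2
    refine (hx1.fun_sub hx2).congr_deriv (congrArg _ (Finset.sum_congr rfl fun m hm => ?_))
    have := hpos m hm
    rw [twiceFactor]
    field_simp
  · rw [show -(3 * ((M : ℝ) + 1) / 2) - 1 = -(1 + 3 * ((M : ℝ) + 1) / 2) by ring]
    exact h1

/-- The terms of an expansion beyond the first two. -/
theorem HasExp.isBigO_sub {c : ℕ → ℝ} {M : ℕ} {f : ℝ → ℝ} (h : HasExp (-1 / 2) c (M + 2) f) :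
    (fun x => f x - powSum (-1 / 2) c 2 x - ∑ m ∈ Finset.Icc 1 M, c (m + 1) *
      x ^ (-2 - 3 * (m : ℝ) / 2)) =O[atTop] fun x : ℝ => x ^ (-2 - 3 * ((M : ℝ) + 1) / 2) := by
  have h1 := Symb.isBigO h
  rw [show (-1 / 2 - 3 * ((M + 2 : ℕ) : ℝ) / 2) = -2 - 3 * ((M : ℝ) + 1) / 2 by push_cast; ring] at h1
  refine h1.congr_left fun x => ?_
  have e : powSum (-1 / 2) c (M + 2) x = powSum (-1 / 2) c 2 x + ∑ m ∈ Finset.Icc 1 M, c (m + 1) *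
      x ^ (-2 - 3 * (m : ℝ) / 2) := by
    clear h h1
    induction M with
    | zero => simp
    | succ M ih =>
      rw [powSum_succ, ih, Finset.sum_Icc_succ_top (by omega), add_assoc]
      congr 3
      push_cast
      ring_nf
  rw [e, sub_sub]

/-- The coefficients of the expansions of the primitives on the diagonal. -/
def airyCoeff (l m : ℕ) : ℝ := l.factorial * (airyPoly (m + 1)).coeff l / twiceFactor m

theorem airyPhi_isBigO {l : ℕ} (hl : 1 ≤ l) (M : ℕ) :
    (fun x : ℝ => airyPhi l (fun _ => x) - airyPhiLead l (fun _ => x)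
      - ∑ m ∈ Finset.Icc 1 M, airyCoeff l m * x ^ (-(3 * (m : ℝ) / 2)))
      =O[atTop] fun x : ℝ => x ^ (-(3 * ((M : ℝ) + 1) / 2)) := by
  obtain ⟨n, rfl⟩ := Nat.exists_eq_add_of_le' hl
  obtain ⟨-, H₁, hd, h0, h1, -⟩ := primitiveFacts n
  refine isBigO_integrate_twice (c := fun m => (n + 1).factorial * (airyPoly (m + 1)).coeff (n + 1))
    (G₂ := airyPhiDD n) h0 h1 ?_ ?_ ?_
  · filter_upwards [eventually_gt_atTop 0] with x hx using (hd x hx).1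
  · filter_upwards [eventually_gt_atTop 0] with x hx using (hd x hx).2
  · refine ((hasExp_airyQ (M + 1) (n + 1)).isBigO_sub.const_mul_left ((n + 1).factorial : ℝ)).congr_left
      fun x => ?_
    rw [airyPhiDD_eq, mul_sub, Finset.mul_sum]
    simp only [mul_assoc]

theorem airyCoeff_eq_zero {l m : ℕ} (h : m + 2 < l) : airyCoeff l m = 0 := by
  rw [airyCoeff, Polynomial.coeff_eq_zero_of_natDegree_lt
    ((natDegree_airyPoly_le (m + 1)).trans_lt h)]
  simp

/-- The factorials cancel. As `airyPoly (m + 1)` has no constant term and degree at most `m + 2`,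
the sum over these `l` is its full evaluation at `ε`. -/
theorem sum_airyCoeff (ε : ℝ) (m : ℕ) : ∑ l ∈ Finset.Icc 1 (m + 2), ε ^ l / (l.factorial : ℝ) *
    airyCoeff l m = (airyPoly (m + 1)).eval ε / twiceFactor m := by
  rw [Polynomial.eval_eq_sum_range' (n := m + 3) (by have := natDegree_airyPoly_le (m + 1); omega),
    Finset.sum_range_succ', coeff_zero_airyPoly, zero_mul, add_zero, Finset.sum_div]
  rw [Finset.range_eq_Ico, Finset.sum_Ico_add' (fun l => (airyPoly (m + 1)).coeff l * ε ^ l /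
    twiceFactor m) 0 (m + 2) 1]
  refine Finset.sum_congr (by ext; simp) fun l _ => ?_
  have : (l.factorial : ℝ) ≠ 0 := by positivity
  rw [airyCoeff]
  field_simp

end Integration

end

/-! ### Comparison of logarithms and exponentiation. -/

noncomputable section

open LaplaceRep

section Exponential

theorem airyPhiLead_one (x : ℝ) : airyPhiLead 1 (fun _ => x) = -(2 / 3) * x ^ (3 / 2 : ℝ) := rfl

theorem airyPhiLead_two (x : ℝ) : airyPhiLead 2 (fun _ => x) = -Real.log (√x + √x) := rfl

theorem airyPhiLead_of_three_le {l : ℕ} (hl : 3 ≤ l) (x : Fin l → ℝ) : airyPhiLead l x = 0 := by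
  obtain ⟨k, rfl⟩ := Nat.exists_eq_add_of_le' hl
  rfl

/-- The leading part of `log Ai` (`ε = 1`) and `log Bi` (`ε = -1`). -/
def airyLead (ε x : ℝ) : ℝ :=
  ∑ l ∈ Finset.Icc 1 2, ε ^ l / (l.factorial : ℝ) * airyPhiLead l (fun _ => x)

theorem airyLead_eq (ε : ℝ) (hε : ε ^ 2 = 1) {x : ℝ} (hx : 0 < x) : airyLead ε x =
    -(2 / 3 * ε * x ^ (3 / 2 : ℝ)) - 1 / 2 * Real.log 2 - 1 / 4 * Real.log x := by
  have h : √x + √x = 2 * √x := by ring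
  rw [airyLead, show Finset.Icc 1 2 = {1, 2} from rfl, Finset.sum_pair (by norm_num),
    airyPhiLead_one, airyPhiLead_two, h, Real.log_mul two_ne_zero (Real.sqrt_pos.2 hx).ne',
    Real.log_sqrt hx.le, hε]
  norm_num
  ring

theorem hasDerivAt_airyLead (ε : ℝ) (hε : ε ^ 2 = 1) : ∀ᶠ x in atTop,
    HasDerivAt (airyLead ε) (-(ε * x ^ (1 / 2 : ℝ)) - 1 / 4 * x⁻¹) x := by
  filter_upwards [eventually_nhds_of_atTop (eventually_gt_atTop 0), eventually_gt_atTop 0,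
    hasDerivAt_rpow_eventually (3 / 2)] with x hx hx0 hp
  have h := (((hp.const_mul (2 / 3 * ε)).fun_neg.sub_const (1 / 2 * Real.log 2)).fun_sub
    ((Real.hasDerivAt_log hx0.ne').const_mul (1 / 4)))
  refine (h.congr_of_eventuallyEq (hx.mono fun y hy => airyLead_eq ε hε hy)).congr_deriv ?_
  rw [show (3 / 2 - 1 : ℝ) = 1 / 2 by norm_num]
  ring

/-- The expansion of the logarithm of a solution of the Airy equation with logarithmic derivative
`airyV ε`. -/
theorem log_isBigO {ε : ℝ} (hε : ε ^ 2 = 1) {f f' : ℝ → ℝ} (hf : ∀ x, HasDerivAt f (f' x) x)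
    (hf' : ∀ x, HasDerivAt f' (x * f x) x) (hpos : ∀ᶠ x in atTop, 0 < f x)
    (hv : ∀ᶠ x in atTop, airyV ε x = f' x / f x)
    (h0 : Tendsto (fun x => Real.log (f x) - airyLead ε x) atTop (nhds 0)) (M : ℕ) :
    (fun x => Real.log (f x) - airyLead ε x - ∑ m ∈ Finset.Icc 1 M,
      (airyPoly (m + 1)).eval ε / twiceFactor m * x ^ (-(3 * (m : ℝ) / 2))) =O[atTop]
      fun x : ℝ => x ^ (-(3 * ((M : ℝ) + 1) / 2)) := by
  have hV : ∀ᶠ x in atTop, HasDerivAt (airyV ε) (airyR ε x) x := by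
    filter_upwards [eventually_nhds_of_atTop hv, hv, hpos] with x h1 h2 h3
    refine (((hf' x).fun_div (hf x) h3.ne').congr_of_eventuallyEq h1).congr_deriv ?_
    rw [airyR, h2]
    field_simp
  refine isBigO_integrate_twice (c := fun m => (airyPoly (m + 1)).eval ε)
    -- The logarithmic derivative minus that of the leading part; differentiating once more
    -- subtracts exactly the first two terms of the expansion of `R`.
    (G₁ := fun x => airyV ε x + ε * x ^ (1 / 2 : ℝ) + 1 / 4 * x⁻¹)
    (G₂ := fun x => airyR ε x - powSum (-1 / 2) (fun k => (airyPoly k).eval ε) 2 x) h0 ?_ ?_ ?_ ?_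
  · simpa only [mul_zero, add_zero] using ((symb_airyV_add ε).tendsto_zero (by norm_num)).add
      ((tendsto_inv_atTop_zero (𝕜 := ℝ)).const_mul (1 / 4))
  · filter_upwards [hasDerivAt_airyLead ε hε, hv, hpos] with x h1 h2 h3
    refine (((hf x).log h3.ne').fun_sub h1).congr_deriv ?_
    rw [h2]
    ring
  · filter_upwards [hV, hasDerivAt_rpow_eventually (1 / 2), eventually_gt_atTop 0] with x h1 h2 h3
    refine ((h1.fun_add (h2.const_mul ε)).fun_add
      ((hasDerivAt_inv h3.ne').const_mul (1 / 4))).congr_deriv ?_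
    have e : x ^ (-2 : ℝ) = (x ^ 2)⁻¹ := by
      rw [Real.rpow_neg h3.le, ← Real.rpow_natCast]; norm_num
    simp only [powSum, Finset.sum_range_succ, Finset.sum_range_zero, airyPoly, Polynomial.eval_mul,
      Polynomial.eval_C, Polynomial.eval_X, Polynomial.eval_pow, hε, Nat.cast_zero, mul_zero,
      zero_div, sub_zero, zero_add, Nat.cast_one]
    rw [show (1 / 2 - 1 : ℝ) = -1 / 2 by norm_num, show (-1 / 2 - 3 * 1 / 2 : ℝ) = -2 by norm_num, e]
    ring
  · exact (hasExp_airyR hε hV (M + 1)).isBigO_sub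

theorem airyAi_pos_eventually : ∀ᶠ x in atTop, 0 < airyAi x := by
  filter_upwards [tendsto_airyAi_mul.eventually_const_lt (u := 0) (by positivity),
    eventually_gt_atTop 0] with x hx h0
  rw [mul_assoc] at hx
  exact pos_of_mul_pos_left hx (by positivity)

theorem airyBi_pos_eventually : ∀ᶠ x in atTop, 0 < airyBi x := by
  filter_upwards [airyAi_pos_eventually, eventually_airyP_pos] with x h1 h2
  rw [airyP_eq] at h2
  exact (pos_iff_pos_of_mul_pos h2).1 h1

theorem tendsto_log_airyAi :
    Tendsto (fun x => Real.log (airyAi x) - airyLead 1 x) atTop (nhds 0) := by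
  have h := (tendsto_airyAi_mul.log (by positivity)).add_const (1 / 2 * Real.log 2)
  rw [one_div (√2), Real.log_inv, Real.log_sqrt (by norm_num),
    show -(Real.log 2 / 2) + 1 / 2 * Real.log 2 = 0 by ring] at h
  refine h.congr' ?_
  filter_upwards [airyAi_pos_eventually, eventually_gt_atTop 0] with x h1 h2
  rw [airyLead_eq 1 (one_pow 2) h2, Real.log_mul (by positivity) (by positivity),
    Real.log_mul h1.ne' (by positivity), Real.log_exp, Real.log_rpow h2]
  ring

/-- The constant for `Bi` comes from `Ai Bi ∼ x^(-1/2) / 2` and the asymptotics of `Ai`. -/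
theorem tendsto_log_airyBi :
    Tendsto (fun x => Real.log (airyBi x) - airyLead (-1) x) atTop (nhds 0) := by
  have h := ((tendsto_airyP_mul.log (by norm_num)).add_const (Real.log 2)).sub tendsto_log_airyAi
  rw [one_div (2 : ℝ), Real.log_inv, neg_add_cancel, sub_zero] at h
  refine h.congr' ?_
  filter_upwards [airyAi_pos_eventually, airyBi_pos_eventually, eventually_gt_atTop 0] with x h1 h3 h2
  rw [airyLead_eq 1 (one_pow 2) h2, airyLead_eq (-1) (by norm_num) h2, airyP_eq,
    Real.log_mul (by positivity) (by positivity), Real.log_mul h1.ne' h3.ne', Real.log_rpow h2]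
  ring

theorem log_airyAi_isBigO (M : ℕ) : (fun x => Real.log (airyAi x) - airyLead 1 x -
    ∑ m ∈ Finset.Icc 1 M, (airyPoly (m + 1)).eval 1 / twiceFactor m * x ^ (-(3 * (m : ℝ) / 2)))
      =O[atTop] fun x : ℝ => x ^ (-(3 * ((M : ℝ) + 1) / 2)) := by
  refine log_isBigO (one_pow 2) hasDerivAt_airyAi hasDerivAt_airyAi' airyAi_pos_eventually ?_
    tendsto_log_airyAi M
  filter_upwards [airyAi_pos_eventually, airyBi_pos_eventually] with x h1 h2
  have h := airyAi'_mul_airyBi x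
  rw [airyV, airyP_eq]
  field_simp
  linear_combination -2 * h

theorem log_airyBi_isBigO (M : ℕ) : (fun x => Real.log (airyBi x) - airyLead (-1) x -
    ∑ m ∈ Finset.Icc 1 M, (airyPoly (m + 1)).eval (-1) / twiceFactor m * x ^ (-(3 * (m : ℝ) / 2)))
      =O[atTop] fun x : ℝ => x ^ (-(3 * ((M : ℝ) + 1) / 2)) := by
  refine log_isBigO (by norm_num) hasDerivAt_airyBi hasDerivAt_airyBi' airyBi_pos_eventually ?_
    tendsto_log_airyBi M
  filter_upwards [airyAi_pos_eventually, airyBi_pos_eventually] with x h1 h2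
  have h := airyAi_mul_airyBi' x
  rw [airyV, airyP_eq]
  field_simp
  linear_combination -2 * h

/-- Exponentiation of an asymptotic formula for the logarithm. -/
theorem div_exp_isBigO {f E : ℝ → ℝ} {s : ℝ} (hs : 0 < s) (hf : ∀ᶠ x in atTop, 0 < f x)
    (h : (fun x => Real.log (f x) - E x) =O[atTop] fun x : ℝ => x ^ (-s)) :
    (fun x => f x / Real.exp (E x) - 1) =O[atTop] fun x : ℝ => x ^ (-s) := by
  have h0 := h.trans_tendsto (tendsto_rpow_neg_atTop hs)
  refine IsBigO.trans (IsBigO.of_bound 2 ?_) h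
  filter_upwards [hf, h0.abs.eventually_le_const (u := 1) (by simp)] with x h1 h2
  have e : f x / Real.exp (E x) = Real.exp (Real.log (f x) - E x) := by
    rw [Real.exp_sub, Real.exp_log h1]
  rw [e]
  exact Real.abs_exp_sub_one_le h2

theorem exp_coeff_isBigO {f : ℝ → ℝ} {ε : ℝ} (hf : ∀ᶠ x in atTop, 0 < f x) {M : ℕ}
    (h : (fun x => Real.log (f x) - airyLead ε x - ∑ m ∈ Finset.Icc 1 M,
      (airyPoly (m + 1)).eval ε / twiceFactor m * x ^ (-(3 * (m : ℝ) / 2)))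
      =O[atTop] fun x : ℝ => x ^ (-(3 * ((M : ℝ) + 1) / 2))) :
    (fun x : ℝ => f x / Real.exp (
        ∑ l ∈ Finset.Icc 1 2, ε ^ l / (l.factorial : ℝ) * airyPhiLead l (fun _ => x)
        + ∑ m ∈ Finset.Icc 1 M, (∑ l ∈ Finset.Icc 1 (m + 2), ε ^ l / (l.factorial : ℝ) *
          airyCoeff l m) * x ^ (-(3 * (m : ℝ) / 2))) - 1)
      =O[atTop] fun x : ℝ => x ^ (-(3 * ((M : ℝ) + 1) / 2)) := by
  refine div_exp_isBigO (by positivity) hf ?_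
  simp only [sum_airyCoeff, ← sub_sub]
  exact h

/-- For `m ≤ M` all nonzero coefficients have `l ≤ m + 2 ≤ M + 2`, so the truncated sum of
primitives already contains every contribution up to this order. -/
theorem sum_airyPhi_isBigO (ε : ℝ) (M : ℕ) :
    (fun x : ℝ => ∑ l ∈ Finset.Icc 1 (M + 2), ε ^ l / (l.factorial : ℝ) * airyPhi l (fun _ => x)
      - airyLead ε x - ∑ m ∈ Finset.Icc 1 M,
        (airyPoly (m + 1)).eval ε / twiceFactor m * x ^ (-(3 * (m : ℝ) / 2)))
      =O[atTop] fun x : ℝ => x ^ (-(3 * ((M : ℝ) + 1) / 2)) := by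
  have h := IsBigO.sum (s := Finset.Icc 1 (M + 2)) fun l hl =>
    (airyPhi_isBigO (Finset.mem_Icc.1 hl).1 M).const_mul_left (ε ^ l / (l.factorial : ℝ))
  refine h.congr_left fun x => ?_
  have e1 : airyLead ε x =
      ∑ l ∈ Finset.Icc 1 (M + 2), ε ^ l / (l.factorial : ℝ) * airyPhiLead l (fun _ => x) := by
    refine Finset.sum_subset (Finset.Icc_subset_Icc_right (by omega)) fun l h1 h2 => ?_
    rw [Finset.mem_Icc] at h1 h2
    rw [airyPhiLead_of_three_le (by omega), mul_zero]
  have e2 : ∑ m ∈ Finset.Icc 1 M,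
        (airyPoly (m + 1)).eval ε / twiceFactor m * x ^ (-(3 * (m : ℝ) / 2)) =
      ∑ l ∈ Finset.Icc 1 (M + 2), ε ^ l / (l.factorial : ℝ) *
        ∑ m ∈ Finset.Icc 1 M, airyCoeff l m * x ^ (-(3 * (m : ℝ) / 2)) := by
    simp only [Finset.mul_sum]
    rw [Finset.sum_comm]
    refine Finset.sum_congr rfl fun m hm => ?_
    rw [Finset.mem_Icc] at hm
    rw [← sum_airyCoeff, Finset.sum_mul]
    simp only [← mul_assoc]
    refine Finset.sum_subset (Finset.Icc_subset_Icc_right (by omega)) fun l h1 h2 => ?_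
    rw [Finset.mem_Icc] at h1 h2
    rw [airyCoeff_eq_zero (by omega), mul_zero, zero_mul]
  rw [e1, e2]
  simp only [Finset.sum_apply, mul_sub, Finset.sum_sub_distrib]

/-- With `L = M + 2`, the logarithm of `f` and the truncated sum have the same expansion through `m
= M`; their difference is of the order of the next term. -/
theorem exp_airyPhi_isBigO {f : ℝ → ℝ} {ε : ℝ} (hf : ∀ᶠ x in atTop, 0 < f x)
    (h : ∀ M : ℕ, (fun x => Real.log (f x) - airyLead ε x - ∑ m ∈ Finset.Icc 1 M,
      (airyPoly (m + 1)).eval ε / twiceFactor m * x ^ (-(3 * (m : ℝ) / 2)))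
      =O[atTop] fun x : ℝ => x ^ (-(3 * ((M : ℝ) + 1) / 2))) {L : ℕ} (hL : 2 ≤ L) :
    (fun x : ℝ => f x / Real.exp (∑ l ∈ Finset.Icc 1 L,
        ε ^ l / (l.factorial : ℝ) * airyPhi l (fun _ => x)) - 1)
      =O[atTop] fun x : ℝ => x ^ (-(3 * ((L : ℝ) - 1) / 2)) := by
  obtain ⟨M, rfl⟩ := Nat.exists_eq_add_of_le' hL
  rw [show ((M + 2 : ℕ) : ℝ) - 1 = M + 1 by push_cast; ring]
  refine div_exp_isBigO (by positivity) hf (((h M).sub (sum_airyPhi_isBigO ε M)).congr_left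
    fun x => ?_)
  ring

end Exponential

end

theorem mainTheorem4 :
    -- the integrals that define the primitives converge absolutely
    (∀ (n : ℕ) (x : Fin n → ℝ), (∀ i, 0 < x i) →
      IntegrableOn (airyWReg n) (Set.univ.pi fun i => Set.Ioi (x i))) ∧
    -- summing all `l ≤ L` is exact up to the order of the first omitted term
    (∀ L : ℕ, 2 ≤ L →
      ((fun x : ℝ =>
          airyAi x / Real.exp (∑ l ∈ Finset.Icc 1 L,
            1 / (l.factorial : ℝ) * airyPhi l (fun _ => x)) - 1)
        =O[atTop] fun x : ℝ => x ^ (-(3 * ((L : ℝ) - 1) / 2))) ∧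
      ((fun x : ℝ =>
          airyBi x / Real.exp (∑ l ∈ Finset.Icc 1 L,
            (-1) ^ l / (l.factorial : ℝ) * airyPhi l (fun _ => x)) - 1)
        =O[atTop] fun x : ℝ => x ^ (-(3 * ((L : ℝ) - 1) / 2)))) ∧
    -- `a l m` is the coefficient of `x ^ (-3 m / 2)` in the large `x` expansion of `Φ_l(x, …, x)`
    ∃ a : ℕ → ℕ → ℝ,
      (∀ l : ℕ, 1 ≤ l → ∀ M : ℕ,
        (fun x : ℝ => airyPhi l (fun _ => x) - airyPhiLead l (fun _ => x)
            - ∑ m ∈ Finset.Icc 1 M, a l m * x ^ (-(3 * (m : ℝ) / 2)))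
          =O[atTop] fun x : ℝ => x ^ (-(3 * ((M : ℝ) + 1) / 2))) ∧
      -- only finitely many `l` contribute to a given power of `x`
      (∀ l m : ℕ, m + 2 < l → a l m = 0) ∧
      -- the exponential formulas hold order by order
      (∀ M : ℕ,
        ((fun x : ℝ =>
            airyAi x / Real.exp (
              ∑ l ∈ Finset.Icc 1 2, 1 / (l.factorial : ℝ) * airyPhiLead l (fun _ => x)
              + ∑ m ∈ Finset.Icc 1 M,
                  (∑ l ∈ Finset.Icc 1 (m + 2), 1 / (l.factorial : ℝ) * a l m)
                    * x ^ (-(3 * (m : ℝ) / 2))) - 1)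
          =O[atTop] fun x : ℝ => x ^ (-(3 * ((M : ℝ) + 1) / 2))) ∧
        ((fun x : ℝ =>
            airyBi x / Real.exp (
              ∑ l ∈ Finset.Icc 1 2, (-1) ^ l / (l.factorial : ℝ) * airyPhiLead l (fun _ => x)
              + ∑ m ∈ Finset.Icc 1 M,
                  (∑ l ∈ Finset.Icc 1 (m + 2), (-1) ^ l / (l.factorial : ℝ) * a l m)
                    * x ^ (-(3 * (m : ℝ) / 2))) - 1)
          =O[atTop] fun x : ℝ => x ^ (-(3 * ((M : ℝ) + 1) / 2)))) := by
  have hAi := fun M => exp_coeff_isBigO airyAi_pos_eventually (log_airyAi_isBigO M)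
  have hAi' := fun (L : ℕ) (hL : 2 ≤ L) =>
    exp_airyPhi_isBigO airyAi_pos_eventually log_airyAi_isBigO hL
  simp only [one_pow] at hAi hAi'
  exact ⟨integrableOn_airyWReg, fun L hL =>
    ⟨hAi' L hL, exp_airyPhi_isBigO airyBi_pos_eventually log_airyBi_isBigO hL⟩,
    airyCoeff, fun _ hl M => airyPhi_isBigO hl M, fun _ _ h => airyCoeff_eq_zero h, fun M =>
    ⟨hAi M, exp_coeff_isBigO airyBi_pos_eventually (log_airyBi_isBigO M)⟩⟩
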